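/- Let $(M,g)$ be a smooth pseudo-Riemannian manifold of dimension $n\ge 3$ and of arbitrary signature, with a spin structure (structure group $\mathrm{Spin}_0$, the elements of the spin group of spinor norm $1$), and let $\mathbb K\in\{\mathbb R,\mathbb C\}$. Let $\Delta$ be a finite-dimensional $\mathbb K$-linear Clifford module (for instance an irreducible one, the usual spinor module), with the Clifford relation $v\cdot v=g(v,v)$; let $\mathcal S$ be the associated spinor bundle with its spin connection $\nabla$, and let $(\cdot,\cdot)$ be a spinor inner product: nondegenerate, linear in the second argument, $\sigma$-linear in the first argument, where $\sigma$ is the identity or the conjugation of $\mathbb K$, with $(\psi,\varphi)=\varepsilon\,\sigma((\varphi,\psi))$, $\varepsilon=\pm1$, and $(v.\psi,\varphi)=s(\psi,v.\varphi)$ for all vectors $v$, $s=\pm1$. Let $(X_a)$ be local orthonormal frames, $(e^a)$ the dual coframes, $X^a$ and $e_a$ the vectors and covectors with index moved by $g$, $\widetilde X$ the metric dual of $X$, $\delta=-i_{X^a}\nabla_{X_a}$ and $D\!\!\!\!/=e^a.\nabla_{X_a}$. Forms are smooth and $\mathbb K$-valued, spinor fields are smooth. A $p$-form $\omega$ is a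 *CKY form* if $\nabla_X\omega=\frac1{p+1}i_Xd\omega-\frac1{n-p+1}\widetilde X\wedge\delta\omega$ for all $X$. Put $K_a=\frac1{n-2}\big(\frac{\mathcal R}{2(n-1)}e_a-P_a\big)$ with the Ricci $1$-forms $P_a$ and the scalar curvature $\mathcal R$, and $K(X)=X^aK_a$ (as a $1$-form or as its dual vector). A CKY $p$-form $\omega$ is *normal* if, for $\mu=\frac{d\omega}{p+1}$ and $\phi=-\frac{\delta\omega}{n-p+1}$, there is a $p$-form $\tau$ with $$\nabla_X\mu=\widetilde X\wedge\tau+K(X)\wedge\omega,\quad \nabla_X\phi=-i_X\tau+i_{K(X)}\omega,\quad \nabla_X\tau=i_{K(X)}\mu-K(X)\wedge\phi$$ for all $X$. A spinor field $\psi$ is a *twistor spinor* if $\nabla_X\psi=\frac1n\widetilde X.D\!\!\!\!/\,\psi$ for all $X$. For a $p$-form $\omega_1$, a $q$-form $\omega_2$, a $p$-form $\omega$ and spinor fields $\psi,\varphi$ put $$[\omega_1,\omega_2]=\tfrac1{q+1}i_{X^a}\omega_1\wedge i_{X_a}d\omega_2+\tfrac{(-1)^p}{p+1}i_{X^a}d\omega_1\wedge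 i_{X_a}\omega_2+\tfrac{(-1)^p}{n-q+1}\omega_1\wedge\delta\omega_2+\tfrac1{n-p+1}\delta\omega_1\wedge\omega_2,$$ $$L_\omega\psi=-(-1)^p\tfrac pn\,\omega.D\!\!\!\!/\,\psi+\tfrac p{2(p+1)}d\omega.\psi+\tfrac p{2(n-p+1)}\delta\omega.\psi,$$ $$(\psi\overline\varphi)_p=\sum_{a_1<\dots<a_p}(\varphi,e_{a_p}\cdots e_{a_2}e_{a_1}.\psi)\,e^{a_1}\wedge\dots\wedge e^{a_p},\qquad \{\psi,\varphi\}_p=\tfrac12\big((\psi\overline\varphi)_p+(\varphi\overline\psi)_p\big).$$ Suppose that either (a) $g$ has constant curvature, and $\bar{\mathfrak k}_0^p$ is the set of CKY $p$-forms for $1\le p\le n-1$ and the set of normal CKY $p$-forms for $p\ge n$ (every $n$-form satisfies the CKY equation), or (b) $g$ is Einstein, and $\bar{\mathfrak k}_0^p$ is the set of normal CKY $p$-forms for all $p\ge1$. Let $\bar{\mathfrak k}_1$ be the set of twistor spinors. Then all $\bar{\mathfrak k}_0^p$, $p\ge 1$, and $\bar{\mathfrak k}_1$ are vector spaces over $\mathbb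 K$, and $\bar{\mathfrak k}=\bigoplus_{p\ge1}\bar{\mathfrak k}_0^p\oplus\bar{\mathfrak k}_1$ is a superalgebra in the following sense, for all $p,q,r\ge1$. 1. $[\cdot,\cdot]$ is a $\mathbb K$-bilinear map $\bar{\mathfrak k}_0^p\times\bar{\mathfrak k}_0^q\to\bar{\mathfrak k}_0^{p+q-1}$ with $[\omega_1,\omega_2]=(-1)^{pq}[\omega_2,\omega_1]$ (so it is skew on forms of odd degree) and $(-1)^{p(r+1)}[\omega_1,[\omega_2,\omega_3]]+(-1)^{q(p+1)}[\omega_2,[\omega_3,\omega_1]]+(-1)^{r(q+1)}[\omega_3,[\omega_1,\omega_2]]=0$ for $\omega_1\in\bar{\mathfrak k}_0^p,\ \omega_2\in\bar{\mathfrak k}_0^q,\ \omega_3\in\bar{\mathfrak k}_0^r$. 2. $(\omega,\psi)\mapsto L_\omega\psi$ is a $\mathbb K$-bilinear map $\bar{\mathfrak k}_0^p\times\bar{\mathfrak k}_1\to\bar{\mathfrak k}_1$ (the odd-even bracket being $[\psi,\omega]=-L_\omega\psi$). 3. $(\psi,\varphi)\mapsto(\psi\overline\varphi)_p$ is a map $\bar{\mathfrak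 k}_1\times\bar{\mathfrak k}_1\to\bar{\mathfrak k}_0^p$, $\mathbb K$-linear in $\psi$ and $\sigma$-linear in $\varphi$. The components of $(\varphi\overline\psi)_p$ are $\varepsilon s^p(-1)^{p(p-1)/2}$ times the images under $\sigma$ of those of $(\psi\overline\varphi)_p$. The odd-odd bracket $\{\psi,\varphi\}_p$, the polarization of the squaring map $\psi\mapsto(\psi\overline\psi)_p$, has values in $\bar{\mathfrak k}_0^p$, is symmetric, and $\{\psi,\psi\}_p=(\psi\overline\psi)_p$. -/

import Mathlib

open scoped Manifold ContDiff

namespace SpinGeometry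

noncomputable section

/-- The model space of an `n`-dimensional manifold. -/
abbrev Model (n : ℕ) : Type := EuclideanSpace ℝ (Fin n)

/-- A smooth pseudo-Riemannian metric of arbitrary signature on an `n`-dimensional manifold. -/
structure PseudoRiemannianMetric (n : ℕ) (M : Type*) [TopologicalSpace M]
    [ChartedSpace (Model n) M] [IsManifold 𝓘(ℝ, Model n) ∞ M] where
  val : ∀ x : M, TangentSpace 𝓘(ℝ, Model n) x →L[ℝ] TangentSpace 𝓘(ℝ, Model n) x →L[ℝ] ℝ
  symm : ∀ (x : M) (v w : TangentSpace 𝓘(ℝ, Model n) x), val x v w = val x w v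
  nondegenerate : ∀ (x : M) (v : TangentSpace 𝓘(ℝ, Model n) x), (∀ w, val x v w = 0) → v = 0
  contMDiff : ContMDiff 𝓘(ℝ, Model n)
    (𝓘(ℝ, Model n).prod 𝓘(ℝ, Model n →L[ℝ] Model n →L[ℝ] ℝ)) ∞
    (fun x : M => Bundle.TotalSpace.mk' (Model n →L[ℝ] Model n →L[ℝ] ℝ) x (val x))

/-! ### The algebra of the model space -/

section Algebra

/-- The quadratic form `∑ η_a v_a²` on `𝕜ⁿ` (here `η_a = ±1`); with it the Clifford relation reads
`v · v = ∑ η_a v_a²`. -/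
def quadForm (𝕜 : Type*) [RCLike 𝕜] {n : ℕ} (η : Fin n → ℝ) : QuadraticForm 𝕜 (Fin n → 𝕜) :=
  QuadraticMap.weightedSumSquares 𝕜 (fun a => (algebraMap ℝ 𝕜 (η a)))

/-- The real Clifford algebra inside the Clifford algebra with scalars `𝕜`. -/
def cliffordOfReal (𝕜 : Type*) [RCLike 𝕜] {n : ℕ} (η : Fin n → ℝ) :
    CliffordAlgebra (quadForm ℝ η) →ₐ[ℝ] CliffordAlgebra (quadForm 𝕜 η) :=
  CliffordAlgebra.lift (quadForm ℝ η)
    ⟨((CliffordAlgebra.ι (quadForm 𝕜 η)).restrictScalars ℝ).comp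
        (LinearMap.pi fun a => (Algebra.linearMap ℝ 𝕜).comp (LinearMap.proj a)), by
      intro v
      simp only [LinearMap.comp_apply, LinearMap.restrictScalars_apply,
        CliffordAlgebra.ι_sq_scalar]
      rw [IsScalarTower.algebraMap_apply ℝ 𝕜 (CliffordAlgebra (quadForm 𝕜 η))]
      congr 1
      simp [quadForm, QuadraticMap.weightedSumSquares_apply]⟩

/-- The identification of exterior forms with Clifford elements (a wedge product of distinct
elements of an orthogonal basis goes to their Clifford product). -/
def quantize {𝕜 : Type*} [RCLike 𝕜] {n : ℕ} (η : Fin n → ℝ) :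
    ExteriorAlgebra 𝕜 (Fin n → 𝕜) ≃ₗ[𝕜] CliffordAlgebra (quadForm 𝕜 η) :=
  letI : Invertible (2 : 𝕜) := invertibleOfNonzero two_ne_zero
  (CliffordAlgebra.equivExterior (quadForm 𝕜 η)).symm

/-- A spinor inner product on a Clifford module `ρ`: a nondegenerate form, `σ`-linear in the first
argument (`σ` the identity or the conjugation) and linear in the second one, `(ψ,φ) = ε σ(φ,ψ)`
with `ε = ±1`, for which all vectors are self-adjoint (`s = 1`) or all vectors are skew-adjoint
(`s = -1`). -/
structure SpinorInnerProduct {𝕜 : Type*} [RCLike 𝕜] {n : ℕ} {η : Fin n → ℝ}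
    {Δ : Type*} [AddCommGroup Δ] [Module 𝕜 Δ]
    (ρ : CliffordAlgebra (quadForm 𝕜 η) →ₐ[𝕜] Module.End 𝕜 Δ) (σ : 𝕜 →+* 𝕜) where
  form : Δ →ₛₗ[σ] Δ →ₗ[𝕜] 𝕜
  conj_eq : σ = RingHom.id 𝕜 ∨ σ = starRingEnd 𝕜
  nondegenerate : ∀ ψ : Δ, (∀ φ : Δ, form ψ φ = 0) → ψ = 0
  ε : 𝕜
  ε_eq : ε = 1 ∨ ε = -1
  symm : ∀ ψ φ : Δ, form ψ φ = ε * σ (form φ ψ)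
  s : 𝕜
  s_eq : s = 1 ∨ s = -1
  adjoint : ∀ (a : Fin n) (ψ φ : Δ),
    form (ρ (CliffordAlgebra.ι _ (Pi.single a 1)) ψ) φ =
      s * form ψ (ρ (CliffordAlgebra.ι _ (Pi.single a 1)) φ)

end Algebra

/-! ### Differential forms -/

section Forms

variable {n : ℕ} {M : Type*} [TopologicalSpace M] [ChartedSpace (Model n) M]

/-- The `𝕜`-valued covectors at `x`. -/
abbrev Covector (𝕜 : Type*) [RCLike 𝕜] (n : ℕ) {M : Type*} [TopologicalSpace M]
    [ChartedSpace (Model n) M] (x : M) : Type _ :=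
  TangentSpace 𝓘(ℝ, Model n) x →ₗ[ℝ] 𝕜

/-- The `𝕜`-valued exterior forms at `x`, of all degrees; the wedge product is the product of this
algebra. -/
abbrev FormAt (𝕜 : Type*) [RCLike 𝕜] (n : ℕ) {M : Type*} [TopologicalSpace M]
    [ChartedSpace (Model n) M] (x : M) : Type _ :=
  ExteriorAlgebra 𝕜 (Covector 𝕜 n x)

/-- Fields of `𝕜`-valued exterior forms on `M` (no smoothness, any degrees). -/
abbrev FormField (𝕜 : Type*) [RCLike 𝕜] (n : ℕ) (M : Type*) [TopologicalSpace M]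
    [ChartedSpace (Model n) M] : Type _ :=
  ∀ x : M, FormAt 𝕜 n x

/-- The interior product `i_v`. -/
def interior {𝕜 : Type*} [RCLike 𝕜] {x : M} (v : TangentSpace 𝓘(ℝ, Model n) x) :
    FormAt 𝕜 n x →ₗ[𝕜] FormAt 𝕜 n x :=
  CliffordAlgebra.contractLeft
    { toFun := fun α => α v
      map_add' := fun _ _ => rfl
      map_smul' := fun _ _ => rfl }

/-- The derivative at `x` along `v` of a function with values in a normed space. -/
def dirDeriv {F : Type*} [NormedAddCommGroup F] [NormedSpace ℝ F] (f : M → F) (x : M)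
    (v : TangentSpace 𝓘(ℝ, Model n) x) : F :=
  mfderiv 𝓘(ℝ, Model n) 𝓘(ℝ, F) f x v

/-- The derivative at `x` along `v` of a function with values in a finite-dimensional `𝕜`-vector
space, computed in the coordinates of a basis. -/
def coordDeriv {𝕜 : Type*} [RCLike 𝕜] {W κ : Type*} [AddCommGroup W] [Module 𝕜 W] [Fintype κ]
    (b : Module.Basis κ 𝕜 W) (f : M → W) (x : M) (v : TangentSpace 𝓘(ℝ, Model n) x) : W :=
  ∑ k, dirDeriv (fun y => b.repr (f y) k) x v • b k

/-- Smoothness on `U` of a function with values in a finite-dimensional `𝕜`-vector space, in the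
coordinates of a basis. -/
def CoordSmoothOn {𝕜 : Type*} [RCLike 𝕜] {W κ : Type*} [AddCommGroup W] [Module 𝕜 W]
    (b : Module.Basis κ 𝕜 W) (f : M → W) (U : Set M) : Prop :=
  ∀ k, ContMDiffOn 𝓘(ℝ, Model n) 𝓘(ℝ, 𝕜) ∞ (fun y => b.repr (f y) k) U

/-- The basis `e^{a₁} ∧ … ∧ e^{a_p}`, `a₁ < … < a_p`, of the exterior algebra of `𝕜ⁿ`. -/
def formBasis (𝕜 : Type*) [RCLike 𝕜] (n : ℕ) :
    Module.Basis (Finset (Fin n)) 𝕜 (ExteriorAlgebra 𝕜 (Fin n → 𝕜)) :=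
  (Pi.basisFun 𝕜 (Fin n)).ExteriorAlgebra

end Forms

/-! ### Spin structures -/

/-- A spin structure on the pseudo-Riemannian manifold `(M, g)`, given by local data: a cover of `M`
by open sets with smooth orthonormal frames `(X_a)`, together with smooth lifts to the spin group of
the changes of frame, which satisfy the cocycle condition. As for `VectorBundleCore`, `indexAt x`
is a choice of one of the open sets that contain `x`. -/
structure SpinStructure {n : ℕ} {M : Type*} [TopologicalSpace M]
    [ChartedSpace (Model n) M] [IsManifold 𝓘(ℝ, Model n) ∞ M]
    (g : PseudoRiemannianMetric n M) (η : Fin n → ℝ) (ι : Type*) where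
  sign : ∀ a, η a = 1 ∨ η a = -1
  baseSet : ι → Set M
  isOpen_baseSet : ∀ i, IsOpen (baseSet i)
  indexAt : M → ι
  mem_baseSet_at : ∀ x, x ∈ baseSet (indexAt x)
  frame : ι → Fin n → ∀ x : M, TangentSpace 𝓘(ℝ, Model n) x
  smooth_frame : ∀ i a, ContMDiffOn 𝓘(ℝ, Model n) 𝓘(ℝ, Model n).tangent ∞
    (fun x => (⟨x, frame i a x⟩ : TangentBundle 𝓘(ℝ, Model n) M)) (baseSet i)
  orthonormal : ∀ i, ∀ x ∈ baseSet i, ∀ a b,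
    g.val x (frame i a x) (frame i b x) = if a = b then η a else 0
  lift : ι → ι → M → CliffordAlgebra (quadForm ℝ η)
  lift_mem : ∀ i j, ∀ x ∈ baseSet i ∩ baseSet j, lift i j x ∈ spinGroup (quadForm ℝ η)
  smooth_lift : ∀ i j, ∀ f : Module.Dual ℝ (CliffordAlgebra (quadForm ℝ η)),
    ContMDiffOn 𝓘(ℝ, Model n) 𝓘(ℝ, ℝ) ∞ (fun x => f (lift i j x)) (baseSet i ∩ baseSet j)
  /-- The spin group element `lift i j x` covers the change of frame: it conjugates the components
  of a covector in the frame `j` to its components in the frame `i`. -/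
  lift_frame : ∀ i j, ∀ x ∈ baseSet i ∩ baseSet j, ∀ α : TangentSpace 𝓘(ℝ, Model n) x →ₗ[ℝ] ℝ,
    CliffordAlgebra.ι (quadForm ℝ η) (fun a => α (frame i a x)) * lift i j x =
      lift i j x * CliffordAlgebra.ι (quadForm ℝ η) (fun a => α (frame j a x))
  lift_cocycle : ∀ i j k, ∀ x ∈ baseSet i ∩ baseSet j ∩ baseSet k,
    lift i j x * lift j k x = lift i k x

namespace SpinStructure

variable {n : ℕ} {M : Type*} [TopologicalSpace M] [ChartedSpace (Model n) M]
  [IsManifold 𝓘(ℝ, Model n) ∞ M] {g : PseudoRiemannianMetric n M} {η : Fin n → ℝ} {ι : Type*}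
  (S : SpinStructure g η ι)

/-! #### The Levi-Civita connection and its curvature in the frames -/

/-- `g([X_a, X_b], X_c)`. -/
def structureCoeff (i : ι) (a b c : Fin n) (x : M) : ℝ :=
  g.val x (VectorField.mlieBracket 𝓘(ℝ, Model n) (S.frame i a) (S.frame i b) x) (S.frame i c x)

/-- `Γ_abc = g(∇_{X_a} X_b, X_c)` for the Levi-Civita connection (Koszul formula). -/
def connCoeff (i : ι) (a b c : Fin n) (x : M) : ℝ :=
  (S.structureCoeff i a b c x - S.structureCoeff i b c a x + S.structureCoeff i c a b x) / 2

/-- The component `g(v, X_a) η_a = e^a(v)`. -/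
def comp (i : ι) {x : M} (v : TangentSpace 𝓘(ℝ, Model n) x) (a : Fin n) : ℝ :=
  η a * g.val x v (S.frame i a x)

/-- `g(∇_v X_b, X_c)`. -/
def connAlong (i : ι) {x : M} (v : TangentSpace 𝓘(ℝ, Model n) x) (b c : Fin n) : ℝ :=
  ∑ a, S.comp i v a * S.connCoeff i a b c x

/-- `R_abcd = g(R(X_a, X_b) X_c, X_d)` with `R(X, Y) = ∇_X ∇_Y - ∇_Y ∇_X - ∇_{[X, Y]}`. -/
def riem (i : ι) (a b c d : Fin n) (x : M) : ℝ :=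
  dirDeriv (S.connCoeff i b c d) x (S.frame i a x)
    - dirDeriv (S.connCoeff i a c d) x (S.frame i b x)
    + ∑ e, η e * (S.connCoeff i b c e x * S.connCoeff i a e d x
        - S.connCoeff i a c e x * S.connCoeff i b e d x)
    - ∑ e, η e * S.structureCoeff i a b e x * S.connCoeff i e c d x

/-- The Ricci curvature `Ric(X_b, X_c)`. -/
def ricci (i : ι) (b c : Fin n) (x : M) : ℝ := ∑ a, η a * S.riem i a b c a x

/-- The scalar curvature. -/
def scalarCurv (i : ι) (x : M) : ℝ := ∑ a, η a * S.ricci i a a x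

/-- Constant sectional curvature `c`: `R(X, Y) Z = c (g(Y, Z) X - g(X, Z) Y)`. -/
def HasConstantCurvature (c : ℝ) : Prop :=
  ∀ i, ∀ x ∈ S.baseSet i, ∀ a b d e, S.riem i a b d e x =
    c * (g.val x (S.frame i b x) (S.frame i d x) * g.val x (S.frame i a x) (S.frame i e x)
      - g.val x (S.frame i a x) (S.frame i d x) * g.val x (S.frame i b x) (S.frame i e x))

/-- The Einstein condition `Ric = l g`, with a constant `l`. -/
def IsEinstein (l : ℝ) : Prop :=
  ∀ i, ∀ x ∈ S.baseSet i, ∀ a b, S.ricci i a b x = l * g.val x (S.frame i a x) (S.frame i b x)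

/-- The components `K_ab` of the `1`-forms `K_a = (1/(n-2)) ((𝓡/(2(n-1))) e_a - P_a)`, where `P_a`
are the Ricci `1`-forms and `𝓡` is the scalar curvature. -/
def kCoeff (i : ι) (a b : Fin n) (x : M) : ℝ :=
  1 / ((n : ℝ) - 2) * (S.scalarCurv i x / (2 * ((n : ℝ) - 1)) *
    g.val x (S.frame i a x) (S.frame i b x) - S.ricci i a b x)

/-! #### Forms -/

section Forms

variable {𝕜 : Type*} [RCLike 𝕜]

/-- The coframe covector `e^a`, with `e^a(X_b) = δ^a_b`, as a form. -/
def coframe (𝕜 : Type*) [RCLike 𝕜] (i : ι) (a : Fin n) (x : M) : FormAt 𝕜 n x :=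
  ExteriorAlgebra.ι 𝕜 ((algebraMap ℝ 𝕜 (η a)) •
    (Algebra.linearMap ℝ 𝕜).comp (g.val x (S.frame i a x) : TangentSpace _ x →ₗ[ℝ] ℝ))

/-- The metric dual `ṽ = g(v, ·)` of a vector, as a form. -/
def flat (𝕜 : Type*) [RCLike 𝕜] (_S : SpinStructure g η ι) {x : M}
    (v : TangentSpace 𝓘(ℝ, Model n) x) : FormAt 𝕜 n x :=
  ExteriorAlgebra.ι 𝕜 ((Algebra.linearMap ℝ 𝕜).comp (g.val x v : TangentSpace _ x →ₗ[ℝ] ℝ))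

/-- A form at `x` in the components of the frame `i`. -/
def toFrame (i : ι) (x : M) : FormAt 𝕜 n x →ₐ[𝕜] ExteriorAlgebra 𝕜 (Fin n → 𝕜) :=
  ExteriorAlgebra.map
    { toFun := fun α a => α (S.frame i a x)
      map_add' := fun _ _ => rfl
      map_smul' := fun _ _ => rfl }

/-- The form at `x` with given components in the frame `i`. -/
def ofFrame (i : ι) (x : M) : ExteriorAlgebra 𝕜 (Fin n → 𝕜) →ₐ[𝕜] FormAt 𝕜 n x :=
  ExteriorAlgebra.map
    (∑ a, (LinearMap.proj a : (Fin n → 𝕜) →ₗ[𝕜] 𝕜).smulRight ((algebraMap ℝ 𝕜 (η a)) •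
      (Algebra.linearMap ℝ 𝕜).comp (g.val x (S.frame i a x) : TangentSpace _ x →ₗ[ℝ] ℝ)))

/-- `w` is a smooth differential `p`-form. -/
def IsSmoothForm (p : ℕ) (w : FormField 𝕜 n M) : Prop :=
  (∀ x, w x ∈ ⋀[𝕜]^p (Covector 𝕜 n x)) ∧
  ∀ i, CoordSmoothOn (n := n) (formBasis 𝕜 n) (fun y => S.toFrame i y (w y)) (S.baseSet i)

/-- The derivative along `v` of the components of `w` in the frame `i`. -/
def partialIn (i : ι) (w : FormField 𝕜 n M) {x : M} (v : TangentSpace 𝓘(ℝ, Model n) x) :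
    FormAt 𝕜 n x :=
  S.ofFrame i x (coordDeriv (formBasis 𝕜 n) (fun y => S.toFrame i y (w y)) x v)

/-- The Levi-Civita covariant derivative `∇_v w`, computed in the frame `i`; here
`∇_v e^c = -∑_b e^c(∇_v X_b) e^b`. -/
def nablaIn (i : ι) (w : FormField 𝕜 n M) {x : M} (v : TangentSpace 𝓘(ℝ, Model n) x) :
    FormAt 𝕜 n x :=
  S.partialIn i w v - ∑ b, ∑ c, (algebraMap ℝ 𝕜 (η c * S.connAlong i v b c)) •
    (S.coframe 𝕜 i b x * interior (S.frame i c x) (w x))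

/-- The exterior derivative, computed in the frame `i`: `d(f e^I) = df ∧ e^I + f d(e^I)`, where
`d e^c = -(1/2) ∑ e^c([X_a, X_b]) e^a ∧ e^b`. -/
def extDerivIn (i : ι) (w : FormField 𝕜 n M) (x : M) : FormAt 𝕜 n x :=
  ∑ a, S.coframe 𝕜 i a x * S.partialIn i w (S.frame i a x)
    - ∑ a, ∑ b, ∑ c, (algebraMap ℝ 𝕜 (η c * S.structureCoeff i a b c x / 2)) •
      (S.coframe 𝕜 i a x * S.coframe 𝕜 i b x * interior (S.frame i c x) (w x))

/-- The Levi-Civita covariant derivative `∇_v w` at `x`. -/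
def nabla (w : FormField 𝕜 n M) {x : M} (v : TangentSpace 𝓘(ℝ, Model n) x) : FormAt 𝕜 n x :=
  S.nablaIn (S.indexAt x) w v

/-- The exterior derivative `dw`. -/
def extDeriv (w : FormField 𝕜 n M) : FormField 𝕜 n M :=
  fun x => S.extDerivIn (S.indexAt x) w x

/-- The co-derivative `δw = -i_{X^a} ∇_{X_a} w`. -/
def coDeriv (w : FormField 𝕜 n M) : FormField 𝕜 n M := fun x =>
  -∑ a, (algebraMap ℝ 𝕜 (η a)) •
    interior (S.frame (S.indexAt x) a x) (S.nabla w (S.frame (S.indexAt x) a x))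

/-- The operation `α, β ↦ i_{X^a} α ∧ i_{X_a} β`. -/
def contractWedge (α β : FormField 𝕜 n M) : FormField 𝕜 n M := fun x =>
  ∑ a, (algebraMap ℝ 𝕜 (η a)) • (interior (S.frame (S.indexAt x) a x) (α x) *
    interior (S.frame (S.indexAt x) a x) (β x))

/-- `w` is a conformal Killing-Yano `p`-form:
`∇_X w = (1/(p+1)) i_X dw - (1/(n-p+1)) X̃ ∧ δw`. -/
def IsCKY (p : ℕ) (w : FormField 𝕜 n M) : Prop :=
  S.IsSmoothForm p w ∧ ∀ (x : M) (v : TangentSpace 𝓘(ℝ, Model n) x),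
    S.nabla w v = (1 / ((p : 𝕜) + 1)) • interior v (S.extDeriv w x)
      - (1 / ((n : 𝕜) - p + 1)) • (S.flat 𝕜 v * S.coDeriv w x)

/-- The vector metrically dual to the `1`-form `K(v) = v^a K_a`. -/
def kVec {x : M} (v : TangentSpace 𝓘(ℝ, Model n) x) : TangentSpace 𝓘(ℝ, Model n) x :=
  ∑ a, ∑ b, (S.comp (S.indexAt x) v a * S.kCoeff (S.indexAt x) a b x * η b) •
    S.frame (S.indexAt x) b x

/-- `w` is a normal conformal Killing-Yano `p`-form: it is a CKY form, and with `μ = dw/(p+1)`,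
`φ = -δw/(n-p+1)` there is a `p`-form `τ` for which the prolonged system
`∇_X w = i_X μ + X̃ ∧ φ`, `∇_X μ = X̃ ∧ τ + K(X) ∧ w`, `∇_X φ = -i_X τ + i_{K(X)} w`,
`∇_X τ = i_{K(X)} μ - K(X) ∧ φ` closes, that is, `(w, μ, φ, τ)` is parallel for the normal conformal
(tractor) connection; `K` is minus the Schouten tensor. -/
def IsNormalCKY (p : ℕ) (w : FormField 𝕜 n M) : Prop :=
  S.IsCKY p w ∧ ∃ μ φ τ : FormField 𝕜 n M, S.IsSmoothForm p τ ∧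
    μ = (1 / ((p : 𝕜) + 1)) • S.extDeriv w ∧
    φ = -(1 / ((n : 𝕜) - p + 1)) • S.coDeriv w ∧
    ∀ (x : M) (v : TangentSpace 𝓘(ℝ, Model n) x),
      S.nabla μ v = S.flat 𝕜 v * τ x + S.flat 𝕜 (S.kVec v) * w x ∧
      S.nabla φ v = -interior v (τ x) + interior (S.kVec v) (w x) ∧
      S.nabla τ v = interior (S.kVec v) (μ x) - S.flat 𝕜 (S.kVec v) * φ x

/-- The CKY bracket of a `p`-form and a `q`-form. -/
def ckyBracket (p q : ℕ) (w₁ w₂ : FormField 𝕜 n M) : FormField 𝕜 n M :=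
  (1 / ((q : 𝕜) + 1)) • S.contractWedge w₁ (S.extDeriv w₂)
    + ((-1) ^ p / ((p : 𝕜) + 1)) • S.contractWedge (S.extDeriv w₁) w₂
    + ((-1) ^ p / ((n : 𝕜) - q + 1)) • (fun x => w₁ x * S.coDeriv w₂ x)
    + (1 / ((n : 𝕜) - p + 1)) • (fun x => S.coDeriv w₁ x * w₂ x)

end Forms

/-! #### Spinors -/

section Spinors

variable {𝕜 : Type*} [RCLike 𝕜] {Δ : Type*} [AddCommGroup Δ] [Module 𝕜 Δ]
  (ρ : CliffordAlgebra (quadForm 𝕜 η) →ₐ[𝕜] Module.End 𝕜 Δ)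

/-- Fields of spinors, i.e. sections of the vector bundle associated with the spin structure and
the Clifford module `Δ`. As in `VectorBundleCore`, the fibre at `x` is `Δ`, which represents a
spinor in the spin frame over the frame `indexAt x`. -/
abbrev SpinorField (_S : SpinStructure g η ι) (Δ : Type*) : Type _ := M → Δ

/-- The components of a spinor field in the spin frame over the frame `i`. -/
def spinorIn (i : ι) (ψ : S.SpinorField Δ) : M → Δ :=
  fun x => ρ (cliffordOfReal 𝕜 η (S.lift i (S.indexAt x) x)) (ψ x)

/-- Smooth spinor fields. -/
def IsSmoothSpinor [FiniteDimensional 𝕜 Δ] (ψ : S.SpinorField Δ) : Prop :=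
  ∀ i, CoordSmoothOn (n := n) (Module.finBasis 𝕜 Δ) (S.spinorIn ρ i ψ) (S.baseSet i)

/-- The Clifford product `w.ψ` of a form and a spinor. -/
def cliff (w : FormField 𝕜 n M) (ψ : S.SpinorField Δ) : S.SpinorField Δ :=
  fun x => ρ (quantize η (S.toFrame (S.indexAt x) x (w x))) (ψ x)

/-- The Clifford product of a form at `x` and a spinor at `x`. -/
def cliffAt {x : M} (α : FormAt 𝕜 n x) (ψ : Δ) : Δ :=
  ρ (quantize η (S.toFrame (S.indexAt x) x α)) ψ

/-- The spinor covariant derivative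
`∇_v ψ = v(ψ) + (1/4) ∑ g(∇_v X_b, X_c) e^c . e^b . ψ`
that is induced by the Levi-Civita connection. -/
def spinNabla [FiniteDimensional 𝕜 Δ] (ψ : S.SpinorField Δ) {x : M}
    (v : TangentSpace 𝓘(ℝ, Model n) x) : Δ :=
  coordDeriv (Module.finBasis 𝕜 Δ) (S.spinorIn ρ (S.indexAt x) ψ) x v
    + (1 / 4 : 𝕜) • ∑ b, ∑ c, (algebraMap ℝ 𝕜 (S.connAlong (S.indexAt x) v b c)) •
      S.cliffAt ρ (S.coframe 𝕜 (S.indexAt x) c x)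
        (S.cliffAt ρ (S.coframe 𝕜 (S.indexAt x) b x) (ψ x))

/-- The Dirac operator `e^a . ∇_{X_a}`. -/
def dirac [FiniteDimensional 𝕜 Δ] (ψ : S.SpinorField Δ) : S.SpinorField Δ := fun x =>
  ∑ a, S.cliffAt ρ (S.coframe 𝕜 (S.indexAt x) a x)
    (S.spinNabla ρ ψ (S.frame (S.indexAt x) a x))

/-- `ψ` is a twistor spinor: `∇_X ψ = (1/n) X̃ . Dψ`. -/
def IsTwistorSpinor [FiniteDimensional 𝕜 Δ] (ψ : S.SpinorField Δ) : Prop :=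
  S.IsSmoothSpinor ρ ψ ∧ ∀ (x : M) (v : TangentSpace 𝓘(ℝ, Model n) x),
    S.spinNabla ρ ψ v = (1 / (n : 𝕜)) • S.cliffAt ρ (S.flat 𝕜 v) (S.dirac ρ ψ x)

/-- The operator
`L_w ψ = -(-1)^p (p/n) w.Dψ + (p/(2(p+1))) dw.ψ + (p/(2(n-p+1))) δw.ψ` of a `p`-form `w`. -/
def ckyOperator [FiniteDimensional 𝕜 Δ] (p : ℕ) (w : FormField 𝕜 n M) (ψ : S.SpinorField Δ) :
    S.SpinorField Δ :=
  (-(-1) ^ p * ((p : 𝕜) / n)) • S.cliff ρ w (S.dirac ρ ψ)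
    + ((p : 𝕜) / (2 * ((p : 𝕜) + 1))) • S.cliff ρ (S.extDeriv w) ψ
    + ((p : 𝕜) / (2 * ((n : 𝕜) - p + 1))) • S.cliff ρ (S.coDeriv w) ψ

variable {ρ} {σ : 𝕜 →+* 𝕜} (B : SpinorInnerProduct ρ σ)

/-- For `A = {a₁ < … < a_p}`, the component `(φ, e_{a_p … a₂ a₁} . ψ)`, where `e_a` is the metric
dual of `X_a`. -/
def currentCoeff (ψ φ : S.SpinorField Δ) (A : Finset (Fin n)) (x : M) : 𝕜 :=
  B.form (φ x) (((A.sort (· ≤ ·)).reverse.map fun a =>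
    ρ (quantize η (S.toFrame (S.indexAt x) x (S.flat 𝕜 (S.frame (S.indexAt x) a x))))).prod (ψ x))

/-- The `p`-form Dirac current
`(ψ φ̄)_p = ∑_{a₁ < … < a_p} (φ, e_{a_p … a₂ a₁} . ψ) e^{a₁ a₂ … a_p}`. -/
def current (p : ℕ) (ψ φ : S.SpinorField Δ) : FormField 𝕜 n M := fun x =>
  ∑ A ∈ Finset.powersetCard p Finset.univ,
    S.currentCoeff B ψ φ A x • S.ofFrame (S.indexAt x) x (formBasis 𝕜 n A)

/-- The polarization of the squaring map `ψ ↦ (ψ ψ̄)_p`. -/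
def polarCurrent (p : ℕ) (ψ φ : S.SpinorField Δ) : FormField 𝕜 n M :=
  (1 / 2 : 𝕜) • (S.current B p ψ φ + S.current B p φ ψ)

/-- The CKY bracket, the operators `L_w` and the `p`-form Dirac currents make a superalgebra out of
the even part `⨁_{p ≥ 1} E p` (`E p` consists of `p`-forms) and the odd part `O`, which consists
of spinors. -/
structure IsExtendedSuperalgebra [FiniteDimensional 𝕜 Δ] (E : ℕ → Submodule 𝕜 (FormField 𝕜 n M))
    (O : Submodule 𝕜 (S.SpinorField Δ)) : Prop where
  /-- The even-even bracket is a bilinear map into the even part. -/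
  even_even : ∀ p q, 1 ≤ p → 1 ≤ q → ∃ b : E p →ₗ[𝕜] E q →ₗ[𝕜] E (p + q - 1),
    ∀ w₁ w₂, (b w₁ w₂ : FormField 𝕜 n M) = S.ckyBracket p q w₁ w₂
  /-- Graded skew-symmetry. -/
  even_even_symm : ∀ p q, 1 ≤ p → 1 ≤ q → ∀ w₁ ∈ E p, ∀ w₂ ∈ E q,
    S.ckyBracket p q w₁ w₂ = ((-1 : 𝕜) ^ (p * q)) • S.ckyBracket q p w₂ w₁
  /-- The graded Jacobi identity. -/
  even_jacobi : ∀ p q r, 1 ≤ p → 1 ≤ q → 1 ≤ r → ∀ w₁ ∈ E p, ∀ w₂ ∈ E q, ∀ w₃ ∈ E r,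
    ((-1 : 𝕜) ^ (p * (r + 1))) • S.ckyBracket p (q + r - 1) w₁ (S.ckyBracket q r w₂ w₃)
      + ((-1 : 𝕜) ^ (q * (p + 1))) • S.ckyBracket q (r + p - 1) w₂ (S.ckyBracket r p w₃ w₁)
      + ((-1 : 𝕜) ^ (r * (q + 1))) • S.ckyBracket r (p + q - 1) w₃ (S.ckyBracket p q w₁ w₂) = 0
  /-- The even-odd bracket is a bilinear map into the odd part; the odd-even bracket is
  `[ψ, w] = -L_w ψ`. -/
  even_odd : ∀ p, 1 ≤ p → ∃ l : E p →ₗ[𝕜] O →ₗ[𝕜] O,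
    ∀ w ψ, (l w ψ : S.SpinorField Δ) = S.ckyOperator ρ p w ψ
  /-- All `p`-form Dirac currents belong to the even part, linearly in `ψ`, `σ`-linearly in `φ`. -/
  odd_odd : ∀ p, 1 ≤ p → ∃ c : O →ₗ[𝕜] O →ₛₗ[σ] E p,
    ∀ ψ φ, (c ψ φ : FormField 𝕜 n M) = S.current B p ψ φ
  /-- Exchange of the two spinors in a Dirac current. -/
  odd_odd_reverse : ∀ p, ∀ ψ ∈ O, ∀ φ ∈ O, ∀ A : Finset (Fin n), A.card = p → ∀ x,
    S.currentCoeff B φ ψ A x =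
      B.ε * B.s ^ p * (-1) ^ (p * (p - 1) / 2) * σ (S.currentCoeff B ψ φ A x)
  /-- The odd-odd bracket, the polarized squaring map, has values in the even part. -/
  polar_mem : ∀ p, 1 ≤ p → ∀ ψ ∈ O, ∀ φ ∈ O, S.polarCurrent B p ψ φ ∈ E p
  /-- Symmetry of the odd-odd bracket. -/
  polar_symm : ∀ p, ∀ ψ ∈ O, ∀ φ ∈ O, S.polarCurrent B p ψ φ = S.polarCurrent B p φ ψ
  /-- On the diagonal the odd-odd bracket is the Dirac current of the spinor. -/
  polar_self : ∀ p, ∀ ψ ∈ O, S.polarCurrent B p ψ ψ = S.current B p ψ ψ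

end Spinors

end SpinStructure

end

end SpinGeometry

open scoped Manifold ContDiff

namespace SpinGeometry

noncomputable section

section

section CliffordLemmas

variable {R V : Type*} [CommRing R] [AddCommGroup V] [Module R V] {Q : QuadraticForm R V}

open CliffordAlgebra

theorem contractLeft_mul (d : Module.Dual R V) (a b : CliffordAlgebra Q) :
    contractLeft d (a * b) = contractLeft d a * b + involute a * contractLeft d b := by
  induction a using CliffordAlgebra.left_induction with
  | algebraMap r => simp [contractLeft_algebraMap_mul]
  | add x y hx hy => simp only [add_mul, map_add, hx, hy]; abel
  | ι_mul x v hx =>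
    simp only [mul_assoc, contractLeft_ι_mul, hx, map_mul, involute_ι]
    simp only [sub_mul, mul_add, smul_mul_assoc, neg_mul, mul_assoc]
    abel

theorem involute_contractLeft (d : Module.Dual R V) (a : CliffordAlgebra Q) :
    involute (contractLeft d a) = -contractLeft d (involute a) := by
  induction a using CliffordAlgebra.left_induction with
  | algebraMap r => simp
  | add x y hx hy => simp only [map_add, hx, hy]; abel
  | ι_mul x v hx =>
    simp only [contractLeft_ι_mul, map_sub, map_mul, involute_ι, hx, map_smul, neg_mul, map_neg]
    simp

theorem ι_mul_sub_involute_mul_ι (v : V) (a : CliffordAlgebra Q) :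
    ι Q v * a - involute a * ι Q v = contractLeft (QuadraticMap.polarBilin Q v) a := by
  induction a using CliffordAlgebra.left_induction with
  | algebraMap r => simp [Algebra.commutes]
  | add x y hx hy => simp only [map_add, ← hx, ← hy, mul_add, add_mul]; abel
  | ι_mul x w hx =>
    rw [contractLeft_ι_mul, ← hx, map_mul, involute_ι, QuadraticMap.polarBilin_apply_apply,
      Algebra.smul_def, ← ι_mul_ι_add_swap]
    noncomm_ring

end CliffordLemmas

section ExteriorLemmas

variable {𝕜 V : Type*} [Field 𝕜] [AddCommGroup V] [Module 𝕜 V]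

open CliffordAlgebra (contractLeft involute)
open ExteriorAlgebra (ι)

@[elab_as_elim]
theorem exteriorPower_induction {p : ℕ} {motive : ExteriorAlgebra 𝕜 V → Prop}
    (hadd : ∀ x y, motive x → motive y → motive (x + y))
    (hprod : ∀ v : Fin p → V, motive (ExteriorAlgebra.ιMulti 𝕜 p v))
    (hsmul : ∀ (c : 𝕜) x, motive x → motive (c • x))
    {a : ExteriorAlgebra 𝕜 V} (ha : a ∈ ⋀[𝕜]^p V) : motive a := by
  rw [← ExteriorAlgebra.ιMulti_span_fixedDegree] at ha
  induction ha using Submodule.span_induction with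
  | mem x h => obtain ⟨v, rfl⟩ := h; exact hprod v
  | zero => simpa using hsmul 0 _ (hprod 0)
  | add x y _ _ hx hy => exact hadd _ _ hx hy
  | smul c x _ hx => exact hsmul c x hx

theorem ι_mem (v : V) : ι 𝕜 v ∈ ⋀[𝕜]^1 V := by
  rw [ExteriorAlgebra.exteriorPower, pow_one]; exact ⟨v, rfl⟩

theorem mul_mem_exteriorPower {p q : ℕ} {a b : ExteriorAlgebra 𝕜 V} (ha : a ∈ ⋀[𝕜]^p V)
    (hb : b ∈ ⋀[𝕜]^q V) : a * b ∈ ⋀[𝕜]^(p + q) V := by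
  rw [ExteriorAlgebra.exteriorPower, pow_add]; exact Submodule.mul_mem_mul ha hb

theorem ι_mul_mem {p : ℕ} (v : V) {a : ExteriorAlgebra 𝕜 V} (ha : a ∈ ⋀[𝕜]^p V) :
    ι 𝕜 v * a ∈ ⋀[𝕜]^(p + 1) V := by
  rw [add_comm]; exact mul_mem_exteriorPower (ι_mem v) ha

/-- Induction on the degree: a form of degree `p + 1` is a sum of products `v ∧ a`. -/
@[elab_as_elim]
theorem exteriorPower_succ_induction {p : ℕ} {motive : ExteriorAlgebra 𝕜 V → Prop}
    (hadd : ∀ x y, motive x → motive y → motive (x + y))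
    (hι : ∀ (v : V) (a : ExteriorAlgebra 𝕜 V), a ∈ ⋀[𝕜]^p V → motive (ι 𝕜 v * a))
    {a : ExteriorAlgebra 𝕜 V} (ha : a ∈ ⋀[𝕜]^(p + 1) V) : motive a := by
  rw [ExteriorAlgebra.exteriorPower, pow_succ'] at ha
  induction ha using Submodule.mul_induction_on' with
  | mem_mul_mem x hx y hy => obtain ⟨v, rfl⟩ := hx; exact hι v y hy
  | add x _ y _ hx hy => exact hadd _ _ hx hy

@[elab_as_elim]
theorem exteriorPower_zero_induction {motive : ExteriorAlgebra 𝕜 V → Prop}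
    (h : ∀ c : 𝕜, motive (algebraMap 𝕜 _ c)) {a : ExteriorAlgebra 𝕜 V} (ha : a ∈ ⋀[𝕜]^0 V) :
    motive a := by
  rw [ExteriorAlgebra.exteriorPower, pow_zero] at ha
  obtain ⟨c, rfl⟩ := Submodule.mem_one.1 ha
  exact h c

theorem contractLeft_mem_zero (d : Module.Dual 𝕜 V) {a : ExteriorAlgebra 𝕜 V}
    (ha : a ∈ ⋀[𝕜]^0 V) : contractLeft d a = 0 :=
  exteriorPower_zero_induction (fun _ => CliffordAlgebra.contractLeft_algebraMap _ _ _) ha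

theorem contractLeft_mem {p : ℕ} (d : Module.Dual 𝕜 V) {a : ExteriorAlgebra 𝕜 V}
    (ha : a ∈ ⋀[𝕜]^(p + 1) V) : contractLeft d a ∈ ⋀[𝕜]^p V := by
  induction p generalizing a with
  | zero =>
    refine exteriorPower_succ_induction (fun x y hx hy => ?_) (fun v a ha => ?_) ha
    · rw [map_add]; exact add_mem hx hy
    · erw [CliffordAlgebra.contractLeft_ι_mul]
      rw [contractLeft_mem_zero d ha, mul_zero, sub_zero]; exact Submodule.smul_mem _ _ ha
  | succ p ih =>
    refine exteriorPower_succ_induction (fun x y hx hy => ?_) (fun v a ha => ?_) ha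
    · rw [map_add]; exact add_mem hx hy
    · erw [CliffordAlgebra.contractLeft_ι_mul]
      exact sub_mem (Submodule.smul_mem _ _ ha) (ι_mul_mem v (ih ha))

theorem contractLeft_mem' {p : ℕ} (d : Module.Dual 𝕜 V) {a : ExteriorAlgebra 𝕜 V}
    (ha : a ∈ ⋀[𝕜]^p V) : contractLeft d a ∈ ⋀[𝕜]^(p - 1) V := by
  cases p with
  | zero => rw [contractLeft_mem_zero d ha]; exact zero_mem _
  | succ p => exact contractLeft_mem d ha

theorem involute_of_mem {p : ℕ} {a : ExteriorAlgebra 𝕜 V} (ha : a ∈ ⋀[𝕜]^p V) :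
    involute a = ((-1 : 𝕜) ^ p) • a := by
  induction p generalizing a with
  | zero => exact exteriorPower_zero_induction (fun c => by simp) ha
  | succ p ih =>
    refine exteriorPower_succ_induction (fun x y hx hy => ?_) (fun v a ha => ?_) ha
    · rw [map_add, hx, hy, smul_add]
    · rw [map_mul, ih ha]
      erw [CliffordAlgebra.involute_ι]
      simp [pow_succ]

theorem ι_mul_eq (v : V) (b : ExteriorAlgebra 𝕜 V) : ι 𝕜 v * b = involute b * ι 𝕜 v := by
  have h := ι_mul_sub_involute_mul_ι (Q := (0 : QuadraticForm 𝕜 V)) v b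
  have : QuadraticMap.polarBilin (0 : QuadraticForm 𝕜 V) v = 0 := by
    ext w; simp [QuadraticMap.polar]
  rw [this, map_zero, LinearMap.zero_apply, sub_eq_zero] at h
  exact h

theorem mul_eq_iterate_involute_mul {p : ℕ} {a : ExteriorAlgebra 𝕜 V} (ha : a ∈ ⋀[𝕜]^p V)
    (b : ExteriorAlgebra 𝕜 V) : a * b = (involute^[p] b) * a := by
  induction p generalizing a with
  | zero => exact exteriorPower_zero_induction (fun c => Algebra.commutes _ _) ha
  | succ p ih =>
    refine exteriorPower_succ_induction (fun x y hx hy => ?_) (fun v a ha => ?_) ha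
    · rw [add_mul, mul_add, hx, hy]
    · rw [mul_assoc, ih ha, ← mul_assoc, ι_mul_eq, mul_assoc, Function.iterate_succ_apply']

theorem iterate_involute_even {p : ℕ} (hp : Even p) (b : ExteriorAlgebra 𝕜 V) :
    involute^[p] b = b := by
  obtain ⟨q, rfl⟩ := hp
  rw [← two_mul, Function.iterate_mul]
  have : (involute : ExteriorAlgebra 𝕜 V →ₐ[𝕜] _)^[2] = id :=
    funext fun x => CliffordAlgebra.involute_involute x
  rw [this, Function.iterate_id, id]

theorem mul_eq_of_mem_even {p : ℕ} (hp : Even p) {a : ExteriorAlgebra 𝕜 V} (ha : a ∈ ⋀[𝕜]^p V)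
    (b : ExteriorAlgebra 𝕜 V) : a * b = b * a := by
  rw [mul_eq_iterate_involute_mul ha, iterate_involute_even hp]

theorem mul_eq_of_mem_odd {p : ℕ} (hp : Odd p) {a : ExteriorAlgebra 𝕜 V} (ha : a ∈ ⋀[𝕜]^p V)
    (b : ExteriorAlgebra 𝕜 V) : a * b = involute b * a := by
  obtain ⟨q, rfl⟩ := hp
  rw [mul_eq_iterate_involute_mul ha, Function.iterate_add_apply,
    iterate_involute_even (even_two_mul q), Function.iterate_one]

variable {n : ℕ} {e : Fin n → V} {d : Fin n → Module.Dual 𝕜 V}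

theorem sum_ι_mul_contractLeft (he : ∀ v, ∑ a, d a v • e a = v) {p : ℕ}
    {a : ExteriorAlgebra 𝕜 V} (ha : a ∈ ⋀[𝕜]^p V) :
    ∑ i, ι 𝕜 (e i) * contractLeft (d i) a = (p : 𝕜) • a := by
  induction p generalizing a with
  | zero => simp [contractLeft_mem_zero _ ha]
  | succ p ih =>
    refine exteriorPower_succ_induction (fun x y hx hy => ?_) (fun v a ha => ?_) ha
    · simp only [map_add, mul_add, Finset.sum_add_distrib, hx, hy, smul_add]
    · have h1 : ∀ i, ι 𝕜 (e i) * contractLeft (d i) (ι 𝕜 v * a)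
          = ι 𝕜 (d i v • e i) * a + ι 𝕜 v * (ι 𝕜 (e i) * contractLeft (d i) a) := by
        intro i
        erw [CliffordAlgebra.contractLeft_ι_mul]
        rw [mul_sub, map_smul, mul_smul_comm, smul_mul_assoc, ← mul_assoc, ← mul_assoc]
        have := ExteriorAlgebra.ι_add_mul_swap (R := 𝕜) (e i) v
        rw [add_eq_zero_iff_eq_neg] at this
        erw [this]
        rw [neg_mul, sub_neg_eq_add]
      simp only [h1]
      rw [Finset.sum_add_distrib, ← Finset.sum_mul, ← map_sum, he, ← Finset.mul_sum, ih ha]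
      simp only [mul_smul_comm, Nat.cast_add, Nat.cast_one, add_smul, one_smul]
      abel

theorem eq_zero_of_mem_exteriorPower_of_gt [CharZero 𝕜] (he : ∀ v, ∑ a, d a v • e a = v) {p : ℕ}
    (hp : n < p) {a : ExteriorAlgebra 𝕜 V} (ha : a ∈ ⋀[𝕜]^p V) : a = 0 := by
  refine exteriorPower_induction (fun x y hx hy => by rw [hx, hy, add_zero]) (fun v => ?_)
    (fun c x hx => by rw [hx, smul_zero]) ha
  refine AlternatingMap.map_linearDependent _ v fun hv => ?_
  have hspan : Submodule.span 𝕜 (Set.range e) = ⊤ := by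
    rw [eq_top_iff]
    intro v _
    rw [← he v]
    exact Submodule.sum_mem _ fun i _ => Submodule.smul_mem _ _ (Submodule.subset_span ⟨i, rfl⟩)
  have : Module.Finite 𝕜 V := ⟨⟨(Set.finite_range e).toFinset, by simpa using hspan⟩⟩
  have h1 := hv.fintype_card_le_finrank
  have h2 := finrank_range_le_card (R := 𝕜) e
  rw [Set.finrank, hspan, finrank_top] at h2
  simp at h1 h2
  omega

end ExteriorLemmas

end

section

section Parity

variable {𝕜 V : Type*} [Field 𝕜] [AddCommGroup V] [Module 𝕜 V]

open CliffordAlgebra (contractLeft involute)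

/-- The sign `-1` of `true`, `1` of `false`. -/
def sgn (𝕜 : Type*) [Field 𝕜] (b : Bool) : 𝕜 := if b then -1 else 1

/-- `a` is even (`b = false`) or odd (`b = true`). -/
def HasParity (b : Bool) (a : ExteriorAlgebra 𝕜 V) : Prop :=
  (∀ c, a * c = (if b then involute c else c) * a) ∧ involute a = sgn 𝕜 b • a

theorem hasParity_of_mem {p : ℕ} {a : ExteriorAlgebra 𝕜 V} (ha : a ∈ ⋀[𝕜]^p V) :
    HasParity (decide (Odd p)) a := by
  refine ⟨fun c => ?_, ?_⟩
  · by_cases hp : Odd p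
    · simpa [hp] using mul_eq_of_mem_odd hp ha c
    · simpa [hp] using mul_eq_of_mem_even (Nat.not_odd_iff_even.1 hp) ha c
  · rw [involute_of_mem ha]
    by_cases hp : Odd p
    · simp [hp, sgn, hp.neg_one_pow]
    · simp [hp, sgn, (Nat.not_odd_iff_even.1 hp).neg_one_pow]

theorem sgn_decide_odd (p : ℕ) : sgn 𝕜 (decide (Odd p)) = (-1) ^ p := by
  by_cases hp : Odd p
  · simp [hp, sgn, hp.neg_one_pow]
  · simp [hp, sgn, (Nat.not_odd_iff_even.1 hp).neg_one_pow]

namespace HasParity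

variable {b c : Bool} {x y z : ExteriorAlgebra 𝕜 V}

theorem add (hx : HasParity b x) (hy : HasParity b y) : HasParity b (x + y) :=
  ⟨fun z => by rw [add_mul, mul_add, hx.1, hy.1], by rw [map_add, hx.2, hy.2, smul_add]⟩

theorem smul (r : 𝕜) (hx : HasParity b x) : HasParity b (r • x) :=
  ⟨fun z => by rw [smul_mul_assoc, mul_smul_comm, hx.1], by rw [map_smul, hx.2, smul_comm]⟩

theorem zero : HasParity b (0 : ExteriorAlgebra 𝕜 V) := ⟨fun z => by simp, by simp⟩

theorem sum {ι : Type*} (s : Finset ι) (f : ι → ExteriorAlgebra 𝕜 V)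
    (h : ∀ i, HasParity b (f i)) : HasParity b (∑ i ∈ s, f i) := by
  classical
  induction s using Finset.induction_on with
  | empty => simpa using zero
  | insert a s ha ih => rw [Finset.sum_insert ha]; exact (h a).add ih

theorem mul (hx : HasParity b x) (hy : HasParity c y) : HasParity (xor b c) (x * y) := by
  refine ⟨fun z => ?_, ?_⟩
  · rw [mul_assoc, hy.1, ← mul_assoc, hx.1, mul_assoc]
    cases b <;> cases c <;> simp
  · rw [map_mul, hx.2, hy.2, smul_mul_smul_comm]
    cases b <;> cases c <;> simp [sgn]

theorem contract (d : Module.Dual 𝕜 V) (hx : HasParity b x) :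
    HasParity (!b) (contractLeft d x) := by
  refine ⟨fun z => ?_, ?_⟩
  · have h1 := congrArg (contractLeft d) (hx.1 z)
    rw [contractLeft_mul, contractLeft_mul, hx.2] at h1
    cases b
    · simp only [sgn, Bool.false_eq_true, if_false, one_smul, hx.1 (contractLeft d z)] at h1
      simp only [Bool.not_false, if_true]
      rw [add_comm] at h1
      exact add_left_cancel h1
    · simp only [sgn, if_true, neg_smul, one_smul, neg_mul, hx.1 (contractLeft d z),
        CliffordAlgebra.involute_involute] at h1
      rw [involute_contractLeft] at h1
      simp only [Bool.not_true, Bool.false_eq_true, if_false]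
      rw [neg_mul, neg_neg, add_comm] at h1
      exact add_left_cancel h1
  · rw [involute_contractLeft, hx.2, map_smul]
    cases b <;> simp [sgn]

theorem comm (hx : HasParity b x) (hy : HasParity c y) : x * y = sgn 𝕜 (b && c) • (y * x) := by
  rw [hx.1]
  cases b
  · simp [sgn]
  · simp [hy.2]

end HasParity

variable {n : ℕ} (h : Fin n → 𝕜) (d : Fin n → Module.Dual 𝕜 V)

/-- The operation `∑ h_a i_a x ∧ i_a y`. -/
def ctr (x y : ExteriorAlgebra 𝕜 V) : ExteriorAlgebra 𝕜 V :=
  ∑ a, h a • (contractLeft (d a) x * contractLeft (d a) y)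

variable {h d} {b c : Bool} {x y z : ExteriorAlgebra 𝕜 V}

theorem ctr_add_left : ctr h d (x + y) z = ctr h d x z + ctr h d y z := by
  simp [ctr, add_mul, Finset.sum_add_distrib]

theorem ctr_add_right : ctr h d x (y + z) = ctr h d x y + ctr h d x z := by
  simp [ctr, mul_add, Finset.sum_add_distrib]

theorem ctr_smul_left (r : 𝕜) : ctr h d (r • x) y = r • ctr h d x y := by
  simp only [ctr, map_smul, smul_mul_assoc, Finset.smul_sum, smul_comm r]

theorem ctr_smul_right (r : 𝕜) : ctr h d x (r • y) = r • ctr h d x y := by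
  simp only [ctr, map_smul, mul_smul_comm, Finset.smul_sum, smul_comm r]

theorem ctr_neg_left : ctr h d (-x) y = -ctr h d x y := by simp [ctr]

theorem ctr_neg_right : ctr h d x (-y) = -ctr h d x y := by simp [ctr]

theorem ctr_sub_left : ctr h d (x - y) z = ctr h d x z - ctr h d y z := by
  simp [sub_eq_add_neg, ctr_add_left, ctr_neg_left]

theorem ctr_sub_right : ctr h d x (y - z) = ctr h d x y - ctr h d x z := by
  simp [sub_eq_add_neg, ctr_add_right, ctr_neg_right]

theorem HasParity.ctr (hx : HasParity b x) (hy : HasParity c y) :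
    HasParity (xor b c) (ctr h d x y) := by
  refine HasParity.sum _ _ fun i => HasParity.smul _ ?_
  have := (hx.contract (d i)).mul (hy.contract (d i))
  simpa using this

theorem ctr_comm (hx : HasParity b x) (hy : HasParity c y) :
    ctr h d x y = sgn 𝕜 (!b && !c) • ctr h d y x := by
  simp only [ctr, Finset.smul_sum]
  refine Finset.sum_congr rfl fun i _ => ?_
  rw [(hx.contract (d i)).comm (hy.contract (d i)), smul_comm]

theorem ctr_mul_right (hx : HasParity b x) (hy : HasParity c y) :
    ctr h d x (y * z) = ctr h d x y * z + sgn 𝕜 (b && c) • (y * ctr h d x z) := by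
  simp only [ctr, Finset.sum_mul, Finset.mul_sum, Finset.smul_sum, ← Finset.sum_add_distrib]
  refine Finset.sum_congr rfl fun i _ => ?_
  rw [contractLeft_mul, mul_add, smul_add, smul_mul_assoc, mul_smul_comm, ← mul_assoc, hy.2,
    smul_mul_assoc, mul_smul_comm, ← mul_assoc, (hx.contract (d i)).comm hy, smul_mul_assoc,
    ← mul_assoc]
  cases b <;> cases c <;> simp [sgn]

theorem ctr_jacobi (hx : HasParity b x) (hy : HasParity c y) :
    ctr h d x (ctr h d y z) = sgn 𝕜 b • ctr h d (ctr h d x y) z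
      + sgn 𝕜 (b && c) • ctr h d y (ctr h d x z) := by
  have h1 : ctr h d x (ctr h d y z) = ∑ i, ∑ j, (h i * h j) •
      (contractLeft (d i) x * (contractLeft (d i) (contractLeft (d j) y) * contractLeft (d j) z)
      + sgn 𝕜 (!c) • (contractLeft (d i) x * (contractLeft (d j) y *
          contractLeft (d i) (contractLeft (d j) z)))) := by
    simp only [ctr, map_sum, map_smul, contractLeft_mul, Finset.mul_sum, Finset.smul_sum]
    refine Finset.sum_congr rfl fun i _ => Finset.sum_congr rfl fun j _ => ?_
    rw [(hy.contract (d j)).2]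
    simp only [mul_smul_comm, smul_mul_assoc, mul_add, smul_add, smul_smul]
    module
  have h2 : ctr h d (ctr h d x y) z = ∑ i, ∑ j, (h i * h j) •
      (- (contractLeft (d i) (contractLeft (d j) x) * (contractLeft (d i) y * contractLeft (d j) z))
      - sgn 𝕜 (!b) • (contractLeft (d i) x * (contractLeft (d i) (contractLeft (d j) y) *
          contractLeft (d j) z))) := by
    simp only [ctr, map_sum, map_smul, contractLeft_mul, Finset.sum_mul, Finset.smul_sum]
    rw [Finset.sum_comm]
    refine Finset.sum_congr rfl fun i _ => Finset.sum_congr rfl fun j _ => ?_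
    rw [(hx.contract (d i)).2, CliffordAlgebra.contractLeft_comm (d := d j) (d' := d i) x,
      CliffordAlgebra.contractLeft_comm (d := d j) (d' := d i) y]
    simp only [smul_mul_assoc, add_mul, neg_mul, mul_neg, mul_assoc]
    module
  have h3 : ctr h d y (ctr h d x z) = ∑ i, ∑ j, (h i * h j) •
      (sgn 𝕜 (b && !c) •
        (contractLeft (d i) (contractLeft (d j) x) * (contractLeft (d i) y * contractLeft (d j) z))
      - sgn 𝕜 (!b) • sgn 𝕜 (!b && !c) • (contractLeft (d i) x * (contractLeft (d j) y *
          contractLeft (d i) (contractLeft (d j) z)))) := by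
    have h4 : ctr h d y (ctr h d x z) = (∑ i, ∑ j, (h i * h j) •
      (contractLeft (d i) y * (contractLeft (d i) (contractLeft (d j) x) * contractLeft (d j) z)))
      + ∑ i, ∑ j, (h i * h j) • sgn 𝕜 (!b) • (contractLeft (d i) y * (contractLeft (d j) x *
          contractLeft (d i) (contractLeft (d j) z))) := by
      simp only [ctr, map_sum, map_smul, contractLeft_mul, Finset.mul_sum, Finset.smul_sum,
        ← Finset.sum_add_distrib]
      refine Finset.sum_congr rfl fun i _ => Finset.sum_congr rfl fun j _ => ?_
      rw [(hx.contract (d j)).2]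
      simp only [mul_smul_comm, smul_mul_assoc, mul_add, smul_add, smul_smul]
      congr 2
      ring
    rw [h4, Finset.sum_comm (f := fun i j => (h i * h j) • sgn 𝕜 (!b) • _),
      ← Finset.sum_add_distrib]
    refine Finset.sum_congr rfl fun i _ => ?_
    rw [← Finset.sum_add_distrib]
    refine Finset.sum_congr rfl fun j _ => ?_
    rw [← mul_assoc, (hy.contract (d i)).comm ((hx.contract (d j)).contract (d i)),
      ← mul_assoc (contractLeft (d j) y), (hy.contract (d j)).comm (hx.contract (d i)),
      CliffordAlgebra.contractLeft_comm (d := d j) (d' := d i) z]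
    simp only [smul_mul_assoc, mul_assoc, mul_neg, smul_neg, smul_sub, smul_smul, Bool.not_not,
      mul_comm (h j), Bool.and_comm]
    rw [sub_eq_add_neg]
  rw [h1, h2, h3, Finset.smul_sum, Finset.smul_sum, ← Finset.sum_add_distrib]
  refine Finset.sum_congr rfl fun i _ => ?_
  rw [Finset.smul_sum, Finset.smul_sum, ← Finset.sum_add_distrib]
  refine Finset.sum_congr rfl fun j _ => ?_
  cases b <;> cases c <;> simp [sgn] <;> module

end Parity

end

section

section BracketAlgebra

variable {𝕜 V : Type*} [Field 𝕜] [AddCommGroup V] [Module 𝕜 V]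
  {n : ℕ} {h : Fin n → 𝕜} {d : Fin n → Module.Dual 𝕜 V}

open CliffordAlgebra (contractLeft involute)

theorem jacobi_wmm {a b c : Bool} {x y z : ExteriorAlgebra 𝕜 V} (hx : HasParity a x)
    (hy : HasParity (!b) y) (hz : HasParity (!c) z) :
    -(sgn 𝕜 (a && !c) • ctr h d x (ctr h d y z))
      + (sgn 𝕜 (b && !a) * sgn 𝕜 b * sgn 𝕜 c) • ctr h d y (ctr h d z x)
      + (sgn 𝕜 (c && !b) * sgn 𝕜 c) • ctr h d z (ctr h d x y) = 0 := by
  rw [ctr_comm hz hx, ctr_smul_right, ctr_comm hz (hx.ctr hy), ctr_jacobi hx hy]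
  cases a <;> cases b <;> cases c <;> simp [sgn]

theorem jacobi_wwt {a b c : Bool} {x y z : ExteriorAlgebra 𝕜 V} (hx : HasParity a x)
    (hy : HasParity b y) (hz : HasParity c z) :
    sgn 𝕜 (a && !c) • (ctr h d x (y * z) - (sgn 𝕜 a * sgn 𝕜 b) • (x * ctr h d y z))
      + sgn 𝕜 (b && !a) • (ctr h d y (z * x) + (sgn 𝕜 b * sgn 𝕜 c) • (y * ctr h d z x)) = 0 := by
  rw [ctr_mul_right hx hy, ctr_mul_right hy hz, ctr_comm hz hx, ctr_comm hy hx,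
    (hy.ctr hz).comm hx, mul_smul_comm, mul_smul_comm, hz.comm (hx.ctr hy)]
  cases a <;> cases b <;> cases c <;> simp [sgn] <;> module

theorem jacobi_wmf {a b c : Bool} {x y z : ExteriorAlgebra 𝕜 V} (hx : HasParity a x)
    (hy : HasParity (!b) y) (hz : HasParity (!c) z) :
    sgn 𝕜 (a && !c) • (sgn 𝕜 a • (x * ctr h d y z))
      + sgn 𝕜 (b && !a) • (-(sgn 𝕜 b • ctr h d y (z * x)))
      + sgn 𝕜 (c && !b) • (-(z * ctr h d x y)) = 0 := by
  rw [ctr_mul_right hy hz, ctr_comm hy hx, (hy.ctr hz).comm hx, mul_smul_comm]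
  cases a <;> cases b <;> cases c <;> simp [sgn]

theorem jacobi_wfm {a b c : Bool} {x y z : ExteriorAlgebra 𝕜 V} (hx : HasParity a x)
    (hy : HasParity (!b) y) (hz : HasParity (!c) z) :
    sgn 𝕜 (a && !c) • (sgn 𝕜 a • (x * ctr h d y z))
      + sgn 𝕜 (b && !a) • (-(sgn 𝕜 c • (y * ctr h d z x)))
      + sgn 𝕜 (c && !b) • (-((sgn 𝕜 c * sgn 𝕜 a) • ctr h d z (x * y))) = 0 := by
  rw [ctr_mul_right hz hx, ctr_comm hz hy, ctr_comm hz hx, mul_smul_comm, mul_smul_comm,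
    hy.comm (hx.ctr hz)]
  cases a <;> cases b <;> cases c <;> simp [sgn] <;> module

theorem jacobi_wff {a b c : Bool} {x y z : ExteriorAlgebra 𝕜 V} (hx : HasParity a x)
    (hy : HasParity (!b) y) (hz : HasParity (!c) z) :
    sgn 𝕜 (b && !a) • (y * (z * x)) + sgn 𝕜 (c && !b) • (sgn 𝕜 a • (z * (x * y))) = 0 := by
  rw [← mul_assoc z, (hz.mul hx).comm hy]
  cases a <;> cases b <;> cases c <;> simp [sgn]

variable (h d) in
/-- The bracket of the solutions `(w, m, f, t)` of the prolonged system: the form itself. -/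
def brW (s : 𝕜) (w₁ m₁ f₁ w₂ m₂ f₂ : ExteriorAlgebra 𝕜 V) : ExteriorAlgebra 𝕜 V :=
  ctr h d w₁ m₂ + s • ctr h d m₁ w₂ - s • (w₁ * f₂) - f₁ * w₂

variable (h d) in
/-- The component `dw/(p+1)` of the bracket of two solutions of the prolonged system. -/
def brM (w₁ m₁ t₁ w₂ m₂ t₂ : ExteriorAlgebra 𝕜 V) : ExteriorAlgebra 𝕜 V :=
  -ctr h d m₁ m₂ + w₁ * t₂ + t₁ * w₂

variable (h d) in
/-- The component `-δw/(n-p+1)` of the bracket of two solutions of the prolonged system. -/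
def brF (s : 𝕜) (w₁ m₁ f₁ t₁ w₂ m₂ f₂ t₂ : ExteriorAlgebra 𝕜 V) : ExteriorAlgebra 𝕜 V :=
  s • ctr h d w₁ t₂ - s • ctr h d t₁ w₂ - ctr h d m₁ f₂ - ctr h d f₁ m₂

variable (h d) in
/-- The component `t` of the bracket of two solutions of the prolonged system. -/
def brT (s : 𝕜) (m₁ f₁ t₁ m₂ f₂ t₂ : ExteriorAlgebra 𝕜 V) : ExteriorAlgebra 𝕜 V :=
  ctr h d t₁ m₂ + s • ctr h d m₁ t₂ + f₁ * t₂ + s • (t₁ * f₂)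

theorem bracket_jacobi {a b c : Bool}
    {w₁ m₁ f₁ t₁ w₂ m₂ f₂ t₂ w₃ m₃ f₃ t₃ : ExteriorAlgebra 𝕜 V}
    (hw₁ : HasParity a w₁) (hm₁ : HasParity (!a) m₁) (hf₁ : HasParity (!a) f₁)
    (ht₁ : HasParity a t₁) (hw₂ : HasParity b w₂) (hm₂ : HasParity (!b) m₂)
    (hf₂ : HasParity (!b) f₂) (ht₂ : HasParity b t₂) (hw₃ : HasParity c w₃)
    (hm₃ : HasParity (!c) m₃) (hf₃ : HasParity (!c) f₃) (ht₃ : HasParity c t₃) :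
    sgn 𝕜 (a && !c) • brW h d (sgn 𝕜 a) w₁ m₁ f₁ (brW h d (sgn 𝕜 b) w₂ m₂ f₂ w₃ m₃ f₃)
        (brM h d w₂ m₂ t₂ w₃ m₃ t₃) (brF h d (sgn 𝕜 b) w₂ m₂ f₂ t₂ w₃ m₃ f₃ t₃)
      + sgn 𝕜 (b && !a) • brW h d (sgn 𝕜 b) w₂ m₂ f₂ (brW h d (sgn 𝕜 c) w₃ m₃ f₃ w₁ m₁ f₁)
        (brM h d w₃ m₃ t₃ w₁ m₁ t₁) (brF h d (sgn 𝕜 c) w₃ m₃ f₃ t₃ w₁ m₁ f₁ t₁)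
      + sgn 𝕜 (c && !b) • brW h d (sgn 𝕜 c) w₃ m₃ f₃ (brW h d (sgn 𝕜 a) w₁ m₁ f₁ w₂ m₂ f₂)
        (brM h d w₁ m₁ t₁ w₂ m₂ t₂) (brF h d (sgn 𝕜 a) w₁ m₁ f₁ t₁ w₂ m₂ f₂ t₂) = 0 := by
  simp only [brW, brM, brF, ctr_add_right, ctr_sub_right, ctr_smul_right, ctr_neg_right, mul_add,
    mul_sub,
    mul_smul_comm]
  linear_combination (norm := module)
    jacobi_wmm (h := h) (d := d) hw₁ hm₂ hm₃ + jacobi_wmm (h := h) (d := d) hw₂ hm₃ hm₁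
    + jacobi_wmm (h := h) (d := d) hw₃ hm₁ hm₂ + jacobi_wwt (h := h) (d := d) hw₁ hw₂ ht₃
    + jacobi_wwt (h := h) (d := d) hw₂ hw₃ ht₁ + jacobi_wwt (h := h) (d := d) hw₃ hw₁ ht₂
    + jacobi_wmf (h := h) (d := d) hw₁ hm₂ hf₃ + jacobi_wmf (h := h) (d := d) hw₂ hm₃ hf₁
    + jacobi_wmf (h := h) (d := d) hw₃ hm₁ hf₂ + jacobi_wfm (h := h) (d := d) hw₁ hf₂ hm₃
    + jacobi_wfm (h := h) (d := d) hw₂ hf₃ hm₁ + jacobi_wfm (h := h) (d := d) hw₃ hf₁ hm₂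
    + jacobi_wff hw₁ hf₂ hf₃ + jacobi_wff hw₂ hf₃ hf₁ + jacobi_wff hw₃ hf₁ hf₂

section Parallel

variable {x : V} {D : Module.Dual 𝕜 V} {a b c : Bool} {y z : ExteriorAlgebra 𝕜 V}

theorem ctr_ι_mul_left (hD : ∑ i, (h i * d i x) • d i = D) (y z : ExteriorAlgebra 𝕜 V) :
    ctr h d (ExteriorAlgebra.ι 𝕜 x * y) z
      = y * contractLeft D z - ExteriorAlgebra.ι 𝕜 x * ctr h d y z := by
  have h1 : ∀ i, contractLeft (d i) (ExteriorAlgebra.ι 𝕜 x * y)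
      = d i x • y - ExteriorAlgebra.ι 𝕜 x * contractLeft (d i) y := fun i =>
    CliffordAlgebra.contractLeft_ι_mul (d := d i) x y
  simp only [ctr, h1, ← hD, map_sum, map_smul, LinearMap.sum_apply, LinearMap.smul_apply,
    Finset.mul_sum, ← Finset.sum_sub_distrib]
  refine Finset.sum_congr rfl fun i _ => ?_
  simp only [sub_mul, smul_mul_assoc, mul_smul_comm, mul_assoc]
  module

theorem hasParity_ι (x : V) : HasParity true (ExteriorAlgebra.ι 𝕜 x) := by
  simpa using hasParity_of_mem (ι_mem (𝕜 := 𝕜) x)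

theorem mul_ι_mul (hy : HasParity a y) (x : V) (z : ExteriorAlgebra 𝕜 V) :
    y * (ExteriorAlgebra.ι 𝕜 x * z) = sgn 𝕜 a • (ExteriorAlgebra.ι 𝕜 x * (y * z)) := by
  rw [← mul_assoc, hy.comm (hasParity_ι x), smul_mul_assoc, mul_assoc, Bool.and_true]

theorem ctr_ι_mul_right (hD : ∑ i, (h i * d i x) • d i = D) (hy : HasParity a y)
    (z : ExteriorAlgebra 𝕜 V) :
    ctr h d y (ExteriorAlgebra.ι 𝕜 x * z)
      = contractLeft D y * z - sgn 𝕜 (!a) • (ExteriorAlgebra.ι 𝕜 x * ctr h d y z) := by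
  have h1 : ∀ i, contractLeft (d i) (ExteriorAlgebra.ι 𝕜 x * z)
      = d i x • z - ExteriorAlgebra.ι 𝕜 x * contractLeft (d i) z := fun i =>
    CliffordAlgebra.contractLeft_ι_mul (d := d i) x z
  simp only [ctr, h1, ← hD, map_sum, map_smul, LinearMap.sum_apply, LinearMap.smul_apply,
    Finset.mul_sum, Finset.sum_mul, Finset.smul_sum, ← Finset.sum_sub_distrib]
  refine Finset.sum_congr rfl fun i _ => ?_
  rw [mul_sub, mul_ι_mul (hy.contract (d i))]
  simp only [smul_mul_assoc, mul_smul_comm]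
  module

theorem contractLeft_ctr (D : Module.Dual 𝕜 V) (hy : HasParity a y) (z : ExteriorAlgebra 𝕜 V) :
    contractLeft D (ctr h d y z) = -ctr h d (contractLeft D y) z
      - sgn 𝕜 (!a) • ctr h d y (contractLeft D z) := by
  simp only [ctr, map_sum, map_smul, Finset.smul_sum, ← Finset.sum_sub_distrib,
    ← Finset.sum_neg_distrib]
  refine Finset.sum_congr rfl fun i _ => ?_
  rw [contractLeft_mul, (hy.contract (d i)).2, CliffordAlgebra.contractLeft_comm D (d i) y,
    CliffordAlgebra.contractLeft_comm D (d i) z]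
  simp only [smul_mul_assoc, neg_mul, mul_neg]
  module

theorem contractLeft_mul' (D : Module.Dual 𝕜 V) (hy : HasParity a y) (z : ExteriorAlgebra 𝕜 V) :
    contractLeft D (y * z) = contractLeft D y * z + sgn 𝕜 a • (y * contractLeft D z) := by
  rw [contractLeft_mul, hy.2, smul_mul_assoc]

variable {w₁ m₁ f₁ t₁ w₂ m₂ f₂ t₂ : ExteriorAlgebra 𝕜 V} (k : 𝕜)

theorem bracket_parallel_w (hD : ∑ i, (h i * d i x) • d i = D)
    (hw₁ : HasParity a w₁) (hm₁ : HasParity (!a) m₁) (hf₁ : HasParity (!a) f₁)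
    (ht₁ : HasParity a t₁) :
    brW h d (sgn 𝕜 a) (contractLeft D m₁ + ExteriorAlgebra.ι 𝕜 x * f₁)
        (ExteriorAlgebra.ι 𝕜 x * (t₁ + k • w₁)) (-contractLeft D (t₁ - k • w₁)) w₂ m₂ f₂
      + brW h d (sgn 𝕜 a) w₁ m₁ f₁ (contractLeft D m₂ + ExteriorAlgebra.ι 𝕜 x * f₂)
        (ExteriorAlgebra.ι 𝕜 x * (t₂ + k • w₂)) (-contractLeft D (t₂ - k • w₂))
      = contractLeft D (brM h d w₁ m₁ t₁ w₂ m₂ t₂)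
        + ExteriorAlgebra.ι 𝕜 x * brF h d (sgn 𝕜 a) w₁ m₁ f₁ t₁ w₂ m₂ f₂ t₂ := by
  simp only [brW, brM, brF, ctr_add_left, ctr_add_right, ctr_smul_left, ctr_smul_right,
    ctr_ι_mul_left hD, ctr_ι_mul_right hD hw₁, ctr_ι_mul_right hD hm₁, contractLeft_ctr D hm₁,
    contractLeft_mul' D hw₁, contractLeft_mul' D ht₁, mul_ι_mul hf₁,
    add_mul, mul_add, sub_mul, mul_sub, map_add, map_sub, map_neg, map_smul, smul_mul_assoc,
    mul_smul_comm, mul_assoc, neg_mul, mul_neg]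
  cases a <;> simp [sgn] <;> module

theorem bracket_parallel_m (hD : ∑ i, (h i * d i x) • d i = D)
    (hw₁ : HasParity a w₁) (hm₁ : HasParity (!a) m₁) (ht₁ : HasParity a t₁) :
    brM h d (contractLeft D m₁ + ExteriorAlgebra.ι 𝕜 x * f₁)
        (ExteriorAlgebra.ι 𝕜 x * (t₁ + k • w₁))
        (k • (contractLeft D m₁ - ExteriorAlgebra.ι 𝕜 x * f₁)) w₂ m₂ t₂
      + brM h d w₁ m₁ t₁ (contractLeft D m₂ + ExteriorAlgebra.ι 𝕜 x * f₂)
        (ExteriorAlgebra.ι 𝕜 x * (t₂ + k • w₂))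
        (k • (contractLeft D m₂ - ExteriorAlgebra.ι 𝕜 x * f₂))
      = ExteriorAlgebra.ι 𝕜 x * (brT h d (sgn 𝕜 a) m₁ f₁ t₁ m₂ f₂ t₂
          + k • brW h d (sgn 𝕜 a) w₁ m₁ f₁ w₂ m₂ f₂) := by
  simp only [brW, brM, brT, ctr_add_right, ctr_smul_right,
    ctr_ι_mul_left hD, ctr_ι_mul_right hD hm₁, mul_ι_mul hw₁, mul_ι_mul ht₁,
    add_mul, mul_add, sub_mul, mul_sub, smul_mul_assoc, ctr_add_left, ctr_smul_left,
    mul_smul_comm, mul_assoc]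
  cases a <;> simp [sgn] <;> module

theorem bracket_parallel_f (hD : ∑ i, (h i * d i x) • d i = D)
    (hw₁ : HasParity a w₁) (hm₁ : HasParity (!a) m₁) (hf₁ : HasParity (!a) f₁)
    (ht₁ : HasParity a t₁) :
    brF h d (sgn 𝕜 a) (contractLeft D m₁ + ExteriorAlgebra.ι 𝕜 x * f₁)
        (ExteriorAlgebra.ι 𝕜 x * (t₁ + k • w₁)) (-contractLeft D (t₁ - k • w₁))
        (k • (contractLeft D m₁ - ExteriorAlgebra.ι 𝕜 x * f₁)) w₂ m₂ f₂ t₂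
      + brF h d (sgn 𝕜 a) w₁ m₁ f₁ t₁ (contractLeft D m₂ + ExteriorAlgebra.ι 𝕜 x * f₂)
        (ExteriorAlgebra.ι 𝕜 x * (t₂ + k • w₂)) (-contractLeft D (t₂ - k • w₂))
        (k • (contractLeft D m₂ - ExteriorAlgebra.ι 𝕜 x * f₂))
      = -contractLeft D (brT h d (sgn 𝕜 a) m₁ f₁ t₁ m₂ f₂ t₂
          - k • brW h d (sgn 𝕜 a) w₁ m₁ f₁ w₂ m₂ f₂) := by
  simp only [brW, brF, brT, ctr_add_left, ctr_add_right, ctr_smul_left, ctr_smul_right,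
    ctr_sub_left, ctr_sub_right, ctr_neg_left, ctr_neg_right,
    ctr_ι_mul_left hD, ctr_ι_mul_right hD hw₁, ctr_ι_mul_right hD hf₁,
    ctr_ι_mul_right hD ht₁, contractLeft_ctr D hm₁, contractLeft_ctr D hw₁,
    contractLeft_ctr D ht₁,
    contractLeft_mul' D hw₁, contractLeft_mul' D ht₁, contractLeft_mul' D hf₁,
    mul_add, map_add, map_sub, map_smul,
    mul_smul_comm]
  cases a <;> simp [sgn] <;> module

theorem bracket_parallel_t (hD : ∑ i, (h i * d i x) • d i = D)
    (hw₁ : HasParity a w₁) (hm₁ : HasParity (!a) m₁) (hf₁ : HasParity (!a) f₁)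
    (ht₁ : HasParity a t₁) :
    brT h d (sgn 𝕜 a) (ExteriorAlgebra.ι 𝕜 x * (t₁ + k • w₁)) (-contractLeft D (t₁ - k • w₁))
        (k • (contractLeft D m₁ - ExteriorAlgebra.ι 𝕜 x * f₁)) m₂ f₂ t₂
      + brT h d (sgn 𝕜 a) m₁ f₁ t₁
        (ExteriorAlgebra.ι 𝕜 x * (t₂ + k • w₂)) (-contractLeft D (t₂ - k • w₂))
        (k • (contractLeft D m₂ - ExteriorAlgebra.ι 𝕜 x * f₂))
      = k • (contractLeft D (brM h d w₁ m₁ t₁ w₂ m₂ t₂)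
        - ExteriorAlgebra.ι 𝕜 x * brF h d (sgn 𝕜 a) w₁ m₁ f₁ t₁ w₂ m₂ f₂ t₂) := by
  simp only [brM, brF, brT, ctr_add_left, ctr_add_right, ctr_smul_left, ctr_smul_right,
    ctr_sub_left, ctr_sub_right,
    ctr_ι_mul_left hD, ctr_ι_mul_right hD hm₁, ctr_ι_mul_right hD ht₁, contractLeft_ctr D hm₁,
    contractLeft_mul' D hw₁, contractLeft_mul' D ht₁, mul_ι_mul hf₁,
    mul_add, sub_mul, mul_sub, map_add, map_sub, map_neg, map_smul, smul_mul_assoc,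
    mul_smul_comm, mul_assoc, neg_mul, mul_neg]
  cases a <;> simp [sgn] <;> module

end Parallel

end BracketAlgebra

end

section

section ScalarCalculus

variable {n : ℕ} {M : Type*} [TopologicalSpace M] [ChartedSpace (Model n) M]
  {F G : Type*} [NormedAddCommGroup F] [NormedSpace ℝ F] [NormedAddCommGroup G] [NormedSpace ℝ G]
  {U : Set M} {x : M} {v w : TangentSpace 𝓘(ℝ, Model n) x}

/-- A smooth function on `U`. -/
abbrev SmoothOn (f : M → F) (U : Set M) : Prop := ContMDiffOn 𝓘(ℝ, Model n) 𝓘(ℝ, F) ∞ f U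

theorem SmoothOn.mdiff {f : M → F} (hf : SmoothOn (n := n) f U) (hU : IsOpen U) (hx : x ∈ U) :
    MDifferentiableAt 𝓘(ℝ, Model n) 𝓘(ℝ, F) f x :=
  (hf.contMDiffAt (hU.mem_nhds hx)).mdifferentiableAt (by simp)

theorem dirDeriv_add_right (f : M → F) : dirDeriv f x (v + w) = dirDeriv f x v + dirDeriv f x w :=
  map_add _ _ _

theorem dirDeriv_smul_right (f : M → F) (c : ℝ) : dirDeriv f x (c • v) = c • dirDeriv f x v :=
  map_smul _ _ _

theorem dirDeriv_sum_right {κ : Type*} (s : Finset κ) (f : M → F)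
    (v : κ → TangentSpace 𝓘(ℝ, Model n) x) :
    dirDeriv f x (∑ k ∈ s, v k) = ∑ k ∈ s, dirDeriv f x (v k) :=
  map_sum _ _ _

theorem dirDeriv_congr {f g : M → F} (hU : IsOpen U) (hx : x ∈ U) (h : Set.EqOn f g U) :
    dirDeriv f x v = dirDeriv g x v := by
  have : f =ᶠ[nhds x] g := Filter.eventuallyEq_of_mem (hU.mem_nhds hx) h
  simp only [dirDeriv]
  rw [this.mfderiv_eq]
  rfl

theorem dirDeriv_const (c : F) : dirDeriv (fun _ : M => c) x v = 0 := by
  simp only [dirDeriv]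
  rw [mfderiv_const]
  rfl

theorem dirDeriv_add {f g : M → F} (hf : MDifferentiableAt 𝓘(ℝ, Model n) 𝓘(ℝ, F) f x)
    (hg : MDifferentiableAt 𝓘(ℝ, Model n) 𝓘(ℝ, F) g x) :
    dirDeriv (fun y => f y + g y) x v = dirDeriv f x v + dirDeriv g x v := by
  have h := HasMFDerivAt.add hf.hasMFDerivAt hg.hasMFDerivAt
  exact congrArg (fun L => L v) h.mfderiv

theorem dirDeriv_clm (L : F →L[ℝ] G) {f : M → F}
    (hf : MDifferentiableAt 𝓘(ℝ, Model n) 𝓘(ℝ, F) f x) :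
    dirDeriv (fun y => L (f y)) x v = L (dirDeriv f x v) := by
  have h := L.hasMFDerivAt.comp x hf.hasMFDerivAt (I'' := 𝓘(ℝ, G))
  exact congrArg (fun L => L v) h.mfderiv

theorem dirDeriv_mul {𝕜 : Type*} [RCLike 𝕜] {f g : M → 𝕜}
    (hf : MDifferentiableAt 𝓘(ℝ, Model n) 𝓘(ℝ, 𝕜) f x)
    (hg : MDifferentiableAt 𝓘(ℝ, Model n) 𝓘(ℝ, 𝕜) g x) :
    dirDeriv (fun y => f y * g y) x v = dirDeriv f x v * g x + f x * dirDeriv g x v := by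
  have h := hf.hasMFDerivAt.mul hg.hasMFDerivAt
  have h2 : dirDeriv (fun y => f y * g y) x v = f x * dirDeriv g x v + g x * dirDeriv f x v :=
    congrArg (fun L => L v) h.mfderiv
  rw [h2]; ring

theorem SmoothOn.clm (L : F →L[ℝ] G) {f : M → F} (hf : SmoothOn (n := n) f U) :
    SmoothOn (n := n) (fun y => L (f y)) U :=
  L.contDiff.contMDiff.comp_contMDiffOn hf

theorem SmoothOn.mul' {𝕜 : Type*} [RCLike 𝕜] {f g : M → 𝕜} (hf : SmoothOn (n := n) f U)
    (hg : SmoothOn (n := n) g U) : SmoothOn (n := n) (fun y => f y * g y) U :=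
  (contDiff_mul (𝕜 := ℝ)).contMDiff.comp_contMDiffOn (hf.prodMk_space hg)

theorem SmoothOn.add' {f g : M → F} (hf : SmoothOn (n := n) f U)
    (hg : SmoothOn (n := n) g U) : SmoothOn (n := n) (fun y => f y + g y) U :=
  ContMDiffOn.add hf hg

theorem SmoothOn.sum' {κ : Type*} (s : Finset κ) {f : κ → M → F}
    (hf : ∀ k, SmoothOn (n := n) (f k) U) : SmoothOn (n := n) (fun y => ∑ k ∈ s, f k y) U :=
  contMDiffOn_finsetSum fun k _ => hf k

theorem mdifferentiableAt_sum {κ : Type*} (s : Finset κ) {f : κ → M → F}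
    (hf : ∀ k, MDifferentiableAt 𝓘(ℝ, Model n) 𝓘(ℝ, F) (f k) x) :
    MDifferentiableAt 𝓘(ℝ, Model n) 𝓘(ℝ, F) (fun y => ∑ k ∈ s, f k y) x := by
  classical
  induction s using Finset.induction_on with
  | empty => simpa using mdifferentiableAt_const
  | insert a s ha ih =>
    simp only [Finset.sum_insert ha]
    exact (hf a).add ih

theorem dirDeriv_sum {κ : Type*} (s : Finset κ) {f : κ → M → F}
    (hf : ∀ k, MDifferentiableAt 𝓘(ℝ, Model n) 𝓘(ℝ, F) (f k) x) :
    dirDeriv (fun y => ∑ k ∈ s, f k y) x v = ∑ k ∈ s, dirDeriv (f k) x v := by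
  classical
  induction s using Finset.induction_on with
  | empty => simp [dirDeriv_const]
  | insert a s ha ih =>
    simp only [Finset.sum_insert ha]
    rw [dirDeriv_add (hf a) (mdifferentiableAt_sum s hf), ih]

variable [IsManifold 𝓘(ℝ, Model n) ∞ M]

/-- A smooth vector field on `U`. -/
abbrev SmoothFieldOn (X : ∀ x : M, TangentSpace 𝓘(ℝ, Model n) x) (U : Set M) : Prop :=
  ContMDiffOn 𝓘(ℝ, Model n) 𝓘(ℝ, Model n).tangent ∞
    (fun x => (⟨x, X x⟩ : TangentBundle 𝓘(ℝ, Model n) M)) U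

theorem SmoothFieldOn.mdiff {X : ∀ x : M, TangentSpace 𝓘(ℝ, Model n) x}
    (hf : SmoothFieldOn X U) (hU : IsOpen U) (hx : x ∈ U) :
    MDifferentiableAt 𝓘(ℝ, Model n) 𝓘(ℝ, Model n).tangent
      (fun x => (⟨x, X x⟩ : TangentBundle 𝓘(ℝ, Model n) M)) x :=
  (hf.contMDiffAt (hU.mem_nhds hx)).mdifferentiableAt (by simp)

theorem SmoothOn.dirDeriv {f : M → F} (hf : SmoothOn (n := n) f U) (hU : IsOpen U)
    {X : ∀ x : M, TangentSpace 𝓘(ℝ, Model n) x} (hX : SmoothFieldOn X U) :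
    SmoothOn (n := n) (fun y => dirDeriv f y (X y)) U := by
  have h1 := hf.contMDiffOn_tangentMapWithin (m := ∞) (by simp) hU.uniqueMDiffOn
  have h2 : ContMDiffOn 𝓘(ℝ, Model n) 𝓘(ℝ, F).tangent ∞
      (fun y => tangentMapWithin 𝓘(ℝ, Model n) 𝓘(ℝ, F) f U
        (⟨y, X y⟩ : TangentBundle 𝓘(ℝ, Model n) M)) U :=
    h1.comp hX fun y hy => hy
  have h3 := (contMDiff_snd_tangentBundle_modelSpace F 𝓘(ℝ, F) (n := ∞)).comp_contMDiffOn h2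
  refine h3.congr fun y hy => ?_
  simp only [Function.comp, tangentMapWithin, SpinGeometry.dirDeriv]
  rw [mfderivWithin_of_isOpen hU hy]

theorem SmoothFieldOn.mlieBracket {X Y : ∀ x : M, TangentSpace 𝓘(ℝ, Model n) x}
    (hX : SmoothFieldOn X U) (hY : SmoothFieldOn Y U) (hU : IsOpen U) :
    SmoothFieldOn (VectorField.mlieBracket 𝓘(ℝ, Model n) X Y) U := fun y hy => by
  have : IsManifold 𝓘(ℝ, Model n) ((∞ : WithTop ℕ∞) + 1) M := by
    rw [show ((∞ : WithTop ℕ∞) + 1) = ∞ by simp]; infer_instance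
  have : IsManifold 𝓘(ℝ, Model n) (minSmoothness ℝ 2) M := by
    rw [minSmoothness_of_isRCLikeNormedField]
    exact IsManifold.of_le (n := ∞) (by norm_cast)
  exact (ContMDiffAt.mlieBracket_vectorField (m := ⊤) (n := ⊤) (hX.contMDiffAt (hU.mem_nhds hy))
    (hY.contMDiffAt (hU.mem_nhds hy)) (by simp)).contMDiffWithinAt

theorem SmoothFieldOn.smul {f : M → ℝ} {X : ∀ x : M, TangentSpace 𝓘(ℝ, Model n) x}
    (hf : SmoothOn (n := n) f U) (hX : SmoothFieldOn X U) :
    SmoothFieldOn (fun y => f y • X y) U := ContMDiffOn.smul_section hf hX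

theorem SmoothFieldOn.sum {κ : Type*} (s : Finset κ)
    {X : κ → ∀ x : M, TangentSpace 𝓘(ℝ, Model n) x} (hX : ∀ k, SmoothFieldOn (X k) U) :
    SmoothFieldOn (fun y => ∑ k ∈ s, X k y) U := by
  exact ContMDiffOn.sum_section fun k _ => hX k

open VectorField

theorem mlieBracket_congr {X Y Y' : ∀ x : M, TangentSpace 𝓘(ℝ, Model n) x} (hU : IsOpen U)
    (hx : x ∈ U) (h : ∀ y ∈ U, Y y = Y' y) :
    mlieBracket 𝓘(ℝ, Model n) X Y x = mlieBracket 𝓘(ℝ, Model n) X Y' x :=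
  Filter.EventuallyEq.mlieBracket_vectorField_eq (Filter.EventuallyEq.refl _ _)
    (Filter.eventuallyEq_of_mem (hU.mem_nhds hx) h)

theorem mlieBracket_smul_right' {f : M → ℝ} {X Y : ∀ x : M, TangentSpace 𝓘(ℝ, Model n) x}
    (hU : IsOpen U) (hx : x ∈ U) (hf : SmoothOn (n := n) f U) (hY : SmoothFieldOn Y U) :
    mlieBracket 𝓘(ℝ, Model n) X (fun y => f y • Y y) x
      = dirDeriv f x (X x) • Y x + f x • mlieBracket 𝓘(ℝ, Model n) X Y x := by
  have : IsManifold 𝓘(ℝ, Model n) 2 M := IsManifold.of_le (n := ∞) (by norm_cast)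
  exact mlieBracket_smul_right (V := X) (hf.mdiff hU hx) (hY.mdiff hU hx)

theorem mlieBracket_sum_right {κ : Type*} (s : Finset κ) {X : ∀ x : M, TangentSpace 𝓘(ℝ, Model n) x}
    {Y : κ → ∀ x : M, TangentSpace 𝓘(ℝ, Model n) x} (hU : IsOpen U) (hx : x ∈ U)
    (hY : ∀ k, SmoothFieldOn (Y k) U) :
    mlieBracket 𝓘(ℝ, Model n) X (fun y => ∑ k ∈ s, Y k y) x
      = ∑ k ∈ s, mlieBracket 𝓘(ℝ, Model n) X (Y k) x := by
  classical
  have : IsManifold 𝓘(ℝ, Model n) 2 M := IsManifold.of_le (n := ∞) (by norm_cast)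
  induction s using Finset.induction_on with
  | empty =>
    simp only [Finset.sum_empty]
    exact congrFun (mlieBracket_zero_right (W := X)) x
  | insert a s ha ih =>
    simp only [Finset.sum_insert ha]
    rw [← ih]
    exact mlieBracket_add_right (V := X) ((hY a).mdiff hU hx)
      ((SmoothFieldOn.sum s hY).mdiff hU hx)

/-- The Lie bracket acts on functions as the commutator. -/
theorem dirDeriv_mlieBracket_real {f : M → ℝ} {X Y Z : ∀ x : M, TangentSpace 𝓘(ℝ, Model n) x}
    (hU : IsOpen U) (hx : x ∈ U) (hf : SmoothOn (n := n) f U) (hX : SmoothFieldOn X U)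
    (hY : SmoothFieldOn Y U) (hZ : SmoothFieldOn Z U) (hZ0 : Z x ≠ 0) :
    dirDeriv f x (mlieBracket 𝓘(ℝ, Model n) X Y x)
      = dirDeriv (fun y => dirDeriv f y (Y y)) x (X x)
        - dirDeriv (fun y => dirDeriv f y (X y)) x (Y x) := by
  have : IsManifold 𝓘(ℝ, Model n) (minSmoothness ℝ 3) M := by
    rw [minSmoothness_of_isRCLikeNormedField]
    exact IsManifold.of_le (n := ∞) (by norm_cast)
  have hs : ∀ {W : ∀ x : M, TangentSpace 𝓘(ℝ, Model n) x}, SmoothFieldOn W U →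
      ContMDiffAt 𝓘(ℝ, Model n) 𝓘(ℝ, Model n).tangent (minSmoothness ℝ 2)
      (fun x => (⟨x, W x⟩ : TangentBundle 𝓘(ℝ, Model n) M)) x := fun hW =>
    (hW.contMDiffAt (hU.mem_nhds hx)).of_le (by
      rw [minSmoothness_of_isRCLikeNormedField]; norm_cast)
  have h1 := leibniz_identity_mlieBracket_apply (hs hX) (hs hY) (hs (hZ.smul hf))
  have h2 := leibniz_identity_mlieBracket_apply (hs hX) (hs hY) (hs hZ)
  have e : ∀ {W W' : ∀ x : M, TangentSpace 𝓘(ℝ, Model n) x}, SmoothFieldOn W U →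
      SmoothFieldOn W' U →
      mlieBracket 𝓘(ℝ, Model n) W (mlieBracket 𝓘(ℝ, Model n) W' fun y => f y • Z y) x
      = dirDeriv (fun y => dirDeriv f y (W' y)) x (W x) • Z x
        + dirDeriv f x (W' x) • mlieBracket 𝓘(ℝ, Model n) W Z x
        + (dirDeriv f x (W x) • mlieBracket 𝓘(ℝ, Model n) W' Z x
        + f x • mlieBracket 𝓘(ℝ, Model n) W (mlieBracket 𝓘(ℝ, Model n) W' Z) x) := by
    intro W W' hW hW'
    rw [mlieBracket_congr hU hx (fun y hy => mlieBracket_smul_right' (X := W') hU hy hf hZ),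
      ← mlieBracket_smul_right' hU hx (hf.dirDeriv hU hW') hZ,
      ← mlieBracket_smul_right' hU hx hf (hW'.mlieBracket hZ hU)]
    have : IsManifold 𝓘(ℝ, Model n) 2 M := IsManifold.of_le (n := ∞) (by norm_cast)
    exact mlieBracket_add_right (V := W) ((hZ.smul (hf.dirDeriv hU hW')).mdiff hU hx)
      (((hW'.mlieBracket hZ hU).smul hf).mdiff hU hx)
  rw [e hX hY, e hY hX, mlieBracket_smul_right' hU hx hf hZ, h2] at h1
  have h3 : (dirDeriv f x (mlieBracket 𝓘(ℝ, Model n) X Y x)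
      - (dirDeriv (fun y => dirDeriv f y (Y y)) x (X x)
        - dirDeriv (fun y => dirDeriv f y (X y)) x (Y x))) • Z x = 0 := by
    linear_combination (norm := module) -h1
  rcases smul_eq_zero.1 h3 with h | h
  · exact sub_eq_zero.1 h
  · exact absurd h hZ0

theorem dirDeriv_mlieBracket {𝕜 : Type*} [RCLike 𝕜] {f : M → 𝕜}
    {X Y Z : ∀ x : M, TangentSpace 𝓘(ℝ, Model n) x}
    (hU : IsOpen U) (hx : x ∈ U) (hf : SmoothOn (n := n) f U) (hX : SmoothFieldOn X U)
    (hY : SmoothFieldOn Y U) (hZ : SmoothFieldOn Z U) (hZ0 : Z x ≠ 0) :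
    dirDeriv f x (mlieBracket 𝓘(ℝ, Model n) X Y x)
      = dirDeriv (fun y => dirDeriv f y (Y y)) x (X x)
        - dirDeriv (fun y => dirDeriv f y (X y)) x (Y x) := by
  have key : ∀ L : 𝕜 →L[ℝ] ℝ, L (dirDeriv f x (mlieBracket 𝓘(ℝ, Model n) X Y x))
      = L (dirDeriv (fun y => dirDeriv f y (Y y)) x (X x)
        - dirDeriv (fun y => dirDeriv f y (X y)) x (Y x)) := by
    intro L
    rw [map_sub, ← dirDeriv_clm L (hf.mdiff hU hx),
      ← dirDeriv_clm L ((hf.dirDeriv hU hX).mdiff hU hx),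
      ← dirDeriv_clm L ((hf.dirDeriv hU hY).mdiff hU hx),
      dirDeriv_mlieBracket_real hU hx (hf.clm L) hX hY hZ hZ0]
    congr 1 <;> refine dirDeriv_congr hU hx fun y hy => ?_
    · exact dirDeriv_clm L (hf.mdiff hU hy)
    · exact dirDeriv_clm L (hf.mdiff hU hy)
  refine RCLike.ext (key RCLike.reCLM) (key RCLike.imCLM)

end ScalarCalculus

end

section

section VectorCalculus

variable {n : ℕ} {M : Type*} [TopologicalSpace M] [ChartedSpace (Model n) M]
  {𝕜 : Type*} [RCLike 𝕜] {W₁ W₂ W₃ κ₁ κ₂ κ₃ : Type*} [AddCommGroup W₁] [Module 𝕜 W₁] [Fintype κ₁]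
  [AddCommGroup W₂] [Module 𝕜 W₂] [Fintype κ₂] [AddCommGroup W₃] [Module 𝕜 W₃] [Fintype κ₃]
  {b₁ : Module.Basis κ₁ 𝕜 W₁} {b₂ : Module.Basis κ₂ 𝕜 W₂} {b₃ : Module.Basis κ₃ 𝕜 W₃}
  {f f' : M → W₁} {h : M → W₂} {U : Set M} {x : M} {v w : TangentSpace 𝓘(ℝ, Model n) x}

theorem repr_coordDeriv (k : κ₁) :
    b₁.repr (coordDeriv b₁ f x v) k = dirDeriv (fun y => b₁.repr (f y) k) x v := by
  classical
  simp [coordDeriv, map_sum, Finsupp.single_apply]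

theorem coordDeriv_ext {z : W₁} (hz : ∀ k, dirDeriv (fun y => b₁.repr (f y) k) x v = b₁.repr z k) :
    coordDeriv b₁ f x v = z :=
  b₁.ext_elem fun k => by rw [repr_coordDeriv, hz]

theorem coordDeriv_add_right : coordDeriv b₁ f x (v + w) = coordDeriv b₁ f x v + coordDeriv b₁ f x w :=
  coordDeriv_ext fun k => by simp [repr_coordDeriv, dirDeriv_add_right]

theorem coordDeriv_smul_right (c : ℝ) :
    coordDeriv b₁ f x (c • v) = (algebraMap ℝ 𝕜 c) • coordDeriv b₁ f x v :=
  coordDeriv_ext fun k => by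
    simp [repr_coordDeriv, dirDeriv_smul_right, Algebra.smul_def]

theorem coordDeriv_sum_right {κ : Type*} (s : Finset κ) (v : κ → TangentSpace 𝓘(ℝ, Model n) x) :
    coordDeriv b₁ f x (∑ k ∈ s, v k) = ∑ k ∈ s, coordDeriv b₁ f x (v k) :=
  coordDeriv_ext fun k => by simp [repr_coordDeriv, dirDeriv_sum_right, Finsupp.finsetSum_apply]

theorem coordDeriv_congr (hU : IsOpen U) (hx : x ∈ U) (hf : Set.EqOn f f' U) :
    coordDeriv b₁ f x v = coordDeriv b₁ f' x v :=
  coordDeriv_ext fun k => by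
    rw [repr_coordDeriv]
    exact dirDeriv_congr hU hx fun y hy => by rw [hf hy]

theorem coordDeriv_const (c : W₁) : coordDeriv b₁ (fun _ : M => c) x v = 0 :=
  coordDeriv_ext fun k => by simp [dirDeriv_const]

theorem CoordSmoothOn.const (c : W₁) : CoordSmoothOn (n := n) b₁ (fun _ : M => c) U :=
  fun _ => contMDiffOn_const

theorem CoordSmoothOn.mono {V : Set M} (hf : CoordSmoothOn (n := n) b₁ f U) (hV : V ⊆ U) :
    CoordSmoothOn (n := n) b₁ f V := fun k => (hf k).mono hV

theorem CoordSmoothOn.congr (hf : CoordSmoothOn (n := n) b₁ f U) (h : Set.EqOn f' f U) :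
    CoordSmoothOn (n := n) b₁ f' U :=
  fun k => ContMDiffOn.congr (hf k) fun y hy => by rw [h hy]

theorem CoordSmoothOn.add (hf : CoordSmoothOn (n := n) b₁ f U)
    (hf' : CoordSmoothOn (n := n) b₁ f' U) :
    CoordSmoothOn (n := n) b₁ (fun y => f y + f' y) U := fun k => by
  simpa using SmoothOn.add' (hf k) (hf' k)

theorem CoordSmoothOn.sum {κ : Type*} (s : Finset κ) {f : κ → M → W₁}
    (hf : ∀ i, CoordSmoothOn (n := n) b₁ (f i) U) :
    CoordSmoothOn (n := n) b₁ (fun y => ∑ i ∈ s, f i y) U := fun k => by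
  simpa [map_sum, Finsupp.finsetSum_apply] using SmoothOn.sum' s (fun i => hf i k)

theorem coordDeriv_add (hU : IsOpen U) (hx : x ∈ U) (hf : CoordSmoothOn (n := n) b₁ f U)
    (hf' : CoordSmoothOn (n := n) b₁ f' U) :
    coordDeriv b₁ (fun y => f y + f' y) x v = coordDeriv b₁ f x v + coordDeriv b₁ f' x v :=
  coordDeriv_ext fun k => by
    simp only [map_add, Finsupp.add_apply, repr_coordDeriv]
    exact dirDeriv_add (SmoothOn.mdiff (hf k) hU hx) (SmoothOn.mdiff (hf' k) hU hx)

theorem coordDeriv_sum {κ : Type*} (s : Finset κ) {f : κ → M → W₁} (hU : IsOpen U) (hx : x ∈ U)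
    (hf : ∀ i, CoordSmoothOn (n := n) b₁ (f i) U) :
    coordDeriv b₁ (fun y => ∑ i ∈ s, f i y) x v = ∑ i ∈ s, coordDeriv b₁ (f i) x v :=
  coordDeriv_ext fun k => by
    simp only [map_sum, Finsupp.finsetSum_apply, repr_coordDeriv]
    exact dirDeriv_sum s fun i => SmoothOn.mdiff (hf i k) hU hx

section Sesquilinear

variable {σ : 𝕜 →+* 𝕜}

theorem exists_realLinear (hσ : σ = RingHom.id 𝕜 ∨ σ = starRingEnd 𝕜) :
    ∃ L : 𝕜 →L[ℝ] 𝕜, ∀ z, L z = σ z := by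
  rcases hσ with rfl | rfl
  · exact ⟨ContinuousLinearMap.id ℝ 𝕜, fun z => rfl⟩
  · exact ⟨(RCLike.conjCLE : 𝕜 ≃L[ℝ] 𝕜), fun z => by simp⟩

theorem repr_sesquilinear (B : W₁ →ₛₗ[σ] W₂ →ₗ[𝕜] W₃) (u : W₁) (z : W₂) (m : κ₃) :
    b₃.repr (B u z) m =
      ∑ k, ∑ l, σ (b₁.repr u k) * b₂.repr z l * b₃.repr (B (b₁ k) (b₂ l)) m := by
  conv_lhs => rw [← b₁.sum_repr u, ← b₂.sum_repr z]
  simp only [map_sum, LinearMap.map_smulₛₗ, LinearMap.sum_apply, LinearMap.smul_apply,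
    map_smul, Finsupp.finsetSum_apply, Finsupp.smul_apply, smul_eq_mul]
  rw [Finset.sum_comm]
  simp only [Finset.mul_sum, mul_left_comm, mul_assoc]

theorem CoordSmoothOn.sesquilinear (hσ : σ = RingHom.id 𝕜 ∨ σ = starRingEnd 𝕜)
    (B : W₁ →ₛₗ[σ] W₂ →ₗ[𝕜] W₃) (hf : CoordSmoothOn (n := n) b₁ f U)
    (hh : CoordSmoothOn (n := n) b₂ h U) :
    CoordSmoothOn (n := n) b₃ (fun y => B (f y) (h y)) U := fun m => by
  obtain ⟨L, hL⟩ := exists_realLinear hσ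
  refine ContMDiffOn.congr ?_ fun y _ => repr_sesquilinear (b₁ := b₁) (b₂ := b₂) B (f y) (h y) m
  simp only [← hL]
  exact SmoothOn.sum' _ fun k => SmoothOn.sum' _ fun l =>
    (SmoothOn.mul' (SmoothOn.clm L (hf k)) (hh l)).mul' contMDiffOn_const

theorem coordDeriv_sesquilinear (hσ : σ = RingHom.id 𝕜 ∨ σ = starRingEnd 𝕜)
    (B : W₁ →ₛₗ[σ] W₂ →ₗ[𝕜] W₃) (hU : IsOpen U) (hx : x ∈ U)
    (hf : CoordSmoothOn (n := n) b₁ f U) (hh : CoordSmoothOn (n := n) b₂ h U) :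
    coordDeriv b₃ (fun y => B (f y) (h y)) x v
      = B (coordDeriv b₁ f x v) (h x) + B (f x) (coordDeriv b₂ h x v) :=
  coordDeriv_ext fun m => by
    obtain ⟨L, hL⟩ := exists_realLinear hσ
    rw [map_add, Finsupp.add_apply, funext fun y => repr_sesquilinear (b₁ := b₁) (b₂ := b₂)
      (b₃ := b₃) B (f y) (h y) m, repr_sesquilinear (b₁ := b₁) (b₂ := b₂),
      repr_sesquilinear (b₁ := b₁) (b₂ := b₂)]
    simp only [← hL]
    have d₁ : ∀ k, MDifferentiableAt 𝓘(ℝ, Model n) 𝓘(ℝ, 𝕜) (fun y => L (b₁.repr (f y) k)) x :=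
      fun k => (SmoothOn.clm L (hf k)).mdiff hU hx
    have d₂ : ∀ l, MDifferentiableAt 𝓘(ℝ, Model n) 𝓘(ℝ, 𝕜) (fun y => b₂.repr (h y) l) x :=
      fun l => SmoothOn.mdiff (hh l) hU hx
    have d₃ : ∀ k l, MDifferentiableAt 𝓘(ℝ, Model n) 𝓘(ℝ, 𝕜)
        (fun y => L (b₁.repr (f y) k) * b₂.repr (h y) l) x := fun k l =>
      SmoothOn.mdiff (SmoothOn.mul' (SmoothOn.clm L (hf k)) (hh l)) hU hx
    have d₄ : ∀ k l, MDifferentiableAt 𝓘(ℝ, Model n) 𝓘(ℝ, 𝕜)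
        (fun y => L (b₁.repr (f y) k) * b₂.repr (h y) l * b₃.repr (B (b₁ k) (b₂ l)) m) x :=
      fun k l => SmoothOn.mdiff
        ((SmoothOn.mul' (SmoothOn.clm L (hf k)) (hh l)).mul' contMDiffOn_const) hU hx
    rw [dirDeriv_sum _ fun k => mdifferentiableAt_sum _ fun l => d₄ k l, ← Finset.sum_add_distrib]
    refine Finset.sum_congr rfl fun k _ => ?_
    rw [dirDeriv_sum _ (d₄ k), ← Finset.sum_add_distrib]
    refine Finset.sum_congr rfl fun l _ => ?_
    rw [dirDeriv_mul (d₃ k l) mdifferentiableAt_const, dirDeriv_mul (d₁ k) (d₂ l), dirDeriv_const,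
      dirDeriv_clm L (SmoothOn.mdiff (hf k) hU hx), repr_coordDeriv, repr_coordDeriv]
    ring

end Sesquilinear

theorem CoordSmoothOn.bilinear (B : W₁ →ₗ[𝕜] W₂ →ₗ[𝕜] W₃) (hf : CoordSmoothOn (n := n) b₁ f U)
    (hh : CoordSmoothOn (n := n) b₂ h U) :
    CoordSmoothOn (n := n) b₃ (fun y => B (f y) (h y)) U :=
  CoordSmoothOn.sesquilinear (Or.inl rfl) B hf hh

theorem coordDeriv_bilinear (B : W₁ →ₗ[𝕜] W₂ →ₗ[𝕜] W₃) (hU : IsOpen U) (hx : x ∈ U)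
    (hf : CoordSmoothOn (n := n) b₁ f U) (hh : CoordSmoothOn (n := n) b₂ h U) :
    coordDeriv b₃ (fun y => B (f y) (h y)) x v
      = B (coordDeriv b₁ f x v) (h x) + B (f x) (coordDeriv b₂ h x v) :=
  coordDeriv_sesquilinear (Or.inl rfl) B hU hx hf hh

theorem CoordSmoothOn.linear (L : W₁ →ₗ[𝕜] W₂) (hf : CoordSmoothOn (n := n) b₁ f U) :
    CoordSmoothOn (n := n) b₂ (fun y => L (f y)) U := by
  simpa using CoordSmoothOn.bilinear (b₁ := Module.Basis.singleton Unit 𝕜) (b₂ := b₁) (b₃ := b₂)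
    (LinearMap.toSpanSingleton 𝕜 (W₁ →ₗ[𝕜] W₂) L) (CoordSmoothOn.const (1 : 𝕜)) hf

theorem coordDeriv_linear (L : W₁ →ₗ[𝕜] W₂) (hU : IsOpen U) (hx : x ∈ U)
    (hf : CoordSmoothOn (n := n) b₁ f U) :
    coordDeriv b₂ (fun y => L (f y)) x v = L (coordDeriv b₁ f x v) := by
  have := coordDeriv_bilinear (b₁ := Module.Basis.singleton Unit 𝕜) (b₂ := b₁) (b₃ := b₂) (v := v)
    (LinearMap.toSpanSingleton 𝕜 (W₁ →ₗ[𝕜] W₂) L) hU hx (CoordSmoothOn.const (1 : 𝕜)) hf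
  simpa [coordDeriv_const] using this

theorem coordSmoothOn_smul {r : M → ℝ} (hr : SmoothOn (n := n) r U)
    (hf : CoordSmoothOn (n := n) b₁ f U) :
    CoordSmoothOn (n := n) b₁ (fun y => (algebraMap ℝ 𝕜 (r y)) • f y) U := fun k => by
  simp only [map_smul, Finsupp.smul_apply, smul_eq_mul]
  exact SmoothOn.mul' (SmoothOn.clm (Algebra.linearMap ℝ 𝕜).toContinuousLinearMap hr) (hf k)

theorem coordDeriv_smul {r : M → ℝ} (hU : IsOpen U) (hx : x ∈ U) (hr : SmoothOn (n := n) r U)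
    (hf : CoordSmoothOn (n := n) b₁ f U) :
    coordDeriv b₁ (fun y => (algebraMap ℝ 𝕜 (r y)) • f y) x v
      = (algebraMap ℝ 𝕜 (dirDeriv r x v)) • f x + (algebraMap ℝ 𝕜 (r x)) • coordDeriv b₁ f x v :=
  coordDeriv_ext fun k => by
    simp only [map_smul, map_add, Finsupp.add_apply, Finsupp.smul_apply, smul_eq_mul,
      repr_coordDeriv]
    have h1 := dirDeriv_clm (v := v) (Algebra.linearMap ℝ 𝕜).toContinuousLinearMap (hr.mdiff hU hx)
    have h2 := dirDeriv_mul (v := v)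
      ((SmoothOn.clm (Algebra.linearMap ℝ 𝕜).toContinuousLinearMap hr).mdiff hU hx)
      (SmoothOn.mdiff (hf k) hU hx)
    rw [h1] at h2
    exact h2

variable [IsManifold 𝓘(ℝ, Model n) ∞ M]

theorem CoordSmoothOn.coordDeriv (hf : CoordSmoothOn (n := n) b₁ f U) (hU : IsOpen U)
    {X : ∀ x : M, TangentSpace 𝓘(ℝ, Model n) x} (hX : SmoothFieldOn X U) :
    CoordSmoothOn (n := n) b₁ (fun y => coordDeriv b₁ f y (X y)) U := fun k => by
  simp only [repr_coordDeriv]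
  exact SmoothOn.dirDeriv (hf k) hU hX

theorem coordDeriv_mlieBracket {X Y Z : ∀ x : M, TangentSpace 𝓘(ℝ, Model n) x}
    (hU : IsOpen U) (hx : x ∈ U) (hf : CoordSmoothOn (n := n) b₁ f U) (hX : SmoothFieldOn X U)
    (hY : SmoothFieldOn Y U) (hZ : SmoothFieldOn Z U) (hZ0 : Z x ≠ 0) :
    coordDeriv b₁ f x (VectorField.mlieBracket 𝓘(ℝ, Model n) X Y x)
      = coordDeriv b₁ (fun y => coordDeriv b₁ f y (Y y)) x (X x)
        - coordDeriv b₁ (fun y => coordDeriv b₁ f y (X y)) x (Y x) :=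
  coordDeriv_ext fun k => by
    simp only [map_sub, Finsupp.sub_apply, repr_coordDeriv]
    exact dirDeriv_mlieBracket hU hx (hf k) hX hY hZ hZ0

end VectorCalculus

end

section

section Model

variable (𝕜 : Type*) [RCLike 𝕜] {n : ℕ}

/-- The covector `e^a` of the model space, as a form. -/
def stdE (a : Fin n) : ExteriorAlgebra 𝕜 (Fin n → 𝕜) := ExteriorAlgebra.ι 𝕜 (Pi.single a 1)

/-- The coordinate functional `a` on the model space. -/
abbrev stdD (a : Fin n) : Module.Dual 𝕜 (Fin n → 𝕜) := LinearMap.proj a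

/-- The interior product with the `a`-th vector of the model frame. -/
def stdI (a : Fin n) : ExteriorAlgebra 𝕜 (Fin n → 𝕜) →ₗ[𝕜] ExteriorAlgebra 𝕜 (Fin n → 𝕜) :=
  CliffordAlgebra.contractLeft (stdD 𝕜 a)

theorem sum_stdD_smul (v : Fin n → 𝕜) : ∑ a, stdD 𝕜 a v • (Pi.single a 1 : Fin n → 𝕜) = v := by
  ext b; simp [Finset.sum_apply, Pi.single_apply]

theorem stdD_single (a b : Fin n) :
    stdD 𝕜 a (Pi.single b 1 : Fin n → 𝕜) = if a = b then 1 else 0 := by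
  simp [Pi.single_apply]

variable {𝕜}

theorem stdI_stdE_mul (a b : Fin n) (α : ExteriorAlgebra 𝕜 (Fin n → 𝕜)) :
    stdI 𝕜 a (stdE 𝕜 b * α) = (if a = b then (1 : 𝕜) else 0) • α - stdE 𝕜 b * stdI 𝕜 a α := by
  rw [stdI, stdE, ExteriorAlgebra.ι, CliffordAlgebra.contractLeft_ι_mul, stdD_single]

theorem stdI_stdI_comm (a b : Fin n) (α : ExteriorAlgebra 𝕜 (Fin n → 𝕜)) :
    stdI 𝕜 a (stdI 𝕜 b α) = -stdI 𝕜 b (stdI 𝕜 a α) :=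
  CliffordAlgebra.contractLeft_comm (Q := 0) _ _ α

theorem stdE_mul_stdE_mul (a b : Fin n) (α : ExteriorAlgebra 𝕜 (Fin n → 𝕜)) :
    stdE 𝕜 a * (stdE 𝕜 b * α) = -(stdE 𝕜 b * (stdE 𝕜 a * α)) := by
  have h : stdE 𝕜 a * stdE 𝕜 b + stdE 𝕜 b * stdE 𝕜 a = 0 := ExteriorAlgebra.ι_add_mul_swap _ _
  rw [← mul_assoc, ← mul_assoc, eq_neg_of_add_eq_zero_left h, neg_mul]

/-- An algebra map that is induced by a linear map intertwines interior products. -/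
theorem map_contractLeft {V V' : Type*} [AddCommGroup V] [Module 𝕜 V] [AddCommGroup V']
    [Module 𝕜 V'] (f : V →ₗ[𝕜] V') (d : Module.Dual 𝕜 V) (d' : Module.Dual 𝕜 V')
    (h : ∀ v, d' (f v) = d v) (α : ExteriorAlgebra 𝕜 V) :
    ExteriorAlgebra.map f (CliffordAlgebra.contractLeft d α)
      = CliffordAlgebra.contractLeft d' (ExteriorAlgebra.map f α) := by
  induction α using CliffordAlgebra.left_induction with
  | algebraMap r => simp [CliffordAlgebra.contractLeft_algebraMap, AlgHom.commutes]
  | add x y hx hy => simp only [map_add, hx, hy]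
  | ι_mul x v hx =>
    have e : ExteriorAlgebra.map f (CliffordAlgebra.ι _ v) = CliffordAlgebra.ι _ (f v) :=
      ExteriorAlgebra.map_apply_ι f v
    rw [CliffordAlgebra.contractLeft_ι_mul, map_sub, map_smul, map_mul, map_mul, e,
      CliffordAlgebra.contractLeft_ι_mul, hx, h]

theorem map_mem_exteriorPower {V V' : Type*} [AddCommGroup V] [Module 𝕜 V] [AddCommGroup V']
    [Module 𝕜 V'] (f : V →ₗ[𝕜] V') {p : ℕ} {α : ExteriorAlgebra 𝕜 V} (h : α ∈ ⋀[𝕜]^p V) :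
    ExteriorAlgebra.map f α ∈ ⋀[𝕜]^p V' := by
  refine exteriorPower_induction (fun x y hx hy => ?_) (fun v => ?_) (fun c x hx => ?_) h
  · rw [map_add]; exact add_mem hx hy
  · rw [ExteriorAlgebra.map_apply_ιMulti]
    exact (ExteriorAlgebra.ιMulti_range 𝕜 p) ⟨_, rfl⟩
  · rw [map_smul]; exact Submodule.smul_mem _ _ hx

end Model

namespace SpinStructure

variable {n : ℕ} {M : Type*} [TopologicalSpace M] [ChartedSpace (Model n) M]
  [IsManifold 𝓘(ℝ, Model n) ∞ M] {g : PseudoRiemannianMetric n M} {η : Fin n → ℝ} {ι : Type*}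
  (S : SpinStructure g η ι) {i j : ι} {x : M}

section Pointwise

include S in
theorem sign_mul_self (a : Fin n) : η a * η a = 1 := by rcases S.sign a with h | h <;> simp [h]

include S in
theorem sign_ne_zero (a : Fin n) : η a ≠ 0 := by rcases S.sign a with h | h <;> simp [h]

theorem comp_add (v w : TangentSpace 𝓘(ℝ, Model n) x) (a : Fin n) :
    S.comp i (v + w) a = S.comp i v a + S.comp i w a := by simp [comp, mul_add]

theorem comp_smul (c : ℝ) (v : TangentSpace 𝓘(ℝ, Model n) x) (a : Fin n) :
    S.comp i (c • v) a = c * S.comp i v a := by simp [comp]; ring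

theorem comp_sum {κ : Type*} (s : Finset κ) (v : κ → TangentSpace 𝓘(ℝ, Model n) x) (a : Fin n) :
    S.comp i (∑ k ∈ s, v k) a = ∑ k ∈ s, S.comp i (v k) a := by
  simp [comp, map_sum, _root_.sum_apply, Finset.mul_sum]

theorem comp_frame (hx : x ∈ S.baseSet i) (a b : Fin n) :
    S.comp i (S.frame i b x) a = if a = b then 1 else 0 := by
  rw [comp, S.orthonormal i x hx]
  by_cases h : a = b
  · subst h; simp [S.sign_mul_self]
  · simp [h, Ne.symm h]

theorem linearIndependent_frame (hx : x ∈ S.baseSet i) :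
    LinearIndependent ℝ (fun a => S.frame i a x) := by
  rw [Fintype.linearIndependent_iff]
  intro c hc a
  have h := S.comp_sum (i := i) Finset.univ (fun b => c b • S.frame i b x) a
  rw [hc] at h
  have h0 : S.comp i (0 : TangentSpace 𝓘(ℝ, Model n) x) a = 0 := by simp [comp]
  simpa only [comp_smul, S.comp_frame hx, h0, mul_ite, mul_one, mul_zero, Finset.sum_ite_eq,
    Finset.mem_univ, if_true] using h.symm

/-- The expansion of a tangent vector in an orthonormal frame. -/
theorem sum_comp_smul_frame (hx : x ∈ S.baseSet i) (v : TangentSpace 𝓘(ℝ, Model n) x) :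
    ∑ a, S.comp i v a • S.frame i a x = v := by
  have hli := S.linearIndependent_frame hx
  have hspan : Submodule.span ℝ (Set.range fun a => S.frame i a x) = ⊤ := by
    have : FiniteDimensional ℝ (TangentSpace 𝓘(ℝ, Model n) x) :=
      inferInstanceAs (FiniteDimensional ℝ (Model n))
    refine hli.span_eq_top_of_card_eq_finrank' ?_
    have : Module.finrank ℝ (TangentSpace 𝓘(ℝ, Model n) x) = Module.finrank ℝ (Model n) := rfl
    rw [this, finrank_euclideanSpace]
  have hv : v ∈ Submodule.span ℝ (Set.range fun a => S.frame i a x) := hspan ▸ Submodule.mem_top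
  obtain ⟨c, rfl⟩ := (Submodule.mem_span_range_iff_exists_fun ℝ).1 hv
  refine Finset.sum_congr rfl fun a _ => ?_
  simp [comp_sum, comp_smul, S.comp_frame hx]

theorem metric_eq_sum (hx : x ∈ S.baseSet i) (v w : TangentSpace 𝓘(ℝ, Model n) x) :
    g.val x v w = ∑ a, S.comp i v a * g.val x (S.frame i a x) w := by
  conv_lhs => rw [← S.sum_comp_smul_frame hx v]
  simp [map_sum, _root_.sum_apply]

/-- The trace of a biadditive map over an orthonormal frame does not depend on the frame. -/
theorem trace_frame {W : Type*} [AddCommGroup W]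
    (β : TangentSpace 𝓘(ℝ, Model n) x →+ TangentSpace 𝓘(ℝ, Model n) x →+ W)
    (hβ : ∀ (c : ℝ) u v, β (c • u) v = β u (c • v)) (hi : x ∈ S.baseSet i) (hj : x ∈ S.baseSet j) :
    ∑ a, β (η a • S.frame i a x) (S.frame i a x) = ∑ a, β (η a • S.frame j a x) (S.frame j a x) := by
  have h1 : ∀ a, S.frame i a x = ∑ b, (η b * g.val x (S.frame i a x) (S.frame j b x)) •
      S.frame j b x := fun a => (S.sum_comp_smul_frame hj _).symm
  have h2 : ∀ b, S.frame j b x = ∑ a, (η a * g.val x (S.frame j b x) (S.frame i a x)) •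
      S.frame i a x := fun a => (S.sum_comp_smul_frame hi _).symm
  calc _ = ∑ a, ∑ b, β (η a • S.frame i a x)
        ((η b * g.val x (S.frame i a x) (S.frame j b x)) • S.frame j b x) := by
        refine Finset.sum_congr rfl fun a _ => ?_
        conv_lhs => enter [2]; rw [h1 a]
        rw [map_sum]
    _ = ∑ b, ∑ a, β (η b • (η a * g.val x (S.frame j b x) (S.frame i a x)) • S.frame i a x)
          (S.frame j b x) := by
        rw [Finset.sum_comm]
        refine Finset.sum_congr rfl fun b _ => Finset.sum_congr rfl fun a _ => ?_
        rw [← hβ, smul_smul, smul_smul, g.symm]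
        congr 2; ring_nf
    _ = _ := by
        refine Finset.sum_congr rfl fun b _ => ?_
        conv_rhs => enter [1]; rw [h2 b]
        rw [Finset.smul_sum, map_sum, AddMonoidHom.finsetSum_apply]

variable {𝕜 : Type*} [RCLike 𝕜]

theorem interior_add (v w : TangentSpace 𝓘(ℝ, Model n) x) (α : FormAt 𝕜 n x) :
    interior (v + w) α = interior v α + interior w α := by
  rw [interior, interior, interior, ← LinearMap.add_apply, ← map_add]
  congr 2
  ext f
  exact f.map_add v w

theorem interior_smul (c : ℝ) (v : TangentSpace 𝓘(ℝ, Model n) x) (α : FormAt 𝕜 n x) :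
    interior (c • v) α = (algebraMap ℝ 𝕜 c) • interior v α := by
  rw [interior, interior, ← LinearMap.smul_apply, ← map_smul]
  congr 2
  refine LinearMap.ext fun f => ?_
  simp [Algebra.smul_def]

theorem flat_add (v w : TangentSpace 𝓘(ℝ, Model n) x) :
    S.flat 𝕜 (v + w) = S.flat 𝕜 v + S.flat 𝕜 w := by
  rw [flat, flat, flat, ← map_add]
  congr 1
  ext u
  simp

theorem flat_smul (c : ℝ) (v : TangentSpace 𝓘(ℝ, Model n) x) :
    S.flat 𝕜 (c • v) = (algebraMap ℝ 𝕜 c) • S.flat 𝕜 v := by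
  rw [flat, flat, ← map_smul]
  congr 1
  ext u
  simp

theorem ofFrame_toFrame (hx : x ∈ S.baseSet i) (α : FormAt 𝕜 n x) :
    S.ofFrame i x (S.toFrame i x α) = α := by
  have : (S.ofFrame i x).comp (S.toFrame i x) = AlgHom.id 𝕜 (FormAt 𝕜 n x) := by
    rw [ofFrame, toFrame, ExteriorAlgebra.map_comp_map]
    rw [← ExteriorAlgebra.map_id]
    congr 1
    refine LinearMap.ext fun f => LinearMap.ext fun v => ?_
    conv_rhs => rw [← S.sum_comp_smul_frame hx v]
    simp [LinearMap.sum_apply, comp, g.symm x v]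
    refine Finset.sum_congr rfl fun a _ => ?_
    rw [Algebra.smul_def, mul_comm]; simp
  exact DFunLike.congr_fun this α

theorem toFrame_ofFrame (hx : x ∈ S.baseSet i) (α : ExteriorAlgebra 𝕜 (Fin n → 𝕜)) :
    S.toFrame i x (S.ofFrame i x α) = α := by
  have : (S.toFrame i x).comp (S.ofFrame i x) = AlgHom.id 𝕜 (ExteriorAlgebra 𝕜 (Fin n → 𝕜)) := by
    rw [ofFrame, toFrame, ExteriorAlgebra.map_comp_map]
    rw [← ExteriorAlgebra.map_id]
    congr 1
    refine LinearMap.ext fun f => funext fun b => ?_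
    simp only [LinearMap.comp_apply, LinearMap.sum_apply, LinearMap.smulRight_apply,
      LinearMap.proj_apply, LinearMap.coe_mk, AddHom.coe_mk, LinearMap.smul_apply,
      ContinuousLinearMap.coe_coe, Algebra.linearMap_apply, S.orthonormal i x hx,
      LinearMap.id_apply, smul_eq_mul]
    rw [Finset.sum_eq_single b]
    · rw [if_pos rfl, ← map_mul, S.sign_mul_self, map_one, mul_one]
    · intro a _ h; simp [h]
    · simp
  exact DFunLike.congr_fun this α

theorem toFrame_injective (hx : x ∈ S.baseSet i) :
    Function.Injective (S.toFrame i x : FormAt 𝕜 n x → _) :=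
  Function.LeftInverse.injective (S.ofFrame_toFrame hx)

theorem toFrame_flat (v : TangentSpace 𝓘(ℝ, Model n) x) :
    S.toFrame i x (S.flat 𝕜 v) =
      ExteriorAlgebra.ι 𝕜 (fun a => algebraMap ℝ 𝕜 (g.val x v (S.frame i a x))) := by
  rw [toFrame, flat, ExteriorAlgebra.map_apply_ι]; rfl

theorem toFrame_flat_frame (hx : x ∈ S.baseSet i) (a : Fin n) :
    S.toFrame i x (S.flat 𝕜 (S.frame i a x)) = (algebraMap ℝ 𝕜 (η a)) • stdE 𝕜 a := by
  rw [toFrame_flat, stdE, ← map_smul]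
  congr 1
  ext b
  rw [S.orthonormal i x hx]
  by_cases h : a = b <;> simp [h, Ne.symm]

theorem toFrame_coframe (hx : x ∈ S.baseSet i) (a : Fin n) :
    S.toFrame i x (S.coframe 𝕜 i a x) = stdE 𝕜 a := by
  have h : S.coframe 𝕜 i a x = (algebraMap ℝ 𝕜 (η a)) • S.flat 𝕜 (S.frame i a x) := by
    rw [coframe, flat, map_smul]
  rw [h, map_smul, S.toFrame_flat_frame hx, smul_smul, ← map_mul, S.sign_mul_self, map_one,
    one_smul]

theorem toFrame_interior_frame (a : Fin n) (α : FormAt 𝕜 n x) :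
    S.toFrame i x (interior (S.frame i a x) α) = stdI 𝕜 a (S.toFrame i x α) :=
  map_contractLeft _ _ _ (fun _ => rfl) α

theorem toFrame_mem {p : ℕ} {α : FormAt 𝕜 n x} (h : α ∈ ⋀[𝕜]^p (Covector 𝕜 n x)) :
    S.toFrame i x α ∈ ⋀[𝕜]^p (Fin n → 𝕜) := map_mem_exteriorPower _ h

theorem ofFrame_mem {p : ℕ} {α : ExteriorAlgebra 𝕜 (Fin n → 𝕜)} (h : α ∈ ⋀[𝕜]^p (Fin n → 𝕜)) :
    S.ofFrame i x α ∈ ⋀[𝕜]^p (Covector 𝕜 n x) := map_mem_exteriorPower _ h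

theorem mem_of_toFrame_mem {p : ℕ} (hx : x ∈ S.baseSet i) {α : FormAt 𝕜 n x}
    (h : S.toFrame i x α ∈ ⋀[𝕜]^p (Fin n → 𝕜)) : α ∈ ⋀[𝕜]^p (Covector 𝕜 n x) := by
  rw [← S.ofFrame_toFrame hx α]; exact S.ofFrame_mem h

end Pointwise

end SpinStructure

end

section

namespace SpinStructure

variable {n : ℕ} {M : Type*} [TopologicalSpace M] [ChartedSpace (Model n) M]
  [IsManifold 𝓘(ℝ, Model n) ∞ M] {g : PseudoRiemannianMetric n M} {η : Fin n → ℝ} {ι : Type*}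
  (S : SpinStructure g η ι) {i j : ι} {x : M}

section LeviCivita

open VectorField

include S in
theorem smoothOn_metric {U : Set M} {X Y : ∀ x : M, TangentSpace 𝓘(ℝ, Model n) x}
    (hX : SmoothFieldOn X U) (hY : SmoothFieldOn Y U) :
    SmoothOn (n := n) (fun y => g.val y (X y) (Y y)) U := by
  intro y hy
  have : ContMDiffWithinAt 𝓘(ℝ, Model n) (𝓘(ℝ, Model n).prod 𝓘(ℝ)) ∞
      (fun m => Bundle.TotalSpace.mk' ℝ (E := Bundle.Trivial M ℝ) m (g.val m (X m) (Y m))) U y := by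
    apply ContMDiffWithinAt.clm_bundle_apply₂ (F₁ := Model n) (F₂ := Model n)
    · exact g.contMDiff.contMDiffAt.contMDiffWithinAt
    · exact hX y hy
    · exact hY y hy
  rw [Bundle.contMDiffWithinAt_totalSpace] at this
  exact this.2

theorem smoothOn_comp {U : Set M} (hU : U ⊆ S.baseSet i)
    {X : ∀ x : M, TangentSpace 𝓘(ℝ, Model n) x} (hX : SmoothFieldOn X U) (a : Fin n) :
    SmoothOn (n := n) (fun y => S.comp i (X y) a) U :=
  SmoothOn.mul' contMDiffOn_const (S.smoothOn_metric hX ((S.smooth_frame i a).mono hU))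

theorem smoothOn_structureCoeff (a b c : Fin n) :
    SmoothOn (n := n) (S.structureCoeff i a b c) (S.baseSet i) :=
  S.smoothOn_metric (SmoothFieldOn.mlieBracket (S.smooth_frame i a) (S.smooth_frame i b)
    (S.isOpen_baseSet i)) (S.smooth_frame i c)

theorem smoothOn_connCoeff (a b c : Fin n) :
    SmoothOn (n := n) (S.connCoeff i a b c) (S.baseSet i) :=
  SmoothOn.clm (((1 / 2 : ℝ) • ContinuousLinearMap.id ℝ ℝ)) (((S.smoothOn_structureCoeff a b c).sub
    (S.smoothOn_structureCoeff b c a)).add (S.smoothOn_structureCoeff c a b)) |>.congr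
      fun y _ => by simp [connCoeff]; ring

theorem structureCoeff_swap (a b c : Fin n) (x : M) :
    S.structureCoeff i a b c x = -S.structureCoeff i b a c x := by
  rw [structureCoeff, mlieBracket_swap_apply]; simp [structureCoeff]

theorem connCoeff_swap (a b c : Fin n) (x : M) :
    S.connCoeff i a b c x = -S.connCoeff i a c b x := by
  rw [connCoeff, connCoeff, S.structureCoeff_swap a b c, S.structureCoeff_swap c a b,
    S.structureCoeff_swap b c a]
  ring

theorem connCoeff_sub (a b c : Fin n) (x : M) :
    S.connCoeff i a b c x - S.connCoeff i b a c x = S.structureCoeff i a b c x := by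
  rw [connCoeff, connCoeff, S.structureCoeff_swap b a c, S.structureCoeff_swap c a b,
    S.structureCoeff_swap b c a]
  ring

theorem connAlong_swap (v : TangentSpace 𝓘(ℝ, Model n) x) (b c : Fin n) :
    S.connAlong i v b c = -S.connAlong i v c b := by
  rw [connAlong, connAlong, ← Finset.sum_neg_distrib]
  exact Finset.sum_congr rfl fun a _ => by rw [S.connCoeff_swap a b c]; ring

theorem connAlong_add (v w : TangentSpace 𝓘(ℝ, Model n) x) (b c : Fin n) :
    S.connAlong i (v + w) b c = S.connAlong i v b c + S.connAlong i w b c := by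
  simp [connAlong, comp_add, add_mul, Finset.sum_add_distrib]

theorem connAlong_smul (r : ℝ) (v : TangentSpace 𝓘(ℝ, Model n) x) (b c : Fin n) :
    S.connAlong i (r • v) b c = r * S.connAlong i v b c := by
  simp [connAlong, comp_smul, Finset.mul_sum, mul_assoc]

theorem connAlong_frame (hx : x ∈ S.baseSet i) (a b c : Fin n) :
    S.connAlong i (S.frame i a x) b c = S.connCoeff i a b c x := by
  simp [connAlong, S.comp_frame hx]

theorem mlieBracket_frame (hx : x ∈ S.baseSet i) (a b : Fin n) :
    mlieBracket 𝓘(ℝ, Model n) (S.frame i a) (S.frame i b) x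
      = ∑ c, (η c * S.structureCoeff i a b c x) • S.frame i c x :=
  (S.sum_comp_smul_frame hx _).symm

theorem mlieBracket_expand {U : Set M} (hU : IsOpen U) (hUi : U ⊆ S.baseSet i) (hx : x ∈ U)
    {Z Y : ∀ x : M, TangentSpace 𝓘(ℝ, Model n) x} (hY : SmoothFieldOn Y U) :
    mlieBracket 𝓘(ℝ, Model n) Z Y x
      = ∑ a, (dirDeriv (fun y => S.comp i (Y y) a) x (Z x) • S.frame i a x
        + S.comp i (Y x) a • mlieBracket 𝓘(ℝ, Model n) Z (S.frame i a) x) := by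
  have hs : ∀ a, SmoothFieldOn (S.frame i a) U := fun a => (S.smooth_frame i a).mono hUi
  rw [mlieBracket_congr (Y' := fun y => ∑ a, S.comp i (Y y) a • S.frame i a y) hU hx
    (fun y hy => (S.sum_comp_smul_frame (hUi hy) (Y y)).symm),
    mlieBracket_sum_right _ hU hx (fun a => SmoothFieldOn.smul (S.smoothOn_comp hUi hY a) (hs a))]
  exact Finset.sum_congr rfl fun a _ =>
    mlieBracket_smul_right' hU hx (S.smoothOn_comp hUi hY a) (hs a)

/-- The Levi-Civita derivative of a vector field, computed in the frame `i`. -/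
def covField (i : ι) (Y : ∀ x : M, TangentSpace 𝓘(ℝ, Model n) x) (x : M)
    (v : TangentSpace 𝓘(ℝ, Model n) x) : TangentSpace 𝓘(ℝ, Model n) x :=
  ∑ a, (dirDeriv (fun y => S.comp i (Y y) a) x v
    + ∑ b, S.comp i (Y x) b * (η a * S.connAlong i v b a)) • S.frame i a x

theorem comp_covField (hx : x ∈ S.baseSet i) (Y : ∀ x : M, TangentSpace 𝓘(ℝ, Model n) x)
    (v : TangentSpace 𝓘(ℝ, Model n) x) (a : Fin n) :
    S.comp i (S.covField i Y x v) a = dirDeriv (fun y => S.comp i (Y y) a) x v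
      + ∑ b, S.comp i (Y x) b * (η a * S.connAlong i v b a) := by
  simp [covField, comp_sum, comp_smul, S.comp_frame hx]

theorem covField_add_right (Y : ∀ x : M, TangentSpace 𝓘(ℝ, Model n) x)
    (v w : TangentSpace 𝓘(ℝ, Model n) x) :
    S.covField i Y x (v + w) = S.covField i Y x v + S.covField i Y x w := by
  rw [covField, covField, covField, ← Finset.sum_add_distrib]
  refine Finset.sum_congr rfl fun a _ => ?_
  rw [← add_smul, dirDeriv_add_right]
  simp only [connAlong_add, mul_add, Finset.sum_add_distrib]
  congr 1; ring

theorem covField_smul_right (Y : ∀ x : M, TangentSpace 𝓘(ℝ, Model n) x) (r : ℝ)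
    (v : TangentSpace 𝓘(ℝ, Model n) x) :
    S.covField i Y x (r • v) = r • S.covField i Y x v := by
  rw [covField, covField, Finset.smul_sum]
  refine Finset.sum_congr rfl fun a _ => ?_
  rw [smul_smul, dirDeriv_smul_right]
  simp only [connAlong_smul, smul_eq_mul, mul_add, Finset.mul_sum]
  congr 2
  exact Finset.sum_congr rfl fun b _ => by ring

theorem covField_frame (hx : x ∈ S.baseSet i) (v : TangentSpace 𝓘(ℝ, Model n) x) (b : Fin n) :
    S.covField i (S.frame i b) x v = ∑ a, (η a * S.connAlong i v b a) • S.frame i a x := by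
  refine Finset.sum_congr rfl fun a _ => ?_
  have : dirDeriv (fun y => S.comp i (S.frame i b y) a) x v = 0 := by
    rw [dirDeriv_congr (S.isOpen_baseSet i) hx (g := fun _ => if a = b then 1 else 0)
      (fun y hy => S.comp_frame hy a b), dirDeriv_const]
  simp [this, S.comp_frame hx]

theorem metric_eq_sum_comp (hx : x ∈ S.baseSet i) (v w : TangentSpace 𝓘(ℝ, Model n) x) :
    g.val x v w = ∑ a, η a * (S.comp i v a * S.comp i w a) := by
  rw [S.metric_eq_sum hx]
  refine Finset.sum_congr rfl fun a _ => ?_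
  have := S.sign_mul_self a
  rw [g.symm]
  simp only [comp]
  linear_combination (-(η a * g.val x v (S.frame i a x) * g.val x w (S.frame i a x))) * this

theorem dirDeriv_metric {U : Set M} (hU : IsOpen U) (hUi : U ⊆ S.baseSet i) (hx : x ∈ U)
    {Y Z : ∀ x : M, TangentSpace 𝓘(ℝ, Model n) x} (hY : SmoothFieldOn Y U)
    (hZ : SmoothFieldOn Z U) (v : TangentSpace 𝓘(ℝ, Model n) x) :
    dirDeriv (fun y => g.val y (Y y) (Z y)) x v
      = g.val x (S.covField i Y x v) (Z x) + g.val x (Y x) (S.covField i Z x v) := by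
  have sY := fun a => S.smoothOn_comp hUi hY a
  have sZ := fun a => S.smoothOn_comp hUi hZ a
  rw [dirDeriv_congr (g := fun y => ∑ a, η a * (S.comp i (Y y) a * S.comp i (Z y) a)) hU hx
    (fun y hy => S.metric_eq_sum_comp (hUi hy) _ _),
    dirDeriv_sum _ (fun a => (SmoothOn.mul' contMDiffOn_const
      (SmoothOn.mul' (sY a) (sZ a))).mdiff hU hx)]
  have e : ∀ a, dirDeriv (fun y => η a * (S.comp i (Y y) a * S.comp i (Z y) a)) x v
      = η a * (dirDeriv (fun y => S.comp i (Y y) a) x v * S.comp i (Z x) a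
        + S.comp i (Y x) a * dirDeriv (fun y => S.comp i (Z y) a) x v) := by
    intro a
    rw [dirDeriv_mul (mdifferentiableAt_const) ((SmoothOn.mul' (sY a) (sZ a)).mdiff hU hx),
      dirDeriv_mul ((sY a).mdiff hU hx) ((sZ a).mdiff hU hx), dirDeriv_const]
    ring
  rw [Finset.sum_congr rfl fun a _ => e a, S.metric_eq_sum_comp (hUi hx),
    S.metric_eq_sum_comp (hUi hx)]
  simp only [S.comp_covField (hUi hx)]
  have e2 : ∑ a, ∑ b, η a * (S.comp i (Y x) b * (η a * S.connAlong i v b a) * S.comp i (Z x) a)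
      + ∑ a, ∑ b, η a * (S.comp i (Y x) a * (S.comp i (Z x) b * (η a * S.connAlong i v b a))) = 0 := by
    rw [Finset.sum_comm, ← Finset.sum_add_distrib]
    refine Finset.sum_eq_zero fun b _ => ?_
    rw [← Finset.sum_add_distrib]
    refine Finset.sum_eq_zero fun a _ => ?_
    rw [S.connAlong_swap v b a]
    linear_combination (-S.comp i (Y x) b * S.comp i (Z x) a * S.connAlong i v a b) *
      S.sign_mul_self a + (S.comp i (Y x) b * S.comp i (Z x) a * S.connAlong i v a b) *
      S.sign_mul_self b
  simp only [add_mul, mul_add, Finset.sum_mul, Finset.mul_sum, Finset.sum_add_distrib] at e2 ⊢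
  linear_combination -e2

theorem covField_sub_covField {U : Set M} (hU : IsOpen U) (hUi : U ⊆ S.baseSet i) (hx : x ∈ U)
    {Y Z : ∀ x : M, TangentSpace 𝓘(ℝ, Model n) x} (hY : SmoothFieldOn Y U)
    (hZ : SmoothFieldOn Z U) :
    S.covField i Y x (Z x) - S.covField i Z x (Y x) = mlieBracket 𝓘(ℝ, Model n) Z Y x := by
  have e1 : ∀ a, mlieBracket 𝓘(ℝ, Model n) Z (S.frame i a) x
      = -∑ b, (dirDeriv (fun y => S.comp i (Z y) b) x (S.frame i a x) • S.frame i b x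
        + S.comp i (Z x) b • ∑ c, (η c * S.structureCoeff i a b c x) • S.frame i c x) := by
    intro a
    rw [mlieBracket_swap_apply, S.mlieBracket_expand hU hUi hx hZ]
    simp only [S.mlieBracket_frame (hUi hx)]
  have e2 : ∀ b, dirDeriv (fun y => S.comp i (Z y) b) x (Y x)
      = ∑ a, S.comp i (Y x) a * dirDeriv (fun y => S.comp i (Z y) b) x (S.frame i a x) := by
    intro b
    conv_lhs => rw [← S.sum_comp_smul_frame (hUi hx) (Y x)]
    simp [dirDeriv_sum_right, dirDeriv_smul_right]
  rw [S.mlieBracket_expand hU hUi hx hY]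
  simp only [e1, covField, e2]
  have e3 : ∀ c, (∑ b, S.comp i (Y x) b * (η c * S.connAlong i (Z x) b c))
      - (∑ b, S.comp i (Z x) b * (η c * S.connAlong i (Y x) b c))
      = -∑ a, ∑ b, S.comp i (Y x) a * S.comp i (Z x) b * (η c * S.structureCoeff i a b c x) := by
    intro c
    simp only [connAlong, Finset.mul_sum]
    rw [Finset.sum_comm (s := Finset.univ) (f := fun b a => S.comp i (Z x) b * _)]
    rw [← Finset.sum_sub_distrib, ← Finset.sum_neg_distrib]
    refine Finset.sum_congr rfl fun a _ => ?_
    rw [← Finset.sum_sub_distrib, ← Finset.sum_neg_distrib]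
    refine Finset.sum_congr rfl fun b _ => ?_
    rw [← S.connCoeff_sub a b c]
    ring
  rw [← sub_eq_zero]
  simp only [add_smul, Finset.sum_add_distrib, smul_neg, Finset.smul_sum, smul_add, smul_smul,
    Finset.sum_neg_distrib, Finset.sum_smul]
  have e4 := Finset.sum_congr (rfl : Finset.univ = Finset.univ) fun c (_ : c ∈ Finset.univ) =>
    congrArg (fun r : ℝ => r • S.frame i c x) (e3 c)
  simp only [sub_smul, neg_smul, Finset.sum_sub_distrib, Finset.sum_neg_distrib,
    Finset.sum_smul] at e4
  have c1 : ∑ c, ∑ a, (S.comp i (Y x) a * dirDeriv (fun y => S.comp i (Z y) c) x (S.frame i a x))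
      • S.frame i c x = ∑ a, ∑ c, (S.comp i (Y x) a *
        dirDeriv (fun y => S.comp i (Z y) c) x (S.frame i a x)) • S.frame i c x := Finset.sum_comm
  have c2 : ∑ c, ∑ a, ∑ b, (S.comp i (Y x) a * S.comp i (Z x) b *
      (η c * S.structureCoeff i a b c x)) • S.frame i c x = ∑ a, ∑ b, ∑ c, (S.comp i (Y x) a *
      (S.comp i (Z x) b * (η c * S.structureCoeff i a b c x))) • S.frame i c x := by
    rw [Finset.sum_comm]
    refine Finset.sum_congr rfl fun a _ => ?_
    rw [Finset.sum_comm]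
    simp only [mul_assoc]
  rw [c2] at e4
  rw [← c1]
  linear_combination (norm := module) e4

/-- The Levi-Civita derivative does not depend on the frame. -/
theorem covField_frame_eq (hi : x ∈ S.baseSet i) (hj : x ∈ S.baseSet j) (b : Fin n)
    (v : TangentSpace 𝓘(ℝ, Model n) x) :
    S.covField i (S.frame j b) x v = S.covField j (S.frame j b) x v := by
  set U := S.baseSet i ∩ S.baseSet j with hUdef
  have hU : IsOpen U := (S.isOpen_baseSet i).inter (S.isOpen_baseSet j)
  have hx : x ∈ U := ⟨hi, hj⟩
  have hs : ∀ a, SmoothFieldOn (S.frame j a) U := fun a =>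
    (S.smooth_frame j a).mono Set.inter_subset_right
  set N : Fin n → Fin n → Fin n → ℝ := fun a b c =>
    g.val x (S.covField i (S.frame j b) x (S.frame j a x)
      - S.covField j (S.frame j b) x (S.frame j a x)) (S.frame j c x) with hN
  have anti : ∀ a b c, N a b c = -N a c b := by
    intro a b c
    have h1 := S.dirDeriv_metric hU Set.inter_subset_left hx (hs b) (hs c) (S.frame j a x)
    have h2 := S.dirDeriv_metric hU Set.inter_subset_right hx (hs b) (hs c) (S.frame j a x)
    rw [h1] at h2
    simp only [hN, map_sub, _root_.sub_apply]
    rw [g.symm x (S.frame j b x), g.symm x (S.frame j b x)] at h2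
    linear_combination h2
  have sym : ∀ a b c, N a b c = N b a c := by
    intro a b c
    have h1 := S.covField_sub_covField hU Set.inter_subset_left hx (hs b) (hs a)
    have h2 := S.covField_sub_covField hU Set.inter_subset_right hx (hs b) (hs a)
    rw [← h2] at h1
    have h3 := congrArg (fun u => g.val x u (S.frame j c x)) h1
    simp only [map_sub, _root_.sub_apply] at h3
    simp only [hN, map_sub, _root_.sub_apply]
    linear_combination h3
  have zero : ∀ a b c, N a b c = 0 := by
    intro a b c
    have h1 := anti a b c
    have h2 := sym a c b
    have h3 := anti c a b
    have h4 := sym c b a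
    have h5 := anti b c a
    have h6 := sym b a c
    linarith
  have key : ∀ a, S.covField i (S.frame j b) x (S.frame j a x)
      = S.covField j (S.frame j b) x (S.frame j a x) := by
    intro a
    rw [← sub_eq_zero]
    rw [← S.sum_comp_smul_frame hj (S.covField i (S.frame j b) x (S.frame j a x)
      - S.covField j (S.frame j b) x (S.frame j a x))]
    refine Finset.sum_eq_zero fun c _ => ?_
    have := zero a b c
    simp only [hN] at this
    rw [comp, this, mul_zero, zero_smul]
  have lin : ∀ (k : ι) (s : Finset (Fin n)), S.covField k (S.frame j b) x
      (∑ a ∈ s, S.comp j v a • S.frame j a x)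
      = ∑ a ∈ s, S.comp j v a • S.covField k (S.frame j b) x (S.frame j a x) := by
    intro k s
    classical
    induction s using Finset.induction_on with
    | empty =>
      have := S.covField_smul_right (i := k) (S.frame j b) 0 (0 : TangentSpace 𝓘(ℝ, Model n) x)
      simpa using this
    | insert a s ha ih => rw [Finset.sum_insert ha, covField_add_right, covField_smul_right, ih,
        Finset.sum_insert ha]
  rw [← S.sum_comp_smul_frame hj v, lin, lin]
  exact Finset.sum_congr rfl fun a _ => by rw [key]

/-- The derivative of the matrix of a change of frame. -/
theorem dirDeriv_transition (hi : x ∈ S.baseSet i) (hj : x ∈ S.baseSet j) (a b : Fin n)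
    (v : TangentSpace 𝓘(ℝ, Model n) x) :
    dirDeriv (fun y => g.val y (S.frame i a y) (S.frame j b y)) x v
      = ∑ c, η c * S.connAlong i v a c * g.val x (S.frame i c x) (S.frame j b x)
        + ∑ c, η c * S.connAlong j v b c * g.val x (S.frame i a x) (S.frame j c x) := by
  rw [S.dirDeriv_metric ((S.isOpen_baseSet i).inter (S.isOpen_baseSet j)) Set.inter_subset_left
    ⟨hi, hj⟩ ((S.smooth_frame i a).mono Set.inter_subset_left)
    ((S.smooth_frame j b).mono Set.inter_subset_right), S.covField_frame_eq hi hj,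
    S.covField_frame hi, S.covField_frame hj]
  simp [map_sum, _root_.sum_apply]

end LeviCivita

end SpinStructure

end

section

namespace SpinStructure

variable {n : ℕ} {M : Type*} [TopologicalSpace M] [ChartedSpace (Model n) M]
  [IsManifold 𝓘(ℝ, Model n) ∞ M] {g : PseudoRiemannianMetric n M} {η : Fin n → ℝ} {ι : Type*}
  (S : SpinStructure g η ι) {i j : ι} {x : M}

section Curvature

open VectorField

theorem riem_swap_left (a b c d : Fin n) (x : M) : S.riem i a b c d x = -S.riem i b a c d x := by
  have h1 : ∑ e, η e * (S.connCoeff i b c e x * S.connCoeff i a e d x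
        - S.connCoeff i a c e x * S.connCoeff i b e d x)
      = -∑ e, η e * (S.connCoeff i a c e x * S.connCoeff i b e d x
        - S.connCoeff i b c e x * S.connCoeff i a e d x) := by
    rw [← Finset.sum_neg_distrib]; exact Finset.sum_congr rfl fun e _ => by ring
  have h2 : ∑ e, η e * S.structureCoeff i a b e x * S.connCoeff i e c d x
      = -∑ e, η e * S.structureCoeff i b a e x * S.connCoeff i e c d x := by
    rw [← Finset.sum_neg_distrib]
    exact Finset.sum_congr rfl fun e _ => by rw [S.structureCoeff_swap a b]; ring
  rw [riem, riem, h1, h2]; ring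

theorem dirDeriv_neg {f : M → ℝ} {v : TangentSpace 𝓘(ℝ, Model n) x} {U : Set M} (hU : IsOpen U)
    (hx : x ∈ U) (hf : SmoothOn (n := n) f U) :
    dirDeriv (fun y => -f y) x v = -dirDeriv f x v := by
  simpa using dirDeriv_clm (v := v) (-ContinuousLinearMap.id ℝ ℝ) (hf.mdiff hU hx)

theorem riem_swap_right (hx : x ∈ S.baseSet i) (a b c d : Fin n) :
    S.riem i a b c d x = -S.riem i a b d c x := by
  have hd : ∀ a b c d, dirDeriv (S.connCoeff i b c d) x (S.frame i a x)
      = -dirDeriv (S.connCoeff i b d c) x (S.frame i a x) := by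
    intro a b c d
    rw [← dirDeriv_neg (S.isOpen_baseSet i) hx (S.smoothOn_connCoeff b d c)]
    congr 1; ext y; exact S.connCoeff_swap b c d y
  have h1 : ∑ e, η e * (S.connCoeff i b c e x * S.connCoeff i a e d x
        - S.connCoeff i a c e x * S.connCoeff i b e d x)
      = -∑ e, η e * (S.connCoeff i b d e x * S.connCoeff i a e c x
        - S.connCoeff i a d e x * S.connCoeff i b e c x) := by
    rw [← Finset.sum_neg_distrib]
    exact Finset.sum_congr rfl fun e _ => by
      rw [S.connCoeff_swap b c e, S.connCoeff_swap a e d, S.connCoeff_swap a c e,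
        S.connCoeff_swap b e d]
      ring
  have h2 : ∑ e, η e * S.structureCoeff i a b e x * S.connCoeff i e c d x
      = -∑ e, η e * S.structureCoeff i a b e x * S.connCoeff i e d c x := by
    rw [← Finset.sum_neg_distrib]
    exact Finset.sum_congr rfl fun e _ => by rw [S.connCoeff_swap e c d]; ring
  rw [riem, riem, h1, h2, hd a b c d, hd b a c d]; ring

/-- The Jacobi identity of the frame fields, in components. -/
theorem structureCoeff_jacobi (hx : x ∈ S.baseSet i) (a b c d : Fin n) :
    dirDeriv (S.structureCoeff i b c d) x (S.frame i a x)
      + dirDeriv (S.structureCoeff i c a d) x (S.frame i b x)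
      + dirDeriv (S.structureCoeff i a b d) x (S.frame i c x)
      + ∑ e, η e * (S.structureCoeff i b c e x * S.structureCoeff i a e d x
        + S.structureCoeff i c a e x * S.structureCoeff i b e d x
        + S.structureCoeff i a b e x * S.structureCoeff i c e d x) = 0 := by
  have hU := S.isOpen_baseSet i
  have hs := S.smooth_frame i
  have e : ∀ a b c, g.val x (mlieBracket 𝓘(ℝ, Model n) (S.frame i a)
      (mlieBracket 𝓘(ℝ, Model n) (S.frame i b) (S.frame i c)) x) (S.frame i d x)
      = dirDeriv (S.structureCoeff i b c d) x (S.frame i a x)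
        + ∑ e, η e * (S.structureCoeff i b c e x * S.structureCoeff i a e d x) := by
    intro a b c
    rw [S.mlieBracket_expand hU subset_rfl hx (SmoothFieldOn.mlieBracket (hs b) (hs c) hU)]
    simp only [Finset.sum_add_distrib, map_add, map_sum, map_smul, _root_.add_apply, _root_.sum_apply,
      _root_.smul_apply, smul_eq_mul, S.orthonormal i x hx, mul_ite, mul_zero, Finset.sum_ite_eq',
      Finset.mem_univ, if_true]
    congr 1
    · have : dirDeriv (fun y => S.comp i (mlieBracket 𝓘(ℝ, Model n) (S.frame i b) (S.frame i c) y) d)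
          x (S.frame i a x) = η d * dirDeriv (S.structureCoeff i b c d) x (S.frame i a x) :=
        dirDeriv_clm (η d • ContinuousLinearMap.id ℝ ℝ)
          ((S.smoothOn_structureCoeff b c d).mdiff hU hx)
      rw [this]
      linear_combination dirDeriv (S.structureCoeff i b c d) x (S.frame i a x) * S.sign_mul_self d
    · exact Finset.sum_congr rfl fun e _ => by simp only [comp, structureCoeff]; ring
  have h3 : IsManifold 𝓘(ℝ, Model n) (minSmoothness ℝ 3) M := by
    rw [minSmoothness_of_isRCLikeNormedField]
    exact IsManifold.of_le (n := ∞) (by norm_cast)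
  have hm : ∀ a, ContMDiffAt 𝓘(ℝ, Model n) 𝓘(ℝ, Model n).tangent (minSmoothness ℝ 2)
      (fun x => (⟨x, S.frame i a x⟩ : TangentBundle 𝓘(ℝ, Model n) M)) x := fun a =>
    ((hs a).contMDiffAt (hU.mem_nhds hx)).of_le (by
      rw [minSmoothness_of_isRCLikeNormedField]; norm_cast)
  have h := leibniz_identity_mlieBracket_apply (hm a) (hm b) (hm c)
  rw [mlieBracket_swap_apply (V := mlieBracket 𝓘(ℝ, Model n) (S.frame i a) (S.frame i b)),
    show mlieBracket 𝓘(ℝ, Model n) (S.frame i a) (S.frame i c)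
      = -mlieBracket 𝓘(ℝ, Model n) (S.frame i c) (S.frame i a) from mlieBracket_swap] at h
  have hneg : mlieBracket 𝓘(ℝ, Model n) (S.frame i b)
      (-mlieBracket 𝓘(ℝ, Model n) (S.frame i c) (S.frame i a)) x
      = -mlieBracket 𝓘(ℝ, Model n) (S.frame i b)
        (mlieBracket 𝓘(ℝ, Model n) (S.frame i c) (S.frame i a)) x := by
    have := mlieBracket_smul_right' (X := S.frame i b) (f := fun _ => (-1 : ℝ)) hU hx
      contMDiffOn_const (SmoothFieldOn.mlieBracket (hs c) (hs a) hU)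
    simp only [dirDeriv_const, zero_smul, zero_add, neg_smul, one_smul] at this
    exact this
  rw [hneg] at h
  have h' := congrArg (fun u => g.val x u (S.frame i d x)) h
  simp only [map_add, map_neg, _root_.add_apply, _root_.neg_apply, e] at h'
  simp only [mul_add, Finset.sum_add_distrib] at h' ⊢
  linear_combination h'

/-- The first Bianchi identity. -/
theorem riem_cyclic (hx : x ∈ S.baseSet i) (a b c d : Fin n) :
    S.riem i a b c d x + S.riem i b c a d x + S.riem i c a b d x = 0 := by
  have h := S.structureCoeff_jacobi hx a b c d
  have hd : ∀ a b c, dirDeriv (S.structureCoeff i b c d) x (S.frame i a x)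
      = dirDeriv (S.connCoeff i b c d) x (S.frame i a x)
        - dirDeriv (S.connCoeff i c b d) x (S.frame i a x) := by
    intro a b c
    have h1 := dirDeriv_add (v := S.frame i a x) ((S.smoothOn_connCoeff b c d).mdiff (S.isOpen_baseSet i) hx)
      ((SmoothOn.clm (-ContinuousLinearMap.id ℝ ℝ) (S.smoothOn_connCoeff c b d)).mdiff
        (S.isOpen_baseSet i) hx)
    have h2 := dirDeriv_neg (v := S.frame i a x) (S.isOpen_baseSet i) hx (S.smoothOn_connCoeff c b d)
    have h3 : dirDeriv (fun y => (-ContinuousLinearMap.id ℝ ℝ) (S.connCoeff i c b d y)) x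
      (S.frame i a x) = dirDeriv (fun y => -S.connCoeff i c b d y) x (S.frame i a x) := rfl
    rw [h3, h2, ← sub_eq_add_neg] at h1
    rw [← h1]
    congr 1
    ext y
    simp [← S.connCoeff_sub b c d y, sub_eq_add_neg]
  rw [hd, hd, hd] at h
  have hq : ∑ e, η e * (S.structureCoeff i b c e x * S.structureCoeff i a e d x
        + S.structureCoeff i c a e x * S.structureCoeff i b e d x
        + S.structureCoeff i a b e x * S.structureCoeff i c e d x)
      = (∑ e, η e * (S.connCoeff i b c e x * S.connCoeff i a e d x
        - S.connCoeff i a c e x * S.connCoeff i b e d x)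
        - ∑ e, η e * S.structureCoeff i a b e x * S.connCoeff i e c d x)
      + (∑ e, η e * (S.connCoeff i c a e x * S.connCoeff i b e d x
        - S.connCoeff i b a e x * S.connCoeff i c e d x)
        - ∑ e, η e * S.structureCoeff i b c e x * S.connCoeff i e a d x)
      + (∑ e, η e * (S.connCoeff i a b e x * S.connCoeff i c e d x
        - S.connCoeff i c b e x * S.connCoeff i a e d x)
        - ∑ e, η e * S.structureCoeff i c a e x * S.connCoeff i e b d x) := by
    simp only [← Finset.sum_sub_distrib, ← Finset.sum_add_distrib]
    refine Finset.sum_congr rfl fun e _ => ?_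
    simp only [← S.connCoeff_sub]
    ring
  rw [hq] at h
  simp only [riem]
  linear_combination h

theorem riem_pair_symm (hx : x ∈ S.baseSet i) (a b c d : Fin n) :
    S.riem i a b c d x = S.riem i c d a b x := by
  have h1 := S.riem_cyclic hx a b c d
  have h2 := S.riem_cyclic hx b c d a
  have h3 := S.riem_cyclic hx c d a b
  have h4 := S.riem_cyclic hx d a b c
  have l := fun a b c d => S.riem_swap_left (i := i) a b c d x
  have r := S.riem_swap_right hx
  linarith [l a b c d, l b c a d, l c a b d, l c d b a, l d b c a, l d a c b, l a c d b, l b d a c,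
    l a b d c, l b c d a, l c d a b, l d a b c, r a b c d, r b c a d, r c a b d, r b c d a,
    r c d b a, r d b c a, r c d a b, r d a c b, r a c d b, r d a b c, r a b d c, r b d a c]

/-- The first Bianchi identity in the last three indices. -/
theorem riem_cyclic_right (hx : x ∈ S.baseSet i) (a b c d : Fin n) :
    S.riem i a b c d x + S.riem i a c d b x + S.riem i a d b c x = 0 := by
  have h1 := S.riem_cyclic hx b c d a
  have l := fun a b c d => S.riem_swap_left (i := i) a b c d x
  have r := S.riem_swap_right hx
  have p := S.riem_pair_symm hx
  linarith [p a b c d, p a c d b, p a d b c, l a b c d, r b c a d, r c d b a, r d b c a, r b c d a,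
    r c d a b, r d b a c, p b c d a, r a b c d, r c d a b]

/-- A space of constant curvature is an Einstein space. -/
theorem HasConstantCurvature.isEinstein {c : ℝ} (h : S.HasConstantCurvature c) :
    S.IsEinstein (((n : ℝ) - 1) * c) := by
  intro i x hx b d
  have e : ∀ a, η a * S.riem i a b d a x
      = c * g.val x (S.frame i b x) (S.frame i d x) - (if a = b then
        c * g.val x (S.frame i b x) (S.frame i d x) else 0) := by
    intro a
    rw [h i x hx, S.orthonormal i x hx a a, S.orthonormal i x hx b a, if_pos rfl]
    by_cases hab : a = b
    · subst hab
      simp only [if_true]; ring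
    · rw [if_neg (Ne.symm hab), if_neg hab]
      linear_combination c * g.val x (S.frame i b x) (S.frame i d x) * S.sign_mul_self a
  rw [ricci, Finset.sum_congr rfl fun a _ => e a, Finset.sum_sub_distrib]
  simp
  ring

/-- The vector `K(v)` on an Einstein space. -/
theorem IsEinstein.kVec {l : ℝ} (h : S.IsEinstein l) (hn : 3 ≤ n)
    (v : TangentSpace 𝓘(ℝ, Model n) x) :
    S.kVec v = (-(l / (2 * ((n : ℝ) - 1)))) • v := by
  have hx := S.mem_baseSet_at x
  have h3 : (3 : ℝ) ≤ n := by exact_mod_cast hn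
  have hs : S.scalarCurv (S.indexAt x) x = n * l := by
    rw [scalarCurv]
    have : ∀ a, η a * S.ricci (S.indexAt x) a a x = l := fun a => by
      rw [h _ x hx, S.orthonormal _ x hx, if_pos rfl]
      linear_combination l * S.sign_mul_self a
    simp [this]
  have hk : ∀ a b, S.kCoeff (S.indexAt x) a b x
      = (-(l / (2 * ((n : ℝ) - 1)))) * (if a = b then η a else 0) := by
    intro a b
    rw [kCoeff, hs, h _ x hx, S.orthonormal _ x hx]
    have h1 : (n : ℝ) - 2 ≠ 0 := by linarith
    have h2 : (n : ℝ) - 1 ≠ 0 := by linarith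
    field_simp
    ring
  rw [SpinStructure.kVec]
  conv_rhs => rw [← S.sum_comp_smul_frame hx v, Finset.smul_sum]
  refine Finset.sum_congr rfl fun a _ => ?_
  rw [Finset.sum_eq_single a]
  · rw [hk, if_pos rfl, smul_smul]
    congr 1
    linear_combination (-(l / (2 * ((n : ℝ) - 1))) * S.comp (S.indexAt x) v a) * S.sign_mul_self a
  · intro b _ hb
    rw [hk, if_neg (Ne.symm hb)]; simp
  · simp

end Curvature

end SpinStructure

end

section

section ModelClifford

variable {𝕜 : Type*} [RCLike 𝕜] {n : ℕ} {η : Fin n → ℝ}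

/-- The generator `e_a` of the Clifford algebra of the model space. -/
def cliffE (𝕜 : Type*) [RCLike 𝕜] {n : ℕ} (η : Fin n → ℝ) (a : Fin n) :
    CliffordAlgebra (quadForm 𝕜 η) := CliffordAlgebra.ι _ (Pi.single a 1)

theorem ι_eq_sum_cliffE (v : Fin n → 𝕜) :
    CliffordAlgebra.ι (quadForm 𝕜 η) v = ∑ a, v a • cliffE 𝕜 η a := by
  conv_lhs => rw [← sum_stdD_smul 𝕜 v]
  simp [cliffE, map_sum, map_smul]

theorem polarBilin_quadForm (a : Fin n) :
    QuadraticMap.polarBilin (quadForm 𝕜 η) (Pi.single a 1)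
      = (2 * algebraMap ℝ 𝕜 (η a)) • stdD 𝕜 a := by
  classical
  ext b
  simp only [QuadraticMap.polarBilin_apply_apply, QuadraticMap.polar, quadForm,
    QuadraticMap.weightedSumSquares_apply, LinearMap.comp_apply, LinearMap.smul_apply,
    LinearMap.proj_apply, Pi.add_apply, LinearMap.single_apply, smul_eq_mul,
    ← Finset.sum_sub_distrib]
  rw [Finset.sum_eq_single a]
  · by_cases h : a = b
    · subst h; simp; ring
    · simp [h]
  · intro c _ hc
    simp [hc]
  · simp

theorem quantize_ι_mul (u : Fin n → 𝕜) (α : ExteriorAlgebra 𝕜 (Fin n → 𝕜)) :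
    quantize η (ExteriorAlgebra.ι 𝕜 u * α) = CliffordAlgebra.ι _ u * quantize η α
      - (1 / 2 : 𝕜) • CliffordAlgebra.contractLeft (QuadraticMap.polarBilin (quadForm 𝕜 η) u)
        (quantize η α) := by
  let _ : Invertible (2 : 𝕜) := invertibleOfNonzero two_ne_zero
  have h : ∀ β, quantize η β = CliffordAlgebra.changeForm
      (CliffordAlgebra.changeForm.neg_proof
        (CliffordAlgebra.changeForm.associated_neg_proof (Q := quadForm 𝕜 η))) β := fun β => rfl
  rw [h, h, ExteriorAlgebra.ι, CliffordAlgebra.changeForm_ι_mul]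
  congr 1
  rw [← LinearMap.smul_apply, ← map_smul]
  congr 2
  ext b
  simp [QuadraticMap.associated_apply, QuadraticMap.polar]

theorem quantize_contractLeft (d : Module.Dual 𝕜 (Fin n → 𝕜))
    (α : ExteriorAlgebra 𝕜 (Fin n → 𝕜)) :
    quantize η (CliffordAlgebra.contractLeft d α)
      = CliffordAlgebra.contractLeft d (quantize η α) :=
  let _ : Invertible (2 : 𝕜) := invertibleOfNonzero two_ne_zero
  CliffordAlgebra.changeForm_contractLeft (CliffordAlgebra.changeForm.neg_proof
    (CliffordAlgebra.changeForm.associated_neg_proof (Q := quadForm 𝕜 η))) d α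

theorem quantize_algebraMap (r : 𝕜) :
    quantize η (algebraMap 𝕜 (ExteriorAlgebra 𝕜 (Fin n → 𝕜)) r) = algebraMap 𝕜 _ r :=
  let _ : Invertible (2 : 𝕜) := invertibleOfNonzero two_ne_zero
  CliffordAlgebra.changeForm_algebraMap (CliffordAlgebra.changeForm.neg_proof
    (CliffordAlgebra.changeForm.associated_neg_proof (Q := quadForm 𝕜 η))) r

theorem quantize_one : quantize (𝕜 := 𝕜) η 1 = 1 := let _ : Invertible (2 : 𝕜) := invertibleOfNonzero two_ne_zero
  CliffordAlgebra.changeForm_one (CliffordAlgebra.changeForm.neg_proof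
    (CliffordAlgebra.changeForm.associated_neg_proof (Q := quadForm 𝕜 η))) 

theorem quantize_ι (u : Fin n → 𝕜) :
    quantize η (ExteriorAlgebra.ι 𝕜 u) = CliffordAlgebra.ι _ u :=
  let _ : Invertible (2 : 𝕜) := invertibleOfNonzero two_ne_zero
  CliffordAlgebra.changeForm_ι (CliffordAlgebra.changeForm.neg_proof
    (CliffordAlgebra.changeForm.associated_neg_proof (Q := quadForm 𝕜 η))) u

theorem quantize_stdE (a : Fin n) : quantize η (stdE 𝕜 a) = cliffE 𝕜 η a := quantize_ι _

theorem involute_quantize (α : ExteriorAlgebra 𝕜 (Fin n → 𝕜)) :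
    CliffordAlgebra.involute (quantize η α) = quantize η (CliffordAlgebra.involute α) := by
  induction α using CliffordAlgebra.left_induction with
  | algebraMap r => rw [AlgHom.commutes, quantize_algebraMap, AlgHom.commutes]
  | add x y hx hy => simp only [map_add, hx, hy]
  | ι_mul x v hx =>
    have e : CliffordAlgebra.ι 0 v * x = ExteriorAlgebra.ι 𝕜 v * x := rfl
    have e' : CliffordAlgebra.ι 0 v * CliffordAlgebra.involute x
      = ExteriorAlgebra.ι 𝕜 v * CliffordAlgebra.involute x := rfl
    rw [map_mul CliffordAlgebra.involute (CliffordAlgebra.ι 0 v), CliffordAlgebra.involute_ι,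
      neg_mul, map_neg, e, e', quantize_ι_mul, quantize_ι_mul, map_sub, map_mul, CliffordAlgebra.involute_ι, map_smul,
      involute_contractLeft, hx]
    rw [neg_mul]
    module

theorem contractLeft_polarBilin (a : Fin n) (α : ExteriorAlgebra 𝕜 (Fin n → 𝕜)) :
    CliffordAlgebra.contractLeft (QuadraticMap.polarBilin (quadForm 𝕜 η) (Pi.single a 1))
      (quantize η α) = (2 * algebraMap ℝ 𝕜 (η a)) • quantize η (stdI 𝕜 a α) := by
  rw [polarBilin_quadForm, map_smul, LinearMap.smul_apply, stdI, quantize_contractLeft]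

/-- Clifford multiplication by a covector from the left: `e_a . α = e_a ∧ α + i_a α`. -/
theorem cliffE_mul_quantize (a : Fin n) (α : ExteriorAlgebra 𝕜 (Fin n → 𝕜)) :
    cliffE 𝕜 η a * quantize η α
      = quantize η (stdE 𝕜 a * α + (algebraMap ℝ 𝕜 (η a)) • stdI 𝕜 a α) := by
  rw [map_add, stdE, quantize_ι_mul, contractLeft_polarBilin, map_smul, cliffE]
  module

/-- Clifford multiplication by a covector from the right. -/
theorem quantize_mul_cliffE (a : Fin n) (α : ExteriorAlgebra 𝕜 (Fin n → 𝕜)) :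
    quantize η α * cliffE 𝕜 η a
      = quantize η (stdE 𝕜 a * CliffordAlgebra.involute α
        - (algebraMap ℝ 𝕜 (η a)) • stdI 𝕜 a (CliffordAlgebra.involute α)) := by
  have h := ι_mul_sub_involute_mul_ι (Q := quadForm 𝕜 η) (Pi.single a 1)
    (quantize η (CliffordAlgebra.involute α))
  have hi : CliffordAlgebra.involute (quantize η (CliffordAlgebra.involute α)) = quantize η α := by
    rw [involute_quantize, CliffordAlgebra.involute_involute]
  rw [contractLeft_polarBilin, hi] at h
  have h2 := cliffE_mul_quantize (η := η) a (CliffordAlgebra.involute α)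
  rw [cliffE] at h2 ⊢
  rw [h2] at h
  rw [map_sub, map_smul]
  rw [map_add, map_smul] at h
  linear_combination (norm := module) -h

theorem cliffE_mul_cliffE (a b : Fin n) : cliffE 𝕜 η a * cliffE 𝕜 η b
    = (if a = b then 2 * algebraMap ℝ 𝕜 (η a) else 0) • 1 - cliffE 𝕜 η b * cliffE 𝕜 η a := by
  have h := CliffordAlgebra.ι_mul_ι_add_swap (Q := quadForm 𝕜 η) (Pi.single a (1 : 𝕜)) (Pi.single b 1)
  have e := congrArg (fun f => f (Pi.single b (1 : 𝕜))) (polarBilin_quadForm (𝕜 := 𝕜) (η := η) a)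
  simp only [QuadraticMap.polarBilin_apply_apply, LinearMap.smul_apply, LinearMap.proj_apply,
    Pi.single_apply, smul_eq_mul, mul_ite, mul_one, mul_zero] at e
  rw [e, Algebra.algebraMap_eq_smul_one] at h
  rw [cliffE, cliffE]
  linear_combination (norm := module) h

theorem cliffE_mul_self (a : Fin n) :
    cliffE 𝕜 η a * cliffE 𝕜 η a = (algebraMap ℝ 𝕜 (η a)) • 1 := by
  have h := cliffE_mul_cliffE (𝕜 := 𝕜) (η := η) a a
  rw [if_pos rfl] at h
  have h2 : (2 : 𝕜) • (cliffE 𝕜 η a * cliffE 𝕜 η a) = (2 : 𝕜) • ((algebraMap ℝ 𝕜 (η a)) • 1) := by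
    linear_combination (norm := module) h
  exact smul_right_injective _ (two_ne_zero : (2 : 𝕜) ≠ 0) h2

/-- The element `(1/4) ∑ A_bc e_c e_b` of the Clifford algebra. -/
def spinElement (𝕜 : Type*) [RCLike 𝕜] {n : ℕ} (η : Fin n → ℝ) (A : Fin n → Fin n → ℝ) :
    CliffordAlgebra (quadForm 𝕜 η) :=
  (1 / 4 : 𝕜) • ∑ b, ∑ c, (algebraMap ℝ 𝕜 (A b c)) • (cliffE 𝕜 η c * cliffE 𝕜 η b)

variable {A B : Fin n → Fin n → ℝ}

theorem spinElement_commutator (hA : ∀ b c, A b c = -A c b)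
    (α : ExteriorAlgebra 𝕜 (Fin n → 𝕜)) :
    spinElement 𝕜 η A * quantize η α - quantize η α * spinElement 𝕜 η A
      = -quantize η (∑ b, ∑ c, (algebraMap ℝ 𝕜 (η c * A b c)) • (stdE 𝕜 b * stdI 𝕜 c α)) := by
  have h1 : ∀ b c, cliffE 𝕜 η c * cliffE 𝕜 η b * quantize η α
      - quantize η α * (cliffE 𝕜 η c * cliffE 𝕜 η b)
      = quantize η ((2 * algebraMap ℝ 𝕜 (η b)) • (stdE 𝕜 c * stdI 𝕜 b α)
        - (2 * algebraMap ℝ 𝕜 (η c)) • (stdE 𝕜 b * stdI 𝕜 c α)) := by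
    intro b c
    rw [mul_assoc, cliffE_mul_quantize, cliffE_mul_quantize, ← mul_assoc, quantize_mul_cliffE,
      quantize_mul_cliffE, ← map_sub]
    congr 1
    simp only [map_sub, map_mul, map_smul, stdI, involute_contractLeft,
      CliffordAlgebra.involute_involute, map_neg, map_add]
    have hE : CliffordAlgebra.involute (stdE 𝕜 c) = -stdE 𝕜 c := CliffordAlgebra.involute_ι _
    have hbc := stdI_stdE_mul (𝕜 := 𝕜) b c α
    have hcb := stdI_stdE_mul (𝕜 := 𝕜) c b α
    have hI := stdI_stdI_comm (𝕜 := 𝕜) b c α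
    have hEE := stdE_mul_stdE_mul (𝕜 := 𝕜) b c α
    rw [hE]
    simp only [neg_mul, mul_neg, map_neg, mul_add, mul_smul_comm, smul_add,
      smul_neg, sub_neg_eq_add]
    simp only [stdI] at hbc hcb hI
    rw [hbc, hcb, hI, hEE]
    by_cases h : b = c
    · subst h; simp only [if_true]; module
    · rw [if_neg h, if_neg (Ne.symm h)]; module
  have h2 : spinElement 𝕜 η A * quantize η α - quantize η α * spinElement 𝕜 η A
      = (1 / 4 : 𝕜) • ∑ b, ∑ c, (algebraMap ℝ 𝕜 (A b c)) •
        (cliffE 𝕜 η c * cliffE 𝕜 η b * quantize η α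
          - quantize η α * (cliffE 𝕜 η c * cliffE 𝕜 η b)) := by
    simp only [spinElement, smul_mul_assoc, mul_smul_comm, Finset.sum_mul, Finset.mul_sum,
      smul_sub, Finset.sum_sub_distrib]
  rw [h2]
  simp only [h1]
  have h3 : ∑ b, ∑ c, (algebraMap ℝ 𝕜 (A b c)) • ((2 * algebraMap ℝ 𝕜 (η b)) •
      (stdE 𝕜 c * stdI 𝕜 b α) - (2 * algebraMap ℝ 𝕜 (η c)) • (stdE 𝕜 b * stdI 𝕜 c α))
      = (-4 : 𝕜) • ∑ b, ∑ c, (algebraMap ℝ 𝕜 (η c * A b c)) • (stdE 𝕜 b * stdI 𝕜 c α) := by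
    simp only [smul_sub, Finset.sum_sub_distrib]
    rw [Finset.sum_comm]
    simp only [← Finset.sum_sub_distrib, Finset.smul_sum]
    refine Finset.sum_congr rfl fun b _ => Finset.sum_congr rfl fun c _ => ?_
    rw [hA c b, map_neg, map_mul]
    module
  have h4 := congrArg (quantize η) h3
  simp only [map_sum, map_smul] at h4 ⊢
  rw [h4]
  module

theorem spinElement_cliffE (hA : ∀ b c, A b c = -A c b) (d : Fin n) :
    spinElement 𝕜 η A * cliffE 𝕜 η d - cliffE 𝕜 η d * spinElement 𝕜 η A
      = -∑ b, (algebraMap ℝ 𝕜 (η d * A b d)) • cliffE 𝕜 η b := by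
  have h := spinElement_commutator (η := η) hA (stdE 𝕜 d)
  rw [quantize_stdE] at h
  rw [h, map_sum]
  congr 1
  refine Finset.sum_congr rfl fun b _ => ?_
  have e : ∀ c, stdI 𝕜 c (stdE 𝕜 d) = algebraMap 𝕜 _ (if c = d then 1 else 0) := fun c => by
    rw [stdI, stdE, ExteriorAlgebra.ι, CliffordAlgebra.contractLeft_ι, stdD_single]
  rw [Finset.sum_eq_single d]
  · rw [e, if_pos rfl, map_one, mul_one, map_smul, quantize_stdE]
  · intro c _ hc
    rw [e, if_neg hc, map_zero, mul_zero, smul_zero]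
  · simp

theorem spinElement_add : spinElement 𝕜 η (fun b c => A b c + B b c)
    = spinElement 𝕜 η A + spinElement 𝕜 η B := by
  simp [spinElement, add_smul, Finset.sum_add_distrib, smul_add]

theorem spinElement_smul (r : ℝ) : spinElement 𝕜 η (fun b c => r * A b c)
    = (algebraMap ℝ 𝕜 r) • spinElement 𝕜 η A := by
  simp only [spinElement, map_mul, mul_smul, Finset.smul_sum, smul_comm (1 / 4 : 𝕜)]

theorem spinElement_sum {κ : Type*} (s : Finset κ) (A : κ → Fin n → Fin n → ℝ) :
    spinElement 𝕜 η (fun b c => ∑ k ∈ s, A k b c) = ∑ k ∈ s, spinElement 𝕜 η (A k) := by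
  classical
  induction s using Finset.induction_on with
  | empty => simp [spinElement]
  | insert a s ha ih => simp only [Finset.sum_insert ha, spinElement_add, ih]

theorem spinElement_bracket (hA : ∀ b c, A b c = -A c b) :
    spinElement 𝕜 η A * spinElement 𝕜 η B - spinElement 𝕜 η B * spinElement 𝕜 η A
      = spinElement 𝕜 η (fun b c => ∑ e, η e * (B b e * A e c - A b e * B e c)) := by
  have h1 : spinElement 𝕜 η A * spinElement 𝕜 η B - spinElement 𝕜 η B * spinElement 𝕜 η A
      = (1 / 4 : 𝕜) • ∑ b, ∑ c, (algebraMap ℝ 𝕜 (B b c)) •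
        ((spinElement 𝕜 η A * cliffE 𝕜 η c - cliffE 𝕜 η c * spinElement 𝕜 η A) * cliffE 𝕜 η b
          + cliffE 𝕜 η c * (spinElement 𝕜 η A * cliffE 𝕜 η b
            - cliffE 𝕜 η b * spinElement 𝕜 η A)) := by
    have e : ∀ X b c, (X * cliffE 𝕜 η c - cliffE 𝕜 η c * X) * cliffE 𝕜 η b
          + cliffE 𝕜 η c * (X * cliffE 𝕜 η b - cliffE 𝕜 η b * X)
        = X * (cliffE 𝕜 η c * cliffE 𝕜 η b) - (cliffE 𝕜 η c * cliffE 𝕜 η b) * X := by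
      intro X b c; noncomm_ring
    simp only [e]
    generalize spinElement 𝕜 η A = X
    simp only [spinElement, smul_mul_assoc, mul_smul_comm, Finset.sum_mul, Finset.mul_sum,
      smul_sub, Finset.sum_sub_distrib]
  rw [h1]
  simp only [spinElement_cliffE hA]
  rw [spinElement]
  congr 1
  simp only [neg_mul, mul_neg, Finset.sum_mul, Finset.mul_sum, smul_mul_assoc, mul_smul_comm,
    map_sum, Finset.sum_smul, smul_add, smul_neg, Finset.smul_sum, smul_smul,
    Finset.sum_add_distrib, Finset.sum_neg_distrib]
  have c1 : ∑ b, ∑ c, ∑ e, (algebraMap ℝ 𝕜 (B b c) * algebraMap ℝ 𝕜 (η c * A e c)) •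
      (cliffE 𝕜 η e * cliffE 𝕜 η b) = ∑ b, ∑ c, ∑ e, (algebraMap ℝ 𝕜 (B b e) *
      algebraMap ℝ 𝕜 (η e * A c e)) • (cliffE 𝕜 η c * cliffE 𝕜 η b) :=
    Finset.sum_congr rfl fun b _ => Finset.sum_comm
  have c2 : ∑ b, ∑ c, ∑ e, (algebraMap ℝ 𝕜 (B b c) * algebraMap ℝ 𝕜 (η b * A e b)) •
      (cliffE 𝕜 η c * cliffE 𝕜 η e) = ∑ b, ∑ c, ∑ e, (algebraMap ℝ 𝕜 (B e c) *
      algebraMap ℝ 𝕜 (η e * A b e)) • (cliffE 𝕜 η c * cliffE 𝕜 η b) := by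
    have : ∀ b, ∑ c, ∑ e, (algebraMap ℝ 𝕜 (B b c) * algebraMap ℝ 𝕜 (η b * A e b)) •
      (cliffE 𝕜 η c * cliffE 𝕜 η e) = ∑ e, ∑ c, (algebraMap ℝ 𝕜 (B b c) *
        algebraMap ℝ 𝕜 (η b * A e b)) • (cliffE 𝕜 η c * cliffE 𝕜 η e) :=
      fun b => Finset.sum_comm
    simp only [this]
    rw [Finset.sum_comm]
    exact Finset.sum_congr rfl fun b _ => Finset.sum_comm
  rw [c1, c2, ← Finset.sum_neg_distrib, ← Finset.sum_neg_distrib, ← Finset.sum_add_distrib]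
  refine Finset.sum_congr rfl fun b _ => ?_
  rw [← Finset.sum_neg_distrib, ← Finset.sum_neg_distrib, ← Finset.sum_add_distrib]
  refine Finset.sum_congr rfl fun c _ => ?_
  rw [← Finset.sum_neg_distrib, ← Finset.sum_neg_distrib, ← Finset.sum_add_distrib]
  refine Finset.sum_congr rfl fun e _ => ?_
  rw [hA c e]
  simp only [map_mul, map_sub, map_neg]
  module

theorem eq_algebraMap_of_stdI_eq_zero {α : ExteriorAlgebra 𝕜 (Fin n → 𝕜)}
    (h : ∀ a, stdI 𝕜 a α = 0) : ∃ r : 𝕜, α = algebraMap 𝕜 _ r := by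
  classical
  set N : ExteriorAlgebra 𝕜 (Fin n → 𝕜) →ₗ[𝕜] ExteriorAlgebra 𝕜 (Fin n → 𝕜) :=
    ∑ a, (LinearMap.mulLeft 𝕜 (stdE 𝕜 a)).comp (stdI 𝕜 a) with hN
  have hNp : ∀ p, ∀ β ∈ ⋀[𝕜]^p (Fin n → 𝕜), N β = (p : 𝕜) • β := fun p β hβ => by
    simpa [hN, LinearMap.sum_apply, stdE, stdI] using sum_ι_mul_contractLeft (sum_stdD_smul 𝕜) hβ
  set 𝒜 : ℕ → Submodule 𝕜 (ExteriorAlgebra 𝕜 (Fin n → 𝕜)) := fun p => ⋀[𝕜]^p (Fin n → 𝕜)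
  have hdec : ∀ p, ((DirectSum.decompose 𝒜 (N α)) p : ExteriorAlgebra 𝕜 (Fin n → 𝕜))
      = (p : 𝕜) • (DirectSum.decompose 𝒜 α p : ExteriorAlgebra 𝕜 (Fin n → 𝕜)) := by
    intro p
    have e : ∀ β, ((DirectSum.decompose 𝒜 (N β)) p : ExteriorAlgebra 𝕜 (Fin n → 𝕜))
      = (p : 𝕜) • (DirectSum.decompose 𝒜 β p : ExteriorAlgebra 𝕜 (Fin n → 𝕜)) := by
      intro β
      induction β using DirectSum.Decomposition.inductionOn 𝒜 with
      | zero => simp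
      | homogeneous m =>
        rename_i q
        rw [hNp q m.1 m.2, DirectSum.decompose_smul, DirectSum.smul_apply, Submodule.coe_smul]
        by_cases hpq : q = p
        · subst hpq; rfl
        · rw [DirectSum.decompose_of_mem_ne 𝒜 m.2 hpq, smul_zero, smul_zero]
      | add x y hx hy =>
        rw [map_add, DirectSum.decompose_add, DirectSum.decompose_add, DirectSum.add_apply,
          DirectSum.add_apply, Submodule.coe_add, Submodule.coe_add, hx, hy, smul_add]
    exact e α
  have hzero : N α = 0 := by simp [hN, LinearMap.sum_apply, h]
  have hp : ∀ p, p ≠ 0 → (DirectSum.decompose 𝒜 α p : ExteriorAlgebra 𝕜 (Fin n → 𝕜)) = 0 := by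
    intro p hp
    have := hdec p
    rw [hzero, DirectSum.decompose_zero] at this
    exact (smul_eq_zero.1 this.symm).resolve_left (Nat.cast_ne_zero.2 hp)
  have hα : α = (DirectSum.decompose 𝒜 α 0 : ExteriorAlgebra 𝕜 (Fin n → 𝕜)) := by
    conv_lhs => rw [← DirectSum.sum_support_decompose 𝒜 α]
    by_cases h0 : 0 ∈ (DirectSum.decompose 𝒜 α).support
    · exact Finset.sum_eq_single_of_mem 0 h0 fun p _ h => hp p h
    · rw [Finset.sum_eq_zero fun p hps => hp p (fun e => h0 (e ▸ hps))]
      rw [DFinsupp.notMem_support_iff.1 h0]; rfl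
  rw [hα]
  exact exteriorPower_zero_induction (motive := fun β => ∃ r : 𝕜, β = algebraMap 𝕜 _ r)
    (fun c => ⟨c, rfl⟩) (DirectSum.decompose 𝒜 α 0).2

/-- An even element that commutes with all vectors is a scalar. -/
theorem eq_algebraMap_of_commute (hη : ∀ a, η a ≠ 0) {z : CliffordAlgebra (quadForm 𝕜 η)}
    (hz : CliffordAlgebra.involute z = z)
    (h : ∀ a, cliffE 𝕜 η a * z = z * cliffE 𝕜 η a) : ∃ r : 𝕜, z = algebraMap 𝕜 _ r := by
  obtain ⟨α, rfl⟩ := (quantize η).surjective z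
  obtain ⟨r, hr⟩ := eq_algebraMap_of_stdI_eq_zero (α := α) fun a => by
    have h1 := ι_mul_sub_involute_mul_ι (Q := quadForm 𝕜 η) (Pi.single a 1) (quantize η α)
    rw [contractLeft_polarBilin, hz] at h1
    have h2 := h a
    rw [cliffE] at h2
    rw [h2, sub_self] at h1
    have h3 := (smul_eq_zero.1 h1.symm).resolve_left (mul_ne_zero two_ne_zero (by simpa using hη a))
    exact (quantize η).injective (by rw [h3, map_zero])
  exact ⟨r, by rw [hr, quantize_algebraMap]⟩

theorem involute_spinElement : CliffordAlgebra.involute (spinElement 𝕜 η A) = spinElement 𝕜 η A := by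
  simp only [spinElement, cliffE, map_sum, map_smul, map_mul, CliffordAlgebra.involute_ι,
    neg_mul_neg]

theorem reverse_spinElement (hA : ∀ b c, A b c = -A c b) :
    CliffordAlgebra.reverse (spinElement 𝕜 η A) = -spinElement 𝕜 η A := by
  simp only [spinElement, cliffE, map_sum, map_smul, CliffordAlgebra.reverse.map_mul,
    CliffordAlgebra.reverse_ι]
  rw [Finset.sum_comm, ← smul_neg]
  simp only [← Finset.sum_neg_distrib]
  congr 1
  refine Finset.sum_congr rfl fun b _ => Finset.sum_congr rfl fun c _ => ?_
  rw [hA c b, map_neg, neg_smul]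

theorem cliffordOfReal_ι (v : Fin n → ℝ) :
    cliffordOfReal 𝕜 η (CliffordAlgebra.ι _ v)
      = CliffordAlgebra.ι (quadForm 𝕜 η) (fun a => algebraMap ℝ 𝕜 (v a)) := by
  rw [cliffordOfReal, CliffordAlgebra.lift_ι_apply]; rfl

theorem involute_cliffordOfReal (z : CliffordAlgebra (quadForm ℝ η)) :
    CliffordAlgebra.involute (cliffordOfReal 𝕜 η z)
      = cliffordOfReal 𝕜 η (CliffordAlgebra.involute z) := by
  induction z using CliffordAlgebra.left_induction with
  | algebraMap r =>
    rw [AlgHom.commutes, AlgHom.commutes,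
      IsScalarTower.algebraMap_apply ℝ 𝕜 (CliffordAlgebra (quadForm 𝕜 η)), AlgHom.commutes, AlgHom.commutes,
      ← IsScalarTower.algebraMap_apply]
  | add x y hx hy => simp only [map_add, hx, hy]
  | ι_mul x v hx =>
    simp only [map_mul, cliffordOfReal_ι, CliffordAlgebra.involute_ι, hx, map_neg]

theorem reverse_cliffordOfReal (z : CliffordAlgebra (quadForm ℝ η)) :
    CliffordAlgebra.reverse (cliffordOfReal 𝕜 η z)
      = cliffordOfReal 𝕜 η (CliffordAlgebra.reverse z) := by
  induction z using CliffordAlgebra.left_induction with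
  | algebraMap r =>
    rw [CliffordAlgebra.reverse.commutes, AlgHom.commutes,
      IsScalarTower.algebraMap_apply ℝ 𝕜 (CliffordAlgebra (quadForm 𝕜 η)),
      CliffordAlgebra.reverse.commutes, ← IsScalarTower.algebraMap_apply]
  | add x y hx hy => simp only [map_add, hx, hy]
  | ι_mul x v hx =>
    simp only [map_mul, cliffordOfReal_ι, CliffordAlgebra.reverse.map_mul,
      CliffordAlgebra.reverse_ι, hx]

end ModelClifford

end

section

/-- The basis of the Clifford algebra that corresponds to the basis of the exterior algebra. -/
def cliffordBasis (𝕜 : Type*) [RCLike 𝕜] {n : ℕ} (η : Fin n → ℝ) :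
    Module.Basis (Finset (Fin n)) 𝕜 (CliffordAlgebra (quadForm 𝕜 η)) :=
  (formBasis 𝕜 n).map (quantize η)

theorem quantize_ι_mul_eq {𝕜 : Type*} [RCLike 𝕜] {n : ℕ} {η : Fin n → ℝ} (u : Fin n → 𝕜)
    (α : ExteriorAlgebra 𝕜 (Fin n → 𝕜)) :
    quantize η (ExteriorAlgebra.ι 𝕜 u * α) = (1 / 2 : 𝕜) • (CliffordAlgebra.ι _ u * quantize η α
      + CliffordAlgebra.involute (quantize η α) * CliffordAlgebra.ι _ u) := by
  rw [quantize_ι_mul, ← ι_mul_sub_involute_mul_ι]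
  module

namespace SpinStructure

variable {n : ℕ} {M : Type*} [TopologicalSpace M] [ChartedSpace (Model n) M]
  [IsManifold 𝓘(ℝ, Model n) ∞ M] {g : PseudoRiemannianMetric n M} {η : Fin n → ℝ} {ι : Type*}
  (S : SpinStructure g η ι) {i j : ι} {x : M} (𝕜 : Type*) [RCLike 𝕜]

section Lift

/-- The transition element of the spin group in the Clifford algebra with scalars `𝕜`. -/
def transition (i j : ι) (x : M) : CliffordAlgebra (quadForm 𝕜 η) :=
  cliffordOfReal 𝕜 η (S.lift i j x)

/-- The inverse of the transition element. -/
def transitionInv (i j : ι) (x : M) : CliffordAlgebra (quadForm 𝕜 η) :=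
  CliffordAlgebra.reverse (S.transition 𝕜 i j x)

theorem involute_transition (hi : x ∈ S.baseSet i) (hj : x ∈ S.baseSet j) :
    CliffordAlgebra.involute (S.transition 𝕜 i j x) = S.transition 𝕜 i j x := by
  rw [transition, involute_cliffordOfReal,
    CliffordAlgebra.involute_eq_of_mem_even (spinGroup.mem_even (S.lift_mem i j x ⟨hi, hj⟩))]

theorem star_lift (hi : x ∈ S.baseSet i) (hj : x ∈ S.baseSet j) :
    star (S.lift i j x) = CliffordAlgebra.reverse (S.lift i j x) := by
  rw [CliffordAlgebra.star_def, CliffordAlgebra.involute_eq_of_mem_even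
    (spinGroup.mem_even (S.lift_mem i j x ⟨hi, hj⟩))]

theorem transitionInv_mul (hi : x ∈ S.baseSet i) (hj : x ∈ S.baseSet j) :
    S.transitionInv 𝕜 i j x * S.transition 𝕜 i j x = 1 := by
  rw [transitionInv, transition, reverse_cliffordOfReal, ← S.star_lift hi hj, ← map_mul,
    spinGroup.star_mul_self_of_mem (S.lift_mem i j x ⟨hi, hj⟩), map_one]

theorem mul_transitionInv (hi : x ∈ S.baseSet i) (hj : x ∈ S.baseSet j) :
    S.transition 𝕜 i j x * S.transitionInv 𝕜 i j x = 1 := by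
  rw [transitionInv, transition, reverse_cliffordOfReal, ← S.star_lift hi hj, ← map_mul,
    spinGroup.mul_star_self_of_mem (S.lift_mem i j x ⟨hi, hj⟩), map_one]

theorem transition_mul {k : ι} (hi : x ∈ S.baseSet i) (hj : x ∈ S.baseSet j)
    (hk : x ∈ S.baseSet k) :
    S.transition 𝕜 i j x * S.transition 𝕜 j k x = S.transition 𝕜 i k x := by
  rw [transition, transition, transition, ← map_mul, S.lift_cocycle i j k x ⟨⟨hi, hj⟩, hk⟩]

theorem transition_self (hi : x ∈ S.baseSet i) : S.transition 𝕜 i i x = 1 := by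
  have h := congrArg (fun z => S.transitionInv 𝕜 i i x * z) (S.transition_mul 𝕜 hi hi hi)
  simpa only [← mul_assoc, S.transitionInv_mul 𝕜 hi hi, one_mul] using h

theorem ι_mul_transition (hi : x ∈ S.baseSet i) (hj : x ∈ S.baseSet j)
    (α : TangentSpace 𝓘(ℝ, Model n) x →ₗ[ℝ] ℝ) :
    CliffordAlgebra.ι (quadForm 𝕜 η) (fun a => algebraMap ℝ 𝕜 (α (S.frame i a x)))
        * S.transition 𝕜 i j x
      = S.transition 𝕜 i j x *
        CliffordAlgebra.ι (quadForm 𝕜 η) (fun a => algebraMap ℝ 𝕜 (α (S.frame j a x))) := by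
  have h := congrArg (cliffordOfReal 𝕜 η) (S.lift_frame i j x ⟨hi, hj⟩ α)
  simpa only [map_mul, cliffordOfReal_ι, transition] using h

theorem sum_cliffE_mul_transition (hi : x ∈ S.baseSet i) (hj : x ∈ S.baseSet j) (b : Fin n) :
    (∑ a, (algebraMap ℝ 𝕜 (g.val x (S.frame i a x) (S.frame j b x))) • cliffE 𝕜 η a)
        * S.transition 𝕜 i j x
      = (algebraMap ℝ 𝕜 (η b)) • (S.transition 𝕜 i j x * cliffE 𝕜 η b) := by
  have h := S.ι_mul_transition 𝕜 hi hj (g.val x (S.frame j b x)).toLinearMap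
  rw [ι_eq_sum_cliffE, ι_eq_sum_cliffE] at h
  simp only [ContinuousLinearMap.coe_coe, S.orthonormal j x hj] at h
  simp only [g.symm x _ (S.frame j b x)]
  rw [h, Finset.sum_eq_single b]
  · rw [if_pos rfl, mul_smul_comm]
  · intro c _ hc; rw [if_neg (Ne.symm hc), map_zero, zero_smul]
  · simp

theorem sum_metric_mul_metric (hi : x ∈ S.baseSet i) (hj : x ∈ S.baseSet j) (a c : Fin n) :
    ∑ b, η b * (g.val x (S.frame i a x) (S.frame j b x) * g.val x (S.frame i c x) (S.frame j b x))
      = if a = c then η a else 0 := by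
  rw [← S.orthonormal i x hi a c, S.metric_eq_sum_comp hj]
  refine Finset.sum_congr rfl fun b _ => ?_
  simp only [comp]
  linear_combination (-η b * g.val x (S.frame i a x) (S.frame j b x) *
    g.val x (S.frame i c x) (S.frame j b x)) * S.sign_mul_self b

theorem smooth_transition (i j : ι) :
    CoordSmoothOn (n := n) (cliffordBasis 𝕜 η) (S.transition 𝕜 i j) (S.baseSet i ∩ S.baseSet j) := by
  intro k
  set L : CliffordAlgebra (quadForm ℝ η) →ₗ[ℝ] 𝕜 :=
    (((cliffordBasis 𝕜 η).coord k).restrictScalars ℝ).comp (cliffordOfReal 𝕜 η).toLinearMap with hL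
  have h1 := S.smooth_lift i j (RCLike.reLm.comp L)
  have h2 := S.smooth_lift i j (RCLike.imLm.comp L)
  have h3 : SmoothOn (n := n) (fun y => algebraMap ℝ 𝕜 (RCLike.re (L (S.lift i j y))))
      (S.baseSet i ∩ S.baseSet j) :=
    SmoothOn.clm (Algebra.linearMap ℝ 𝕜).toContinuousLinearMap h1
  have h4 : SmoothOn (n := n) (fun y => algebraMap ℝ 𝕜 (RCLike.im (L (S.lift i j y))))
      (S.baseSet i ∩ S.baseSet j) :=
    SmoothOn.clm (Algebra.linearMap ℝ 𝕜).toContinuousLinearMap h2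
  refine (SmoothOn.add' h3 (SmoothOn.mul' h4 (contMDiffOn_const (c := (RCLike.I : 𝕜))))).congr ?_
  intro y _
  exact (RCLike.re_add_im (L (S.lift i j y))).symm

/-- The connection element `(1/4) ∑ g(∇_v X_b, X_c) e_c e_b` of the Clifford algebra. -/
def connElement (i : ι) {x : M} (v : TangentSpace 𝓘(ℝ, Model n) x) :
    CliffordAlgebra (quadForm 𝕜 η) :=
  spinElement 𝕜 η (fun b c => S.connAlong i v b c)

theorem sum_dirDeriv_transition (hi : x ∈ S.baseSet i) (hj : x ∈ S.baseSet j) (b : Fin n)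
    (v : TangentSpace 𝓘(ℝ, Model n) x) :
    ∑ a, (algebraMap ℝ 𝕜 (dirDeriv (fun y => g.val y (S.frame i a y) (S.frame j b y)) x v)) •
        cliffE 𝕜 η a * S.transition 𝕜 i j x
      = -((S.connElement 𝕜 i v *
          (∑ a, (algebraMap ℝ 𝕜 (g.val x (S.frame i a x) (S.frame j b x))) • cliffE 𝕜 η a)
        - (∑ a, (algebraMap ℝ 𝕜 (g.val x (S.frame i a x) (S.frame j b x))) • cliffE 𝕜 η a)
          * S.connElement 𝕜 i v) * S.transition 𝕜 i j x)
        + (algebraMap ℝ 𝕜 (η b)) • (S.transition 𝕜 i j x *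
          (S.connElement 𝕜 j v * cliffE 𝕜 η b - cliffE 𝕜 η b * S.connElement 𝕜 j v)) := by
  have h1 : S.connElement 𝕜 i v *
      (∑ a, (algebraMap ℝ 𝕜 (g.val x (S.frame i a x) (S.frame j b x))) • cliffE 𝕜 η a)
        - (∑ a, (algebraMap ℝ 𝕜 (g.val x (S.frame i a x) (S.frame j b x))) • cliffE 𝕜 η a)
          * S.connElement 𝕜 i v
      = -∑ a, ∑ c, (algebraMap ℝ 𝕜 (η c * S.connAlong i v a c *
          g.val x (S.frame i c x) (S.frame j b x))) • cliffE 𝕜 η a := by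
    rw [Finset.sum_comm]
    simp only [Finset.mul_sum, Finset.sum_mul, mul_smul_comm, smul_mul_assoc,
      ← Finset.sum_sub_distrib, ← smul_sub]
    rw [← Finset.sum_neg_distrib]
    refine Finset.sum_congr rfl fun c _ => ?_
    rw [connElement, spinElement_cliffE (S.connAlong_swap v), smul_neg, Finset.smul_sum]
    congr 1
    refine Finset.sum_congr rfl fun a _ => ?_
    rw [smul_smul, ← map_mul]
    congr 2; ring
  have h2 : S.connElement 𝕜 j v * cliffE 𝕜 η b - cliffE 𝕜 η b * S.connElement 𝕜 j v
      = ∑ c, (algebraMap ℝ 𝕜 (η b * S.connAlong j v b c)) • cliffE 𝕜 η c := by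
    rw [connElement, spinElement_cliffE (S.connAlong_swap v), ← Finset.sum_neg_distrib]
    refine Finset.sum_congr rfl fun c _ => ?_
    rw [S.connAlong_swap v c b, mul_neg, map_neg, neg_smul, neg_neg]
  have h3 : (algebraMap ℝ 𝕜 (η b)) • (S.transition 𝕜 i j x *
      ∑ c, (algebraMap ℝ 𝕜 (η b * S.connAlong j v b c)) • cliffE 𝕜 η c)
      = (∑ a, ∑ c, (algebraMap ℝ 𝕜 (η c * S.connAlong j v b c *
          g.val x (S.frame i a x) (S.frame j c x))) • cliffE 𝕜 η a) * S.transition 𝕜 i j x := by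
    rw [Finset.sum_comm, Finset.mul_sum, Finset.smul_sum, Finset.sum_mul]
    refine Finset.sum_congr rfl fun c _ => ?_
    have h := S.sum_cliffE_mul_transition 𝕜 hi hj c
    have e : ∑ a, (algebraMap ℝ 𝕜 (η c * S.connAlong j v b c *
          g.val x (S.frame i a x) (S.frame j c x))) • cliffE 𝕜 η a
        = (algebraMap ℝ 𝕜 (η c * S.connAlong j v b c)) •
          ∑ a, (algebraMap ℝ 𝕜 (g.val x (S.frame i a x) (S.frame j c x))) • cliffE 𝕜 η a := by
      simp only [Finset.smul_sum, smul_smul, ← map_mul]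
    rw [e, smul_mul_assoc, h, smul_smul, ← map_mul, mul_smul_comm, smul_smul, ← map_mul]
    congr 2
    linear_combination S.connAlong j v b c * (S.sign_mul_self b - S.sign_mul_self c)
  rw [h1, h2, h3, neg_mul, neg_neg, ← add_mul, ← Finset.sum_mul, ← Finset.sum_add_distrib]
  congr 1
  refine Finset.sum_congr rfl fun a _ => ?_
  rw [S.dirDeriv_transition hi hj, map_add, map_sum, map_sum, add_smul, Finset.sum_smul,
    Finset.sum_smul]

/-- The change of the connection element under a change of the spin frame. -/
theorem coordDeriv_transition (hi : x ∈ S.baseSet i) (hj : x ∈ S.baseSet j)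
    (v : TangentSpace 𝓘(ℝ, Model n) x) :
    coordDeriv (cliffordBasis 𝕜 η) (S.transition 𝕜 i j) x v
      = S.transition 𝕜 i j x * S.connElement 𝕜 j v
        - S.connElement 𝕜 i v * S.transition 𝕜 i j x := by
  set U := S.baseSet i ∩ S.baseSet j with hUdef
  have hU : IsOpen U := (S.isOpen_baseSet i).inter (S.isOpen_baseSet j)
  have hx : x ∈ U := ⟨hi, hj⟩
  have hs := S.smooth_transition 𝕜 i j
  set l := S.transition 𝕜 i j x with hl
  set m := S.transitionInv 𝕜 i j x with hm
  have hml : m * l = 1 := S.transitionInv_mul 𝕜 hi hj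
  have hlm : l * m = 1 := S.mul_transitionInv 𝕜 hi hj
  set Dl := coordDeriv (cliffordBasis 𝕜 η) (S.transition 𝕜 i j) x v with hDl
  set Gi := S.connElement 𝕜 i v with hGi
  set Gj := S.connElement 𝕜 j v with hGj
  set E : Fin n → CliffordAlgebra (quadForm 𝕜 η) := fun b =>
    ∑ a, (algebraMap ℝ 𝕜 (g.val x (S.frame i a x) (S.frame j b x))) • cliffE 𝕜 η a with hE
  have hEl : ∀ b, E b * l = (algebraMap ℝ 𝕜 (η b)) • (l * cliffE 𝕜 η b) := fun b =>
    S.sum_cliffE_mul_transition 𝕜 hi hj b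
  have hEm : ∀ b, m * E b = (algebraMap ℝ 𝕜 (η b)) • (cliffE 𝕜 η b * m) := by
    intro b
    have h := congrArg (fun z => m * z * m) (hEl b)
    simp only [mul_smul_comm, smul_mul_assoc] at h
    rwa [mul_assoc, mul_assoc, hlm, mul_one, ← mul_assoc m l, hml, one_mul] at h
  have hQ : ∀ a b, SmoothOn (n := n) (fun y => g.val y (S.frame i a y) (S.frame j b y)) U :=
    fun a b => S.smoothOn_metric ((S.smooth_frame i a).mono Set.inter_subset_left)
      ((S.smooth_frame j b).mono Set.inter_subset_right)
  set z := Dl + Gi * l - l * Gj with hz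
  have hEz : ∀ b, E b * z = (algebraMap ℝ 𝕜 (η b)) • (z * cliffE 𝕜 η b) := by
    intro b
    have hcE : ∀ a, CoordSmoothOn (n := n) (cliffordBasis 𝕜 η)
        (fun y => cliffE 𝕜 η a * S.transition 𝕜 i j y) U := fun a =>
      CoordSmoothOn.linear (LinearMap.mulLeft 𝕜 (cliffE 𝕜 η a)) hs
    have h1 := coordDeriv_congr (b₁ := cliffordBasis 𝕜 η) (v := v) hU hx
      (fun y (hy : y ∈ U) => S.sum_cliffE_mul_transition 𝕜 hy.1 hy.2 b)
    have h2 := coordDeriv_linear (b₁ := cliffordBasis 𝕜 η) (b₂ := cliffordBasis 𝕜 η) (v := v)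
      ((algebraMap ℝ 𝕜 (η b)) • LinearMap.mulRight 𝕜 (cliffE 𝕜 η b)) hU hx hs
    have h3 : ∀ a, coordDeriv (cliffordBasis 𝕜 η)
        (fun y => cliffE 𝕜 η a * S.transition 𝕜 i j y) x v = cliffE 𝕜 η a * Dl := fun a =>
      coordDeriv_linear (LinearMap.mulLeft 𝕜 (cliffE 𝕜 η a)) hU hx hs
    simp only [LinearMap.smul_apply, LinearMap.mulRight_apply] at h2
    rw [h2] at h1
    simp only [Finset.sum_mul, smul_mul_assoc] at h1
    rw [coordDeriv_sum _ hU hx (fun a => coordSmoothOn_smul (hQ a b) (hcE a))] at h1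
    simp only [fun a => coordDeriv_smul (b₁ := cliffordBasis 𝕜 η) (v := v) hU hx (hQ a b) (hcE a),
      h3, Finset.sum_add_distrib] at h1
    have h4 := S.sum_dirDeriv_transition 𝕜 hi hj b v
    simp only [smul_mul_assoc] at h4
    rw [h4] at h1
    have h5 : ∑ a, (algebraMap ℝ 𝕜 (g.val x (S.frame i a x) (S.frame j b x))) •
        (cliffE 𝕜 η a * Dl) = E b * Dl := by
      simp only [hE, Finset.sum_mul, smul_mul_assoc]
    rw [h5] at h1
    change -((Gi * E b - E b * Gi) * l) + (algebraMap ℝ 𝕜 (η b)) • (l * (Gj * cliffE 𝕜 η b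
      - cliffE 𝕜 η b * Gj)) + E b * Dl = (algebraMap ℝ 𝕜 (η b)) • (Dl * cliffE 𝕜 η b) at h1
    have h6 : Gi * E b * l = (algebraMap ℝ 𝕜 (η b)) • (Gi * l * cliffE 𝕜 η b) := by
      rw [mul_assoc, hEl, mul_smul_comm, mul_assoc]
    have h7 : E b * l * Gj = (algebraMap ℝ 𝕜 (η b)) • (l * cliffE 𝕜 η b * Gj) := by
      rw [hEl, smul_mul_assoc]
    rw [hz]
    simp only [mul_add, mul_sub, add_mul, sub_mul, smul_add, smul_sub, ← mul_assoc, neg_sub] at h1 ⊢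
    rw [h6] at h1
    rw [h7]
    linear_combination (norm := module) h1
  have hcomm : ∀ a, cliffE 𝕜 η a * (z * m) = z * m * cliffE 𝕜 η a := by
    have hE' : ∀ b, E b * (z * m) = z * m * E b := by
      intro b
      rw [← mul_assoc, hEz, mul_assoc z m, hEm, smul_mul_assoc, mul_smul_comm, mul_assoc]
    have hc : ∀ a, cliffE 𝕜 η a = ∑ b, (algebraMap ℝ 𝕜 (η a * η b *
        g.val x (S.frame i a x) (S.frame j b x))) • E b := by
      intro a
      simp only [hE, Finset.smul_sum, smul_smul, ← map_mul]
      rw [Finset.sum_comm]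
      simp only [← Finset.sum_smul, ← map_sum]
      have e : ∀ c, ∑ b, η a * η b * g.val x (S.frame i a x) (S.frame j b x) *
          g.val x (S.frame i c x) (S.frame j b x) = if a = c then 1 else 0 := by
        intro c
        have h := S.sum_metric_mul_metric hi hj a c
        have h' := congrArg (fun r => η a * r) h
        simp only [Finset.mul_sum, mul_ite, S.sign_mul_self, mul_zero] at h'
        rw [← h']
        exact Finset.sum_congr rfl fun b _ => by ring
      simp only [e]
      rw [Finset.sum_eq_single a]
      · simp
      · intro c _ hc; simp [Ne.symm hc]
      · simp
    intro a
    rw [hc a, Finset.sum_mul, Finset.mul_sum]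
    exact Finset.sum_congr rfl fun b _ => by rw [smul_mul_assoc, hE', mul_smul_comm]
  have invl : CliffordAlgebra.involute l = l := S.involute_transition 𝕜 hi hj
  have invDl : CliffordAlgebra.involute Dl = Dl := by
    have h := coordDeriv_linear (b₁ := cliffordBasis 𝕜 η) (b₂ := cliffordBasis 𝕜 η) (v := v)
      (CliffordAlgebra.involute (Q := quadForm 𝕜 η)).toLinearMap hU hx hs
    have h' := coordDeriv_congr (b₁ := cliffordBasis 𝕜 η) (v := v) hU hx
      (fun y (hy : y ∈ U) => S.involute_transition 𝕜 hy.1 hy.2)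
    exact h.symm.trans h'
  have revDl : CliffordAlgebra.reverse Dl * l + m * Dl = 0 := by
    have h := coordDeriv_linear (b₁ := cliffordBasis 𝕜 η) (b₂ := cliffordBasis 𝕜 η) (v := v)
      (CliffordAlgebra.reverse (Q := quadForm 𝕜 η)) hU hx hs
    have h1 := coordDeriv_bilinear (b₁ := cliffordBasis 𝕜 η) (b₂ := cliffordBasis 𝕜 η)
      (b₃ := cliffordBasis 𝕜 η) (v := v) (LinearMap.mul 𝕜 (CliffordAlgebra (quadForm 𝕜 η)))
      hU hx (CoordSmoothOn.linear (CliffordAlgebra.reverse (Q := quadForm 𝕜 η)) hs) hs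
    have h2 := coordDeriv_congr (b₁ := cliffordBasis 𝕜 η) (v := v) (f' := fun _ => 1) hU hx
      (fun y (hy : y ∈ U) => S.transitionInv_mul 𝕜 hy.1 hy.2)
    rw [coordDeriv_const] at h2
    rw [h] at h1
    exact h1.symm.trans h2
  have invm : CliffordAlgebra.involute m = m := by
    rw [hm, transitionInv, ← hl, ← CliffordAlgebra.reverse_involute, invl]
  obtain ⟨r, hr⟩ := eq_algebraMap_of_commute (S.sign_ne_zero) (z := z * m) (by
    rw [hz]
    simp only [map_mul, map_sub, map_add, invl, invDl, invm, hGi, hGj, connElement,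
      involute_spinElement]) hcomm
  have hzr : z = r • l := by
    have h := congrArg (fun w => w * l) hr
    simpa only [mul_assoc, hml, mul_one, Algebra.algebraMap_eq_smul_one, smul_mul_assoc, one_mul]
      using h
  have hD : Dl = r • l - Gi * l + l * Gj := by rw [← hzr, hz]; abel
  have hr0 : (2 * r) • (1 : CliffordAlgebra (quadForm 𝕜 η)) = 0 := by
    rw [hD] at revDl
    have gi : CliffordAlgebra.reverse Gi = -Gi := reverse_spinElement (S.connAlong_swap v)
    have gj : CliffordAlgebra.reverse Gj = -Gj := reverse_spinElement (S.connAlong_swap v)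
    have rl : CliffordAlgebra.reverse l = m := rfl
    simp only [map_add, map_sub, map_smul, CliffordAlgebra.reverse.map_mul, gi, gj, rl] at revDl
    simp only [add_mul, sub_mul, mul_add, mul_sub, smul_mul_assoc, mul_smul_comm, neg_mul, mul_neg,
      hml, mul_assoc, mul_one] at revDl
    rw [← mul_assoc m l, hml, one_mul] at revDl
    linear_combination (norm := module) revDl
  have : r = 0 := by
    have h := (smul_eq_zero.1 hr0).resolve_right (fun h => by
      have h' := congrArg (quantize η).symm h
      rw [← quantize_one, LinearEquiv.symm_apply_apply, map_zero] at h'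
      exact one_ne_zero h')
    simpa using h
  rw [hD, this, zero_smul]
  abel

end Lift

end SpinStructure

end

section

namespace SpinStructure

variable {n : ℕ} {M : Type*} [TopologicalSpace M] [ChartedSpace (Model n) M]
  [IsManifold 𝓘(ℝ, Model n) ∞ M] {g : PseudoRiemannianMetric n M} {η : Fin n → ℝ} {ι : Type*}
  (S : SpinStructure g η ι) {i j : ι} {x : M} {𝕜 : Type*} [RCLike 𝕜]

section FormGauge

theorem covector_mul_transition (hi : x ∈ S.baseSet i) (hj : x ∈ S.baseSet j)
    (α : Covector 𝕜 n x) :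
    CliffordAlgebra.ι (quadForm 𝕜 η) (fun a => α (S.frame i a x)) * S.transition 𝕜 i j x
      = S.transition 𝕜 i j x * CliffordAlgebra.ι (quadForm 𝕜 η) (fun a => α (S.frame j a x)) := by
  have h1 : ∀ a, α (S.frame i a x) = ∑ b, algebraMap ℝ 𝕜 (η b) * α (S.frame j b x) *
      algebraMap ℝ 𝕜 (g.val x (S.frame i a x) (S.frame j b x)) := by
    intro a
    conv_lhs => rw [← S.sum_comp_smul_frame hj (S.frame i a x), map_sum]
    refine Finset.sum_congr rfl fun b _ => ?_
    rw [map_smul, Algebra.smul_def, comp, map_mul]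
    ring
  rw [ι_eq_sum_cliffE, ι_eq_sum_cliffE]
  simp only [h1, Finset.sum_smul]
  rw [Finset.sum_comm, Finset.sum_mul, Finset.mul_sum]
  refine Finset.sum_congr rfl fun b _ => ?_
  have h := S.sum_cliffE_mul_transition 𝕜 hi hj b
  simp only [mul_smul]
  rw [← Finset.smul_sum, ← Finset.smul_sum, smul_mul_assoc, smul_mul_assoc, h, smul_comm,
    smul_smul, smul_smul, mul_assoc, ← map_mul, S.sign_mul_self, map_one, mul_one, mul_smul_comm]

/-- The components of a form in two frames are conjugate under the transition element. -/
theorem quantize_toFrame_mul_transition (hi : x ∈ S.baseSet i) (hj : x ∈ S.baseSet j)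
    (α : FormAt 𝕜 n x) :
    quantize η (S.toFrame i x α) * S.transition 𝕜 i j x
      = S.transition 𝕜 i j x * quantize η (S.toFrame j x α) := by
  induction α using CliffordAlgebra.left_induction with
  | algebraMap r =>
    have h : ∀ k, S.toFrame k x (algebraMap 𝕜 _ r) = algebraMap 𝕜 _ r := fun k =>
      AlgHom.commutes _ _
    rw [h, h, quantize_algebraMap, Algebra.commutes]
  | add y z hy hz => simp only [map_add, add_mul, mul_add, hy, hz]
  | ι_mul y v hy =>
    have h : ∀ k, S.toFrame k x (CliffordAlgebra.ι 0 v * y)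
        = ExteriorAlgebra.ι 𝕜 (fun a => v (S.frame k a x)) * S.toFrame k x y := by
      intro k
      rw [map_mul]
      congr 1
      exact ExteriorAlgebra.map_apply_ι _ _
    have hi' := congrArg CliffordAlgebra.involute hy
    rw [map_mul, map_mul, S.involute_transition 𝕜 hi hj] at hi'
    have hc := S.covector_mul_transition hi hj v
    rw [h, h, quantize_ι_mul_eq, quantize_ι_mul_eq, smul_mul_assoc, mul_smul_comm, add_mul, mul_add,
      mul_assoc, hy, ← mul_assoc, hc, mul_assoc, mul_assoc _ _ (S.transition 𝕜 i j x), hc,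
      ← mul_assoc _ (S.transition 𝕜 i j x), hi', mul_assoc]

/-- The covariant derivative in the frame `i` of the components of a form. -/
def covIn (i : ι) (W : M → ExteriorAlgebra 𝕜 (Fin n → 𝕜)) (x : M)
    (v : TangentSpace 𝓘(ℝ, Model n) x) : ExteriorAlgebra 𝕜 (Fin n → 𝕜) :=
  coordDeriv (formBasis 𝕜 n) W x v
    - ∑ b, ∑ c, (algebraMap ℝ 𝕜 (η c * S.connAlong i v b c)) • (stdE 𝕜 b * stdI 𝕜 c (W x))

theorem toFrame_nablaIn (hi : x ∈ S.baseSet i) (w : FormField 𝕜 n M)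
    (v : TangentSpace 𝓘(ℝ, Model n) x) :
    S.toFrame i x (S.nablaIn i w v) = S.covIn i (fun y => S.toFrame i y (w y)) x v := by
  rw [nablaIn, partialIn, map_sub, S.toFrame_ofFrame hi, covIn]
  congr 1
  simp only [map_sum, map_smul, map_mul, S.toFrame_coframe hi, S.toFrame_interior_frame]

theorem quantize_covIn {U : Set M} (hU : IsOpen U) (hx : x ∈ U)
    {W : M → ExteriorAlgebra 𝕜 (Fin n → 𝕜)} (hW : CoordSmoothOn (n := n) (formBasis 𝕜 n) W U)
    (v : TangentSpace 𝓘(ℝ, Model n) x) :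
    quantize η (S.covIn i W x v)
      = coordDeriv (cliffordBasis 𝕜 η) (fun y => quantize η (W y)) x v
        + (S.connElement 𝕜 i v * quantize η (W x) - quantize η (W x) * S.connElement 𝕜 i v) := by
  rw [covIn, map_sub, connElement, spinElement_commutator (S.connAlong_swap v), sub_eq_add_neg]
  congr 1
  exact (coordDeriv_linear (b₁ := formBasis 𝕜 n) (quantize η).toLinearMap hU hx hW).symm

theorem smooth_quantize {U : Set M} {W : M → ExteriorAlgebra 𝕜 (Fin n → 𝕜)}
    (hW : CoordSmoothOn (n := n) (formBasis 𝕜 n) W U) :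
    CoordSmoothOn (n := n) (cliffordBasis 𝕜 η) (fun y => quantize η (W y)) U :=
  CoordSmoothOn.linear (b₁ := formBasis 𝕜 n) (quantize η).toLinearMap hW

theorem quantize_covIn_mul_transition (hi : x ∈ S.baseSet i) (hj : x ∈ S.baseSet j)
    {w : FormField 𝕜 n M}
    (hw : ∀ k, CoordSmoothOn (n := n) (formBasis 𝕜 n) (fun y => S.toFrame k y (w y)) (S.baseSet k))
    (v : TangentSpace 𝓘(ℝ, Model n) x) :
    quantize η (S.covIn i (fun y => S.toFrame i y (w y)) x v) * S.transition 𝕜 i j x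
      = S.transition 𝕜 i j x * quantize η (S.covIn j (fun y => S.toFrame j y (w y)) x v) := by
  set U := S.baseSet i ∩ S.baseSet j with hUdef
  have hU : IsOpen U := (S.isOpen_baseSet i).inter (S.isOpen_baseSet j)
  have hx : x ∈ U := ⟨hi, hj⟩
  have hwi := (hw i).mono (V := U) Set.inter_subset_left
  have hwj := (hw j).mono (V := U) Set.inter_subset_right
  have hs := S.smooth_transition 𝕜 i j
  have h1 := coordDeriv_congr (b₁ := cliffordBasis 𝕜 η) (v := v) hU hx
    (fun y (hy : y ∈ U) => S.quantize_toFrame_mul_transition hy.1 hy.2 (w y))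
  have h2 := coordDeriv_bilinear (b₁ := cliffordBasis 𝕜 η) (b₂ := cliffordBasis 𝕜 η)
    (b₃ := cliffordBasis 𝕜 η) (v := v) (LinearMap.mul 𝕜 (CliffordAlgebra (quadForm 𝕜 η))) hU hx
    (smooth_quantize (η := η) hwi) hs
  have h3 := coordDeriv_bilinear (b₁ := cliffordBasis 𝕜 η) (b₂ := cliffordBasis 𝕜 η)
    (b₃ := cliffordBasis 𝕜 η) (v := v) (LinearMap.mul 𝕜 (CliffordAlgebra (quadForm 𝕜 η))) hU hx
    hs (smooth_quantize (η := η) hwj)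
  simp only [LinearMap.mul_apply'] at h2 h3
  rw [h2, h3, S.coordDeriv_transition 𝕜 hi hj] at h1
  have h4 := S.quantize_toFrame_mul_transition hi hj (w x)
  rw [S.quantize_covIn hU hx hwi, S.quantize_covIn hU hx hwj]
  simp only [add_mul, sub_mul, mul_add, mul_sub, mul_assoc] at h1 ⊢
  rw [h4]
  rw [← mul_assoc (quantize η (S.toFrame i x (w x))) (S.transition 𝕜 i j x), h4, mul_assoc] at h1
  linear_combination (norm := abel) h1

theorem nablaIn_eq (hi : x ∈ S.baseSet i) (hj : x ∈ S.baseSet j) {w : FormField 𝕜 n M}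
    (hw : ∀ k, CoordSmoothOn (n := n) (formBasis 𝕜 n) (fun y => S.toFrame k y (w y)) (S.baseSet k))
    (v : TangentSpace 𝓘(ℝ, Model n) x) : S.nablaIn i w v = S.nablaIn j w v := by
  refine S.toFrame_injective hj ((quantize η).injective ?_)
  have h1 := S.quantize_covIn_mul_transition hi hj hw v
  have h2 := S.quantize_toFrame_mul_transition hi hj (S.nablaIn i w v)
  rw [← S.toFrame_nablaIn hi, h2, ← S.toFrame_nablaIn hj] at h1
  have h3 := congrArg (fun z => S.transitionInv 𝕜 i j x * z) h1
  simpa only [← mul_assoc, S.transitionInv_mul 𝕜 hi hj, one_mul] using h3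

end FormGauge

section SpinorGauge

variable {Δ : Type*} [AddCommGroup Δ] [Module 𝕜 Δ] [FiniteDimensional 𝕜 Δ]
  (ρ : CliffordAlgebra (quadForm 𝕜 η) →ₐ[𝕜] Module.End 𝕜 Δ)

/-- The covariant derivative in the spin frame over the frame `i` of the components of a spinor. -/
def spinCovIn (i : ι) (f : M → Δ) (x : M) (v : TangentSpace 𝓘(ℝ, Model n) x) : Δ :=
  coordDeriv (Module.finBasis 𝕜 Δ) f x v + ρ (S.connElement 𝕜 i v) (f x)

theorem spinorIn_eq (hi : x ∈ S.baseSet i) (hj : x ∈ S.baseSet j) (ψ : S.SpinorField Δ) :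
    S.spinorIn ρ i ψ x = ρ (S.transition 𝕜 i j x) (S.spinorIn ρ j ψ x) := by
  have h := S.transition_mul 𝕜 hi hj (S.mem_baseSet_at x)
  rw [spinorIn, spinorIn, ← Module.End.mul_apply, ← map_mul]
  exact (congrArg (fun z => ρ z (ψ x)) h).symm

theorem spinorIn_indexAt (ψ : S.SpinorField Δ) : S.spinorIn ρ (S.indexAt x) ψ x = ψ x := by
  have h := S.transition_self 𝕜 (S.mem_baseSet_at x)
  rw [transition] at h
  rw [spinorIn, h, map_one, Module.End.one_apply]

theorem spinNabla_eq (ψ : S.SpinorField Δ) (v : TangentSpace 𝓘(ℝ, Model n) x) :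
    S.spinNabla ρ ψ v = S.spinCovIn ρ (S.indexAt x) (S.spinorIn ρ (S.indexAt x) ψ) x v := by
  rw [spinNabla, spinCovIn, S.spinorIn_indexAt, connElement, spinElement, map_smul, map_sum]
  congr 1
  simp only [map_sum, map_smul, map_mul, LinearMap.smul_apply, LinearMap.sum_apply,
    Module.End.mul_apply, cliffAt, S.toFrame_coframe (S.mem_baseSet_at x), quantize_stdE]

theorem smooth_rho {U : Set M} {L : M → CliffordAlgebra (quadForm 𝕜 η)} {f : M → Δ}
    (hL : CoordSmoothOn (n := n) (cliffordBasis 𝕜 η) L U)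
    (hf : CoordSmoothOn (n := n) (Module.finBasis 𝕜 Δ) f U) :
    CoordSmoothOn (n := n) (Module.finBasis 𝕜 Δ) (fun y => ρ (L y) (f y)) U :=
  CoordSmoothOn.bilinear (ρ.toLinearMap : _ →ₗ[𝕜] Δ →ₗ[𝕜] Δ) hL hf

theorem coordDeriv_rho {U : Set M} {L : M → CliffordAlgebra (quadForm 𝕜 η)} {f : M → Δ}
    (hU : IsOpen U) (hx : x ∈ U) (hL : CoordSmoothOn (n := n) (cliffordBasis 𝕜 η) L U)
    (hf : CoordSmoothOn (n := n) (Module.finBasis 𝕜 Δ) f U) (v : TangentSpace 𝓘(ℝ, Model n) x) :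
    coordDeriv (Module.finBasis 𝕜 Δ) (fun y => ρ (L y) (f y)) x v
      = ρ (coordDeriv (cliffordBasis 𝕜 η) L x v) (f x)
        + ρ (L x) (coordDeriv (Module.finBasis 𝕜 Δ) f x v) :=
  coordDeriv_bilinear (ρ.toLinearMap : _ →ₗ[𝕜] Δ →ₗ[𝕜] Δ) hU hx hL hf

theorem spinCovIn_eq (hi : x ∈ S.baseSet i) (hj : x ∈ S.baseSet j) {ψ : S.SpinorField Δ}
    (hψ : S.IsSmoothSpinor ρ ψ) (v : TangentSpace 𝓘(ℝ, Model n) x) :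
    S.spinCovIn ρ i (S.spinorIn ρ i ψ) x v
      = ρ (S.transition 𝕜 i j x) (S.spinCovIn ρ j (S.spinorIn ρ j ψ) x v) := by
  set U := S.baseSet i ∩ S.baseSet j with hUdef
  have hU : IsOpen U := (S.isOpen_baseSet i).inter (S.isOpen_baseSet j)
  have hx : x ∈ U := ⟨hi, hj⟩
  have h1 := coordDeriv_congr (b₁ := Module.finBasis 𝕜 Δ) (v := v) hU hx
    (fun y (hy : y ∈ U) => S.spinorIn_eq ρ hy.1 hy.2 ψ)
  rw [coordDeriv_rho ρ hU hx (S.smooth_transition 𝕜 i j) ((hψ j).mono Set.inter_subset_right),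
    S.coordDeriv_transition 𝕜 hi hj] at h1
  rw [spinCovIn, spinCovIn, h1, S.spinorIn_eq ρ hi hj ψ]
  simp only [map_sub, map_add, map_mul, LinearMap.sub_apply, Module.End.mul_apply]
  abel

/-- In the spin frame over any frame, the covariant derivative is the one of the components. -/
theorem transition_spinNabla (hi : x ∈ S.baseSet i) {ψ : S.SpinorField Δ}
    (hψ : S.IsSmoothSpinor ρ ψ) (v : TangentSpace 𝓘(ℝ, Model n) x) :
    ρ (S.transition 𝕜 i (S.indexAt x) x) (S.spinNabla ρ ψ v)
      = S.spinCovIn ρ i (S.spinorIn ρ i ψ) x v := by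
  rw [S.spinNabla_eq, S.spinCovIn_eq ρ hi (S.mem_baseSet_at x) hψ]

theorem transition_cliffAt (hi : x ∈ S.baseSet i) (α : FormAt 𝕜 n x) (ψ : Δ) :
    ρ (S.transition 𝕜 i (S.indexAt x) x) (S.cliffAt ρ α ψ)
      = ρ (quantize η (S.toFrame i x α)) (ρ (S.transition 𝕜 i (S.indexAt x) x) ψ) := by
  rw [cliffAt, ← Module.End.mul_apply, ← map_mul,
    ← S.quantize_toFrame_mul_transition hi (S.mem_baseSet_at x), map_mul, Module.End.mul_apply]

end SpinorGauge

end SpinStructure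

end

section

namespace SpinStructure

variable {n : ℕ} {M : Type*} [TopologicalSpace M] [ChartedSpace (Model n) M]
  [IsManifold 𝓘(ℝ, Model n) ∞ M] {g : PseudoRiemannianMetric n M} {η : Fin n → ℝ} {ι : Type*}
  (S : SpinStructure g η ι) {i j : ι} {x : M} {𝕜 : Type*} [RCLike 𝕜]

section Commutator

theorem smooth_spinElement {U : Set M} {A : Fin n → Fin n → M → ℝ}
    (hA : ∀ b c, SmoothOn (n := n) (A b c) U) :
    CoordSmoothOn (n := n) (cliffordBasis 𝕜 η) (fun y => spinElement 𝕜 η fun b c => A b c y) U := by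
  have h : CoordSmoothOn (n := n) (cliffordBasis 𝕜 η) (fun y => ∑ b, ∑ c,
      (algebraMap ℝ 𝕜 (A b c y)) • (cliffE 𝕜 η c * cliffE 𝕜 η b)) U :=
    CoordSmoothOn.sum Finset.univ fun b => CoordSmoothOn.sum Finset.univ fun c =>
      coordSmoothOn_smul (hA b c) (CoordSmoothOn.const _)
  exact CoordSmoothOn.linear (b₂ := cliffordBasis 𝕜 η)
    ((1 / 4 : 𝕜) • (LinearMap.id : CliffordAlgebra (quadForm 𝕜 η) →ₗ[𝕜] _)) h

theorem coordDeriv_spinElement {U : Set M} {A : Fin n → Fin n → M → ℝ} (hU : IsOpen U) (hx : x ∈ U)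
    (hA : ∀ b c, SmoothOn (n := n) (A b c) U) (v : TangentSpace 𝓘(ℝ, Model n) x) :
    coordDeriv (cliffordBasis 𝕜 η) (fun y => spinElement 𝕜 η fun b c => A b c y) x v
      = spinElement 𝕜 η fun b c => dirDeriv (A b c) x v := by
  have h1 : ∀ b c, CoordSmoothOn (n := n) (cliffordBasis 𝕜 η) (fun y => (algebraMap ℝ 𝕜 (A b c y)) •
      (cliffE 𝕜 η c * cliffE 𝕜 η b)) U := fun b c =>
    coordSmoothOn_smul (hA b c) (CoordSmoothOn.const _)
  have h := coordDeriv_linear (b₁ := cliffordBasis 𝕜 η) (b₂ := cliffordBasis 𝕜 η) (v := v)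
    ((1 / 4 : 𝕜) • (LinearMap.id : CliffordAlgebra (quadForm 𝕜 η) →ₗ[𝕜] _)) hU hx
    (CoordSmoothOn.sum Finset.univ fun b => CoordSmoothOn.sum Finset.univ fun c => h1 b c)
  refine h.trans ?_
  rw [coordDeriv_sum _ hU hx (fun b => CoordSmoothOn.sum Finset.univ fun c => h1 b c)]
  simp only [fun b => coordDeriv_sum (v := v) (b₁ := cliffordBasis 𝕜 η) Finset.univ hU hx (h1 b),
    fun b c => coordDeriv_smul (v := v) (b₁ := cliffordBasis 𝕜 η) hU hx (hA b c)
      (CoordSmoothOn.const (cliffE 𝕜 η c * cliffE 𝕜 η b)), coordDeriv_const, smul_zero, add_zero]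
  rfl

theorem smooth_connElement (a : Fin n) :
    CoordSmoothOn (n := n) (cliffordBasis 𝕜 η)
      (fun y => S.connElement 𝕜 i (S.frame i a y)) (S.baseSet i) :=
  (smooth_spinElement (A := fun b c => S.connCoeff i a b c) (S.smoothOn_connCoeff a)).congr
    fun y hy => by simp only [connElement, S.connAlong_frame hy]

theorem coordDeriv_connElement (hx : x ∈ S.baseSet i) (a : Fin n)
    (v : TangentSpace 𝓘(ℝ, Model n) x) :
    coordDeriv (cliffordBasis 𝕜 η) (fun y => S.connElement 𝕜 i (S.frame i a y)) x v
      = spinElement 𝕜 η fun b c => dirDeriv (S.connCoeff i a b c) x v := by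
  rw [← coordDeriv_spinElement (S.isOpen_baseSet i) hx (S.smoothOn_connCoeff a)]
  exact coordDeriv_congr (S.isOpen_baseSet i) hx
    fun y hy => by simp only [connElement, S.connAlong_frame hy]

variable {W κ : Type*} [AddCommGroup W] [Module 𝕜 W] [Fintype κ] (bW : Module.Basis κ 𝕜 W)
  (r : CliffordAlgebra (quadForm 𝕜 η) →ₗ[𝕜] Module.End 𝕜 W)

/-- The covariant derivative in the frame `i` that is associated with a linear action `r` of the
Clifford algebra. -/
def actCov (i : ι) (f : M → W) (x : M) (v : TangentSpace 𝓘(ℝ, Model n) x) : W :=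
  coordDeriv bW f x v + r (S.connElement 𝕜 i v) (f x)

variable {bW r}

theorem smooth_actCov {f : M → W} (hf : CoordSmoothOn (n := n) bW f (S.baseSet i)) (a : Fin n) :
    CoordSmoothOn (n := n) bW (fun y => S.actCov bW r i f y (S.frame i a y)) (S.baseSet i) :=
  (hf.coordDeriv (S.isOpen_baseSet i) (S.smooth_frame i a)).add
    (CoordSmoothOn.bilinear r (S.smooth_connElement a) hf)

/-- The commutator of covariant derivatives is the action of the curvature. -/
theorem actCov_commutator (hr : ∀ y z, r (y * z - z * y) = r y * r z - r z * r y)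
    (hx : x ∈ S.baseSet i) {f : M → W} (hf : CoordSmoothOn (n := n) bW f (S.baseSet i))
    (a b : Fin n) :
    S.actCov bW r i (fun y => S.actCov bW r i f y (S.frame i b y)) x (S.frame i a x)
      - S.actCov bW r i (fun y => S.actCov bW r i f y (S.frame i a y)) x (S.frame i b x)
      - ∑ e, (algebraMap ℝ 𝕜 (η e * S.structureCoeff i a b e x)) • S.actCov bW r i f x (S.frame i e x)
      = r (spinElement 𝕜 η fun c d => S.riem i a b c d x) (f x) := by
  have hU := S.isOpen_baseSet i
  have e1 : ∀ a b, S.actCov bW r i (fun y => S.actCov bW r i f y (S.frame i b y)) x (S.frame i a x)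
      = coordDeriv bW (fun y => coordDeriv bW f y (S.frame i b y)) x (S.frame i a x)
        + r (spinElement 𝕜 η fun c d => dirDeriv (S.connCoeff i b c d) x (S.frame i a x)) (f x)
        + r (S.connElement 𝕜 i (S.frame i b x)) (coordDeriv bW f x (S.frame i a x))
        + r (S.connElement 𝕜 i (S.frame i a x)) (coordDeriv bW f x (S.frame i b x))
        + r (S.connElement 𝕜 i (S.frame i a x)) (r (S.connElement 𝕜 i (S.frame i b x)) (f x)) := by
    intro a b
    have h1 := coordDeriv_add (v := S.frame i a x) hU hx
      (hf.coordDeriv (S.isOpen_baseSet i) (S.smooth_frame i b))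
      (CoordSmoothOn.bilinear (b₃ := bW) r (S.smooth_connElement b) hf)
    have h2 := coordDeriv_bilinear (b₃ := bW) (v := S.frame i a x) r hU hx
      (S.smooth_connElement (i := i) b) hf
    rw [h2, S.coordDeriv_connElement hx] at h1
    rw [actCov]
    simp only [actCov]
    rw [h1, map_add]
    abel
  have e2 : coordDeriv bW f x (VectorField.mlieBracket 𝓘(ℝ, Model n) (S.frame i a) (S.frame i b) x)
      = ∑ e, (algebraMap ℝ 𝕜 (η e * S.structureCoeff i a b e x)) •
        coordDeriv bW f x (S.frame i e x) := by
    rw [S.mlieBracket_frame hx, coordDeriv_sum_right]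
    simp only [coordDeriv_smul_right]
  have hne : S.frame i a x ≠ 0 := fun h => by
    have h1 := S.orthonormal i x hx a a
    rw [h, if_pos rfl, map_zero] at h1
    exact S.sign_ne_zero a h1.symm
  rw [coordDeriv_mlieBracket hU hx hf (S.smooth_frame i a) (S.smooth_frame i b) (S.smooth_frame i a)
    hne] at e2
  have e3 : (spinElement 𝕜 η fun c d => S.riem i a b c d x)
      = spinElement 𝕜 η (fun c d => dirDeriv (S.connCoeff i b c d) x (S.frame i a x))
        - spinElement 𝕜 η (fun c d => dirDeriv (S.connCoeff i a c d) x (S.frame i b x))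
        + (S.connElement 𝕜 i (S.frame i a x) * S.connElement 𝕜 i (S.frame i b x)
          - S.connElement 𝕜 i (S.frame i b x) * S.connElement 𝕜 i (S.frame i a x))
        - ∑ e, (algebraMap ℝ 𝕜 (η e * S.structureCoeff i a b e x)) •
          S.connElement 𝕜 i (S.frame i e x) := by
    have hc : ∀ a, S.connElement 𝕜 i (S.frame i a x)
        = spinElement 𝕜 η (fun b c => S.connCoeff i a b c x) := fun a => by
      simp only [connElement, S.connAlong_frame hx]
    have hneg : ∀ A : Fin n → Fin n → ℝ,
        -spinElement 𝕜 η A = spinElement 𝕜 η (fun b c => (-1 : ℝ) * A b c) := fun A => by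
      rw [spinElement_smul, map_neg, map_one, neg_smul, one_smul]
    simp only [hc, ← spinElement_smul, ← spinElement_sum]
    rw [spinElement_bracket (fun b c => S.connCoeff_swap a b c x), sub_eq_add_neg, sub_eq_add_neg,
      hneg, hneg, ← spinElement_add, ← spinElement_add, ← spinElement_add]
    congr 1
    ext c d
    rw [riem]
    ring
  have e4 : ∀ e, S.actCov bW r i f x (S.frame i e x) = coordDeriv bW f x (S.frame i e x)
      + r (S.connElement 𝕜 i (S.frame i e x)) (f x) := fun e => rfl
  rw [e1, e1, e3]
  simp only [e4, map_sub, map_add, hr, LinearMap.sub_apply, LinearMap.add_apply,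
    Module.End.mul_apply, map_sum, LinearMap.sum_apply, map_smul, LinearMap.smul_apply, smul_add,
    Finset.sum_add_distrib]
  rw [← e2]
  abel

end Commutator

section FormCalculus

variable {U : Set M} {W W' : M → ExteriorAlgebra 𝕜 (Fin n → 𝕜)}

theorem covIn_congr (hU : IsOpen U) (hx : x ∈ U) (h : Set.EqOn W W' U)
    (v : TangentSpace 𝓘(ℝ, Model n) x) : S.covIn i W x v = S.covIn i W' x v := by
  rw [covIn, covIn, coordDeriv_congr hU hx h, h hx]

theorem covIn_add_right (v w : TangentSpace 𝓘(ℝ, Model n) x) :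
    S.covIn i W x (v + w) = S.covIn i W x v + S.covIn i W x w := by
  simp only [covIn, coordDeriv_add_right, connAlong_add, mul_add, map_add, add_smul,
    Finset.sum_add_distrib]
  abel

theorem covIn_smul_right (c : ℝ) (v : TangentSpace 𝓘(ℝ, Model n) x) :
    S.covIn i W x (c • v) = (algebraMap ℝ 𝕜 c) • S.covIn i W x v := by
  simp only [covIn, coordDeriv_smul_right, connAlong_smul, smul_sub, Finset.smul_sum, smul_smul,
    ← map_mul, mul_left_comm]

theorem covIn_linear (hU : IsOpen U) (hx : x ∈ U)
    (hW : CoordSmoothOn (n := n) (formBasis 𝕜 n) W U)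
    (L : ExteriorAlgebra 𝕜 (Fin n → 𝕜) →ₗ[𝕜] ExteriorAlgebra 𝕜 (Fin n → 𝕜))
    (v : TangentSpace 𝓘(ℝ, Model n) x) :
    S.covIn i (fun y => L (W y)) x v = L (S.covIn i W x v)
      + ∑ b, ∑ c, (algebraMap ℝ 𝕜 (η c * S.connAlong i v b c)) •
        (L (stdE 𝕜 b * stdI 𝕜 c (W x)) - stdE 𝕜 b * stdI 𝕜 c (L (W x))) := by
  rw [covIn, coordDeriv_linear L hU hx hW, covIn]
  simp only [map_sub, map_sum, map_smul, smul_sub, Finset.sum_sub_distrib]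
  abel

theorem covIn_add (hU : IsOpen U) (hx : x ∈ U)
    (hW : CoordSmoothOn (n := n) (formBasis 𝕜 n) W U)
    (hW' : CoordSmoothOn (n := n) (formBasis 𝕜 n) W' U) (v : TangentSpace 𝓘(ℝ, Model n) x) :
    S.covIn i (fun y => W y + W' y) x v = S.covIn i W x v + S.covIn i W' x v := by
  rw [covIn, coordDeriv_add hU hx hW hW', covIn, covIn]
  simp only [map_add, mul_add, smul_add, Finset.sum_add_distrib]
  abel

theorem covIn_sum {κ : Type*} (s : Finset κ) {W : κ → M → ExteriorAlgebra 𝕜 (Fin n → 𝕜)}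
    (hU : IsOpen U) (hx : x ∈ U) (hW : ∀ k, CoordSmoothOn (n := n) (formBasis 𝕜 n) (W k) U)
    (v : TangentSpace 𝓘(ℝ, Model n) x) :
    S.covIn i (fun y => ∑ k ∈ s, W k y) x v = ∑ k ∈ s, S.covIn i (W k) x v := by
  classical
  induction s using Finset.induction_on with
  | empty => simp [covIn, coordDeriv_const]
  | insert a s ha ih =>
    simp only [Finset.sum_insert ha]
    rw [S.covIn_add hU hx (hW a) (CoordSmoothOn.sum s hW), ih]

theorem covIn_smul (c : 𝕜) (hU : IsOpen U) (hx : x ∈ U)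
    (hW : CoordSmoothOn (n := n) (formBasis 𝕜 n) W U) (v : TangentSpace 𝓘(ℝ, Model n) x) :
    S.covIn i (fun y => c • W y) x v = c • S.covIn i W x v := by
  have h := S.covIn_linear (i := i) hU hx hW (c • LinearMap.id) v
  simpa using h

theorem covIn_mul (hU : IsOpen U) (hx : x ∈ U)
    (hW : CoordSmoothOn (n := n) (formBasis 𝕜 n) W U)
    (hW' : CoordSmoothOn (n := n) (formBasis 𝕜 n) W' U) (v : TangentSpace 𝓘(ℝ, Model n) x) :
    S.covIn i (fun y => W y * W' y) x v = S.covIn i W x v * W' x + W x * S.covIn i W' x v := by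
  have h := coordDeriv_bilinear (b₃ := formBasis 𝕜 n) (v := v)
    (LinearMap.mul 𝕜 (ExteriorAlgebra 𝕜 (Fin n → 𝕜))) hU hx hW hW'
  simp only [LinearMap.mul_apply'] at h
  have e : ∀ b c, stdE 𝕜 b * stdI 𝕜 c (W x * W' x)
      = stdE 𝕜 b * stdI 𝕜 c (W x) * W' x + W x * (stdE 𝕜 b * stdI 𝕜 c (W' x)) := by
    intro b c
    have h1 : stdI 𝕜 c (W x * W' x) = stdI 𝕜 c (W x) * W' x
      + CliffordAlgebra.involute (W x) * stdI 𝕜 c (W' x) := contractLeft_mul _ _ _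
    have h2 : stdE 𝕜 b * CliffordAlgebra.involute (W x) = W x * stdE 𝕜 b := by
      have := ι_mul_eq (Pi.single b 1) (CliffordAlgebra.involute (W x))
      rwa [CliffordAlgebra.involute_involute] at this
    rw [h1, mul_add, ← mul_assoc, ← mul_assoc, h2, mul_assoc (W x)]
  rw [covIn, h, covIn, covIn]
  simp only [e, smul_add, Finset.sum_add_distrib, sub_mul, mul_sub, Finset.sum_mul, Finset.mul_sum,
    smul_mul_assoc, mul_smul_comm]
  abel

theorem covIn_stdI (hU : IsOpen U) (hx : x ∈ U)
    (hW : CoordSmoothOn (n := n) (formBasis 𝕜 n) W U) (v : TangentSpace 𝓘(ℝ, Model n) x)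
    (a : Fin n) :
    S.covIn i (fun y => stdI 𝕜 a (W y)) x v = stdI 𝕜 a (S.covIn i W x v)
      + ∑ c, (algebraMap ℝ 𝕜 (η c * S.connAlong i v a c)) • stdI 𝕜 c (W x) := by
  rw [S.covIn_linear hU hx hW (stdI 𝕜 a)]
  congr 1
  rw [Finset.sum_comm]
  refine Finset.sum_congr rfl fun c _ => ?_
  have e : ∀ b, stdI 𝕜 a (stdE 𝕜 b * stdI 𝕜 c (W x)) - stdE 𝕜 b * stdI 𝕜 c (stdI 𝕜 a (W x))
      = (if a = b then (1 : 𝕜) else 0) • stdI 𝕜 c (W x) := by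
    intro b
    rw [stdI_stdE_mul, stdI_stdI_comm a c, mul_neg]
    abel
  simp only [e]
  rw [Finset.sum_eq_single a]
  · simp
  · intro b _ hb; simp [Ne.symm hb]
  · simp

theorem covIn_stdE_mul (hU : IsOpen U) (hx : x ∈ U)
    (hW : CoordSmoothOn (n := n) (formBasis 𝕜 n) W U) (v : TangentSpace 𝓘(ℝ, Model n) x)
    (a : Fin n) :
    S.covIn i (fun y => stdE 𝕜 a * W y) x v = stdE 𝕜 a * S.covIn i W x v
      + ∑ b, (algebraMap ℝ 𝕜 (η a * S.connAlong i v a b)) • (stdE 𝕜 b * W x) := by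
  have h := S.covIn_linear (i := i) hU hx hW (LinearMap.mulLeft 𝕜 (stdE 𝕜 a)) v
  simp only [LinearMap.mulLeft_apply] at h
  rw [h]
  congr 1
  refine Finset.sum_congr rfl fun b _ => ?_
  have e : ∀ c, stdE 𝕜 a * (stdE 𝕜 b * stdI 𝕜 c (W x)) - stdE 𝕜 b * stdI 𝕜 c (stdE 𝕜 a * W x)
      = -((if c = a then (1 : 𝕜) else 0) • (stdE 𝕜 b * W x)) := by
    intro c
    rw [stdI_stdE_mul, stdE_mul_stdE_mul a b, mul_sub, mul_smul_comm]
    abel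
  simp only [e]
  rw [Finset.sum_eq_single a]
  · rw [if_pos rfl, one_smul, smul_neg, S.connAlong_swap v b a, mul_neg, map_neg, neg_smul, neg_neg]
  · intro b _ hb; simp [hb]
  · simp

/-- The model of `α, β ↦ i_{X^a} α ∧ i_{X_a} β`. -/
abbrev stdCtr {𝕜 : Type*} [RCLike 𝕜] {n : ℕ} (η : Fin n → ℝ)
    (α β : ExteriorAlgebra 𝕜 (Fin n → 𝕜)) : ExteriorAlgebra 𝕜 (Fin n → 𝕜) :=
  ctr (fun a => algebraMap ℝ 𝕜 (η a)) (stdD 𝕜) α β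

theorem smooth_stdI (hW : CoordSmoothOn (n := n) (formBasis 𝕜 n) W U) (a : Fin n) :
    CoordSmoothOn (n := n) (formBasis 𝕜 n) (fun y => stdI 𝕜 a (W y)) U :=
  CoordSmoothOn.linear (stdI 𝕜 a) hW

theorem smooth_mul (hW : CoordSmoothOn (n := n) (formBasis 𝕜 n) W U)
    (hW' : CoordSmoothOn (n := n) (formBasis 𝕜 n) W' U) :
    CoordSmoothOn (n := n) (formBasis 𝕜 n) (fun y => W y * W' y) U :=
  CoordSmoothOn.bilinear (LinearMap.mul 𝕜 (ExteriorAlgebra 𝕜 (Fin n → 𝕜))) hW hW'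

theorem smooth_smul (c : 𝕜) (hW : CoordSmoothOn (n := n) (formBasis 𝕜 n) W U) :
    CoordSmoothOn (n := n) (formBasis 𝕜 n) (fun y => c • W y) U :=
  CoordSmoothOn.linear (b₁ := formBasis 𝕜 n) (c • LinearMap.id) hW

theorem smooth_stdCtr (hW : CoordSmoothOn (n := n) (formBasis 𝕜 n) W U)
    (hW' : CoordSmoothOn (n := n) (formBasis 𝕜 n) W' U) :
    CoordSmoothOn (n := n) (formBasis 𝕜 n) (fun y => stdCtr η (W y) (W' y)) U :=
  CoordSmoothOn.sum _ fun a => smooth_smul _ (smooth_mul (smooth_stdI hW a) (smooth_stdI hW' a))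

theorem covIn_stdCtr (hU : IsOpen U) (hx : x ∈ U)
    (hW : CoordSmoothOn (n := n) (formBasis 𝕜 n) W U)
    (hW' : CoordSmoothOn (n := n) (formBasis 𝕜 n) W' U) (v : TangentSpace 𝓘(ℝ, Model n) x) :
    S.covIn i (fun y => stdCtr η (W y) (W' y)) x v
      = stdCtr η (S.covIn i W x v) (W' x) + stdCtr η (W x) (S.covIn i W' x v) := by
  have h1 : ∀ a, CoordSmoothOn (n := n) (formBasis 𝕜 n)
      (fun y => stdI 𝕜 a (W y) * stdI 𝕜 a (W' y)) U := fun a =>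
    smooth_mul (smooth_stdI hW a) (smooth_stdI hW' a)
  have e : ∀ α β : ExteriorAlgebra 𝕜 (Fin n → 𝕜), stdCtr η α β
      = ∑ a, (algebraMap ℝ 𝕜 (η a)) • (stdI 𝕜 a α * stdI 𝕜 a β) := fun α β => rfl
  simp only [e]
  rw [S.covIn_sum Finset.univ hU hx (fun a => smooth_smul _ (h1 a))]
  simp only [fun a => S.covIn_smul (i := i) (algebraMap ℝ 𝕜 (η a)) hU hx (h1 a) v,
    fun a => S.covIn_mul (i := i) hU hx (smooth_stdI hW a) (smooth_stdI hW' a) v,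
    fun a => S.covIn_stdI (i := i) hU hx hW v a, fun a => S.covIn_stdI (i := i) hU hx hW' v a]
  have h0 : ∑ a, (algebraMap ℝ 𝕜 (η a)) •
      ((∑ c, (algebraMap ℝ 𝕜 (η c * S.connAlong i v a c)) • stdI 𝕜 c (W x)) * stdI 𝕜 a (W' x))
      + ∑ a, (algebraMap ℝ 𝕜 (η a)) • (stdI 𝕜 a (W x) *
        ∑ c, (algebraMap ℝ 𝕜 (η c * S.connAlong i v a c)) • stdI 𝕜 c (W' x)) = 0 := by
    simp only [Finset.sum_mul, Finset.mul_sum, Finset.smul_sum]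
    rw [Finset.sum_comm, ← Finset.sum_add_distrib]
    refine Finset.sum_eq_zero fun a _ => ?_
    rw [← Finset.sum_add_distrib]
    refine Finset.sum_eq_zero fun c _ => ?_
    rw [S.connAlong_swap v c a, smul_mul_assoc, mul_smul_comm, smul_smul, smul_smul, ← map_mul,
      ← map_mul, ← add_smul, ← map_add]
    convert zero_smul 𝕜 _
    convert map_zero (algebraMap ℝ 𝕜)
    ring
  simp only [add_mul, mul_add, smul_add, Finset.sum_add_distrib]
  linear_combination (norm := abel) h0

/-- The action of the Clifford algebra on the exterior algebra by commutators. -/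
def adAction (𝕜 : Type*) [RCLike 𝕜] {n : ℕ} (η : Fin n → ℝ) :
    CliffordAlgebra (quadForm 𝕜 η) →ₗ[𝕜] Module.End 𝕜 (ExteriorAlgebra 𝕜 (Fin n → 𝕜)) :=
  (LinearEquiv.conj (quantize η).symm).toLinearMap.comp
    (LinearMap.mul 𝕜 (CliffordAlgebra (quadForm 𝕜 η)) - (LinearMap.mul 𝕜 _).flip)

theorem quantize_adAction (z : CliffordAlgebra (quadForm 𝕜 η))
    (α : ExteriorAlgebra 𝕜 (Fin n → 𝕜)) :
    quantize η (adAction 𝕜 η z α) = z * quantize η α - quantize η α * z := by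
  simp [adAction, LinearEquiv.conj_apply]

theorem adAction_commutator (y z : CliffordAlgebra (quadForm 𝕜 η)) :
    adAction 𝕜 η (y * z - z * y) = adAction 𝕜 η y * adAction 𝕜 η z
      - adAction 𝕜 η z * adAction 𝕜 η y := by
  refine LinearMap.ext fun α => (quantize η).injective ?_
  simp only [LinearMap.sub_apply, Module.End.mul_apply, map_sub, quantize_adAction]
  noncomm_ring

theorem covIn_eq_actCov (v : TangentSpace 𝓘(ℝ, Model n) x) :
    S.covIn i W x v = S.actCov (formBasis 𝕜 n) (adAction 𝕜 η) i W x v := by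
  rw [covIn, actCov, sub_eq_add_neg]
  congr 1
  refine (quantize η).injective ?_
  rw [quantize_adAction, connElement, spinElement_commutator (S.connAlong_swap v), map_neg]

theorem smooth_covIn (hW : CoordSmoothOn (n := n) (formBasis 𝕜 n) W (S.baseSet i)) (a : Fin n) :
    CoordSmoothOn (n := n) (formBasis 𝕜 n) (fun y => S.covIn i W y (S.frame i a y))
      (S.baseSet i) := by
  simp only [covIn_eq_actCov]
  exact S.smooth_actCov hW a

/-- The Ricci identity for forms. -/
theorem covIn_commutator (hx : x ∈ S.baseSet i)
    (hW : CoordSmoothOn (n := n) (formBasis 𝕜 n) W (S.baseSet i)) (a b : Fin n) :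
    S.covIn i (fun y => S.covIn i W y (S.frame i b y)) x (S.frame i a x)
      - S.covIn i (fun y => S.covIn i W y (S.frame i a y)) x (S.frame i b x)
      - ∑ e, (algebraMap ℝ 𝕜 (η e * S.structureCoeff i a b e x)) • S.covIn i W x (S.frame i e x)
      = -∑ c, ∑ d, (algebraMap ℝ 𝕜 (η d * S.riem i a b c d x)) • (stdE 𝕜 c * stdI 𝕜 d (W x)) := by
  simp only [covIn_eq_actCov]
  rw [S.actCov_commutator adAction_commutator hx hW]
  refine (quantize η).injective ?_
  rw [quantize_adAction, spinElement_commutator (S.riem_swap_right hx a b), map_neg]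

end FormCalculus

end SpinStructure

end

section

theorem coordDeriv_mem {n : ℕ} {M : Type*} [TopologicalSpace M] [ChartedSpace (Model n) M]
    {𝕜 W κ : Type*} [RCLike 𝕜] [AddCommGroup W] [Module 𝕜 W] [Fintype κ]
    {b : Module.Basis κ 𝕜 W} {f : M → W} {U : Set M} {x : M} (hU : IsOpen U) (hx : x ∈ U)
    (hf : CoordSmoothOn (n := n) b f U) (N : Submodule 𝕜 W) (hN : ∀ y ∈ U, f y ∈ N)
    (v : TangentSpace 𝓘(ℝ, Model n) x) : coordDeriv b f x v ∈ N := by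
  have : Module.Finite 𝕜 W := Module.Finite.of_basis b
  have h1 := coordDeriv_linear (b₂ := Module.finBasis 𝕜 (W ⧸ N)) (v := v) N.mkQ hU hx hf
  have h2 := coordDeriv_congr (b₁ := Module.finBasis 𝕜 (W ⧸ N)) (v := v) (f' := fun _ => 0) hU hx
    (fun y hy => (Submodule.Quotient.mk_eq_zero N).2 (hN y hy) : Set.EqOn (fun y => N.mkQ (f y)) _ U)
  rw [coordDeriv_const] at h2
  exact (Submodule.Quotient.mk_eq_zero N).1 (h1.symm.trans h2)

/-- The metric dual of the `a`-th vector of the model frame, as a form. -/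
def stdF (𝕜 : Type*) [RCLike 𝕜] {n : ℕ} (η : Fin n → ℝ) (a : Fin n) :
    ExteriorAlgebra 𝕜 (Fin n → 𝕜) :=
  ExteriorAlgebra.ι 𝕜 ((algebraMap ℝ 𝕜 (η a)) • Pi.single a 1)

theorem stdF_eq {𝕜 : Type*} [RCLike 𝕜] {n : ℕ} {η : Fin n → ℝ} (a : Fin n) :
    stdF 𝕜 η a = (algebraMap ℝ 𝕜 (η a)) • stdE 𝕜 a := by rw [stdF, map_smul, stdE]

theorem stdI_mem {𝕜 : Type*} [RCLike 𝕜] {n p : ℕ} {α : ExteriorAlgebra 𝕜 (Fin n → 𝕜)}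
    (h : α ∈ ⋀[𝕜]^p (Fin n → 𝕜)) (a : Fin n) : stdI 𝕜 a α ∈ ⋀[𝕜]^(p - 1) (Fin n → 𝕜) :=
  contractLeft_mem' _ h

theorem stdE_mul_mem {𝕜 : Type*} [RCLike 𝕜] {n p : ℕ} {α : ExteriorAlgebra 𝕜 (Fin n → 𝕜)}
    (h : α ∈ ⋀[𝕜]^p (Fin n → 𝕜)) (a : Fin n) : stdE 𝕜 a * α ∈ ⋀[𝕜]^(p + 1) (Fin n → 𝕜) :=
  ι_mul_mem _ h

theorem stdE_mul_stdI_mem {𝕜 : Type*} [RCLike 𝕜] {n p : ℕ} {α : ExteriorAlgebra 𝕜 (Fin n → 𝕜)}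
    (h : α ∈ ⋀[𝕜]^p (Fin n → 𝕜)) (a b : Fin n) :
    stdE 𝕜 a * stdI 𝕜 b α ∈ ⋀[𝕜]^p (Fin n → 𝕜) := by
  cases p with
  | zero =>
    have : stdI 𝕜 b α = 0 := contractLeft_mem_zero _ h
    rw [this, mul_zero]; exact zero_mem _
  | succ p => exact stdE_mul_mem (contractLeft_mem _ h) a

theorem sum_antisymm_mul {𝕜 A : Type*} [RCLike 𝕜] [Ring A] [Algebra 𝕜 A] {n : ℕ} {η : Fin n → ℝ}
    (G C : Fin n → Fin n → Fin n → ℝ) (hC : ∀ a b c, C a b c = G a b c - G b a c) (e I : Fin n → A)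
    (he : ∀ a b, e b * e a = -(e a * e b)) :
    ∑ a, ∑ b, ∑ c, (algebraMap ℝ 𝕜 (η c * C a b c / 2)) • (e a * e b * I c)
      = ∑ a, e a * ∑ b, ∑ c, (algebraMap ℝ 𝕜 (η c * G a b c)) • (e b * I c) := by
  have h2 : ∑ a, ∑ b, ∑ c, (algebraMap ℝ 𝕜 (η c * C a b c / 2)) • (e a * e b * I c)
      = (1 / 2 : 𝕜) • ∑ a, ∑ b, ∑ c, (algebraMap ℝ 𝕜 (η c * G a b c)) • (e a * e b * I c)
      - (1 / 2 : 𝕜) • ∑ a, ∑ b, ∑ c, (algebraMap ℝ 𝕜 (η c * G b a c)) • (e a * e b * I c) := by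
    simp only [Finset.smul_sum, ← Finset.sum_sub_distrib]
    refine Finset.sum_congr rfl fun a _ => Finset.sum_congr rfl fun b _ =>
      Finset.sum_congr rfl fun c _ => ?_
    rw [hC]
    simp only [map_mul, map_sub, map_div₀, map_ofNat]
    module
  have h3 : ∑ a, ∑ b, ∑ c, (algebraMap ℝ 𝕜 (η c * G b a c)) • (e a * e b * I c)
      = -∑ a, ∑ b, ∑ c, (algebraMap ℝ 𝕜 (η c * G a b c)) • (e a * e b * I c) := by
    rw [Finset.sum_comm]
    simp only [← Finset.sum_neg_distrib]
    refine Finset.sum_congr rfl fun a _ => Finset.sum_congr rfl fun b _ =>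
      Finset.sum_congr rfl fun c _ => ?_
    rw [he a b, neg_mul, smul_neg]
  rw [h2, h3]
  simp only [Finset.mul_sum, mul_smul_comm, ← mul_assoc]
  module

namespace SpinStructure

variable {n : ℕ} {M : Type*} [TopologicalSpace M] [ChartedSpace (Model n) M]
  [IsManifold 𝓘(ℝ, Model n) ∞ M] {g : PseudoRiemannianMetric n M} {η : Fin n → ℝ} {ι : Type*}
  (S : SpinStructure g η ι) {i j : ι} {x : M} {𝕜 : Type*} [RCLike 𝕜]

theorem trace_frame' {W : Type*} [AddCommGroup W]
    (β : TangentSpace 𝓘(ℝ, Model n) x → TangentSpace 𝓘(ℝ, Model n) x → W)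
    (h₁ : ∀ u u' v, β (u + u') v = β u v + β u' v) (h₂ : ∀ u v v', β u (v + v') = β u v + β u v')
    (hβ : ∀ (c : ℝ) u v, β (c • u) v = β u (c • v)) (hi : x ∈ S.baseSet i) (hj : x ∈ S.baseSet j) :
    ∑ a, β (η a • S.frame i a x) (S.frame i a x) = ∑ a, β (η a • S.frame j a x) (S.frame j a x) :=
  S.trace_frame (AddMonoidHom.mk' (fun u => AddMonoidHom.mk' (β u) (h₂ u))
    fun u u' => AddMonoidHom.ext fun v => h₁ u u' v) hβ hi hj

section GlobalForms

variable {p q : ℕ} {w w' w₁ w₂ : FormField 𝕜 n M}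

/-- The components of a form in the frame `i`. -/
abbrev locForm (i : ι) (w : FormField 𝕜 n M) : M → ExteriorAlgebra 𝕜 (Fin n → 𝕜) :=
  fun y => S.toFrame i y (w y)

variable {S}

theorem IsSmoothForm.smooth (hw : S.IsSmoothForm p w) (i : ι) :
    CoordSmoothOn (n := n) (formBasis 𝕜 n) (S.locForm i w) (S.baseSet i) := hw.2 i

theorem IsSmoothForm.mem (hw : S.IsSmoothForm p w) (i : ι) (y : M) :
    S.locForm i w y ∈ ⋀[𝕜]^p (Fin n → 𝕜) := S.toFrame_mem (hw.1 y)

theorem IsSmoothForm.of_loc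
    (h1 : ∀ i, CoordSmoothOn (n := n) (formBasis 𝕜 n) (S.locForm i w) (S.baseSet i))
    (h2 : ∀ i, ∀ y ∈ S.baseSet i, S.locForm i w y ∈ ⋀[𝕜]^p (Fin n → 𝕜)) : S.IsSmoothForm p w :=
  ⟨fun x => S.mem_of_toFrame_mem (S.mem_baseSet_at x) (h2 _ x (S.mem_baseSet_at x)), h1⟩

theorem IsSmoothForm.add (hw : S.IsSmoothForm p w) (hw' : S.IsSmoothForm p w') :
    S.IsSmoothForm p (w + w') :=
  ⟨fun x => add_mem (hw.1 x) (hw'.1 x), fun i => by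
    simpa using (hw.2 i).add (hw'.2 i)⟩

theorem IsSmoothForm.smul (c : 𝕜) (hw : S.IsSmoothForm p w) : S.IsSmoothForm p (c • w) :=
  ⟨fun x => Submodule.smul_mem _ _ (hw.1 x), fun i => by
    simpa using smooth_smul c (hw.2 i)⟩

theorem IsSmoothForm.neg (hw : S.IsSmoothForm p w) : S.IsSmoothForm p (-w) := by
  simpa using hw.smul (-1)

theorem IsSmoothForm.sub (hw : S.IsSmoothForm p w) (hw' : S.IsSmoothForm p w') :
    S.IsSmoothForm p (w - w') := by
  rw [sub_eq_add_neg]; exact hw.add hw'.neg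

theorem IsSmoothForm.zero : S.IsSmoothForm p (0 : FormField 𝕜 n M) :=
  ⟨fun x => zero_mem _, fun i => by
    simpa using CoordSmoothOn.const (n := n) (M := M) (b₁ := formBasis 𝕜 n) (U := S.baseSet i) 0⟩

theorem IsSmoothForm.mul (hw : S.IsSmoothForm p w) (hw' : S.IsSmoothForm q w') :
    S.IsSmoothForm (p + q) (w * w') :=
  ⟨fun x => mul_mem_exteriorPower (hw.1 x) (hw'.1 x), fun i => by
    simpa using smooth_mul (hw.2 i) (hw'.2 i)⟩

theorem covIn_mem (hx : x ∈ S.baseSet i) (hw : S.IsSmoothForm p w)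
    (v : TangentSpace 𝓘(ℝ, Model n) x) :
    S.covIn i (S.locForm i w) x v ∈ ⋀[𝕜]^p (Fin n → 𝕜) := by
  refine Submodule.sub_mem _ (coordDeriv_mem (S.isOpen_baseSet i) hx (hw.smooth i) _
    (fun y _ => hw.mem i y) v) ?_
  exact Submodule.sum_mem _ fun b _ => Submodule.sum_mem _ fun c _ =>
    Submodule.smul_mem _ _ (stdE_mul_stdI_mem (hw.mem i x) b c)

theorem toFrame_nabla (hw : S.IsSmoothForm p w) (hx : x ∈ S.baseSet i)
    (v : TangentSpace 𝓘(ℝ, Model n) x) :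
    S.toFrame i x (S.nabla w v) = S.covIn i (S.locForm i w) x v := by
  rw [nabla, S.nablaIn_eq (S.mem_baseSet_at x) hx hw.2, S.toFrame_nablaIn hx]

theorem nabla_add_right (v v' : TangentSpace 𝓘(ℝ, Model n) x) :
    S.nabla w (v + v') = S.nabla w v + S.nabla w v' := by
  have hx := S.mem_baseSet_at x
  refine S.toFrame_injective hx ?_
  rw [map_add, nabla, nabla, nabla, S.toFrame_nablaIn hx, S.toFrame_nablaIn hx,
    S.toFrame_nablaIn hx, covIn_add_right]

theorem nabla_smul_right (c : ℝ) (v : TangentSpace 𝓘(ℝ, Model n) x) :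
    S.nabla w (c • v) = (algebraMap ℝ 𝕜 c) • S.nabla w v := by
  have hx := S.mem_baseSet_at x
  refine S.toFrame_injective hx ?_
  rw [map_smul, nabla, nabla, S.toFrame_nablaIn hx, S.toFrame_nablaIn hx, covIn_smul_right]

theorem coframe_eq_flat (a : Fin n) : S.coframe 𝕜 i a x = S.flat 𝕜 (η a • S.frame i a x) := by
  rw [flat_smul, coframe, flat, map_smul]

theorem coframe_mul_coframe (a b : Fin n) :
    S.coframe 𝕜 i b x * S.coframe 𝕜 i a x = -(S.coframe 𝕜 i a x * S.coframe 𝕜 i b x) :=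
  eq_neg_of_add_eq_zero_left (ExteriorAlgebra.ι_add_mul_swap _ _)

theorem extDerivIn_eq (hx : x ∈ S.baseSet i) (w : FormField 𝕜 n M) :
    S.extDerivIn i w x = ∑ a, S.coframe 𝕜 i a x * S.nablaIn i w (S.frame i a x) := by
  rw [extDerivIn]
  simp only [nablaIn, S.connAlong_frame hx, mul_sub, Finset.sum_sub_distrib]
  congr 1
  exact sum_antisymm_mul (fun a b c => S.connCoeff i a b c x)
    (fun a b c => S.structureCoeff i a b c x) (fun a b c => (S.connCoeff_sub a b c x).symm)
    (fun a => S.coframe 𝕜 i a x) (fun c => interior (S.frame i c x) (w x))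
    (fun a b => coframe_mul_coframe a b)

theorem extDeriv_eq (w : FormField 𝕜 n M) (x : M) :
    S.extDeriv w x = ∑ a, S.flat 𝕜 (η a • S.frame (S.indexAt x) a x) *
      S.nabla w (S.frame (S.indexAt x) a x) := by
  simp only [← coframe_eq_flat]
  exact extDerivIn_eq (S.mem_baseSet_at x) w

theorem toFrame_flat_smul_frame (hx : x ∈ S.baseSet i) (a : Fin n) :
    S.toFrame i x (S.flat 𝕜 (η a • S.frame i a x)) = stdE 𝕜 a := by
  rw [← coframe_eq_flat, S.toFrame_coframe hx]

theorem toFrame_flat_frame_eq (hx : x ∈ S.baseSet i) (a : Fin n) :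
    S.toFrame i x (S.flat 𝕜 (S.frame i a x)) = stdF 𝕜 η a := by
  rw [S.toFrame_flat_frame hx, stdF_eq]

theorem toFrame_extDeriv (hw : S.IsSmoothForm p w) (hx : x ∈ S.baseSet i) :
    S.toFrame i x (S.extDeriv w x)
      = ∑ a, stdE 𝕜 a * S.covIn i (S.locForm i w) x (S.frame i a x) := by
  rw [extDeriv_eq, S.trace_frame' (fun u v => S.flat 𝕜 u * S.nabla w v)
    (fun u u' v => by rw [flat_add, add_mul]) (fun u v v' => by rw [nabla_add_right, mul_add])
    (fun c u v => by rw [flat_smul, nabla_smul_right, smul_mul_assoc, mul_smul_comm])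
    (S.mem_baseSet_at x) hx, map_sum]
  refine Finset.sum_congr rfl fun a _ => ?_
  rw [map_mul, toFrame_flat_smul_frame hx, toFrame_nabla hw hx]

theorem toFrame_coDeriv (hw : S.IsSmoothForm p w) (hx : x ∈ S.baseSet i) :
    S.toFrame i x (S.coDeriv w x)
      = -∑ a, (algebraMap ℝ 𝕜 (η a)) •
        stdI 𝕜 a (S.covIn i (S.locForm i w) x (S.frame i a x)) := by
  have h := S.trace_frame' (fun u v => interior u (S.nabla w v))
    (fun u u' v => by rw [interior_add]) (fun u v v' => by rw [nabla_add_right, map_add])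
    (fun c u v => by rw [interior_smul, nabla_smul_right, map_smul])
    (S.mem_baseSet_at x) hx
  simp only [interior_smul] at h
  rw [coDeriv, h, map_neg, map_sum]
  congr 1
  refine Finset.sum_congr rfl fun a _ => ?_
  rw [map_smul, S.toFrame_interior_frame, toFrame_nabla hw hx]

theorem toFrame_contractWedge (w w' : FormField 𝕜 n M) (hx : x ∈ S.baseSet i) :
    S.toFrame i x (S.contractWedge w w' x) = stdCtr η (S.locForm i w x) (S.locForm i w' x) := by
  have h := S.trace_frame' (fun u v => interior u (w x) * interior v (w' x))
    (fun u u' v => by rw [interior_add, add_mul]) (fun u v v' => by rw [interior_add, mul_add])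
    (fun c u v => by rw [interior_smul, interior_smul, smul_mul_assoc, mul_smul_comm])
    (S.mem_baseSet_at x) hx
  simp only [interior_smul, smul_mul_assoc] at h
  rw [contractWedge, h, map_sum]
  refine Finset.sum_congr rfl fun a _ => ?_
  rw [map_smul, map_mul, S.toFrame_interior_frame, S.toFrame_interior_frame]
  rfl

theorem IsSmoothForm.extDeriv (hw : S.IsSmoothForm p w) :
    S.IsSmoothForm (p + 1) (S.extDeriv w) := by
  refine IsSmoothForm.of_loc (fun i => ?_) (fun i y hy => ?_)
  · have h : CoordSmoothOn (n := n) (formBasis 𝕜 n)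
        (fun y => ∑ a, stdE 𝕜 a * S.covIn i (S.locForm i w) y (S.frame i a y)) (S.baseSet i) :=
      CoordSmoothOn.sum Finset.univ fun a =>
        smooth_mul (CoordSmoothOn.const _) (S.smooth_covIn (hw.smooth i) a)
    exact h.congr fun y hy => toFrame_extDeriv hw hy
  · rw [locForm, toFrame_extDeriv hw hy]
    exact Submodule.sum_mem _ fun a _ => stdE_mul_mem (covIn_mem hy hw _) a

theorem IsSmoothForm.coDeriv (hw : S.IsSmoothForm p w) :
    S.IsSmoothForm (p - 1) (S.coDeriv w) := by
  refine IsSmoothForm.of_loc (fun i => ?_) (fun i y hy => ?_)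
  · have h : CoordSmoothOn (n := n) (formBasis 𝕜 n)
        (fun y => ∑ a, (algebraMap ℝ 𝕜 (η a)) •
          stdI 𝕜 a (S.covIn i (S.locForm i w) y (S.frame i a y))) (S.baseSet i) :=
      CoordSmoothOn.sum Finset.univ fun a =>
        smooth_smul _ (smooth_stdI (S.smooth_covIn (hw.smooth i) a) a)
    refine (smooth_smul (-1) h).congr fun y hy => ?_
    exact (toFrame_coDeriv hw hy).trans (neg_one_smul 𝕜 _).symm
  · rw [locForm, toFrame_coDeriv hw hy]
    exact Submodule.neg_mem _ (Submodule.sum_mem _ fun a _ => Submodule.smul_mem _ _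
      (stdI_mem (covIn_mem hy hw _) a))

theorem IsSmoothForm.contractWedge (hw : S.IsSmoothForm p w) (hw' : S.IsSmoothForm q w') :
    S.IsSmoothForm (p - 1 + (q - 1)) (S.contractWedge w w') := by
  refine IsSmoothForm.of_loc (fun i => ?_) (fun i y hy => ?_)
  · exact (smooth_stdCtr (η := η) (hw.smooth i) (hw'.smooth i)).congr
      fun y hy => toFrame_contractWedge w w' hy
  · rw [locForm, toFrame_contractWedge w w' hy]
    exact Submodule.sum_mem _ fun a _ => Submodule.smul_mem _ _
      (mul_mem_exteriorPower (stdI_mem (hw.mem i y) a) (stdI_mem (hw'.mem i y) a))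

theorem locForm_add (w w' : FormField 𝕜 n M) :
    S.locForm i (w + w') = fun y => S.locForm i w y + S.locForm i w' y := by
  funext y; simp [locForm]

theorem locForm_smul (c : 𝕜) (w : FormField 𝕜 n M) :
    S.locForm i (c • w) = fun y => c • S.locForm i w y := by
  funext y; simp [locForm]

/-- Forms agree if their components agree. -/
theorem formField_ext (h : ∀ x, S.locForm (S.indexAt x) w x = S.locForm (S.indexAt x) w' x) :
    w = w' := funext fun x => S.toFrame_injective (S.mem_baseSet_at x) (h x)

theorem covIn_locForm_add (hx : x ∈ S.baseSet i) (hw : S.IsSmoothForm p w)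
    (hw' : S.IsSmoothForm p w') (v : TangentSpace 𝓘(ℝ, Model n) x) :
    S.covIn i (S.locForm i (w + w')) x v
      = S.covIn i (S.locForm i w) x v + S.covIn i (S.locForm i w') x v := by
  rw [locForm_add, S.covIn_add (S.isOpen_baseSet i) hx (hw.smooth i) (hw'.smooth i)]

theorem covIn_locForm_smul (c : 𝕜) (hx : x ∈ S.baseSet i) (hw : S.IsSmoothForm p w)
    (v : TangentSpace 𝓘(ℝ, Model n) x) :
    S.covIn i (S.locForm i (c • w)) x v = c • S.covIn i (S.locForm i w) x v := by
  rw [locForm_smul, S.covIn_smul c (S.isOpen_baseSet i) hx (hw.smooth i)]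

theorem extDeriv_add (hw : S.IsSmoothForm p w) (hw' : S.IsSmoothForm p w') :
    S.extDeriv (w + w') = S.extDeriv w + S.extDeriv w' := by
  refine formField_ext (S := S) fun x => ?_
  have hx := S.mem_baseSet_at x
  rw [locForm_add]
  simp only [locForm]
  rw [toFrame_extDeriv (hw.add hw') hx, toFrame_extDeriv hw hx, toFrame_extDeriv hw' hx]
  simp only [covIn_locForm_add hx hw hw', mul_add, Finset.sum_add_distrib]

theorem extDeriv_smul (c : 𝕜) (hw : S.IsSmoothForm p w) :
    S.extDeriv (c • w) = c • S.extDeriv w := by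
  refine formField_ext (S := S) fun x => ?_
  have hx := S.mem_baseSet_at x
  rw [locForm_smul]
  simp only [locForm]
  rw [toFrame_extDeriv (hw.smul c) hx, toFrame_extDeriv hw hx]
  simp only [covIn_locForm_smul c hx hw, mul_smul_comm, Finset.smul_sum]

theorem coDeriv_add (hw : S.IsSmoothForm p w) (hw' : S.IsSmoothForm p w') :
    S.coDeriv (w + w') = S.coDeriv w + S.coDeriv w' := by
  refine formField_ext (S := S) fun x => ?_
  have hx := S.mem_baseSet_at x
  rw [locForm_add]
  simp only [locForm]
  rw [toFrame_coDeriv (hw.add hw') hx, toFrame_coDeriv hw hx, toFrame_coDeriv hw' hx]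
  simp only [covIn_locForm_add hx hw hw', map_add, smul_add, Finset.sum_add_distrib, neg_add]

theorem coDeriv_smul (c : 𝕜) (hw : S.IsSmoothForm p w) :
    S.coDeriv (c • w) = c • S.coDeriv w := by
  refine formField_ext (S := S) fun x => ?_
  have hx := S.mem_baseSet_at x
  rw [locForm_smul]
  simp only [locForm]
  rw [toFrame_coDeriv (hw.smul c) hx, toFrame_coDeriv hw hx]
  simp only [covIn_locForm_smul c hx hw, map_smul, Finset.smul_sum, smul_neg, smul_comm c]

/-- A form is determined to vanish by its degree. -/
theorem IsSmoothForm.eq_zero_of_lt (hw : S.IsSmoothForm p w) (hp : n < p) : w = 0 :=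
  formField_ext (S := S) fun x => by
    rw [eq_zero_of_mem_exteriorPower_of_gt (sum_stdD_smul 𝕜) hp (hw.mem _ x)]
    exact (map_zero _).symm

end GlobalForms

end SpinStructure

end

section

namespace SpinStructure

variable {n : ℕ} {M : Type*} [TopologicalSpace M] [ChartedSpace (Model n) M]
  [IsManifold 𝓘(ℝ, Model n) ∞ M] {g : PseudoRiemannianMetric n M} {η : Fin n → ℝ} {ι : Type*}
  (S : SpinStructure g η ι) {i j : ι} {x : M} {𝕜 : Type*} [RCLike 𝕜]

section Leibniz

variable {U : Set M} {W W' : M → ExteriorAlgebra 𝕜 (Fin n → 𝕜)}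

theorem smooth_sub (hW : CoordSmoothOn (n := n) (formBasis 𝕜 n) W U)
    (hW' : CoordSmoothOn (n := n) (formBasis 𝕜 n) W' U) :
    CoordSmoothOn (n := n) (formBasis 𝕜 n) (fun y => W y - W' y) U := by
  have h := hW.add (smooth_smul (-1) hW')
  simpa only [neg_one_smul, ← sub_eq_add_neg] using h

theorem covIn_sub (hU : IsOpen U) (hx : x ∈ U)
    (hW : CoordSmoothOn (n := n) (formBasis 𝕜 n) W U)
    (hW' : CoordSmoothOn (n := n) (formBasis 𝕜 n) W' U) (v : TangentSpace 𝓘(ℝ, Model n) x) :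
    S.covIn i (fun y => W y - W' y) x v = S.covIn i W x v - S.covIn i W' x v := by
  have h := S.covIn_add (i := i) hU hx hW (smooth_smul (-1) hW') v
  rw [S.covIn_smul (-1) hU hx hW'] at h
  simpa only [neg_one_smul, ← sub_eq_add_neg] using h

variable {w₁ m₁ f₁ t₁ w₂ m₂ f₂ t₂ : M → ExteriorAlgebra 𝕜 (Fin n → 𝕜)} (s : 𝕜)

/-- The model of the metric coefficients, with values in `𝕜`. -/
abbrev sgnCoeff (𝕜 : Type*) [RCLike 𝕜] {n : ℕ} (η : Fin n → ℝ) : Fin n → 𝕜 :=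
  fun a => algebraMap ℝ 𝕜 (η a)

theorem covIn_brW (hU : IsOpen U) (hx : x ∈ U)
    (hw₁ : CoordSmoothOn (n := n) (formBasis 𝕜 n) w₁ U)
    (hm₁ : CoordSmoothOn (n := n) (formBasis 𝕜 n) m₁ U)
    (hf₁ : CoordSmoothOn (n := n) (formBasis 𝕜 n) f₁ U)
    (hw₂ : CoordSmoothOn (n := n) (formBasis 𝕜 n) w₂ U)
    (hm₂ : CoordSmoothOn (n := n) (formBasis 𝕜 n) m₂ U)
    (hf₂ : CoordSmoothOn (n := n) (formBasis 𝕜 n) f₂ U) (v : TangentSpace 𝓘(ℝ, Model n) x) :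
    S.covIn i (fun y => brW (sgnCoeff 𝕜 η) (stdD 𝕜) s (w₁ y) (m₁ y) (f₁ y) (w₂ y) (m₂ y) (f₂ y)) x v
      = brW (sgnCoeff 𝕜 η) (stdD 𝕜) s (S.covIn i w₁ x v) (S.covIn i m₁ x v) (S.covIn i f₁ x v)
          (w₂ x) (m₂ x) (f₂ x)
        + brW (sgnCoeff 𝕜 η) (stdD 𝕜) s (w₁ x) (m₁ x) (f₁ x) (S.covIn i w₂ x v) (S.covIn i m₂ x v)
          (S.covIn i f₂ x v) := by
  have hA := smooth_stdCtr (η := η) hw₁ hm₂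
  have hB := smooth_stdCtr (η := η) hm₁ hw₂
  have hC := smooth_mul hw₁ hf₂
  simp only [brW]
  rw [S.covIn_sub hU hx (smooth_sub (hA.add (smooth_smul s hB)) (smooth_smul s hC))
      (smooth_mul hf₁ hw₂),
    S.covIn_sub hU hx (hA.add (smooth_smul s hB)) (smooth_smul s hC),
    S.covIn_add hU hx hA (smooth_smul s hB), S.covIn_smul s hU hx hB, S.covIn_smul s hU hx hC,
    S.covIn_stdCtr hU hx hw₁ hm₂, S.covIn_stdCtr hU hx hm₁ hw₂, S.covIn_mul hU hx hw₁ hf₂,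
    S.covIn_mul hU hx hf₁ hw₂]
  module

theorem covIn_brM (hU : IsOpen U) (hx : x ∈ U)
    (hw₁ : CoordSmoothOn (n := n) (formBasis 𝕜 n) w₁ U)
    (hm₁ : CoordSmoothOn (n := n) (formBasis 𝕜 n) m₁ U)
    (ht₁ : CoordSmoothOn (n := n) (formBasis 𝕜 n) t₁ U)
    (hw₂ : CoordSmoothOn (n := n) (formBasis 𝕜 n) w₂ U)
    (hm₂ : CoordSmoothOn (n := n) (formBasis 𝕜 n) m₂ U)
    (ht₂ : CoordSmoothOn (n := n) (formBasis 𝕜 n) t₂ U) (v : TangentSpace 𝓘(ℝ, Model n) x) :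
    S.covIn i (fun y => brM (sgnCoeff 𝕜 η) (stdD 𝕜) (w₁ y) (m₁ y) (t₁ y) (w₂ y) (m₂ y) (t₂ y)) x v
      = brM (sgnCoeff 𝕜 η) (stdD 𝕜) (S.covIn i w₁ x v) (S.covIn i m₁ x v) (S.covIn i t₁ x v)
          (w₂ x) (m₂ x) (t₂ x)
        + brM (sgnCoeff 𝕜 η) (stdD 𝕜) (w₁ x) (m₁ x) (t₁ x) (S.covIn i w₂ x v) (S.covIn i m₂ x v)
          (S.covIn i t₂ x v) := by
  have hA := smooth_stdCtr (η := η) hm₁ hm₂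
  have hB := smooth_mul hw₁ ht₂
  have hC := smooth_mul ht₁ hw₂
  have e : ∀ w₁ m₁ t₁ w₂ m₂ t₂ : ExteriorAlgebra 𝕜 (Fin n → 𝕜),
      brM (sgnCoeff 𝕜 η) (stdD 𝕜) w₁ m₁ t₁ w₂ m₂ t₂
        = w₁ * t₂ + t₁ * w₂ - stdCtr η m₁ m₂ := fun _ _ _ _ _ _ => by rw [brM]; module
  simp only [e]
  rw [S.covIn_sub hU hx (hB.add hC) hA, S.covIn_add hU hx hB hC,
    S.covIn_stdCtr hU hx hm₁ hm₂, S.covIn_mul hU hx hw₁ ht₂, S.covIn_mul hU hx ht₁ hw₂]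
  module

theorem covIn_brF (hU : IsOpen U) (hx : x ∈ U)
    (hw₁ : CoordSmoothOn (n := n) (formBasis 𝕜 n) w₁ U)
    (hm₁ : CoordSmoothOn (n := n) (formBasis 𝕜 n) m₁ U)
    (hf₁ : CoordSmoothOn (n := n) (formBasis 𝕜 n) f₁ U)
    (ht₁ : CoordSmoothOn (n := n) (formBasis 𝕜 n) t₁ U)
    (hw₂ : CoordSmoothOn (n := n) (formBasis 𝕜 n) w₂ U)
    (hm₂ : CoordSmoothOn (n := n) (formBasis 𝕜 n) m₂ U)
    (hf₂ : CoordSmoothOn (n := n) (formBasis 𝕜 n) f₂ U)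
    (ht₂ : CoordSmoothOn (n := n) (formBasis 𝕜 n) t₂ U) (v : TangentSpace 𝓘(ℝ, Model n) x) :
    S.covIn i (fun y => brF (sgnCoeff 𝕜 η) (stdD 𝕜) s (w₁ y) (m₁ y) (f₁ y) (t₁ y)
        (w₂ y) (m₂ y) (f₂ y) (t₂ y)) x v
      = brF (sgnCoeff 𝕜 η) (stdD 𝕜) s (S.covIn i w₁ x v) (S.covIn i m₁ x v) (S.covIn i f₁ x v)
          (S.covIn i t₁ x v) (w₂ x) (m₂ x) (f₂ x) (t₂ x)
        + brF (sgnCoeff 𝕜 η) (stdD 𝕜) s (w₁ x) (m₁ x) (f₁ x) (t₁ x) (S.covIn i w₂ x v)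
          (S.covIn i m₂ x v) (S.covIn i f₂ x v) (S.covIn i t₂ x v) := by
  have hA := smooth_stdCtr (η := η) hw₁ ht₂
  have hB := smooth_stdCtr (η := η) ht₁ hw₂
  have hC := smooth_stdCtr (η := η) hm₁ hf₂
  have hD := smooth_stdCtr (η := η) hf₁ hm₂
  have hAB := smooth_sub (smooth_smul s hA) (smooth_smul s hB)
  simp only [brF]
  rw [S.covIn_sub hU hx (smooth_sub hAB hC) hD, S.covIn_sub hU hx hAB hC,
    S.covIn_sub hU hx (smooth_smul s hA) (smooth_smul s hB), S.covIn_smul s hU hx hA,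
    S.covIn_smul s hU hx hB, S.covIn_stdCtr hU hx hw₁ ht₂, S.covIn_stdCtr hU hx ht₁ hw₂,
    S.covIn_stdCtr hU hx hm₁ hf₂, S.covIn_stdCtr hU hx hf₁ hm₂]
  module

theorem covIn_brT (hU : IsOpen U) (hx : x ∈ U)
    (hm₁ : CoordSmoothOn (n := n) (formBasis 𝕜 n) m₁ U)
    (hf₁ : CoordSmoothOn (n := n) (formBasis 𝕜 n) f₁ U)
    (ht₁ : CoordSmoothOn (n := n) (formBasis 𝕜 n) t₁ U)
    (hm₂ : CoordSmoothOn (n := n) (formBasis 𝕜 n) m₂ U)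
    (hf₂ : CoordSmoothOn (n := n) (formBasis 𝕜 n) f₂ U)
    (ht₂ : CoordSmoothOn (n := n) (formBasis 𝕜 n) t₂ U) (v : TangentSpace 𝓘(ℝ, Model n) x) :
    S.covIn i (fun y => brT (sgnCoeff 𝕜 η) (stdD 𝕜) s (m₁ y) (f₁ y) (t₁ y) (m₂ y) (f₂ y) (t₂ y)) x v
      = brT (sgnCoeff 𝕜 η) (stdD 𝕜) s (S.covIn i m₁ x v) (S.covIn i f₁ x v) (S.covIn i t₁ x v)
          (m₂ x) (f₂ x) (t₂ x)
        + brT (sgnCoeff 𝕜 η) (stdD 𝕜) s (m₁ x) (f₁ x) (t₁ x) (S.covIn i m₂ x v) (S.covIn i f₂ x v)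
          (S.covIn i t₂ x v) := by
  have hA := smooth_stdCtr (η := η) ht₁ hm₂
  have hB := smooth_stdCtr (η := η) hm₁ ht₂
  have hC := smooth_mul hf₁ ht₂
  have hD := smooth_mul ht₁ hf₂
  have hAB := hA.add (smooth_smul s hB)
  simp only [brT]
  rw [S.covIn_add hU hx (hAB.add hC) (smooth_smul s hD), S.covIn_add hU hx hAB hC,
    S.covIn_add hU hx hA (smooth_smul s hB), S.covIn_smul s hU hx hB, S.covIn_smul s hU hx hD,
    S.covIn_stdCtr hU hx ht₁ hm₂, S.covIn_stdCtr hU hx hm₁ ht₂, S.covIn_mul hU hx hf₁ ht₂,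
    S.covIn_mul hU hx ht₁ hf₂]
  module

end Leibniz

section System

variable {p q : ℕ} {w w' w₁ w₂ : FormField 𝕜 n M}

theorem IsSmoothForm.contractWedge' {S : SpinStructure g η ι} (hw : S.IsSmoothForm p w)
    (hw' : S.IsSmoothForm q w') : S.IsSmoothForm (p + q - 2) (S.contractWedge w w') := by
  rcases Nat.eq_zero_or_pos p with rfl | hp
  · have : S.contractWedge w w' = 0 := formField_ext (S := S) fun x => by
      have h0 : ∀ a, stdI 𝕜 a (S.locForm (S.indexAt x) w x) = 0 := fun a =>
        contractLeft_mem_zero _ (hw.mem _ x)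
      rw [locForm, toFrame_contractWedge w w' (S.mem_baseSet_at x)]
      refine (Finset.sum_eq_zero fun a _ => ?_).trans (map_zero _).symm
      change _ • (stdI 𝕜 a _ * _) = _
      rw [h0, zero_mul, smul_zero]
    rw [this]; exact IsSmoothForm.zero
  rcases Nat.eq_zero_or_pos q with rfl | hq
  · have : S.contractWedge w w' = 0 := formField_ext (S := S) fun x => by
      have h0 : ∀ a, stdI 𝕜 a (S.locForm (S.indexAt x) w' x) = 0 := fun a =>
        contractLeft_mem_zero _ (hw'.mem _ x)
      rw [locForm, toFrame_contractWedge w w' (S.mem_baseSet_at x)]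
      refine (Finset.sum_eq_zero fun a _ => ?_).trans (map_zero _).symm
      change _ • (_ * stdI 𝕜 a _) = _
      rw [h0, mul_zero, smul_zero]
    rw [this]; exact IsSmoothForm.zero
  have h := hw.contractWedge hw'
  rwa [show p - 1 + (q - 1) = p + q - 2 by omega] at h

/-- `(w, μ, φ, τ)` is a solution of the prolonged system of normal conformal Killing-Yano `p`-forms
for `K(X) = κ X`, in the components of the frames. -/
structure ProlongedSystem (κ : 𝕜) (p : ℕ) (w μ φ τ : FormField 𝕜 n M) : Prop where
  smooth_w : S.IsSmoothForm p w
  smooth_m : S.IsSmoothForm (p + 1) μ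
  smooth_f : S.IsSmoothForm (p - 1) φ
  smooth_t : S.IsSmoothForm p τ
  cov_w : ∀ i, ∀ x ∈ S.baseSet i, ∀ a, S.covIn i (S.locForm i w) x (S.frame i a x)
    = stdI 𝕜 a (S.locForm i μ x) + stdF 𝕜 η a * S.locForm i φ x
  cov_m : ∀ i, ∀ x ∈ S.baseSet i, ∀ a, S.covIn i (S.locForm i μ) x (S.frame i a x)
    = stdF 𝕜 η a * (S.locForm i τ x + κ • S.locForm i w x)
  cov_f : ∀ i, ∀ x ∈ S.baseSet i, ∀ a, S.covIn i (S.locForm i φ) x (S.frame i a x)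
    = -stdI 𝕜 a (S.locForm i τ x - κ • S.locForm i w x)
  cov_t : ∀ i, ∀ x ∈ S.baseSet i, ∀ a, S.covIn i (S.locForm i τ) x (S.frame i a x)
    = κ • (stdI 𝕜 a (S.locForm i μ x) - stdF 𝕜 η a * S.locForm i φ x)

/-- The form `dw/(p+1)`. -/
def curl (p : ℕ) (w : FormField 𝕜 n M) : FormField 𝕜 n M := (1 / ((p : 𝕜) + 1)) • S.extDeriv w

/-- The form `-δw/(n-p+1)`. -/
def divergence (p : ℕ) (w : FormField 𝕜 n M) : FormField 𝕜 n M :=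
  -(1 / ((n : 𝕜) - p + 1)) • S.coDeriv w

variable {S} {κ : 𝕜}

theorem IsSmoothForm.curl (hw : S.IsSmoothForm p w) : S.IsSmoothForm (p + 1) (S.curl p w) :=
  hw.extDeriv.smul _

theorem IsSmoothForm.divergence (hw : S.IsSmoothForm p w) :
    S.IsSmoothForm (p - 1) (S.divergence p w) := hw.coDeriv.smul _

theorem nabla_ext {L : TangentSpace 𝓘(ℝ, Model n) x → FormAt 𝕜 n x}
    (hadd : ∀ u v, L (u + v) = L u + L v)
    (hsmul : ∀ (c : ℝ) v, L (c • v) = (algebraMap ℝ 𝕜 c) • L v) (hx : x ∈ S.baseSet i)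
    (h : ∀ a, S.nabla w (S.frame i a x) = L (S.frame i a x)) (v : TangentSpace 𝓘(ℝ, Model n) x) :
    S.nabla w v = L v := by
  have h1 : S.nabla w (∑ a, S.comp i v a • S.frame i a x)
      = ∑ a, S.nabla w (S.comp i v a • S.frame i a x) :=
    map_sum (AddMonoidHom.mk' (fun u : TangentSpace 𝓘(ℝ, Model n) x => S.nabla w u)
      nabla_add_right) _ _
  have h2 : L (∑ a, S.comp i v a • S.frame i a x) = ∑ a, L (S.comp i v a • S.frame i a x) :=
    map_sum (AddMonoidHom.mk' L hadd) _ _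
  rw [S.sum_comp_smul_frame hx] at h1 h2
  rw [h1, h2]
  exact Finset.sum_congr rfl fun a _ => by rw [nabla_smul_right, hsmul, h]

theorem sum_stdE_mul_stdI {α : ExteriorAlgebra 𝕜 (Fin n → 𝕜)} (h : α ∈ ⋀[𝕜]^p (Fin n → 𝕜)) :
    ∑ a, stdE 𝕜 a * stdI 𝕜 a α = (p : 𝕜) • α := sum_ι_mul_contractLeft (sum_stdD_smul 𝕜) h

theorem sum_stdI_stdE_mul {α : ExteriorAlgebra 𝕜 (Fin n → 𝕜)} (h : α ∈ ⋀[𝕜]^p (Fin n → 𝕜)) :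
    ∑ a, stdI 𝕜 a (stdE 𝕜 a * α) = ((n : 𝕜) - p) • α := by
  simp only [stdI_stdE_mul, if_true, one_smul, Finset.sum_sub_distrib, sum_stdE_mul_stdI h,
    Finset.sum_const, Finset.card_univ, Fintype.card_fin, sub_smul, Nat.cast_smul_eq_nsmul]

theorem stdE_mul_stdE_mul_self (a : Fin n) (α : ExteriorAlgebra 𝕜 (Fin n → 𝕜)) :
    stdE 𝕜 a * (stdE 𝕜 a * α) = 0 := by
  rw [← mul_assoc, stdE, ExteriorAlgebra.ι_sq_zero, zero_mul]

theorem stdI_stdI_self (a : Fin n) (α : ExteriorAlgebra 𝕜 (Fin n → 𝕜)) :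
    stdI 𝕜 a (stdI 𝕜 a α) = 0 := CliffordAlgebra.contractLeft_contractLeft (Q := 0) _ _

variable (S) in
include S in
theorem sgnCoeff_mul_self (a : Fin n) : algebraMap ℝ 𝕜 (η a) * algebraMap ℝ 𝕜 (η a) = 1 := by
  rw [← map_mul, S.sign_mul_self, map_one]

namespace ProlongedSystem

variable {μ φ τ m₁ f₁ t₁ m₂ f₂ t₂ : FormField 𝕜 n M}

theorem extDeriv_eq (h : S.ProlongedSystem κ p w μ φ τ) :
    S.extDeriv w = ((p : 𝕜) + 1) • μ := by
  refine formField_ext (S := S) fun x => ?_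
  have hx := S.mem_baseSet_at x
  rw [locForm_smul, locForm, toFrame_extDeriv h.smooth_w hx]
  have e := sum_stdE_mul_stdI (h.smooth_m.mem (S.indexAt x) x)
  push_cast at e
  refine Eq.trans ?_ e
  refine Finset.sum_congr rfl fun a _ => ?_
  rw [h.cov_w _ x hx, stdF_eq, mul_add, smul_mul_assoc, mul_smul_comm, stdE_mul_stdE_mul_self,
    smul_zero, add_zero]

theorem coDeriv_eq (h : S.ProlongedSystem κ p w μ φ τ) (hp : 1 ≤ p) :
    S.coDeriv w = -(((n : 𝕜) - p + 1) • φ) := by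
  refine formField_ext (S := S) fun x => ?_
  have hx := S.mem_baseSet_at x
  rw [locForm, toFrame_coDeriv h.smooth_w hx, locForm, Pi.neg_apply, map_neg, Pi.smul_apply,
    map_smul]
  have e := sum_stdI_stdE_mul (h.smooth_f.mem (S.indexAt x) x)
  push_cast [Nat.cast_sub hp] at e
  rw [show (n : 𝕜) - p + 1 = n - (p - 1) by ring, ← e]
  congr 1
  refine Finset.sum_congr rfl fun a _ => ?_
  rw [h.cov_w _ x hx, stdF_eq, map_add, stdI_stdI_self, zero_add, smul_mul_assoc, map_smul,
    smul_smul, S.sgnCoeff_mul_self, one_smul]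

theorem eq_curl (h : S.ProlongedSystem κ p w μ φ τ) : μ = S.curl p w := by
  have : (p : 𝕜) + 1 ≠ 0 := by exact_mod_cast p.succ_ne_zero
  rw [curl, h.extDeriv_eq, smul_smul, one_div_mul_cancel this, one_smul]

theorem eq_divergence (h : S.ProlongedSystem κ p w μ φ τ) (hp : 1 ≤ p) (hn : p ≤ n) :
    φ = S.divergence p w := by
  have : (n : 𝕜) - p + 1 ≠ 0 := by
    rw [← Nat.cast_sub hn]; exact_mod_cast (n - p).succ_ne_zero
  rw [divergence, h.coDeriv_eq hp, smul_neg, neg_smul, neg_neg, smul_smul,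
    one_div_mul_cancel this, one_smul]

theorem mul_eq (h : S.ProlongedSystem κ q w μ φ τ) (hq : 1 ≤ q) (hw : S.IsSmoothForm p w')
    (hp : 1 ≤ p) : w' * φ = w' * S.divergence q w := by
  rcases le_or_gt q n with hn | hn
  · rw [← h.eq_divergence hq hn]
  · rw [(hw.mul h.smooth_f).eq_zero_of_lt (by omega),
      (hw.mul h.smooth_w.divergence).eq_zero_of_lt (by omega)]

theorem mul_eq' (h : S.ProlongedSystem κ q w μ φ τ) (hq : 1 ≤ q) (hw : S.IsSmoothForm p w')
    (hp : 1 ≤ p) : φ * w' = S.divergence q w * w' := by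
  rcases le_or_gt q n with hn | hn
  · rw [← h.eq_divergence hq hn]
  · rw [(h.smooth_f.mul hw).eq_zero_of_lt (by omega),
      (h.smooth_w.divergence.mul hw).eq_zero_of_lt (by omega)]

end ProlongedSystem

theorem contractWedge_smul_left (c : 𝕜) (w w' : FormField 𝕜 n M) :
    S.contractWedge (c • w) w' = c • S.contractWedge w w' := by
  funext x; simp only [contractWedge, Pi.smul_apply, map_smul, smul_mul_assoc, Finset.smul_sum,
    smul_comm c]

theorem contractWedge_smul_right (c : 𝕜) (w w' : FormField 𝕜 n M) :
    S.contractWedge w (c • w') = c • S.contractWedge w w' := by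
  funext x; simp only [contractWedge, Pi.smul_apply, map_smul, mul_smul_comm, Finset.smul_sum,
    smul_comm c]

theorem contractWedge_add_left (w₁ w₂ w' : FormField 𝕜 n M) :
    S.contractWedge (w₁ + w₂) w' = S.contractWedge w₁ w' + S.contractWedge w₂ w' := by
  funext x; simp only [contractWedge, Pi.add_apply, map_add, add_mul, smul_add,
    Finset.sum_add_distrib]

theorem contractWedge_add_right (w' w₁ w₂ : FormField 𝕜 n M) :
    S.contractWedge w' (w₁ + w₂) = S.contractWedge w' w₁ + S.contractWedge w' w₂ := by
  funext x; simp only [contractWedge, Pi.add_apply, map_add, mul_add, smul_add,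
    Finset.sum_add_distrib]

theorem ckyBracket_eq (p q : ℕ) (w₁ w₂ : FormField 𝕜 n M) :
    S.ckyBracket p q w₁ w₂ = S.contractWedge w₁ (S.curl q w₂)
      + (-1 : 𝕜) ^ p • S.contractWedge (S.curl p w₁) w₂
      - (-1 : 𝕜) ^ p • (w₁ * S.divergence q w₂) - S.divergence p w₁ * w₂ := by
  rw [ckyBracket, curl, curl, divergence, divergence, contractWedge_smul_right,
    contractWedge_smul_left, mul_smul_comm, smul_mul_assoc]
  change _ + _ + _ • (w₁ * S.coDeriv w₂) + _ • (S.coDeriv w₁ * w₂) = _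
  module

theorem locForm_ckyBracket (p q : ℕ) (w₁ w₂ : FormField 𝕜 n M) (hx : x ∈ S.baseSet i) :
    S.locForm i (S.ckyBracket p q w₁ w₂) x = brW (sgnCoeff 𝕜 η) (stdD 𝕜) ((-1) ^ p)
      (S.locForm i w₁ x) (S.locForm i (S.curl p w₁) x) (S.locForm i (S.divergence p w₁) x)
      (S.locForm i w₂ x) (S.locForm i (S.curl q w₂) x) (S.locForm i (S.divergence q w₂) x) := by
  rw [ckyBracket_eq]
  simp only [locForm, Pi.add_apply, Pi.sub_apply, Pi.smul_apply, Pi.mul_apply, map_add, map_sub,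
    map_smul, map_mul, toFrame_contractWedge _ _ hx]
  rfl

end System

end SpinStructure

end

section

namespace SpinStructure

variable {n : ℕ} {M : Type*} [TopologicalSpace M] [ChartedSpace (Model n) M]
  [IsManifold 𝓘(ℝ, Model n) ∞ M] {g : PseudoRiemannianMetric n M} {η : Fin n → ℝ} {ι : Type*}
  {S : SpinStructure g η ι} {i j : ι} {x : M} {𝕜 : Type*} [RCLike 𝕜]
  {p q r : ℕ} {κ : 𝕜} {w w₁ m₁ f₁ t₁ w₂ m₂ f₂ t₂ w₃ m₃ f₃ t₃ μ φ τ : FormField 𝕜 n M}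

variable (S) in
/-- The field of forms that corresponds to `brM`. -/
def bracketM (w₁ m₁ t₁ w₂ m₂ t₂ : FormField 𝕜 n M) : FormField 𝕜 n M :=
  -S.contractWedge m₁ m₂ + w₁ * t₂ + t₁ * w₂

variable (S) in
/-- The field of forms that corresponds to `brF`. -/
def bracketF (s : 𝕜) (w₁ m₁ f₁ t₁ w₂ m₂ f₂ t₂ : FormField 𝕜 n M) : FormField 𝕜 n M :=
  s • S.contractWedge w₁ t₂ - s • S.contractWedge t₁ w₂ - S.contractWedge m₁ f₂
    - S.contractWedge f₁ m₂

variable (S) in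
/-- The field of forms that corresponds to `brT`. -/
def bracketT (s : 𝕜) (m₁ f₁ t₁ m₂ f₂ t₂ : FormField 𝕜 n M) : FormField 𝕜 n M :=
  S.contractWedge t₁ m₂ + s • S.contractWedge m₁ t₂ + f₁ * t₂ + s • (t₁ * f₂)

theorem locForm_bracketM (hx : x ∈ S.baseSet i) :
    S.locForm i (S.bracketM w₁ m₁ t₁ w₂ m₂ t₂) x = brM (sgnCoeff 𝕜 η) (stdD 𝕜)
      (S.locForm i w₁ x) (S.locForm i m₁ x) (S.locForm i t₁ x)
      (S.locForm i w₂ x) (S.locForm i m₂ x) (S.locForm i t₂ x) := by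
  simp only [bracketM, locForm, Pi.add_apply, Pi.neg_apply, Pi.mul_apply, map_add, map_neg,
    map_mul, toFrame_contractWedge _ _ hx]
  rfl

theorem locForm_bracketF (s : 𝕜) (hx : x ∈ S.baseSet i) :
    S.locForm i (S.bracketF s w₁ m₁ f₁ t₁ w₂ m₂ f₂ t₂) x = brF (sgnCoeff 𝕜 η) (stdD 𝕜) s
      (S.locForm i w₁ x) (S.locForm i m₁ x) (S.locForm i f₁ x) (S.locForm i t₁ x)
      (S.locForm i w₂ x) (S.locForm i m₂ x) (S.locForm i f₂ x) (S.locForm i t₂ x) := by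
  simp only [bracketF, locForm, Pi.sub_apply, Pi.smul_apply, map_sub, map_smul,
    toFrame_contractWedge _ _ hx]
  rfl

theorem locForm_bracketT (s : 𝕜) (hx : x ∈ S.baseSet i) :
    S.locForm i (S.bracketT s m₁ f₁ t₁ m₂ f₂ t₂) x = brT (sgnCoeff 𝕜 η) (stdD 𝕜) s
      (S.locForm i m₁ x) (S.locForm i f₁ x) (S.locForm i t₁ x)
      (S.locForm i m₂ x) (S.locForm i f₂ x) (S.locForm i t₂ x) := by
  simp only [bracketT, locForm, Pi.add_apply, Pi.smul_apply, Pi.mul_apply, map_add, map_smul,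
    map_mul, toFrame_contractWedge _ _ hx]
  rfl

theorem locForm_add_apply (w w' : FormField 𝕜 n M) :
    S.locForm i (w + w') x = S.locForm i w x + S.locForm i w' x := map_add _ _ _

theorem locForm_smul_apply (c : 𝕜) (w : FormField 𝕜 n M) :
    S.locForm i (c • w) x = c • S.locForm i w x := map_smul (S.toFrame i x) c (w x)

theorem IsSmoothForm.cast (h : S.IsSmoothForm p w) (e : p = q) : S.IsSmoothForm q w := e ▸ h

theorem IsSmoothForm.parity (h : S.IsSmoothForm p w) {b : Bool} (hb : b = decide (Odd p)) :
    HasParity b (S.locForm i w x) := hb ▸ hasParity_of_mem (h.mem i x)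

theorem sum_sgnCoeff_smul_stdD (S : SpinStructure g η ι) (a : Fin n) :
    ∑ b, (sgnCoeff 𝕜 η b * stdD 𝕜 b ((algebraMap ℝ 𝕜 (η a)) • (Pi.single a 1 : Fin n → 𝕜))) •
      stdD 𝕜 b = stdD 𝕜 a := by
  rw [Finset.sum_eq_single a]
  · rw [map_smul, stdD_single, if_pos rfl, smul_eq_mul, mul_one, S.sgnCoeff_mul_self, one_smul]
  · intro b _ hb
    rw [map_smul, stdD_single, if_neg hb, smul_zero, mul_zero, zero_smul]
  · simp

theorem decide_odd_succ (p : ℕ) : decide (Odd (p + 1)) = !decide (Odd p) := by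
  by_cases h : Odd p <;> simp [h, Nat.odd_add_one, -Nat.not_odd_iff_even]

namespace ProlongedSystem

theorem parity_w (h : S.ProlongedSystem κ p w μ φ τ) (i : ι) (x : M) :
    HasParity (decide (Odd p)) (S.locForm i w x) := h.smooth_w.parity rfl

theorem parity_t (h : S.ProlongedSystem κ p w μ φ τ) (i : ι) (x : M) :
    HasParity (decide (Odd p)) (S.locForm i τ x) := h.smooth_t.parity rfl

theorem parity_m (h : S.ProlongedSystem κ p w μ φ τ) (i : ι) (x : M) :
    HasParity (!decide (Odd p)) (S.locForm i μ x) := h.smooth_m.parity (decide_odd_succ p).symm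

theorem parity_f (h : S.ProlongedSystem κ p w μ φ τ) (hp : 1 ≤ p) (i : ι) (x : M) :
    HasParity (!decide (Odd p)) (S.locForm i φ x) := by
  obtain ⟨k, rfl⟩ : ∃ k, p = k + 1 := ⟨p - 1, by omega⟩
  exact h.smooth_f.parity (by rw [decide_odd_succ, Bool.not_not]; rfl)

theorem locForm_ckyBracket (h₁ : S.ProlongedSystem κ p w₁ m₁ f₁ t₁)
    (h₂ : S.ProlongedSystem κ q w₂ m₂ f₂ t₂) (hp : 1 ≤ p) (hq : 1 ≤ q) (hx : x ∈ S.baseSet i) :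
    S.locForm i (S.ckyBracket p q w₁ w₂) x = brW (sgnCoeff 𝕜 η) (stdD 𝕜) ((-1) ^ p)
      (S.locForm i w₁ x) (S.locForm i m₁ x) (S.locForm i f₁ x)
      (S.locForm i w₂ x) (S.locForm i m₂ x) (S.locForm i f₂ x) := by
  have e1 := congrArg (S.toFrame i x) (congrFun (h₂.mul_eq hq h₁.smooth_w hp) x)
  have e2 := congrArg (S.toFrame i x) (congrFun (h₁.mul_eq' hp h₂.smooth_w hq) x)
  simp only [Pi.mul_apply, map_mul] at e1 e2
  rw [SpinStructure.locForm_ckyBracket p q w₁ w₂ hx, ← h₁.eq_curl, ← h₂.eq_curl, brW, brW]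
  simp only [locForm]
  rw [e1, e2]

theorem bracket (h₁ : S.ProlongedSystem κ p w₁ m₁ f₁ t₁)
    (h₂ : S.ProlongedSystem κ q w₂ m₂ f₂ t₂) (hp : 1 ≤ p) (hq : 1 ≤ q) :
    S.ProlongedSystem κ (p + q - 1) (S.ckyBracket p q w₁ w₂) (S.bracketM w₁ m₁ t₁ w₂ m₂ t₂)
      (S.bracketF ((-1) ^ p) w₁ m₁ f₁ t₁ w₂ m₂ f₂ t₂)
      (S.bracketT ((-1) ^ p) m₁ f₁ t₁ m₂ f₂ t₂) := by
  have hU := S.isOpen_baseSet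
  have pw := h₁.parity_w
  have pt := h₁.parity_t
  have pm := h₁.parity_m
  have pf := h₁.parity_f hp
  have hs : sgn 𝕜 (decide (Odd p)) = (-1) ^ p := sgn_decide_odd p
  refine ⟨?_, ?_, ?_, ?_, ?_, ?_, ?_, ?_⟩
  · rw [ckyBracket_eq, ← h₁.eq_curl, ← h₂.eq_curl]
    exact (((((h₁.smooth_w.contractWedge' h₂.smooth_m).cast (by omega)).add
      (((h₁.smooth_m.contractWedge' h₂.smooth_w).cast (by omega)).smul _)).sub
      (((h₁.smooth_w.mul h₂.smooth_w.divergence).cast (by omega)).smul _))).sub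
      ((h₁.smooth_w.divergence.mul h₂.smooth_w).cast (by omega))
  · exact (((h₁.smooth_m.contractWedge' h₂.smooth_m).cast (by omega)).neg.add
      ((h₁.smooth_w.mul h₂.smooth_t).cast (by omega))).add
      ((h₁.smooth_t.mul h₂.smooth_w).cast (by omega))
  · exact (((((h₁.smooth_w.contractWedge' h₂.smooth_t).cast (by omega)).smul _).sub
      (((h₁.smooth_t.contractWedge' h₂.smooth_w).cast (by omega)).smul _)).sub
      ((h₁.smooth_m.contractWedge' h₂.smooth_f).cast (by omega))).sub
      ((h₁.smooth_f.contractWedge' h₂.smooth_m).cast (by omega))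
  · exact ((((h₁.smooth_t.contractWedge' h₂.smooth_m).cast (by omega)).add
      (((h₁.smooth_m.contractWedge' h₂.smooth_t).cast (by omega)).smul _)).add
      ((h₁.smooth_f.mul h₂.smooth_t).cast (by omega))).add
      (((h₁.smooth_t.mul h₂.smooth_f).cast (by omega)).smul _)
  · intro i x hx a
    rw [S.covIn_congr (hU i) hx (fun y hy => h₁.locForm_ckyBracket h₂ hp hq hy),
      S.covIn_brW _ (hU i) hx (h₁.smooth_w.smooth i) (h₁.smooth_m.smooth i) (h₁.smooth_f.smooth i)
        (h₂.smooth_w.smooth i) (h₂.smooth_m.smooth i) (h₂.smooth_f.smooth i),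
      h₁.cov_w i x hx, h₁.cov_m i x hx, h₁.cov_f i x hx, h₂.cov_w i x hx, h₂.cov_m i x hx,
      h₂.cov_f i x hx, locForm_bracketM hx, locForm_bracketF _ hx, ← hs]
    exact bracket_parallel_w κ (S.sum_sgnCoeff_smul_stdD a) (pw i x) (pm i x) (pf i x) (pt i x)
  · intro i x hx a
    rw [S.covIn_congr (hU i) hx (fun y hy => locForm_bracketM hy),
      S.covIn_brM (hU i) hx (h₁.smooth_w.smooth i) (h₁.smooth_m.smooth i) (h₁.smooth_t.smooth i)
        (h₂.smooth_w.smooth i) (h₂.smooth_m.smooth i) (h₂.smooth_t.smooth i),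
      h₁.cov_w i x hx, h₁.cov_m i x hx, h₁.cov_t i x hx, h₂.cov_w i x hx, h₂.cov_m i x hx,
      h₂.cov_t i x hx, locForm_bracketT _ hx, h₁.locForm_ckyBracket h₂ hp hq hx, ← hs]
    exact bracket_parallel_m κ (S.sum_sgnCoeff_smul_stdD a) (pw i x) (pm i x) (pt i x)
  · intro i x hx a
    rw [S.covIn_congr (hU i) hx (fun y hy => locForm_bracketF _ hy),
      S.covIn_brF _ (hU i) hx (h₁.smooth_w.smooth i) (h₁.smooth_m.smooth i) (h₁.smooth_f.smooth i)
        (h₁.smooth_t.smooth i) (h₂.smooth_w.smooth i) (h₂.smooth_m.smooth i)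
        (h₂.smooth_f.smooth i) (h₂.smooth_t.smooth i),
      h₁.cov_w i x hx, h₁.cov_m i x hx, h₁.cov_f i x hx, h₁.cov_t i x hx, h₂.cov_w i x hx,
      h₂.cov_m i x hx, h₂.cov_f i x hx, h₂.cov_t i x hx, locForm_bracketT _ hx,
      h₁.locForm_ckyBracket h₂ hp hq hx, ← hs]
    exact bracket_parallel_f κ (S.sum_sgnCoeff_smul_stdD a) (pw i x) (pm i x) (pf i x) (pt i x)
  · intro i x hx a
    rw [S.covIn_congr (hU i) hx (fun y hy => locForm_bracketT _ hy),
      S.covIn_brT _ (hU i) hx (h₁.smooth_m.smooth i) (h₁.smooth_f.smooth i) (h₁.smooth_t.smooth i)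
        (h₂.smooth_m.smooth i) (h₂.smooth_f.smooth i) (h₂.smooth_t.smooth i),
      h₁.cov_m i x hx, h₁.cov_f i x hx, h₁.cov_t i x hx, h₂.cov_m i x hx, h₂.cov_f i x hx,
      h₂.cov_t i x hx, locForm_bracketM hx, locForm_bracketF _ hx, ← hs]
    exact bracket_parallel_t κ (S.sum_sgnCoeff_smul_stdD a) (pw i x) (pm i x) (pf i x) (pt i x)

theorem ckyBracket_symm (h₁ : S.ProlongedSystem κ p w₁ m₁ f₁ t₁)
    (h₂ : S.ProlongedSystem κ q w₂ m₂ f₂ t₂) (hp : 1 ≤ p) (hq : 1 ≤ q) :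
    S.ckyBracket p q w₁ w₂ = ((-1 : 𝕜) ^ (p * q)) • S.ckyBracket q p w₂ w₁ := by
  refine formField_ext (S := S) fun x => ?_
  have hx := S.mem_baseSet_at x
  rw [locForm_smul_apply, h₁.locForm_ckyBracket h₂ hp hq hx, h₂.locForm_ckyBracket h₁ hq hp hx]
  generalize S.indexAt x = i at hx
  have e : (-1 : 𝕜) ^ (p * q) = sgn 𝕜 (decide (Odd p) && decide (Odd q)) := by
    rw [← sgn_decide_odd]; congr 1; simp [Nat.odd_mul]
  rw [e, ← sgn_decide_odd p, ← sgn_decide_odd q, brW, brW,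
    ctr_comm (h₁.parity_w i x) (h₂.parity_m i x), ctr_comm (h₁.parity_m i x) (h₂.parity_w i x),
    (h₁.parity_w i x).comm (h₂.parity_f hq i x), (h₁.parity_f hp i x).comm (h₂.parity_w i x)]
  generalize decide (Odd p) = a
  generalize decide (Odd q) = b
  cases a <;> cases b <;> simp [sgn] <;> module

theorem ckyBracket_jacobi (h₁ : S.ProlongedSystem κ p w₁ m₁ f₁ t₁)
    (h₂ : S.ProlongedSystem κ q w₂ m₂ f₂ t₂) (h₃ : S.ProlongedSystem κ r w₃ m₃ f₃ t₃)
    (hp : 1 ≤ p) (hq : 1 ≤ q) (hr : 1 ≤ r) :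
    ((-1 : 𝕜) ^ (p * (r + 1))) • S.ckyBracket p (q + r - 1) w₁ (S.ckyBracket q r w₂ w₃)
      + ((-1 : 𝕜) ^ (q * (p + 1))) • S.ckyBracket q (r + p - 1) w₂ (S.ckyBracket r p w₃ w₁)
      + ((-1 : 𝕜) ^ (r * (q + 1))) • S.ckyBracket r (p + q - 1) w₃ (S.ckyBracket p q w₁ w₂)
      = 0 := by
  refine formField_ext (S := S) fun x => ?_
  have hx := S.mem_baseSet_at x
  generalize S.indexAt x = i at hx
  have e : ∀ p q : ℕ, (-1 : 𝕜) ^ (p * (q + 1)) = sgn 𝕜 (decide (Odd p) && !decide (Odd q)) := by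
    intro p q
    rw [← sgn_decide_odd]; congr 1; rw [← decide_odd_succ]; simp only [Nat.odd_mul, Bool.decide_and]
  rw [locForm_add_apply, locForm_add_apply, locForm_smul_apply, locForm_smul_apply,
    locForm_smul_apply, h₁.locForm_ckyBracket (h₂.bracket h₃ hq hr) hp (by omega) hx,
    h₂.locForm_ckyBracket (h₃.bracket h₁ hr hp) hq (by omega) hx,
    h₃.locForm_ckyBracket (h₁.bracket h₂ hp hq) hr (by omega) hx,
    h₂.locForm_ckyBracket h₃ hq hr hx, h₃.locForm_ckyBracket h₁ hr hp hx,
    h₁.locForm_ckyBracket h₂ hp hq hx]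
  simp only [locForm_bracketM hx, locForm_bracketF _ hx, e, ← sgn_decide_odd]
  exact (bracket_jacobi (h₁.parity_w i x) (h₁.parity_m i x) (h₁.parity_f hp i x) (h₁.parity_t i x)
    (h₂.parity_w i x) (h₂.parity_m i x) (h₂.parity_f hq i x) (h₂.parity_t i x)
    (h₃.parity_w i x) (h₃.parity_m i x) (h₃.parity_f hr i x) (h₃.parity_t i x)).trans (map_zero (S.toFrame i x)).symm

theorem add (h₁ : S.ProlongedSystem κ p w₁ m₁ f₁ t₁) (h₂ : S.ProlongedSystem κ p w₂ m₂ f₂ t₂) :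
    S.ProlongedSystem κ p (w₁ + w₂) (m₁ + m₂) (f₁ + f₂) (t₁ + t₂) := by
  refine ⟨h₁.smooth_w.add h₂.smooth_w, h₁.smooth_m.add h₂.smooth_m, h₁.smooth_f.add h₂.smooth_f,
    h₁.smooth_t.add h₂.smooth_t, ?_, ?_, ?_, ?_⟩ <;> intro i x hx a
  · rw [covIn_locForm_add hx h₁.smooth_w h₂.smooth_w, h₁.cov_w i x hx, h₂.cov_w i x hx]
    simp only [locForm, Pi.add_apply, map_add, mul_add]; module
  · rw [covIn_locForm_add hx h₁.smooth_m h₂.smooth_m, h₁.cov_m i x hx, h₂.cov_m i x hx]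
    simp only [locForm, Pi.add_apply, map_add, mul_add, smul_add]; module
  · rw [covIn_locForm_add hx h₁.smooth_f h₂.smooth_f, h₁.cov_f i x hx, h₂.cov_f i x hx]
    simp only [locForm, Pi.add_apply, map_add, map_sub, map_smul, smul_add]; module
  · rw [covIn_locForm_add hx h₁.smooth_t h₂.smooth_t, h₁.cov_t i x hx, h₂.cov_t i x hx]
    simp only [locForm, Pi.add_apply, map_add, mul_add]; module

theorem smul (c : 𝕜) (h : S.ProlongedSystem κ p w μ φ τ) :
    S.ProlongedSystem κ p (c • w) (c • μ) (c • φ) (c • τ) := by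
  refine ⟨h.smooth_w.smul c, h.smooth_m.smul c, h.smooth_f.smul c,
    h.smooth_t.smul c, ?_, ?_, ?_, ?_⟩ <;> intro i x hx a
  · rw [covIn_locForm_smul c hx h.smooth_w, h.cov_w i x hx]
    simp only [locForm, Pi.smul_apply, map_smul, mul_smul_comm]; module
  · rw [covIn_locForm_smul c hx h.smooth_m, h.cov_m i x hx]
    simp only [locForm, Pi.smul_apply, map_smul, mul_smul_comm, mul_add]; module
  · rw [covIn_locForm_smul c hx h.smooth_f, h.cov_f i x hx]
    simp only [locForm, Pi.smul_apply, map_smul, map_sub]; module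
  · rw [covIn_locForm_smul c hx h.smooth_t, h.cov_t i x hx]
    simp only [locForm, Pi.smul_apply, map_smul, mul_smul_comm]; module

theorem zero : S.ProlongedSystem κ p (0 : FormField 𝕜 n M) 0 0 0 := by
  have h : ∀ i : ι, S.locForm i (0 : FormField 𝕜 n M) = fun _ => 0 := fun i => funext fun y => map_zero _
  refine ⟨.zero, .zero, .zero, .zero, ?_, ?_, ?_, ?_⟩ <;> intro i x hx a <;>
    rw [h] <;> simp [covIn, coordDeriv_const]

end ProlongedSystem

end SpinStructure

end

section

namespace SpinStructure

variable {n : ℕ} {M : Type*} [TopologicalSpace M] [ChartedSpace (Model n) M]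
  [IsManifold 𝓘(ℝ, Model n) ∞ M] {g : PseudoRiemannianMetric n M} {η : Fin n → ℝ} {ι : Type*}
  {S : SpinStructure g η ι} {i j : ι} {x : M} {𝕜 : Type*} [RCLike 𝕜]
  {p q r : ℕ} {κ : 𝕜} {k : ℝ} {w w₁ m₁ f₁ t₁ w₂ m₂ f₂ t₂ w₃ m₃ f₃ t₃ μ φ τ : FormField 𝕜 n M}

theorem nabla_eq_of_frame (hw : S.IsSmoothForm p w) (hx : x ∈ S.baseSet i) (A B : FormAt 𝕜 n x)
    (h : ∀ a, S.covIn i (S.locForm i w) x (S.frame i a x)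
      = stdI 𝕜 a (S.toFrame i x A) + stdF 𝕜 η a * S.toFrame i x B)
    (v : TangentSpace 𝓘(ℝ, Model n) x) :
    S.nabla w v = interior v A + S.flat 𝕜 v * B := by
  refine nabla_ext (L := fun v => interior v A + S.flat 𝕜 v * B) (fun u v => ?_) (fun c v => ?_)
    hx (fun a => S.toFrame_injective hx ?_) v
  · simp only [interior_add, flat_add, add_mul]; abel
  · simp only [interior_smul, flat_smul, smul_mul_assoc, smul_add]
  · rw [toFrame_nabla hw hx, h, map_add, map_mul, S.toFrame_interior_frame,
      toFrame_flat_frame_eq hx]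

theorem covIn_frame_of_nabla (hw : S.IsSmoothForm p w) (hx : x ∈ S.baseSet i) (A B : FormAt 𝕜 n x)
    (h : ∀ v : TangentSpace 𝓘(ℝ, Model n) x, S.nabla w v = interior v A + S.flat 𝕜 v * B)
    (a : Fin n) : S.covIn i (S.locForm i w) x (S.frame i a x)
      = stdI 𝕜 a (S.toFrame i x A) + stdF 𝕜 η a * S.toFrame i x B := by
  rw [← toFrame_nabla hw hx, h, map_add, map_mul, S.toFrame_interior_frame,
    toFrame_flat_frame_eq hx]

theorem nabla_zero (v : TangentSpace 𝓘(ℝ, Model n) x) :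
    S.nabla (0 : FormField 𝕜 n M) v = 0 := by
  have h := ProlongedSystem.zero (S := S) (κ := (0 : 𝕜)) (p := 0)
  have hx := S.mem_baseSet_at x
  rw [nabla_eq_of_frame h.smooth_w hx 0 0 (fun a => (h.cov_w _ x hx a).trans rfl), map_zero,
    mul_zero, add_zero]

theorem IsNormalCKY.zero (hp : 1 ≤ p) : S.IsNormalCKY p (0 : FormField 𝕜 n M) := by
  have h := ProlongedSystem.zero (S := S) (κ := (0 : 𝕜)) (p := p)
  have e1 : S.extDeriv (0 : FormField 𝕜 n M) = 0 := h.extDeriv_eq.trans (smul_zero _)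
  have e2 : S.coDeriv (0 : FormField 𝕜 n M) = 0 := (h.coDeriv_eq hp).trans (by simp)
  refine ⟨⟨.zero, fun x v => ?_⟩, _, _, 0, .zero, rfl, rfl, fun x v => ?_⟩
  · rw [nabla_zero, e1, e2]; simp
  · rw [e1, e2, smul_zero, smul_zero]; simp [nabla_zero]

theorem ProlongedSystem.isNormalCKY
    (hk : ∀ (x : M) (v : TangentSpace 𝓘(ℝ, Model n) x), S.kVec v = k • v)
    (h : S.ProlongedSystem (algebraMap ℝ 𝕜 k) p w μ φ τ) (hp : 1 ≤ p) : S.IsNormalCKY p w := by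
  rcases lt_or_ge n p with hn | hn
  · rw [h.smooth_w.eq_zero_of_lt hn]; exact IsNormalCKY.zero hp
  have e1 := h.eq_curl
  have e2 := h.eq_divergence hp hn
  refine ⟨⟨h.smooth_w, fun x v => ?_⟩, μ, φ, τ, h.smooth_t, e1, e2, fun x v => ⟨?_, ?_, ?_⟩⟩
  all_goals have hx := S.mem_baseSet_at x
  · rw [nabla_eq_of_frame h.smooth_w hx _ _ (h.cov_w _ x hx), e1, e2, curl, divergence,
      Pi.smul_apply, Pi.smul_apply, map_smul, mul_smul_comm, neg_smul]
    exact (sub_eq_add_neg _ _).symm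
  · rw [nabla_eq_of_frame h.smooth_m hx 0 (τ x + algebraMap ℝ 𝕜 k • w x) (fun a => by
      rw [h.cov_m _ x hx, map_zero, map_zero, zero_add, map_add, map_smul]), hk, flat_smul,
      map_zero, zero_add, mul_add, mul_smul_comm, smul_mul_assoc]
  · rw [nabla_eq_of_frame h.smooth_f hx (-(τ x - algebraMap ℝ 𝕜 k • w x)) 0 (fun a => by
      rw [h.cov_f _ x hx, map_zero, mul_zero, add_zero]; simp only [locForm, map_neg, map_sub, map_smul]),
      hk, interior_smul, map_neg, map_sub, map_smul, mul_zero]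
    abel
  · rw [nabla_eq_of_frame h.smooth_t hx (algebraMap ℝ 𝕜 k • μ x) (-(algebraMap ℝ 𝕜 k • φ x))
      (fun a => by
        rw [h.cov_t _ x hx, map_smul, map_smul, map_neg, map_smul, mul_neg, mul_smul_comm, smul_sub,
          sub_eq_add_neg]), hk, interior_smul, flat_smul, map_smul, mul_neg, mul_smul_comm,
      smul_mul_assoc, sub_eq_add_neg]

theorem IsCKY.covIn_eq (h : S.IsCKY p w) (hx : x ∈ S.baseSet i) (a : Fin n) :
    S.covIn i (S.locForm i w) x (S.frame i a x)
      = stdI 𝕜 a (S.locForm i (S.curl p w) x)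
        + stdF 𝕜 η a * S.locForm i (S.divergence p w) x := by
  refine covIn_frame_of_nabla h.1 hx _ _ (fun v => ?_) a
  rw [h.2, curl, divergence, Pi.smul_apply, Pi.smul_apply, map_smul, mul_smul_comm, neg_smul,
    sub_eq_add_neg]

theorem IsNormalCKY.prolongedSystem
    (hk : ∀ (x : M) (v : TangentSpace 𝓘(ℝ, Model n) x), S.kVec v = k • v)
    (h : S.IsNormalCKY p w) :
    ∃ τ, S.ProlongedSystem (algebraMap ℝ 𝕜 k) p w (S.curl p w) (S.divergence p w) τ := by
  obtain ⟨hc, μ, φ, τ, ht, hμ, hφ, hv⟩ := h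
  change μ = S.curl p w at hμ
  change φ = S.divergence p w at hφ
  subst hμ
  subst hφ
  refine ⟨τ, hc.1, hc.1.curl, hc.1.divergence, ht, fun i x hx a => hc.covIn_eq hx a, ?_, ?_, ?_⟩
  all_goals intro i x hx a
  · rw [covIn_frame_of_nabla hc.1.curl hx 0 (τ x + algebraMap ℝ 𝕜 k • w x) (fun v => ?_), map_zero,
      map_zero, zero_add, map_add, map_smul]
    rw [(hv x v).1, hk, flat_smul, map_zero, zero_add, mul_add, mul_smul_comm, smul_mul_assoc]
  · rw [covIn_frame_of_nabla hc.1.divergence hx (-(τ x - algebraMap ℝ 𝕜 k • w x)) 0 (fun v => ?_),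
      map_zero, mul_zero, add_zero, map_neg, map_neg, map_sub, map_smul]
    rw [(hv x v).2.1, hk, interior_smul, map_neg, map_sub, map_smul, mul_zero]
    abel
  · rw [covIn_frame_of_nabla ht hx (algebraMap ℝ 𝕜 k • S.curl p w x)
      (-(algebraMap ℝ 𝕜 k • S.divergence p w x)) (fun v => ?_), map_smul, map_smul, map_neg,
      map_smul, mul_neg, mul_smul_comm, smul_sub, sub_eq_add_neg]
    rw [(hv x v).2.2, hk, interior_smul, flat_smul, map_smul, mul_neg, mul_smul_comm,
      smul_mul_assoc, sub_eq_add_neg]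

variable (S) in
/-- The forms of the solutions of the prolonged system. -/
def prolongedForms (κ : 𝕜) (p : ℕ) : Submodule 𝕜 (FormField 𝕜 n M) where
  carrier := {w | ∃ μ φ τ, S.ProlongedSystem κ p w μ φ τ}
  add_mem' := fun ⟨_, _, _, h₁⟩ ⟨_, _, _, h₂⟩ => ⟨_, _, _, h₁.add h₂⟩
  zero_mem' := ⟨0, 0, 0, ProlongedSystem.zero⟩
  smul_mem' := fun c _ ⟨_, _, _, h⟩ => ⟨_, _, _, h.smul c⟩

theorem mem_prolongedForms_iff (hk : ∀ (x : M) (v : TangentSpace 𝓘(ℝ, Model n) x), S.kVec v = k • v)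
    (hp : 1 ≤ p) : w ∈ S.prolongedForms (algebraMap ℝ 𝕜 k) p ↔ S.IsNormalCKY p w :=
  ⟨fun ⟨_, _, _, h⟩ => h.isNormalCKY hk hp, fun h => by
    obtain ⟨τ, h⟩ := h.prolongedSystem hk; exact ⟨_, _, _, h⟩⟩

theorem curl_add (hw : S.IsSmoothForm p w₁) (hw' : S.IsSmoothForm p w₂) :
    S.curl q (w₁ + w₂) = S.curl q w₁ + S.curl q w₂ := by
  rw [curl, curl, curl, extDeriv_add hw hw', smul_add]

theorem curl_smul (c : 𝕜) (hw : S.IsSmoothForm p w) : S.curl q (c • w) = c • S.curl q w := by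
  rw [curl, curl, extDeriv_smul c hw, smul_comm]

theorem divergence_add (hw : S.IsSmoothForm p w₁) (hw' : S.IsSmoothForm p w₂) :
    S.divergence q (w₁ + w₂) = S.divergence q w₁ + S.divergence q w₂ := by
  rw [divergence, divergence, divergence, coDeriv_add hw hw', smul_add]

theorem divergence_smul (c : 𝕜) (hw : S.IsSmoothForm p w) :
    S.divergence q (c • w) = c • S.divergence q w := by
  rw [divergence, divergence, coDeriv_smul c hw, smul_comm]

theorem ckyBracket_add_left (h₁ : S.IsSmoothForm p w₁) (h₂ : S.IsSmoothForm p w₂)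
    (w : FormField 𝕜 n M) :
    S.ckyBracket p q (w₁ + w₂) w = S.ckyBracket p q w₁ w + S.ckyBracket p q w₂ w := by
  simp only [ckyBracket_eq, curl_add h₁ h₂, divergence_add h₁ h₂, contractWedge_add_left, add_mul,
    smul_add]
  abel

theorem ckyBracket_smul_left (c : 𝕜) (h₁ : S.IsSmoothForm p w₁) (w : FormField 𝕜 n M) :
    S.ckyBracket p q (c • w₁) w = c • S.ckyBracket p q w₁ w := by
  simp only [ckyBracket_eq, curl_smul c h₁, divergence_smul c h₁, contractWedge_smul_left,
    smul_mul_assoc, smul_add, smul_sub, smul_comm ((-1 : 𝕜) ^ p) c]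

theorem ckyBracket_add_right (w : FormField 𝕜 n M) (h₁ : S.IsSmoothForm q w₁)
    (h₂ : S.IsSmoothForm q w₂) :
    S.ckyBracket p q w (w₁ + w₂) = S.ckyBracket p q w w₁ + S.ckyBracket p q w w₂ := by
  simp only [ckyBracket_eq, curl_add h₁ h₂, divergence_add h₁ h₂, contractWedge_add_right, mul_add,
    smul_add]
  abel

theorem ckyBracket_smul_right (c : 𝕜) (w : FormField 𝕜 n M) (h₁ : S.IsSmoothForm q w₁) :
    S.ckyBracket p q w (c • w₁) = c • S.ckyBracket p q w w₁ := by
  simp only [ckyBracket_eq, curl_smul c h₁, divergence_smul c h₁, contractWedge_smul_right,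
    mul_smul_comm, smul_add, smul_sub, smul_comm ((-1 : 𝕜) ^ p) c]

theorem smooth_of_mem_prolongedForms (h : w ∈ S.prolongedForms κ p) : S.IsSmoothForm p w := by
  obtain ⟨_, _, _, h⟩ := h
  exact h.smooth_w

variable (S) in
/-- The bracket of the forms of the solutions of the prolonged system, as a bilinear map. -/
def prolongedBracket (κ : 𝕜) (p q : ℕ) (hp : 1 ≤ p) (hq : 1 ≤ q) :
    S.prolongedForms κ p →ₗ[𝕜] S.prolongedForms κ q →ₗ[𝕜] S.prolongedForms κ (p + q - 1) :=
  LinearMap.mk₂ 𝕜 (fun w₁ w₂ => ⟨S.ckyBracket p q w₁ w₂, by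
      obtain ⟨_, _, _, h₁⟩ := w₁.2
      obtain ⟨_, _, _, h₂⟩ := w₂.2
      exact ⟨_, _, _, h₁.bracket h₂ hp hq⟩⟩)
    (fun w₁ w₁' w₂ => Subtype.ext (ckyBracket_add_left (smooth_of_mem_prolongedForms w₁.2)
      (smooth_of_mem_prolongedForms w₁'.2) _))
    (fun c w₁ w₂ => Subtype.ext (ckyBracket_smul_left c (smooth_of_mem_prolongedForms w₁.2) _))
    (fun w₁ w₂ w₂' => Subtype.ext (ckyBracket_add_right _ (smooth_of_mem_prolongedForms w₂.2)
      (smooth_of_mem_prolongedForms w₂'.2)))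
    (fun c w₁ w₂ => Subtype.ext (ckyBracket_smul_right c _ (smooth_of_mem_prolongedForms w₂.2)))

end SpinStructure

end

section

namespace SpinStructure

variable {n : ℕ} {M : Type*} [TopologicalSpace M] [ChartedSpace (Model n) M]
  [IsManifold 𝓘(ℝ, Model n) ∞ M] {g : PseudoRiemannianMetric n M} {η : Fin n → ℝ} {ι : Type*}
  (S : SpinStructure g η ι) {i j : ι} {x : M} {𝕜 : Type*} [RCLike 𝕜]

section Traces

variable {p : ℕ} {Y N P Q : Fin n → ExteriorAlgebra 𝕜 (Fin n → 𝕜)}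
  {X : ExteriorAlgebra 𝕜 (Fin n → 𝕜)}

theorem eq_zero_of_eq_neg (𝕜 : Type*) [RCLike 𝕜] {V : Type*} [AddCommGroup V] [Module 𝕜 V] {v : V}
    (h : v = -v) : v = 0 := by
  have h2 : (2 : 𝕜) • v = 0 := by
    rw [two_smul]; nth_rewrite 1 [h]; exact neg_add_cancel v
  exact (smul_eq_zero.1 h2).resolve_left two_ne_zero

theorem stdF_mul (a : Fin n) (X : ExteriorAlgebra 𝕜 (Fin n → 𝕜)) :
    stdF 𝕜 η a * X = (algebraMap ℝ 𝕜 (η a)) • (stdE 𝕜 a * X) := by rw [stdF_eq, smul_mul_assoc]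

theorem stdI_stdF_mul (a b : Fin n) (X : ExteriorAlgebra 𝕜 (Fin n → 𝕜)) :
    stdI 𝕜 a (stdF 𝕜 η b * X)
      = (if a = b then algebraMap ℝ 𝕜 (η a) else 0) • X - stdF 𝕜 η b * stdI 𝕜 a X := by
  rw [stdF_mul, map_smul, stdI_stdE_mul, stdF_mul, smul_sub, smul_smul]
  by_cases h : a = b <;> simp [h]

theorem stdF_mul_stdF_mul (a b : Fin n) (X : ExteriorAlgebra 𝕜 (Fin n → 𝕜)) :
    stdF 𝕜 η a * (stdF 𝕜 η b * X) = -(stdF 𝕜 η b * (stdF 𝕜 η a * X)) := by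
  simp only [stdF_mul, mul_smul_comm]
  rw [stdE_mul_stdE_mul, smul_neg, smul_neg, smul_comm]

theorem stdF_mul_mem (a : Fin n) (h : X ∈ ⋀[𝕜]^p (Fin n → 𝕜)) :
    stdF 𝕜 η a * X ∈ ⋀[𝕜]^(p + 1) (Fin n → 𝕜) := ι_mul_mem _ h

theorem sum_stdE_mul_stdI_apply (Y : Fin n → ExteriorAlgebra 𝕜 (Fin n → 𝕜)) (a : Fin n) :
    ∑ b, stdE 𝕜 b * stdI 𝕜 a (Y b) = Y a - stdI 𝕜 a (∑ b, stdE 𝕜 b * Y b) := by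
  simp only [map_sum, stdI_stdE_mul, Finset.sum_sub_distrib, ite_smul, one_smul, zero_smul,
    Finset.sum_ite_eq, Finset.mem_univ, if_true]
  abel

theorem sum_stdE_mul_stdF_mul (Y : Fin n → ExteriorAlgebra 𝕜 (Fin n → 𝕜)) (a : Fin n) :
    ∑ b, stdE 𝕜 b * (stdF 𝕜 η a * Y b) = -(stdF 𝕜 η a * ∑ b, stdE 𝕜 b * Y b) := by
  rw [Finset.mul_sum, ← Finset.sum_neg_distrib]
  refine Finset.sum_congr rfl fun b _ => ?_
  rw [stdF_mul, stdF_mul, mul_smul_comm, stdE_mul_stdE_mul, smul_neg]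

theorem sum_stdE_mul_stdF_mul_self (X : ExteriorAlgebra 𝕜 (Fin n → 𝕜)) :
    ∑ b, stdE 𝕜 b * (stdF 𝕜 η b * X) = 0 :=
  Finset.sum_eq_zero fun b _ => by rw [stdF_mul, mul_smul_comm, stdE_mul_stdE_mul_self, smul_zero]

theorem sum_stdI_stdI_apply (Y : Fin n → ExteriorAlgebra 𝕜 (Fin n → 𝕜)) (a : Fin n) :
    ∑ b, algebraMap ℝ 𝕜 (η b) • stdI 𝕜 b (stdI 𝕜 a (Y b))
      = -stdI 𝕜 a (∑ b, algebraMap ℝ 𝕜 (η b) • stdI 𝕜 b (Y b)) := by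
  rw [map_sum, ← Finset.sum_neg_distrib]
  refine Finset.sum_congr rfl fun b _ => ?_
  rw [map_smul, stdI_stdI_comm, smul_neg]

theorem sum_stdI_stdI_self (X : ExteriorAlgebra 𝕜 (Fin n → 𝕜)) :
    ∑ b, algebraMap ℝ 𝕜 (η b) • stdI 𝕜 b (stdI 𝕜 b X) = 0 :=
  Finset.sum_eq_zero fun b _ => by rw [stdI_stdI_self, smul_zero]

include S

theorem sum_stdI_stdF_mul_apply (Y : Fin n → ExteriorAlgebra 𝕜 (Fin n → 𝕜)) (a : Fin n) :
    ∑ b, algebraMap ℝ 𝕜 (η b) • stdI 𝕜 b (stdF 𝕜 η a * Y b)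
      = Y a - stdF 𝕜 η a * ∑ b, algebraMap ℝ 𝕜 (η b) • stdI 𝕜 b (Y b) := by
  simp only [stdI_stdF_mul, smul_sub, Finset.sum_sub_distrib, ite_smul, zero_smul, smul_ite,
    smul_zero, Finset.mul_sum, mul_smul_comm]
  rw [Finset.sum_ite_eq' Finset.univ a, if_pos (Finset.mem_univ a), smul_smul,
    S.sgnCoeff_mul_self, one_smul]

theorem sum_stdI_stdF_mul_self (h : X ∈ ⋀[𝕜]^p (Fin n → 𝕜)) :
    ∑ b, algebraMap ℝ 𝕜 (η b) • stdI 𝕜 b (stdF 𝕜 η b * X) = ((n : 𝕜) - p) • X := by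
  rw [← sum_stdI_stdE_mul h]
  refine Finset.sum_congr rfl fun b _ => ?_
  rw [stdF_mul, map_smul, smul_smul, S.sgnCoeff_mul_self, one_smul]

/-- The algebraic consequences of the integrability condition of the conformal Killing-Yano
equation on spaces of constant curvature. -/
theorem trace_part_of_integrability (hp : 1 ≤ p) (hpn : p ≤ n)
    (hN : ∀ a, N a ∈ ⋀[𝕜]^(p + 1) (Fin n → 𝕜)) (hP : ∀ a, P a ∈ ⋀[𝕜]^(p - 1) (Fin n → 𝕜))
    (h : ∀ a b, stdI 𝕜 b (N a) - stdI 𝕜 a (N b) + stdF 𝕜 η b * P a - stdF 𝕜 η a * P b = 0)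
    (a : Fin n) :
    ((n : 𝕜) - p) • N a = stdF 𝕜 η a * ∑ b, algebraMap ℝ 𝕜 (η b) • stdI 𝕜 b (N b) ∧
    ((n : 𝕜) - p) • P a = -stdI 𝕜 a (∑ b, algebraMap ℝ 𝕜 (η b) • stdI 𝕜 b (N b)) := by
  set ν := ∑ b, algebraMap ℝ 𝕜 (η b) • stdI 𝕜 b (N b) with hν
  have hνm : ν ∈ ⋀[𝕜]^p (Fin n → 𝕜) := Submodule.sum_mem _ fun b _ =>
    Submodule.smul_mem _ _ (stdI_mem (hN b) b)
  have hp0 : (p : 𝕜) ≠ 0 := by exact_mod_cast (by omega : p ≠ 0)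
  have e1 : ∀ a, (p : 𝕜) • N a + stdI 𝕜 a (∑ b, stdE 𝕜 b * N b)
      + stdF 𝕜 η a * ∑ b, stdE 𝕜 b * P b = 0 := by
    intro a
    have h1 := Finset.sum_congr (rfl : Finset.univ = Finset.univ)
      fun b _ => congrArg (stdE 𝕜 b * ·) (h a b)
    simp only [mul_sub, mul_add, mul_zero, Finset.sum_sub_distrib, Finset.sum_add_distrib,
      Finset.sum_const_zero, sum_stdE_mul_stdI (hN a), sum_stdE_mul_stdI_apply,
      sum_stdE_mul_stdF_mul, sum_stdE_mul_stdF_mul_self] at h1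
    push_cast at h1
    rw [← h1]; module
  have e2 : ∑ b, stdE 𝕜 b * N b = 0 := by
    have h1 := Finset.sum_congr (rfl : Finset.univ = Finset.univ)
      fun b _ => congrArg (stdE 𝕜 b * ·) (e1 b)
    have h2 : ∑ b, stdE 𝕜 b * N b ∈ ⋀[𝕜]^(p + 2) (Fin n → 𝕜) := Submodule.sum_mem _ fun b _ =>
      stdE_mul_mem (hN b) b
    simp only [mul_add, mul_zero, mul_smul_comm, Finset.sum_add_distrib, ← Finset.smul_sum,
      Finset.sum_const_zero, sum_stdE_mul_stdI h2, sum_stdE_mul_stdF_mul_self] at h1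
    push_cast at h1
    have h3 : ((2 * p + 2 : ℕ) : 𝕜) • ∑ b, stdE 𝕜 b * N b = 0 := by
      push_cast; rw [← h1]; module
    exact (smul_eq_zero.1 h3).resolve_left (Nat.cast_ne_zero.2 (by omega))
  have e3 : ∀ a, stdI 𝕜 a ν + ((n : 𝕜) - p) • P a
      + stdF 𝕜 η a * ∑ b, algebraMap ℝ 𝕜 (η b) • stdI 𝕜 b (P b) = 0 := by
    intro a
    have h1 := Finset.sum_congr (rfl : Finset.univ = Finset.univ)
      fun b _ => congrArg (fun z => algebraMap ℝ 𝕜 (η b) • stdI 𝕜 b z) (h a b)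
    simp only [map_sub, map_add, smul_sub, smul_add, map_zero, smul_zero, Finset.sum_sub_distrib,
      Finset.sum_add_distrib, Finset.sum_const_zero, sum_stdI_stdI_self, sum_stdI_stdI_apply,
      S.sum_stdI_stdF_mul_self (hP a), S.sum_stdI_stdF_mul_apply, ← hν] at h1
    push_cast [Nat.cast_sub hp] at h1
    rw [← h1]; module
  have e4 : ∑ b, algebraMap ℝ 𝕜 (η b) • stdI 𝕜 b (P b) = 0 := by
    rcases Nat.lt_or_ge p 2 with h2 | h2
    · obtain rfl : p = 1 := by omega
      exact Finset.sum_eq_zero fun b _ => by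
        rw [show stdI 𝕜 b (P b) = 0 from contractLeft_mem_zero _ (hP b), smul_zero]
    have h1 := Finset.sum_congr (rfl : Finset.univ = Finset.univ)
      fun b _ => congrArg (fun z => algebraMap ℝ 𝕜 (η b) • stdI 𝕜 b z) (e3 b)
    have h4 : ∑ b, algebraMap ℝ 𝕜 (η b) • stdI 𝕜 b (P b) ∈ ⋀[𝕜]^(p - 2) (Fin n → 𝕜) :=
      Submodule.sum_mem _ fun b _ => Submodule.smul_mem _ _ (stdI_mem (hP b) b)
    have h5 : ∀ b, algebraMap ℝ 𝕜 (η b) • ((n : 𝕜) - p) • stdI 𝕜 b (P b)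
      = ((n : 𝕜) - p) • algebraMap ℝ 𝕜 (η b) • stdI 𝕜 b (P b) := fun b => smul_comm _ _ _
    simp only [map_add, smul_add, map_zero, smul_zero, map_smul, h5, ← Finset.smul_sum,
      Finset.sum_add_distrib, Finset.sum_const_zero, sum_stdI_stdI_self] at h1
    rw [S.sum_stdI_stdF_mul_self h4] at h1
    push_cast [Nat.cast_sub h2] at h1
    have h3 : ((2 * (n - p) + 2 : ℕ) : 𝕜) • ∑ b, algebraMap ℝ 𝕜 (η b) • stdI 𝕜 b (P b) = 0 := by
      push_cast [Nat.cast_sub hpn]; rw [← h1]; module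
    exact (smul_eq_zero.1 h3).resolve_left (Nat.cast_ne_zero.2 (by omega))
  have e5 : ∀ a, ((n : 𝕜) - p) • P a = -stdI 𝕜 a ν := fun a => by
    have := e3 a
    rw [e4, mul_zero, add_zero] at this
    exact eq_neg_of_add_eq_zero_right this
  have e6 : ((n : 𝕜) - p) • ∑ b, stdE 𝕜 b * P b = -((p : 𝕜) • ν) := by
    rw [← sum_stdE_mul_stdI hνm, Finset.smul_sum, ← Finset.sum_neg_distrib]
    exact Finset.sum_congr rfl fun b _ => by rw [← mul_smul_comm, e5, mul_neg]
  refine ⟨?_, e5 a⟩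
  have h1 := e1 a
  rw [e2, map_zero, add_zero] at h1
  have h2 : (p : 𝕜) • (((n : 𝕜) - p) • N a - stdF 𝕜 η a * ν) = 0 := by
    have h3 : (p : 𝕜) • (stdF 𝕜 η a * ν) = -(((n : 𝕜) - p) • (stdF 𝕜 η a * ∑ b, stdE 𝕜 b * P b)) := by
      rw [← mul_smul_comm, ← mul_smul_comm, e6, mul_neg, neg_neg]
    rw [smul_sub, h3, eq_neg_of_add_eq_zero_right h1]
    module
  exact sub_eq_zero.1 ((smul_eq_zero.1 h2).resolve_left hp0)

theorem eq_zero_of_symmetric (hp : 1 ≤ p) (hpn : p < n) (hn : 3 ≤ n)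
    (hQ : ∀ a, Q a ∈ ⋀[𝕜]^p (Fin n → 𝕜))
    (hF : ∀ a b, stdF 𝕜 η b * Q a = stdF 𝕜 η a * Q b)
    (hI : ∀ a b, stdI 𝕜 b (Q a) = stdI 𝕜 a (Q b)) (a : Fin n) : Q a = 0 := by
  rcases Nat.lt_or_ge p (n - 1) with h1 | h1
  · set s := ∑ b, algebraMap ℝ 𝕜 (η b) • stdI 𝕜 b (Q b) with hs
    have hsm : s ∈ ⋀[𝕜]^(p - 1) (Fin n → 𝕜) := Submodule.sum_mem _ fun b _ =>
      Submodule.smul_mem _ _ (stdI_mem (hQ b) b)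
    have hc : ((n : 𝕜) - p - 1) ≠ 0 := by
      rw [← Nat.cast_sub hpn.le, ← Nat.cast_one, ← Nat.cast_sub (by omega)]
      exact_mod_cast (by omega : n - p - 1 ≠ 0)
    have hc' : ((n : 𝕜) - p) ≠ 0 := by
      rw [← Nat.cast_sub hpn.le]
      exact_mod_cast (by omega : n - p ≠ 0)
    have e1 : ∀ a, ((n : 𝕜) - p - 1) • Q a = -(stdF 𝕜 η a * s) := by
      intro a
      have h2 := Finset.sum_congr (rfl : Finset.univ = Finset.univ)
        fun b _ => congrArg (fun z => algebraMap ℝ 𝕜 (η b) • stdI 𝕜 b z) (hF a b)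
      rw [S.sum_stdI_stdF_mul_self (hQ a), S.sum_stdI_stdF_mul_apply] at h2
      rw [sub_smul, h2, one_smul]; abel
    have e2 : ∀ a b, stdF 𝕜 η b * (stdF 𝕜 η a * s) = 0 := by
      intro a b
      have h2 : stdF 𝕜 η b * (stdF 𝕜 η a * s) = stdF 𝕜 η a * (stdF 𝕜 η b * s) := by
        have h3 := congrArg (((n : 𝕜) - p - 1) • ·) (hF a b)
        simp only [← mul_smul_comm, e1, mul_neg, neg_inj] at h3
        exact h3
      exact eq_zero_of_eq_neg 𝕜 ((stdF_mul_stdF_mul b a s).trans (congrArg Neg.neg h2.symm))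
    have e3 : stdF 𝕜 η a * s = 0 := by
      have h2 : stdF 𝕜 η a * s ∈ ⋀[𝕜]^p (Fin n → 𝕜) := by
        have := stdF_mul_mem (η := η) a hsm
        rwa [Nat.sub_add_cancel hp] at this
      have h3 := S.sum_stdI_stdF_mul_self h2
      simp only [e2, map_zero, smul_zero, Finset.sum_const_zero] at h3
      exact (smul_eq_zero.1 h3.symm).resolve_left hc'
    have h4 := e1 a
    rw [e3, neg_zero] at h4
    exact (smul_eq_zero.1 h4).resolve_left hc
  · set t := ∑ b, stdE 𝕜 b * Q b with ht
    have htm : t ∈ ⋀[𝕜]^(p + 1) (Fin n → 𝕜) := Submodule.sum_mem _ fun b _ =>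
      stdE_mul_mem (hQ b) b
    have hc : ((p : 𝕜) - 1) ≠ 0 := by
      rw [← Nat.cast_one, ← Nat.cast_sub hp]
      exact_mod_cast (by omega : p - 1 ≠ 0)
    have hc' : (p : 𝕜) ≠ 0 := by exact_mod_cast (by omega : p ≠ 0)
    have e1 : ∀ a, ((p : 𝕜) - 1) • Q a = -(stdI 𝕜 a t) := by
      intro a
      have h2 := Finset.sum_congr (rfl : Finset.univ = Finset.univ)
        fun b _ => congrArg (fun z => stdE 𝕜 b * z) (hI a b)
      rw [sum_stdE_mul_stdI (hQ a), sum_stdE_mul_stdI_apply] at h2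
      rw [sub_smul, h2, one_smul]; abel
    have e2 : ∀ a b, stdI 𝕜 b (stdI 𝕜 a t) = 0 := by
      intro a b
      have h2 : stdI 𝕜 b (stdI 𝕜 a t) = stdI 𝕜 a (stdI 𝕜 b t) := by
        have h3 := congrArg (((p : 𝕜) - 1) • ·) (hI a b)
        simp only [← map_smul, e1, map_neg, neg_inj] at h3
        exact h3
      exact eq_zero_of_eq_neg 𝕜 ((stdI_stdI_comm b a t).trans (congrArg Neg.neg h2.symm))
    have e3 : stdI 𝕜 a t = 0 := by
      have h3 := sum_stdE_mul_stdI (stdI_mem htm a)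
      simp only [e2, mul_zero, Finset.sum_const_zero] at h3
      exact (smul_eq_zero.1 h3.symm).resolve_left hc'
    have h4 := e1 a
    rw [e3, neg_zero] at h4
    exact (smul_eq_zero.1 h4).resolve_left hc

end Traces

section ConstantCurvature

variable {W A B : M → ExteriorAlgebra 𝕜 (Fin n → 𝕜)}

theorem smooth_stdF_mul (hW : CoordSmoothOn (n := n) (formBasis 𝕜 n) W (S.baseSet i)) (a : Fin n) :
    CoordSmoothOn (n := n) (formBasis 𝕜 n) (fun y => stdF 𝕜 η a * W y) (S.baseSet i) :=
  smooth_mul (CoordSmoothOn.const _) hW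

theorem covIn_stdF_mul (hx : x ∈ S.baseSet i)
    (hW : CoordSmoothOn (n := n) (formBasis 𝕜 n) W (S.baseSet i))
    (v : TangentSpace 𝓘(ℝ, Model n) x) (a : Fin n) :
    S.covIn i (fun y => stdF 𝕜 η a * W y) x v = stdF 𝕜 η a * S.covIn i W x v
      + ∑ c, (algebraMap ℝ 𝕜 (η c * S.connAlong i v a c)) • (stdF 𝕜 η c * W x) := by
  have hU := S.isOpen_baseSet i
  have h : CoordSmoothOn (n := n) (formBasis 𝕜 n) (fun y => stdE 𝕜 a * W y) (S.baseSet i) :=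
    smooth_mul (CoordSmoothOn.const _) hW
  simp only [stdF_mul]
  rw [S.covIn_smul _ hU hx h, S.covIn_stdE_mul hU hx hW, smul_add, Finset.smul_sum]
  congr 1
  refine Finset.sum_congr rfl fun c _ => ?_
  rw [smul_smul, smul_smul, ← map_mul, ← map_mul]
  congr 2
  linear_combination S.connAlong i v a c * S.sign_mul_self a
    - S.connAlong i v a c * S.sign_mul_self c

/-- The Ricci identity for a form whose derivative is `i_X A + X ∧ B`. -/
theorem covIn_commutator_pair (hx : x ∈ S.baseSet i)
    (hW : CoordSmoothOn (n := n) (formBasis 𝕜 n) W (S.baseSet i))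
    (hA : CoordSmoothOn (n := n) (formBasis 𝕜 n) A (S.baseSet i))
    (hB : CoordSmoothOn (n := n) (formBasis 𝕜 n) B (S.baseSet i))
    (h : ∀ y ∈ S.baseSet i, ∀ a, S.covIn i W y (S.frame i a y)
      = stdI 𝕜 a (A y) + stdF 𝕜 η a * B y) (a b : Fin n) :
    stdI 𝕜 b (S.covIn i A x (S.frame i a x)) - stdI 𝕜 a (S.covIn i A x (S.frame i b x))
      + stdF 𝕜 η b * S.covIn i B x (S.frame i a x) - stdF 𝕜 η a * S.covIn i B x (S.frame i b x)
      = -∑ c, ∑ d, (algebraMap ℝ 𝕜 (η d * S.riem i a b c d x)) •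
        (stdE 𝕜 c * stdI 𝕜 d (W x)) := by
  have hU := S.isOpen_baseSet i
  have e : ∀ a b, S.covIn i (fun y => S.covIn i W y (S.frame i b y)) x (S.frame i a x)
      = stdI 𝕜 b (S.covIn i A x (S.frame i a x)) + stdF 𝕜 η b * S.covIn i B x (S.frame i a x)
      + ∑ c, (algebraMap ℝ 𝕜 (η c * S.connCoeff i a b c x)) •
        (stdI 𝕜 c (A x) + stdF 𝕜 η c * B x) := by
    intro a b
    rw [S.covIn_congr hU hx (fun y hy => h y hy b), S.covIn_add hU hx (smooth_stdI hA b)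
      (S.smooth_stdF_mul hB b), S.covIn_stdI hU hx hA, S.covIn_stdF_mul hx hB]
    simp only [S.connAlong_frame hx, smul_add, Finset.sum_add_distrib]
    abel
  rw [← S.covIn_commutator hx hW, e, e]
  simp only [h x hx, ← S.connCoeff_sub, mul_sub, map_sub, sub_smul, Finset.sum_sub_distrib]
  abel

theorem HasConstantCurvature.covIn_commutator_pair {S : SpinStructure g η ι} {c : ℝ}
    (hc : S.HasConstantCurvature c) (hx : x ∈ S.baseSet i)
    (hW : CoordSmoothOn (n := n) (formBasis 𝕜 n) W (S.baseSet i))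
    (hA : CoordSmoothOn (n := n) (formBasis 𝕜 n) A (S.baseSet i))
    (hB : CoordSmoothOn (n := n) (formBasis 𝕜 n) B (S.baseSet i))
    (h : ∀ y ∈ S.baseSet i, ∀ a, S.covIn i W y (S.frame i a y)
      = stdI 𝕜 a (A y) + stdF 𝕜 η a * B y) (a b : Fin n) :
    stdI 𝕜 b (S.covIn i A x (S.frame i a x)) - stdI 𝕜 a (S.covIn i A x (S.frame i b x))
      + stdF 𝕜 η b * S.covIn i B x (S.frame i a x) - stdF 𝕜 η a * S.covIn i B x (S.frame i b x)
      = -(algebraMap ℝ 𝕜 c • (stdF 𝕜 η b * stdI 𝕜 a (W x) - stdF 𝕜 η a * stdI 𝕜 b (W x))) := by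
  rw [S.covIn_commutator_pair hx hW hA hB h]
  congr 1
  have e : ∀ c' d, (algebraMap ℝ 𝕜 (η d * S.riem i a b c' d x)) • (stdE 𝕜 c' * stdI 𝕜 d (W x))
      = (if b = c' then algebraMap ℝ 𝕜 (c * η b) else 0) • (if a = d then (1 : 𝕜) else 0) •
          (stdE 𝕜 c' * stdI 𝕜 d (W x))
        - (if a = c' then algebraMap ℝ 𝕜 (c * η a) else 0) • (if b = d then (1 : 𝕜) else 0) •
          (stdE 𝕜 c' * stdI 𝕜 d (W x)) := by
    intro c' d
    rw [hc i x hx, S.orthonormal i x hx, S.orthonormal i x hx, S.orthonormal i x hx,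
      S.orthonormal i x hx, smul_smul, smul_smul, ← sub_smul]
    congr 1
    have h1 : ∀ a d, η d * (if a = d then η a else 0) = if a = d then 1 else 0 := by
      intro a d
      by_cases h : a = d
      · subst h; simp [S.sign_mul_self]
      · simp [h]
    rw [show η d * (c * ((if b = c' then η b else 0) * (if a = d then η a else 0)
        - (if a = c' then η a else 0) * (if b = d then η b else 0)))
      = c * (if b = c' then η b else 0) * (η d * (if a = d then η a else 0))
        - c * (if a = c' then η a else 0) * (η d * (if b = d then η b else 0)) by ring, h1, h1]
    simp only [map_sub, map_mul]
    split_ifs <;> simp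
  have e2 : ∀ (u : 𝕜) (a b : Fin n) (Y : Fin n → Fin n → ExteriorAlgebra 𝕜 (Fin n → 𝕜)),
      ∑ c', ∑ d, (if b = c' then u else 0) • (if a = d then (1 : 𝕜) else 0) • Y c' d
        = u • Y b a := by
    intro u a b Y
    rw [Finset.sum_eq_single b, Finset.sum_eq_single a]
    · simp
    · intro d _ hd; simp [Ne.symm hd]
    · simp
    · intro d _ hd; simp [Ne.symm hd]
    · simp
  simp only [e, Finset.sum_sub_distrib]
  rw [e2, e2, stdF_mul, stdF_mul, map_mul, map_mul]
  module

/-- On a space of constant curvature the conformal Killing-Yano equation closes up to the prolonged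
system. -/
theorem HasConstantCurvature.prolongedSystem {S : SpinStructure g η ι} {c k : ℝ} {p : ℕ}
    {w : FormField 𝕜 n M} (hc : S.HasConstantCurvature c) (hk : c = -2 * k) (hn : 3 ≤ n)
    (hp : 1 ≤ p) (hpn : p < n) (h : S.IsCKY p w) :
    ∃ τ, S.ProlongedSystem (algebraMap ℝ 𝕜 k) p w (S.curl p w) (S.divergence p w) τ := by
  set κ := algebraMap ℝ 𝕜 k with hκ
  have hcκ : algebraMap ℝ 𝕜 c = -2 * κ := by rw [hk, map_mul, map_neg, map_ofNat]
  have hnp : (n : 𝕜) - p ≠ 0 := by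
    rw [← Nat.cast_sub hpn.le]; exact_mod_cast (by omega : n - p ≠ 0)
  have sw := h.1
  have sm := h.1.curl
  have sf := h.1.divergence
  set μ := S.curl p w
  set φ := S.divergence p w
  set τ : FormField 𝕜 n M := -(1 / ((n : 𝕜) - p)) • S.coDeriv μ - κ • w with hτ
  have st : S.IsSmoothForm p τ := (sm.coDeriv.smul _).sub (sw.smul _)
  have D1 : ∀ i, ∀ y ∈ S.baseSet i, ∀ a, S.covIn i (S.locForm i w) y (S.frame i a y)
      = stdI 𝕜 a (S.locForm i μ y) + stdF 𝕜 η a * S.locForm i φ y := fun i y hy a => h.covIn_eq hy a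
  have key : ∀ i, ∀ x ∈ S.baseSet i, ∀ a,
      S.covIn i (S.locForm i μ) x (S.frame i a x)
        = stdF 𝕜 η a * (S.locForm i τ x + κ • S.locForm i w x) ∧
      S.covIn i (S.locForm i φ) x (S.frame i a x)
        = -stdI 𝕜 a (S.locForm i τ x - κ • S.locForm i w x) := by
    intro i x hx a
    have hR := fun a b => hc.covIn_commutator_pair hx (sw.smooth i) (sm.smooth i) (sf.smooth i)
      (D1 i) a b
    have hν : ∑ b, algebraMap ℝ 𝕜 (η b) • stdI 𝕜 b (S.covIn i (S.locForm i μ) x (S.frame i b x)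
        - κ • (stdF 𝕜 η b * S.locForm i w x)) = ((n : 𝕜) - p) • S.locForm i τ x := by
      simp only [map_sub, smul_sub, Finset.sum_sub_distrib, map_smul, smul_comm _ κ]
      rw [← Finset.smul_sum, S.sum_stdI_stdF_mul_self (sw.mem i x)]
      have e := toFrame_coDeriv sm hx
      have e' : S.locForm i τ x = -(1 / ((n : 𝕜) - p)) • S.toFrame i x (S.coDeriv μ x)
          - κ • S.locForm i w x :=
        (map_sub (S.toFrame i x) _ _).trans (congrArg₂ (· - ·)
          (map_smul (S.toFrame i x) _ (S.coDeriv μ x)) (map_smul (S.toFrame i x) κ (w x)))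
      rw [e', e, smul_sub, smul_neg, neg_smul, neg_neg, smul_smul, smul_smul, smul_smul,
        mul_one_div_cancel hnp, one_smul, mul_comm κ]
    obtain ⟨h1, h2⟩ := S.trace_part_of_integrability (p := p) hp hpn.le
      (N := fun a => S.covIn i (S.locForm i μ) x (S.frame i a x)
        - κ • (stdF 𝕜 η a * S.locForm i w x))
      (P := fun a => S.covIn i (S.locForm i φ) x (S.frame i a x) - κ • stdI 𝕜 a (S.locForm i w x))
      (fun a => Submodule.sub_mem _ (covIn_mem hx sm _)
        (Submodule.smul_mem _ _ (stdF_mul_mem a (sw.mem i x))))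
      (fun a => Submodule.sub_mem _ (covIn_mem hx sf _)
        (Submodule.smul_mem _ _ (stdI_mem (sw.mem i x) a)))
      (fun a b => by
        have := hR a b
        have hab : (if b = a then algebraMap ℝ 𝕜 (η b) else 0)
            = (if a = b then algebraMap ℝ 𝕜 (η a) else 0) := by
          by_cases h : a = b
          · subst h; rfl
          · rw [if_neg h, if_neg (Ne.symm h)]
        simp only [map_sub, map_smul, mul_sub, mul_smul_comm, stdI_stdF_mul, hab]
        rw [hcκ] at this
        linear_combination (norm := module) this) a
    rw [hν] at h1 h2
    rw [mul_smul_comm] at h1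
    rw [map_smul, ← smul_neg] at h2
    have h1' := smul_right_injective _ hnp h1
    have h2' := smul_right_injective _ hnp h2
    constructor
    · rw [mul_add, mul_smul_comm, ← h1']; abel
    · rw [map_sub, map_smul, neg_sub, sub_eq_add_neg, ← h2']; abel
  refine ⟨τ, sw, sm, sf, st, D1, fun i x hx a => (key i x hx a).1,
    fun i x hx a => (key i x hx a).2, fun i x hx a => ?_⟩
  have hU := S.isOpen_baseSet i
  have sB := (st.smooth i).add (smooth_smul κ (sw.smooth i))
  have sA := smooth_smul (-1) (smooth_sub (st.smooth i) (smooth_smul κ (sw.smooth i)))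
  have s0 : CoordSmoothOn (n := n) (formBasis 𝕜 n)
      (fun _ : M => (0 : ExteriorAlgebra 𝕜 (Fin n → 𝕜))) (S.baseSet i) := CoordSmoothOn.const 0
  have z0 : ∀ v : TangentSpace 𝓘(ℝ, Model n) x,
      S.covIn i (fun _ : M => (0 : ExteriorAlgebra 𝕜 (Fin n → 𝕜))) x v = 0 := fun v => by
    simp [covIn, coordDeriv_const]
  have R1 := fun a b => hc.covIn_commutator_pair hx (sm.smooth i) s0 sB (fun y hy a => by
    rw [(key i y hy a).1, map_zero, zero_add]) a b
  have R2 := fun a b => hc.covIn_commutator_pair hx (sf.smooth i) sA s0 (fun y hy a => by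
    rw [(key i y hy a).2, mul_zero, add_zero, neg_one_smul, map_neg]) a b
  have dB : ∀ v : TangentSpace 𝓘(ℝ, Model n) x,
      S.covIn i (fun y => S.locForm i τ y + κ • S.locForm i w y) x v
      = S.covIn i (S.locForm i τ) x v + κ • S.covIn i (S.locForm i w) x v := fun v => by
    rw [S.covIn_add hU hx (st.smooth i) (smooth_smul κ (sw.smooth i)),
      S.covIn_smul κ hU hx (sw.smooth i)]
  have dA : ∀ v : TangentSpace 𝓘(ℝ, Model n) x,
      S.covIn i (fun y => (-1 : 𝕜) • (S.locForm i τ y - κ • S.locForm i w y)) x v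
      = κ • S.covIn i (S.locForm i w) x v - S.covIn i (S.locForm i τ) x v := fun v => by
    rw [S.covIn_smul _ hU hx (smooth_sub (st.smooth i) (smooth_smul κ (sw.smooth i))),
      S.covIn_sub hU hx (st.smooth i) (smooth_smul κ (sw.smooth i)),
      S.covIn_smul κ hU hx (sw.smooth i), neg_one_smul, neg_sub]
  simp only [dB, z0, map_zero, D1 i x hx, hcκ] at R1
  simp only [dA, z0, mul_zero, D1 i x hx, hcκ] at R2
  refine sub_eq_zero.1 (S.eq_zero_of_symmetric (p := p) hp hpn hn
    (Q := fun a => S.covIn i (S.locForm i τ) x (S.frame i a x)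
      - κ • (stdI 𝕜 a (S.locForm i μ x) - stdF 𝕜 η a * S.locForm i φ x)) (fun a => ?_)
    (fun a b => ?_) (fun a b => ?_) a)
  · refine Submodule.sub_mem _ (covIn_mem hx st _) (Submodule.smul_mem _ _ (Submodule.sub_mem _
      (stdI_mem (sm.mem i x) a) ?_))
    have := stdF_mul_mem (η := η) a (sf.mem i x)
    rwa [Nat.sub_add_cancel hp] at this
  · have e := R1 a b
    simp only [mul_add, mul_sub, mul_smul_comm] at e ⊢
    linear_combination (norm := module) e
  · have e := R2 a b
    have hab : (if b = a then algebraMap ℝ 𝕜 (η b) else 0)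
        = (if a = b then algebraMap ℝ 𝕜 (η a) else 0) := by
      by_cases h : a = b
      · subst h; rfl
      · rw [if_neg h, if_neg (Ne.symm h)]
    simp only [map_add, map_sub, map_smul, stdI_stdF_mul, hab] at e ⊢
    linear_combination (norm := module) -e

end ConstantCurvature

end SpinStructure

end

section

section CliffordRicci

variable {𝕜 : Type*} [RCLike 𝕜] {n : ℕ} {η : Fin n → ℝ}

theorem sum_rotate {A : Type*} [AddCommMonoid A] (G : Fin n → Fin n → Fin n → A) :
    ∑ b, ∑ c, ∑ d, G c d b = ∑ b, ∑ c, ∑ d, G b c d := by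
  rw [Finset.sum_comm]
  exact Finset.sum_congr rfl fun c _ => Finset.sum_comm

theorem sum_cliffE_mul_spinElement {R : Fin n → Fin n → Fin n → ℝ}
    (h1 : ∀ b c d, R b c d = -R b d c) (h2 : ∀ b c d, R b c d + R c d b + R d b c = 0) :
    ∑ b, cliffE 𝕜 η b * spinElement 𝕜 η (R b)
      = (1 / 2 : 𝕜) • ∑ d, (algebraMap ℝ 𝕜 (∑ c, η c * R c d c)) • cliffE 𝕜 η d := by
  set x := cliffE 𝕜 η with hx
  set r : Fin n → Fin n → Fin n → 𝕜 := fun b c d => algebraMap ℝ 𝕜 (R b c d) with hr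
  set h : Fin n → 𝕜 := fun b => algebraMap ℝ 𝕜 (η b) with hh
  have r1 : ∀ b c d, r b c d = -r b d c := fun b c d => by simp only [hr]; rw [h1, map_neg]
  have r2 : ∀ b c d, r b c d + r c d b + r d b c = 0 := fun b c d => by
    simp only [hr]; rw [← map_add, ← map_add, h2, map_zero]
  set T := ∑ b, ∑ c, ∑ d, r b c d • (x b * (x d * x c)) with hT
  have e0 : ∑ b, x b * spinElement 𝕜 η (R b) = (1 / 4 : 𝕜) • T := by
    simp only [spinElement, mul_smul_comm, Finset.mul_sum, ← Finset.smul_sum, hT, hr, hx]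
  have e1 : T = ∑ b, ∑ c, ∑ d, r c d b • (x c * (x b * x d)) :=
    (sum_rotate fun b c d => r b c d • (x b * (x d * x c))).symm
  have e2 : T = ∑ b, ∑ c, ∑ d, r d b c • (x d * (x c * x b)) :=
    (sum_rotate fun b c d => r d b c • (x d * (x c * x b)))
  have hxx : ∀ b c, x b * x c = (if b = c then 2 * h b else 0) • 1 - x c * x b :=
    cliffE_mul_cliffE
  have key : ∀ b c d, r b c d • (x b * (x d * x c)) + r c d b • (x c * (x b * x d))
      + r d b c • (x d * (x c * x b))
      = (if c = b then 2 * h c else 0) • r c d b • x d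
        - (if c = d then 2 * h c else 0) • r c d b • x b
        - (if b = d then 2 * h b else 0) • r d b c • x c
        + (if b = c then 2 * h b else 0) • r d b c • x d := by
    intro b c d
    have c1 : x c * (x b * x d) = x b * (x d * x c) + (if c = b then 2 * h c else 0) • x d
        - (if c = d then 2 * h c else 0) • x b := by
      rw [← mul_assoc, hxx c b, sub_mul, mul_assoc, hxx c d, mul_sub, smul_mul_assoc, one_mul,
        mul_smul_comm, mul_one]
      abel
    have c2 : x d * (x c * x b) = x b * (x d * x c) - (if b = d then 2 * h b else 0) • x c
        + (if b = c then 2 * h b else 0) • x d := by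
      rw [← mul_assoc (x b), hxx b d, sub_mul, mul_assoc, hxx b c, mul_sub, smul_mul_assoc, one_mul,
        mul_smul_comm, mul_one]
      abel
    have c3 : r b c d = -(r c d b + r d b c) := by linear_combination r2 b c d
    rw [c1, c2, c3]
    module
  have e3 : (3 : 𝕜) • T = ∑ b, ∑ c, ∑ d, (r b c d • (x b * (x d * x c))
      + r c d b • (x c * (x b * x d)) + r d b c • (x d * (x c * x b))) := by
    simp only [Finset.sum_add_distrib]
    rw [← hT, ← e1, ← e2]; module
  have s1 : ∑ b, ∑ c, ∑ d, (if c = b then 2 * h c else 0) • r c d b • x d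
      = (2 : 𝕜) • ∑ d, (∑ c, h c * r c d c) • x d := by
    have : ∀ b c, ∑ d, (if c = b then 2 * h c else 0) • r c d b • x d
        = if c = b then (∑ d, (2 * h b) • r b d b • x d) else 0 := by
      intro b c
      by_cases hbc : c = b
      · subst hbc; simp
      · simp [hbc]
    simp only [this, Finset.sum_ite_eq', Finset.mem_univ, if_true]
    rw [Finset.sum_comm, Finset.smul_sum]
    refine Finset.sum_congr rfl fun d _ => ?_
    rw [Finset.sum_smul, Finset.smul_sum]
    exact Finset.sum_congr rfl fun c _ => by module
  have s2 : ∑ b, ∑ c, ∑ d, (if c = d then 2 * h c else 0) • r c d b • x b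
      = -((2 : 𝕜) • ∑ d, (∑ c, h c * r c d c) • x d) := by
    rw [Finset.smul_sum, ← Finset.sum_neg_distrib]
    refine Finset.sum_congr rfl fun b _ => ?_
    rw [Finset.sum_smul, Finset.smul_sum, ← Finset.sum_neg_distrib]
    refine Finset.sum_congr rfl fun c _ => ?_
    rw [Finset.sum_eq_single c]
    · rw [if_pos rfl, r1 c c b]; module
    · intro d _ hd; rw [if_neg (Ne.symm hd), zero_smul]
    · simp
  have s3 : ∑ b, ∑ c, ∑ d, (if b = d then 2 * h b else 0) • r d b c • x c
      = -((2 : 𝕜) • ∑ d, (∑ c, h c * r c d c) • x d) := by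
    rw [Finset.sum_comm, Finset.smul_sum, ← Finset.sum_neg_distrib]
    refine Finset.sum_congr rfl fun b _ => ?_
    rw [Finset.sum_smul, Finset.smul_sum, ← Finset.sum_neg_distrib]
    refine Finset.sum_congr rfl fun c _ => ?_
    rw [Finset.sum_eq_single c]
    · rw [if_pos rfl, r1 c c b]; module
    · intro d _ hd; rw [if_neg (Ne.symm hd), zero_smul]
    · simp
  have s4 : ∑ b, ∑ c, ∑ d, (if b = c then 2 * h b else 0) • r d b c • x d = 0 := by
    refine Finset.sum_eq_zero fun b _ => Finset.sum_eq_zero fun c _ => Finset.sum_eq_zero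
      fun d _ => ?_
    by_cases hbc : b = c
    · subst hbc
      have : r d b b = 0 := by have := r1 d b b; linear_combination this / 2
      rw [this, zero_smul, smul_zero]
    · rw [if_neg hbc, zero_smul]
  simp only [key, Finset.sum_add_distrib, Finset.sum_sub_distrib] at e3
  rw [s1, s2, s3, s4] at e3
  have e4 : T = (2 : 𝕜) • ∑ d, (∑ c, h c * r c d c) • x d := by
    have : (3 : 𝕜) • T = (3 : 𝕜) • (2 : 𝕜) • ∑ d, (∑ c, h c * r c d c) • x d := by
      rw [e3]; module
    exact smul_right_injective _ (three_ne_zero : (3 : 𝕜) ≠ 0) this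
  rw [e0, e4]
  simp only [map_sum, map_mul, hh, hr]
  module

end CliffordRicci

namespace SpinStructure

variable {n : ℕ} {M : Type*} [TopologicalSpace M] [ChartedSpace (Model n) M]
  [IsManifold 𝓘(ℝ, Model n) ∞ M] {g : PseudoRiemannianMetric n M} {η : Fin n → ℝ} {ι : Type*}
  (S : SpinStructure g η ι) {i j : ι} {x : M} {𝕜 : Type*} [RCLike 𝕜]
  {Δ : Type*} [AddCommGroup Δ] [Module 𝕜 Δ]
  (ρ : CliffordAlgebra (quadForm 𝕜 η) →ₐ[𝕜] Module.End 𝕜 Δ)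

/-- The action of the exterior algebra of the model space on spinors. -/
def cliffAct : ExteriorAlgebra 𝕜 (Fin n → 𝕜) →ₗ[𝕜] Module.End 𝕜 Δ :=
  ρ.toLinearMap.comp (quantize η).toLinearMap

theorem cliffAct_apply (α : ExteriorAlgebra 𝕜 (Fin n → 𝕜)) : cliffAct ρ α = ρ (quantize η α) := rfl

variable {ρ}

theorem cliffAct_stdE (a : Fin n) : cliffAct ρ (stdE 𝕜 a) = ρ (cliffE 𝕜 η a) := by
  rw [cliffAct_apply, quantize_stdE]

theorem cliffAct_stdF (a : Fin n) :
    cliffAct ρ (stdF 𝕜 η a) = algebraMap ℝ 𝕜 (η a) • ρ (cliffE 𝕜 η a) := by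
  rw [stdF_eq, map_smul, cliffAct_stdE]

theorem cliffAct_stdF_mul' (hη : ∀ a, η a * η a = 1) (a : Fin n)
    (α : ExteriorAlgebra 𝕜 (Fin n → 𝕜)) :
    cliffAct ρ (stdF 𝕜 η a) * cliffAct ρ α = cliffAct ρ (stdF 𝕜 η a * α + stdI 𝕜 a α) := by
  rw [cliffAct_stdF, cliffAct_apply, smul_mul_assoc, ← map_mul, cliffE_mul_quantize,
    ← cliffAct_apply, ← map_smul, smul_add, smul_smul, ← map_mul, hη, map_one, one_smul, stdF_mul]

theorem cliffAct_mul_stdF' (hη : ∀ a, η a * η a = 1) (a : Fin n)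
    (α : ExteriorAlgebra 𝕜 (Fin n → 𝕜)) :
    cliffAct ρ α * cliffAct ρ (stdF 𝕜 η a)
      = cliffAct ρ (stdF 𝕜 η a * CliffordAlgebra.involute α
        - stdI 𝕜 a (CliffordAlgebra.involute α)) := by
  rw [cliffAct_stdF, cliffAct_apply, mul_smul_comm, ← map_mul, quantize_mul_cliffE,
    ← cliffAct_apply, ← map_smul, smul_sub, smul_smul, ← map_mul, hη, map_one, one_smul, stdF_mul]

include S in
theorem cliffAct_stdF_mul (a : Fin n) (α : ExteriorAlgebra 𝕜 (Fin n → 𝕜)) :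
    cliffAct ρ (stdF 𝕜 η a) * cliffAct ρ α = cliffAct ρ (stdF 𝕜 η a * α + stdI 𝕜 a α) :=
  cliffAct_stdF_mul' S.sign_mul_self a α

include S in
theorem cliffAct_mul_stdF (a : Fin n) (α : ExteriorAlgebra 𝕜 (Fin n → 𝕜)) :
    cliffAct ρ α * cliffAct ρ (stdF 𝕜 η a)
      = cliffAct ρ (stdF 𝕜 η a * CliffordAlgebra.involute α
        - stdI 𝕜 a (CliffordAlgebra.involute α)) := cliffAct_mul_stdF' S.sign_mul_self a α

theorem spinorIn_add (ψ φ : S.SpinorField Δ) :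
    S.spinorIn ρ i (ψ + φ) x = S.spinorIn ρ i ψ x + S.spinorIn ρ i φ x := map_add _ _ _

theorem spinorIn_smul (c : 𝕜) (ψ : S.SpinorField Δ) :
    S.spinorIn ρ i (c • ψ) x = c • S.spinorIn ρ i ψ x := map_smul _ _ _

variable [FiniteDimensional 𝕜 Δ]

variable (ρ) in
theorem spinorIn_cliff (hx : x ∈ S.baseSet i) (w : FormField 𝕜 n M) (ψ : S.SpinorField Δ) :
    S.spinorIn ρ i (S.cliff ρ w ψ) x = cliffAct ρ (S.locForm i w x) (S.spinorIn ρ i ψ x) :=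
  S.transition_cliffAt ρ hx (w x) (ψ x)

theorem spinor_ext {ψ φ : S.SpinorField Δ}
    (h : ∀ x, S.spinorIn ρ (S.indexAt x) ψ x = S.spinorIn ρ (S.indexAt x) φ x) : ψ = φ :=
  funext fun x => by rw [← S.spinorIn_indexAt ρ ψ, h, S.spinorIn_indexAt]

section Cov

variable {f h : M → Δ} {W : M → ExteriorAlgebra 𝕜 (Fin n → 𝕜)} {U : Set M}

theorem smooth_cliffAct (hW : CoordSmoothOn (n := n) (formBasis 𝕜 n) W U)
    (hf : CoordSmoothOn (n := n) (Module.finBasis 𝕜 Δ) f U) :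
    CoordSmoothOn (n := n) (Module.finBasis 𝕜 Δ) (fun y => cliffAct ρ (W y) (f y)) U :=
  smooth_rho ρ (smooth_quantize hW) hf

theorem smooth_spinor_smul (c : 𝕜) (hf : CoordSmoothOn (n := n) (Module.finBasis 𝕜 Δ) f U) :
    CoordSmoothOn (n := n) (Module.finBasis 𝕜 Δ) (fun y => c • f y) U :=
  CoordSmoothOn.linear (b₁ := Module.finBasis 𝕜 Δ) (c • LinearMap.id) hf

theorem spinCovIn_congr (hU : IsOpen U) (hx : x ∈ U) (h' : Set.EqOn f h U)
    (v : TangentSpace 𝓘(ℝ, Model n) x) : S.spinCovIn ρ i f x v = S.spinCovIn ρ i h x v := by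
  rw [spinCovIn, spinCovIn, coordDeriv_congr hU hx h', h' hx]

theorem spinCovIn_add (hU : IsOpen U) (hx : x ∈ U)
    (hf : CoordSmoothOn (n := n) (Module.finBasis 𝕜 Δ) f U)
    (hh : CoordSmoothOn (n := n) (Module.finBasis 𝕜 Δ) h U) (v : TangentSpace 𝓘(ℝ, Model n) x) :
    S.spinCovIn ρ i (fun y => f y + h y) x v = S.spinCovIn ρ i f x v + S.spinCovIn ρ i h x v := by
  rw [spinCovIn, coordDeriv_add hU hx hf hh, spinCovIn, spinCovIn, map_add]; abel

theorem spinCovIn_smul (c : 𝕜) (hU : IsOpen U) (hx : x ∈ U)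
    (hf : CoordSmoothOn (n := n) (Module.finBasis 𝕜 Δ) f U) (v : TangentSpace 𝓘(ℝ, Model n) x) :
    S.spinCovIn ρ i (fun y => c • f y) x v = c • S.spinCovIn ρ i f x v := by
  have h := coordDeriv_linear (b₁ := Module.finBasis 𝕜 Δ) (b₂ := Module.finBasis 𝕜 Δ) (v := v)
    (c • LinearMap.id) hU hx hf
  rw [spinCovIn, spinCovIn, map_smul, smul_add]
  exact congrArg (· + _) h

theorem spinCovIn_cliffAct (hU : IsOpen U) (hx : x ∈ U)
    (hW : CoordSmoothOn (n := n) (formBasis 𝕜 n) W U)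
    (hf : CoordSmoothOn (n := n) (Module.finBasis 𝕜 Δ) f U) (v : TangentSpace 𝓘(ℝ, Model n) x) :
    S.spinCovIn ρ i (fun y => cliffAct ρ (W y) (f y)) x v
      = cliffAct ρ (S.covIn i W x v) (f x) + cliffAct ρ (W x) (S.spinCovIn ρ i f x v) := by
  have h := coordDeriv_rho ρ hU hx (smooth_quantize (η := η) hW) hf v
  rw [cliffAct_apply, S.quantize_covIn hU hx hW, spinCovIn, spinCovIn]
  refine (congrArg (· + _) h).trans ?_
  simp only [cliffAct_apply, map_add, map_sub, map_mul, LinearMap.add_apply, LinearMap.sub_apply,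
    Module.End.mul_apply]
  abel

theorem covIn_stdF (hx : x ∈ S.baseSet i) (v : TangentSpace 𝓘(ℝ, Model n) x) (a : Fin n) :
    S.covIn i (fun _ => stdF 𝕜 η a) x v
      = ∑ c, (algebraMap ℝ 𝕜 (η c * S.connAlong i v a c)) • stdF 𝕜 η c := by
  have h := S.covIn_stdF_mul (W := fun _ => (1 : ExteriorAlgebra 𝕜 (Fin n → 𝕜))) hx
    (CoordSmoothOn.const _) v a
  have h1 : S.covIn i (fun _ => (1 : ExteriorAlgebra 𝕜 (Fin n → 𝕜))) x v = 0 := by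
    have : ∀ c, stdI 𝕜 c (1 : ExteriorAlgebra 𝕜 (Fin n → 𝕜)) = 0 := fun c =>
      CliffordAlgebra.contractLeft_one _ _
    simp [covIn, coordDeriv_const, this]
  simpa only [h1, mul_one, mul_zero, zero_add] using h

theorem spinCovIn_add_right (v w : TangentSpace 𝓘(ℝ, Model n) x) :
    S.spinCovIn ρ i f x (v + w) = S.spinCovIn ρ i f x v + S.spinCovIn ρ i f x w := by
  have h : S.connElement 𝕜 i (v + w) = S.connElement 𝕜 i v + S.connElement 𝕜 i w := by
    rw [connElement, connElement, connElement, ← spinElement_add]; simp only [connAlong_add]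
  rw [spinCovIn, coordDeriv_add_right, h, map_add, LinearMap.add_apply, spinCovIn, spinCovIn]
  abel

theorem spinCovIn_smul_right (c : ℝ) (v : TangentSpace 𝓘(ℝ, Model n) x) :
    S.spinCovIn ρ i f x (c • v) = (algebraMap ℝ 𝕜 c) • S.spinCovIn ρ i f x v := by
  have h : S.connElement 𝕜 i (c • v) = (algebraMap ℝ 𝕜 c) • S.connElement 𝕜 i v := by
    rw [connElement, connElement, ← spinElement_smul]; simp only [connAlong_smul]
  rw [spinCovIn, coordDeriv_smul_right, h, map_smul, LinearMap.smul_apply, spinCovIn, smul_add]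

theorem smooth_spinCovIn (hf : CoordSmoothOn (n := n) (Module.finBasis 𝕜 Δ) f (S.baseSet i))
    (a : Fin n) : CoordSmoothOn (n := n) (Module.finBasis 𝕜 Δ)
      (fun y => S.spinCovIn ρ i f y (S.frame i a y)) (S.baseSet i) :=
  S.smooth_actCov (r := ρ.toLinearMap) hf a

/-- The Ricci identity for a spinor with `∇_X f = X . h`. -/
theorem spinCovIn_commutator (hx : x ∈ S.baseSet i)
    (hf : CoordSmoothOn (n := n) (Module.finBasis 𝕜 Δ) f (S.baseSet i))
    (hh : CoordSmoothOn (n := n) (Module.finBasis 𝕜 Δ) h (S.baseSet i))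
    (H : ∀ y ∈ S.baseSet i, ∀ a, S.spinCovIn ρ i f y (S.frame i a y)
      = cliffAct ρ (stdF 𝕜 η a) (h y)) (a b : Fin n) :
    cliffAct ρ (stdF 𝕜 η b) (S.spinCovIn ρ i h x (S.frame i a x))
      - cliffAct ρ (stdF 𝕜 η a) (S.spinCovIn ρ i h x (S.frame i b x))
      = ρ (spinElement 𝕜 η fun c d => S.riem i a b c d x) (f x) := by
  have hU := S.isOpen_baseSet i
  have e : ∀ a b, S.spinCovIn ρ i (fun y => S.spinCovIn ρ i f y (S.frame i b y)) x (S.frame i a x)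
      = cliffAct ρ (stdF 𝕜 η b) (S.spinCovIn ρ i h x (S.frame i a x))
      + ∑ c, (algebraMap ℝ 𝕜 (η c * S.connCoeff i a b c x)) • cliffAct ρ (stdF 𝕜 η c) (h x) := by
    intro a b
    rw [S.spinCovIn_congr hU hx (fun y hy => H y hy b),
      S.spinCovIn_cliffAct hU hx (CoordSmoothOn.const _) hh, S.covIn_stdF hx, add_comm]
    simp only [map_sum, map_smul, LinearMap.sum_apply, LinearMap.smul_apply, S.connAlong_frame hx]
  have hcomm := S.actCov_commutator (r := ρ.toLinearMap) (bW := Module.finBasis 𝕜 Δ)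
    (fun y z => by
      simp only [AlgHom.toLinearMap_apply, map_sub, map_mul]) hx hf a b
  have e' : ∀ a b, S.actCov (Module.finBasis 𝕜 Δ) ρ.toLinearMap i
      (fun y => S.actCov (Module.finBasis 𝕜 Δ) ρ.toLinearMap i f y (S.frame i b y)) x (S.frame i a x)
      = _ := e
  have H' : ∀ a, S.actCov (Module.finBasis 𝕜 Δ) ρ.toLinearMap i f x (S.frame i a x) = _ := H x hx
  rw [e', e'] at hcomm
  simp only [H', ← S.connCoeff_sub, mul_sub, map_sub, sub_smul, Finset.sum_sub_distrib] at hcomm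
  refine Eq.trans ?_ hcomm
  abel

end Cov

end SpinStructure

end

section

namespace SpinStructure

variable {n : ℕ} {M : Type*} [TopologicalSpace M] [ChartedSpace (Model n) M]
  [IsManifold 𝓘(ℝ, Model n) ∞ M] {g : PseudoRiemannianMetric n M} {η : Fin n → ℝ} {ι : Type*}
  {S : SpinStructure g η ι} {i j : ι} {x : M} {𝕜 : Type*} [RCLike 𝕜]
  {Δ : Type*} [AddCommGroup Δ] [Module 𝕜 Δ] [FiniteDimensional 𝕜 Δ]
  {ρ : CliffordAlgebra (quadForm 𝕜 η) →ₐ[𝕜] Module.End 𝕜 Δ} {ψ φ χ : S.SpinorField Δ}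

theorem IsSmoothSpinor.add (hψ : S.IsSmoothSpinor ρ ψ) (hφ : S.IsSmoothSpinor ρ φ) :
    S.IsSmoothSpinor ρ (ψ + φ) := fun i =>
  ((hψ i).add (hφ i)).congr fun _ _ => S.spinorIn_add ψ φ

theorem IsSmoothSpinor.smul (c : 𝕜) (hψ : S.IsSmoothSpinor ρ ψ) : S.IsSmoothSpinor ρ (c • ψ) :=
  fun i => (smooth_spinor_smul c (hψ i)).congr fun _ _ => S.spinorIn_smul c ψ

theorem IsSmoothSpinor.zero : S.IsSmoothSpinor ρ (0 : S.SpinorField Δ) := fun _ =>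
  (CoordSmoothOn.const 0).congr fun _ _ => map_zero _

theorem IsSmoothSpinor.cliff {p : ℕ} {w : FormField 𝕜 n M} (hw : S.IsSmoothForm p w)
    (hψ : S.IsSmoothSpinor ρ ψ) : S.IsSmoothSpinor ρ (S.cliff ρ w ψ) := fun i =>
  (smooth_cliffAct (hw.smooth i) (hψ i)).congr fun _ hy => S.spinorIn_cliff ρ hy w ψ

theorem spinorIn_dirac (hψ : S.IsSmoothSpinor ρ ψ) (hx : x ∈ S.baseSet i) :
    S.spinorIn ρ i (S.dirac ρ ψ) x
      = ∑ a, cliffAct ρ (stdE 𝕜 a) (S.spinCovIn ρ i (S.spinorIn ρ i ψ) x (S.frame i a x)) := by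
  have h := S.trace_frame' (fun u v => S.cliffAt ρ (S.flat 𝕜 u) (S.spinNabla ρ ψ v))
    (fun u u' v => by rw [flat_add, cliffAt, map_add, map_add, map_add]; rfl)
    (fun u v v' => by rw [spinNabla_eq, spinCovIn_add_right, ← spinNabla_eq, ← spinNabla_eq]
                      exact map_add _ _ _)
    (fun c u v => by
      rw [spinNabla_eq, spinNabla_eq, spinCovIn_smul_right, flat_smul, cliffAt, cliffAt, map_smul,
        map_smul, map_smul, map_smul, LinearMap.smul_apply])
    (S.mem_baseSet_at x) hx
  simp only [← coframe_eq_flat] at h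
  have h2 : S.dirac ρ ψ x = _ := h
  change ρ (S.transition 𝕜 i (S.indexAt x) x) (S.dirac ρ ψ x) = _
  rw [h2, map_sum]
  refine Finset.sum_congr rfl fun a _ => ?_
  rw [S.transition_cliffAt ρ hx, S.transition_spinNabla ρ hx hψ, S.toFrame_coframe hx]
  rfl

theorem IsSmoothSpinor.dirac (hψ : S.IsSmoothSpinor ρ ψ) : S.IsSmoothSpinor ρ (S.dirac ρ ψ) := by
  intro i
  have h : CoordSmoothOn (n := n) (Module.finBasis 𝕜 Δ) (fun y => ∑ a, cliffAct ρ (stdE 𝕜 a)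
      (S.spinCovIn ρ i (S.spinorIn ρ i ψ) y (S.frame i a y))) (S.baseSet i) :=
    CoordSmoothOn.sum Finset.univ fun a =>
      smooth_cliffAct (CoordSmoothOn.const _) (S.smooth_spinCovIn (hψ i) a)
  exact h.congr fun y hy => spinorIn_dirac hψ hy

variable (S ρ i ψ φ) in
theorem spinorIn_add_fun : S.spinorIn ρ i (ψ + φ)
    = fun y => S.spinorIn ρ i ψ y + S.spinorIn ρ i φ y := funext fun _ => S.spinorIn_add ψ φ

variable (S ρ i ψ) in
theorem spinorIn_smul_fun (c : 𝕜) : S.spinorIn ρ i (c • ψ) = fun y => c • S.spinorIn ρ i ψ y :=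
  funext fun _ => S.spinorIn_smul c ψ

theorem dirac_add (hψ : S.IsSmoothSpinor ρ ψ) (hφ : S.IsSmoothSpinor ρ φ) :
    S.dirac ρ (ψ + φ) = S.dirac ρ ψ + S.dirac ρ φ := by
  refine S.spinor_ext (ρ := ρ) fun x => ?_
  have hx := S.mem_baseSet_at x
  rw [spinorIn_add, spinorIn_dirac (hψ.add hφ) hx, spinorIn_dirac hψ hx, spinorIn_dirac hφ hx,
    ← Finset.sum_add_distrib]
  refine Finset.sum_congr rfl fun a _ => ?_
  rw [← map_add, ← S.spinCovIn_add (S.isOpen_baseSet _) hx (hψ _) (hφ _), spinorIn_add_fun]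

theorem dirac_smul (c : 𝕜) (hψ : S.IsSmoothSpinor ρ ψ) :
    S.dirac ρ (c • ψ) = c • S.dirac ρ ψ := by
  refine S.spinor_ext (ρ := ρ) fun x => ?_
  have hx := S.mem_baseSet_at x
  rw [spinorIn_smul, spinorIn_dirac (hψ.smul c) hx, spinorIn_dirac hψ hx, Finset.smul_sum]
  refine Finset.sum_congr rfl fun a _ => ?_
  rw [← map_smul, ← S.spinCovIn_smul c (S.isOpen_baseSet _) hx (hψ _), spinorIn_smul_fun]

include S in
theorem cliffAct_stdE_stdF (a : Fin n) (f : Δ) :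
    cliffAct ρ (stdE 𝕜 a) (cliffAct ρ (stdF 𝕜 η a) f) = f := by
  rw [cliffAct_stdE, cliffAct_stdF, LinearMap.smul_apply, map_smul, ← Module.End.mul_apply,
    ← map_mul, cliffE_mul_self, map_smul, map_one, LinearMap.smul_apply, Module.End.one_apply,
    smul_smul, S.sgnCoeff_mul_self, one_smul]

theorem dirac_eq_smul (hn : 0 < n) (hψ : S.IsSmoothSpinor ρ ψ)
    (h : ∀ i, ∀ x ∈ S.baseSet i, ∀ a, S.spinCovIn ρ i (S.spinorIn ρ i ψ) x (S.frame i a x)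
      = cliffAct ρ (stdF 𝕜 η a) (S.spinorIn ρ i χ x)) : χ = (1 / (n : 𝕜)) • S.dirac ρ ψ := by
  refine S.spinor_ext (ρ := ρ) fun x => ?_
  have hx := S.mem_baseSet_at x
  have hn' : (n : 𝕜) ≠ 0 := by exact_mod_cast hn.ne'
  rw [spinorIn_smul, spinorIn_dirac hψ hx]
  simp only [h _ x hx, S.cliffAct_stdE_stdF, Finset.sum_const, Finset.card_univ, Fintype.card_fin,
    ← Nat.cast_smul_eq_nsmul 𝕜, smul_smul]
  rw [one_div_mul_cancel hn', one_smul]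

theorem isTwistorSpinor_of_frame (hn : 0 < n) (hψ : S.IsSmoothSpinor ρ ψ)
    (h : ∀ i, ∀ x ∈ S.baseSet i, ∀ a, S.spinCovIn ρ i (S.spinorIn ρ i ψ) x (S.frame i a x)
      = cliffAct ρ (stdF 𝕜 η a) (S.spinorIn ρ i χ x)) : S.IsTwistorSpinor ρ ψ := by
  refine ⟨hψ, fun x v => ?_⟩
  have hx := S.mem_baseSet_at x
  have hχ := congrFun (dirac_eq_smul hn hψ h) x
  rw [Pi.smul_apply] at hχ
  have e : (1 / (n : 𝕜)) • S.cliffAt ρ (S.flat 𝕜 v) (S.dirac ρ ψ x)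
      = S.cliffAt ρ (S.flat 𝕜 v) (χ x) := by
    rw [hχ]; exact (map_smul _ _ _).symm
  have e1 : S.spinNabla ρ ψ (∑ a, S.comp (S.indexAt x) v a • S.frame (S.indexAt x) a x)
      = ∑ a, S.spinNabla ρ ψ (S.comp (S.indexAt x) v a • S.frame (S.indexAt x) a x) :=
    map_sum (AddMonoidHom.mk' (fun u : TangentSpace 𝓘(ℝ, Model n) x => S.spinNabla ρ ψ u)
      fun u u' => by simp only [spinNabla_eq, spinCovIn_add_right]) _ _
  have e2 : S.cliffAt ρ (S.flat 𝕜 (∑ a, S.comp (S.indexAt x) v a • S.frame (S.indexAt x) a x)) (χ x)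
      = ∑ a, S.cliffAt ρ (S.flat 𝕜 (S.comp (S.indexAt x) v a • S.frame (S.indexAt x) a x)) (χ x) :=
    map_sum (AddMonoidHom.mk' (fun u : TangentSpace 𝓘(ℝ, Model n) x =>
      S.cliffAt ρ (S.flat 𝕜 u) (χ x)) fun u u' => by
        rw [flat_add, cliffAt, map_add, map_add, map_add]; rfl) _ _
  rw [S.sum_comp_smul_frame hx] at e1 e2
  rw [e, e1, e2]
  refine Finset.sum_congr rfl fun a _ => ?_
  rw [spinNabla_eq, spinCovIn_smul_right, h _ x hx, flat_smul, cliffAt, map_smul, map_smul,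
    map_smul, LinearMap.smul_apply, toFrame_flat_frame_eq hx, S.spinorIn_indexAt]
  rfl

theorem IsTwistorSpinor.spinCovIn_eq (h : S.IsTwistorSpinor ρ ψ) (hx : x ∈ S.baseSet i)
    (a : Fin n) : S.spinCovIn ρ i (S.spinorIn ρ i ψ) x (S.frame i a x)
      = cliffAct ρ (stdF 𝕜 η a) (S.spinorIn ρ i ((1 / (n : 𝕜)) • S.dirac ρ ψ) x) := by
  rw [← S.transition_spinNabla ρ hx h.1, h.2, map_smul, S.transition_cliffAt ρ hx,
    toFrame_flat_frame_eq hx, spinorIn_smul, map_smul]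
  rfl

variable (S ρ) in
/-- The space of twistor spinors. -/
def twistorSpinors (hn : 0 < n) : Submodule 𝕜 (S.SpinorField Δ) where
  carrier := {ψ | S.IsTwistorSpinor ρ ψ}
  add_mem' := fun {ψ φ} h₁ h₂ => isTwistorSpinor_of_frame hn (h₁.1.add h₂.1)
    (χ := (1 / (n : 𝕜)) • S.dirac ρ ψ + (1 / (n : 𝕜)) • S.dirac ρ φ) fun i x hx a => by
      rw [spinorIn_add, map_add, ← h₁.spinCovIn_eq hx, ← h₂.spinCovIn_eq hx,
        ← S.spinCovIn_add (S.isOpen_baseSet i) hx (h₁.1 i) (h₂.1 i), spinorIn_add_fun]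
  zero_mem' := isTwistorSpinor_of_frame hn IsSmoothSpinor.zero (χ := 0) fun i x hx a => by
    have h : S.spinorIn ρ i (0 : S.SpinorField Δ) = fun _ => 0 := funext fun y => map_zero _
    rw [h, spinCovIn, coordDeriv_const, map_zero, map_zero, add_zero]
  smul_mem' := fun c ψ h => isTwistorSpinor_of_frame hn (h.1.smul c)
    (χ := c • (1 / (n : 𝕜)) • S.dirac ρ ψ) fun i x hx a => by
      rw [spinorIn_smul, map_smul, ← h.spinCovIn_eq hx,
        ← S.spinCovIn_smul c (S.isOpen_baseSet i) hx (h.1 i), spinorIn_smul_fun]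

theorem mem_twistorSpinors {hn : 0 < n} : ψ ∈ S.twistorSpinors ρ hn ↔ S.IsTwistorSpinor ρ ψ :=
  Iff.rfl

include S in
theorem cliffE_mul_sum_swap (a : Fin n) (h : Fin n → Δ) :
    ∑ b, cliffAct ρ (stdE 𝕜 b) (cliffAct ρ (stdF 𝕜 η a) (h b))
      = (2 : 𝕜) • h a - cliffAct ρ (stdF 𝕜 η a) (∑ b, cliffAct ρ (stdE 𝕜 b) (h b)) := by
  have e : ∀ b, cliffAct ρ (stdE 𝕜 b) (cliffAct ρ (stdF 𝕜 η a) (h b))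
      = (if b = a then (2 : 𝕜) else 0) • h b
        - cliffAct ρ (stdF 𝕜 η a) (cliffAct ρ (stdE 𝕜 b) (h b)) := by
    intro b
    rw [cliffAct_stdE, cliffAct_stdF, LinearMap.smul_apply, map_smul, ← Module.End.mul_apply,
      ← map_mul, cliffE_mul_cliffE, map_sub, map_smul, map_one, map_mul, LinearMap.sub_apply,
      LinearMap.smul_apply, Module.End.one_apply, Module.End.mul_apply, smul_sub, smul_smul,
      LinearMap.smul_apply]
    congr 2
    by_cases hb : b = a
    · subst hb
      rw [if_pos rfl, if_pos rfl, mul_left_comm, S.sgnCoeff_mul_self, mul_one]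
    · rw [if_neg hb, if_neg hb, mul_zero]
  simp only [e, Finset.sum_sub_distrib, ite_smul, zero_smul, Finset.sum_ite_eq', Finset.mem_univ,
    if_true, map_sum]

theorem sum_cliffE_mul_curvature {l : ℝ} (hE : S.IsEinstein l) (hx : x ∈ S.baseSet i) (a : Fin n) :
    ∑ b, cliffE 𝕜 η b * spinElement 𝕜 η (fun c d => S.riem i a b c d x)
      = (-(algebraMap ℝ 𝕜 l) / 2 * algebraMap ℝ 𝕜 (η a)) • cliffE 𝕜 η a := by
  rw [sum_cliffE_mul_spinElement (fun b c d => S.riem_swap_right hx a b c d)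
    (fun b c d => S.riem_cyclic_right hx a b c d)]
  have h : ∀ d, ∑ c, η c * S.riem i a c d c x = if a = d then -(l * η a) else 0 := by
    intro d
    have h1 : ∑ c, η c * S.riem i a c d c x = -S.ricci i a d x := by
      rw [ricci, ← Finset.sum_neg_distrib]
      exact Finset.sum_congr rfl fun c _ => by rw [S.riem_swap_left a c d c x]; ring
    rw [h1, hE i x hx, S.orthonormal i x hx]
    split_ifs <;> simp
  simp only [h]
  rw [Finset.sum_eq_single a]
  · rw [if_pos rfl, smul_smul, map_neg, map_mul]
    congr 1; ring
  · intro d _ hd; rw [if_neg (Ne.symm hd), map_zero, zero_smul]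
  · simp

/-- The second twistor equation on Einstein spaces. -/
theorem IsTwistorSpinor.spinCovIn_dirac {l k : ℝ} (hE : S.IsEinstein l) (hn : 3 ≤ n)
    (hk : k = -(l / (2 * ((n : ℝ) - 1)))) (h : S.IsTwistorSpinor ρ ψ) (hx : x ∈ S.baseSet i)
    (a : Fin n) :
    S.spinCovIn ρ i (S.spinorIn ρ i ((1 / (n : 𝕜)) • S.dirac ρ ψ)) x (S.frame i a x)
      = (algebraMap ℝ 𝕜 k / 2) • cliffAct ρ (stdF 𝕜 η a) (S.spinorIn ρ i ψ x) := by
  have sχ : S.IsSmoothSpinor ρ ((1 / (n : 𝕜)) • S.dirac ρ ψ) := h.1.dirac.smul _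
  set χ := (1 / (n : 𝕜)) • S.dirac ρ ψ
  set f := S.spinorIn ρ i ψ x
  set H : Fin n → Δ := fun a => S.spinCovIn ρ i (S.spinorIn ρ i χ) x (S.frame i a x)
  have n1 : (n : 𝕜) - 1 ≠ 0 := by
    rw [← Nat.cast_one, ← Nat.cast_sub (by omega)]; exact_mod_cast (by omega : n - 1 ≠ 0)
  have n2 : (n : 𝕜) - 2 ≠ 0 := by
    rw [← Nat.cast_two, ← Nat.cast_sub (by omega)]; exact_mod_cast (by omega : n - 2 ≠ 0)
  set L := algebraMap ℝ 𝕜 l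
  have hkL : algebraMap ℝ 𝕜 k = -(L / (2 * ((n : 𝕜) - 1))) := by
    rw [hk]; simp [L, map_ofNat]
  have R : ∀ a, ((n : 𝕜) - 2) • H a + cliffAct ρ (stdF 𝕜 η a) (∑ b, cliffAct ρ (stdE 𝕜 b) (H b))
      = (-L / 2) • cliffAct ρ (stdF 𝕜 η a) f := by
    intro a
    have h1 := Finset.sum_congr (rfl : Finset.univ = Finset.univ) fun b _ =>
      congrArg (cliffAct ρ (stdE 𝕜 b)) (S.spinCovIn_commutator hx (h.1 i) (sχ i)
        (fun y hy a => h.spinCovIn_eq hy a) a b)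
    simp only [map_sub, S.cliffAct_stdE_stdF, Finset.sum_sub_distrib] at h1
    have h2 : ∑ b, cliffAct ρ (stdE 𝕜 b) (ρ (spinElement 𝕜 η fun c d => S.riem i a b c d x) f)
        = (-L / 2) • cliffAct ρ (stdF 𝕜 η a) f := by
      have e := congrArg (fun z => ρ z f) (sum_cliffE_mul_curvature (𝕜 := 𝕜) hE hx a)
      simp only [map_sum, map_mul, LinearMap.sum_apply, Module.End.mul_apply, map_smul,
        LinearMap.smul_apply] at e
      simp only [cliffAct_stdE, cliffAct_stdF, LinearMap.smul_apply, smul_smul]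
      exact e
    rw [S.cliffE_mul_sum_swap a H, h2] at h1
    simp only [Finset.sum_const, Finset.card_univ, Fintype.card_fin,
      ← Nat.cast_smul_eq_nsmul 𝕜] at h1
    rw [← h1]
    module
  have D : ∑ b, cliffAct ρ (stdE 𝕜 b) (H b) = (-(L * n) / (4 * ((n : 𝕜) - 1))) • f := by
    have h1 := Finset.sum_congr (rfl : Finset.univ = Finset.univ) fun b _ =>
      congrArg (cliffAct ρ (stdE 𝕜 b)) (R b)
    simp only [map_add, map_smul, S.cliffAct_stdE_stdF, Finset.sum_add_distrib, ← Finset.smul_sum,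
      Finset.sum_const, Finset.card_univ, Fintype.card_fin, ← Nat.cast_smul_eq_nsmul 𝕜] at h1
    have h2 : (2 * ((n : 𝕜) - 1)) • ∑ b, cliffAct ρ (stdE 𝕜 b) (H b)
        = (2 * ((n : 𝕜) - 1)) • (-(L * n) / (4 * ((n : 𝕜) - 1))) • f := by
      rw [smul_smul, show (2 * ((n : 𝕜) - 1)) * (-(L * n) / (4 * ((n : 𝕜) - 1))) = -L / 2 * n by
        field_simp; ring]
      linear_combination (norm := module) h1
    exact smul_right_injective _ (mul_ne_zero two_ne_zero n1) h2
  have h3 := R a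
  rw [D, map_smul] at h3
  have h4 : ((n : 𝕜) - 2) • H a
      = ((n : 𝕜) - 2) • (algebraMap ℝ 𝕜 k / 2) • cliffAct ρ (stdF 𝕜 η a) f := by
    rw [eq_sub_of_add_eq h3, ← sub_smul, smul_smul, hkL]
    congr 1
    field_simp
    ring
  exact smul_right_injective _ n2 h4

end SpinStructure

end

section

namespace SpinStructure

variable {n : ℕ} {M : Type*} [TopologicalSpace M] [ChartedSpace (Model n) M]
  [IsManifold 𝓘(ℝ, Model n) ∞ M] {g : PseudoRiemannianMetric n M} {η : Fin n → ℝ} {ι : Type*}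
  {S : SpinStructure g η ι} {i j : ι} {x : M} {𝕜 : Type*} [RCLike 𝕜]
  {Δ : Type*} [AddCommGroup Δ] [Module 𝕜 Δ]
  {ρ : CliffordAlgebra (quadForm 𝕜 η) →ₐ[𝕜] Module.End 𝕜 Δ} {ψ ψ' : S.SpinorField Δ}
  {p : ℕ} {κ : 𝕜} {w w' μ φ τ : FormField 𝕜 n M}

theorem cliff_add_left (w w' : FormField 𝕜 n M) (ψ : S.SpinorField Δ) :
    S.cliff ρ (w + w') ψ = S.cliff ρ w ψ + S.cliff ρ w' ψ := funext fun x => by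
  simp only [cliff, Pi.add_apply, map_add, LinearMap.add_apply]

theorem cliff_smul_left (c : 𝕜) (w : FormField 𝕜 n M) (ψ : S.SpinorField Δ) :
    S.cliff ρ (c • w) ψ = c • S.cliff ρ w ψ := funext fun x => by
  simp only [cliff, Pi.smul_apply, map_smul, LinearMap.smul_apply]

theorem cliff_add_right (w : FormField 𝕜 n M) (ψ ψ' : S.SpinorField Δ) :
    S.cliff ρ w (ψ + ψ') = S.cliff ρ w ψ + S.cliff ρ w ψ' := funext fun x => by
  simp only [cliff, Pi.add_apply, map_add]

theorem cliff_smul_right (c : 𝕜) (w : FormField 𝕜 n M) (ψ : S.SpinorField Δ) :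
    S.cliff ρ w (c • ψ) = c • S.cliff ρ w ψ := funext fun x => by
  simp only [cliff, Pi.smul_apply, map_smul]

theorem ProlongedSystem.involute_f (h : S.ProlongedSystem κ p w μ φ τ) (hp : 1 ≤ p) (i : ι)
    (x : M) : CliffordAlgebra.involute (S.locForm i φ x) = (-(-1 : 𝕜) ^ p) • S.locForm i φ x := by
  obtain ⟨p, rfl⟩ := Nat.exists_eq_add_of_le' hp
  rw [involute_of_mem (h.smooth_f.mem i x), Nat.add_sub_cancel]
  congr 1; ring

variable [FiniteDimensional 𝕜 Δ]

theorem ckyOperator_add_left (hw : S.IsSmoothForm p w) (hw' : S.IsSmoothForm p w') :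
    S.ckyOperator ρ p (w + w') ψ = S.ckyOperator ρ p w ψ + S.ckyOperator ρ p w' ψ := by
  simp only [ckyOperator, extDeriv_add hw hw', coDeriv_add hw hw', cliff_add_left, smul_add]
  abel

theorem ckyOperator_smul_left (c : 𝕜) (hw : S.IsSmoothForm p w) :
    S.ckyOperator ρ p (c • w) ψ = c • S.ckyOperator ρ p w ψ := by
  simp only [ckyOperator, extDeriv_smul c hw, coDeriv_smul c hw, cliff_smul_left, smul_add,
    smul_comm _ c]

theorem ckyOperator_add_right (h : S.IsSmoothSpinor ρ ψ) (h' : S.IsSmoothSpinor ρ ψ') :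
    S.ckyOperator ρ p w (ψ + ψ') = S.ckyOperator ρ p w ψ + S.ckyOperator ρ p w ψ' := by
  simp only [ckyOperator, dirac_add h h', cliff_add_right, smul_add]
  abel

theorem ckyOperator_smul_right (c : 𝕜) (h : S.IsSmoothSpinor ρ ψ) :
    S.ckyOperator ρ p w (c • ψ) = c • S.ckyOperator ρ p w ψ := by
  simp only [ckyOperator, dirac_smul c h, cliff_smul_right, smul_add, smul_comm _ c]

variable (S ρ) in
/-- The action of a solution of the prolonged system on a spinor `ψ`, where `χ = Dψ/n`. -/
def prolongedAction (p : ℕ) (w μ φ : FormField 𝕜 n M) (ψ χ : S.SpinorField Δ) : S.SpinorField Δ :=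
  (-(-1 : 𝕜) ^ p) • S.cliff ρ w χ
    + ((1 / 2 : 𝕜) • S.cliff ρ μ ψ + (-(1 / 2) : 𝕜) • S.cliff ρ φ ψ)

theorem ckyOperator_eq : S.ckyOperator ρ p w ψ = (p : 𝕜) • S.prolongedAction ρ p w (S.curl p w)
    (S.divergence p w) ψ ((1 / (n : 𝕜)) • S.dirac ρ ψ) := by
  have e1 : ((p : 𝕜) / (2 * ((p : 𝕜) + 1))) = p * (1 / 2 * (1 / ((p : 𝕜) + 1))) := by
    rw [div_eq_mul_one_div, one_div_mul_one_div]
  have e2 : ((p : 𝕜) / (2 * ((n : 𝕜) - p + 1)))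
      = p * (-(1 / 2) * (-(1 / ((n : 𝕜) - p + 1)))) := by
    rw [div_eq_mul_one_div, neg_mul_neg, one_div_mul_one_div]
  have e3 : -(-1 : 𝕜) ^ p * ((p : 𝕜) / n) = p * (-(-1 : 𝕜) ^ p * (1 / n)) := by ring
  simp only [ckyOperator, prolongedAction, curl, divergence, cliff_smul_left, cliff_smul_right,
    e1, e2, e3, smul_add, smul_smul, add_assoc]

theorem ProlongedSystem.isTwistorSpinor_prolongedAction {χ : S.SpinorField Δ} (hn : 0 < n)
    (hp : 1 ≤ p) (h : S.ProlongedSystem κ p w μ φ τ) (hψ : S.IsSmoothSpinor ρ ψ)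
    (hχ : S.IsSmoothSpinor ρ χ)
    (h₁ : ∀ i, ∀ x ∈ S.baseSet i, ∀ a, S.spinCovIn ρ i (S.spinorIn ρ i ψ) x (S.frame i a x)
      = cliffAct ρ (stdF 𝕜 η a) (S.spinorIn ρ i χ x))
    (h₂ : ∀ i, ∀ x ∈ S.baseSet i, ∀ a, S.spinCovIn ρ i (S.spinorIn ρ i χ) x (S.frame i a x)
      = (κ / 2) • cliffAct ρ (stdF 𝕜 η a) (S.spinorIn ρ i ψ x)) :
    S.IsTwistorSpinor ρ (S.prolongedAction ρ p w μ φ ψ χ) := by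
  have s1 := (hχ.cliff h.smooth_w).smul (-(-1 : 𝕜) ^ p)
  have s2 := (hψ.cliff h.smooth_m).smul (1 / 2 : 𝕜)
  have s3 := (hψ.cliff h.smooth_f).smul (-(1 / 2) : 𝕜)
  refine isTwistorSpinor_of_frame hn (s1.add (s2.add s3)) (χ := (1 / 2 : 𝕜) • S.cliff ρ τ ψ
    + (-((-1 : 𝕜) ^ p / 2)) • S.cliff ρ (μ + φ) χ) fun i x hx a => ?_
  have hU := S.isOpen_baseSet i
  have key : ∀ {q : ℕ} {v : FormField 𝕜 n M} {f : S.SpinorField Δ} (c : 𝕜), S.IsSmoothForm q v →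
      S.IsSmoothSpinor ρ f → S.spinCovIn ρ i (S.spinorIn ρ i (c • S.cliff ρ v f)) x (S.frame i a x)
      = c • (cliffAct ρ (S.covIn i (S.locForm i v) x (S.frame i a x)) (S.spinorIn ρ i f x)
        + cliffAct ρ (S.locForm i v x)
          (S.spinCovIn ρ i (S.spinorIn ρ i f) x (S.frame i a x))) := by
    intro q v f c hv hf
    rw [spinorIn_smul_fun, S.spinCovIn_smul c hU hx (hf.cliff hv i),
      S.spinCovIn_congr hU hx (fun y hy => S.spinorIn_cliff ρ hy v f),
      S.spinCovIn_cliffAct hU hx (hv.smooth i) (hf i)]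
  rw [prolongedAction, spinorIn_add_fun, S.spinCovIn_add hU hx (s1 i) ((s2.add s3) i),
    spinorIn_add_fun, S.spinCovIn_add hU hx (s2 i) (s3 i), key _ h.smooth_w hχ,
    key _ h.smooth_m hψ, key _ h.smooth_f hψ, h.cov_w i x hx, h.cov_m i x hx, h.cov_f i x hx,
    h₁ i x hx, h₂ i x hx]
  simp only [spinorIn_add, spinorIn_smul, S.spinorIn_cliff ρ hx, map_smul]
  simp only [← Module.End.mul_apply]
  have i1 := involute_of_mem (h.smooth_w.mem i x)
  have i2 := involute_of_mem (h.smooth_m.mem i x)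
  rw [pow_succ, mul_neg_one] at i2
  have i3 := h.involute_f hp i x
  simp only [S.cliffAct_mul_stdF, S.cliffAct_stdF_mul, i1, i2, i3, map_add,
    map_smul, map_sub, map_neg, mul_add, mul_smul_comm, LinearMap.add_apply,
    LinearMap.sub_apply, LinearMap.smul_apply, LinearMap.neg_apply, locForm_add_apply,
    ← Module.End.mul_apply]
  have hc : (-1 : 𝕜) ^ p * (-1 : 𝕜) ^ p = 1 := by rw [← mul_pow]; simp
  generalize (-1 : 𝕜) ^ p = c at hc
  have e : (c * c) • (cliffAct ρ (stdF 𝕜 η a * S.locForm i w x) (S.spinorIn ρ i ψ x)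
      - cliffAct ρ (stdI 𝕜 a (S.locForm i w x)) (S.spinorIn ρ i ψ x))
      = cliffAct ρ (stdF 𝕜 η a * S.locForm i w x) (S.spinorIn ρ i ψ x)
      - cliffAct ρ (stdI 𝕜 a (S.locForm i w x)) (S.spinorIn ρ i ψ x) := by rw [hc, one_smul]
  linear_combination (norm := module) (-(κ / 2)) • e

/-- The operator of a normal CKY form preserves the twistor spinors. -/
theorem IsTwistorSpinor.ckyOperator {l k : ℝ} (hE : S.IsEinstein l) (hn : 3 ≤ n)
    (hk : k = -(l / (2 * ((n : ℝ) - 1)))) (hp : 1 ≤ p)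
    (h : S.ProlongedSystem (algebraMap ℝ 𝕜 k) p w μ φ τ) (hψ : S.IsTwistorSpinor ρ ψ) :
    S.ckyOperator ρ p w ψ ∈ S.twistorSpinors ρ (by omega) := by
  rcases lt_or_ge n p with hpn | hpn
  · have e := ckyOperator_smul_left (S := S) (ρ := ρ) (ψ := ψ) (0 : 𝕜) h.smooth_w
    rw [zero_smul, zero_smul, ← h.smooth_w.eq_zero_of_lt hpn] at e
    rw [e]
    exact Submodule.zero_mem _
  rw [ckyOperator_eq, ← h.eq_curl, ← h.eq_divergence hp hpn]
  exact Submodule.smul_mem _ _ (h.isTwistorSpinor_prolongedAction (by omega) hp hψ.1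
    (hψ.1.dirac.smul _) (fun i x hx a => hψ.spinCovIn_eq hx a)
    fun i x hx a => hψ.spinCovIn_dirac hE hn hk hx a)

end SpinStructure

end

section

section ListProducts

theorem prod_map_reverse {R α : Type*} [Ring R] (x : α → R)
    (h : ∀ a b, a ≠ b → x a * x b = -(x b * x a)) :
    ∀ l : List α, l.Nodup → (l.reverse.map x).prod
      = (-1) ^ (l.length * (l.length - 1) / 2) * (l.map x).prod := by
  have h1 : ∀ (a : α) (l : List α), a ∉ l →
      (l.map x).prod * x a = (-1) ^ l.length * (x a * (l.map x).prod) := by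
    intro a l
    induction l with
    | nil => simp
    | cons b l ih =>
      intro ha
      rw [List.mem_cons, not_or] at ha
      rw [List.map_cons, List.prod_cons, mul_assoc, ih ha.2, List.length_cons, pow_succ,
        ← mul_assoc (x b), ((Commute.neg_one_right (x b)).pow_right _).eq, mul_assoc,
        ← mul_assoc (x b), h b a (Ne.symm ha.1)]
      noncomm_ring
  intro l
  induction l with
  | nil => simp
  | cons a l ih =>
    intro hl
    rw [List.nodup_cons] at hl
    have e : (l.length + 1) * l.length / 2 = l.length * (l.length - 1) / 2 + l.length := by
      rw [← Nat.triangle_succ, Nat.add_sub_cancel]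
    rw [List.reverse_cons, List.map_append, List.prod_append, ih hl.2, List.map_singleton,
      List.prod_singleton, mul_assoc, h1 a l hl.1, List.length_cons, Nat.add_sub_cancel, e, pow_add,
      mul_assoc, List.map_cons, List.prod_cons]

theorem prod_map_smul {𝕜 R α : Type*} [CommRing 𝕜] [Ring R] [Algebra 𝕜 R] (c : α → 𝕜)
    (x : α → R) (l : List α) :
    (l.map fun a => c a • x a).prod = (l.map c).prod • (l.map x).prod := by
  induction l with
  | nil => simp
  | cons a l ih => simp only [List.map_cons, List.prod_cons, ih, smul_mul_smul_comm]

end ListProducts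

section Pairing

variable {𝕜 : Type*} [RCLike 𝕜] {n : ℕ} {η : Fin n → ℝ}

theorem formBasis_eq (A : Finset (Fin n)) : formBasis 𝕜 n A = (A.sort.map (stdE 𝕜)).prod := by
  rw [formBasis, ExteriorAlgebra.basis_apply_ofCard (Pi.basisFun 𝕜 (Fin n)) (rfl : A.card = A.card),
    ExteriorAlgebra.ιMulti_family, ExteriorAlgebra.ιMulti_apply, ← Finset.listMap_orderEmbOfFin_finRange A rfl, List.map_map,
    List.ofFn_eq_map]
  congr 2
  funext a
  simp only [Function.comp_apply, Pi.basisFun_apply]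
  rfl

theorem prod_stdE_mem (l : List (Fin n)) :
    (l.map (stdE 𝕜)).prod ∈ ⋀[𝕜]^l.length (Fin n → 𝕜) := by
  induction l with
  | nil => exact SetLike.GradedOne.one_mem
  | cons a l ih => rw [List.map_cons, List.prod_cons]; exact ι_mul_mem _ ih

theorem formBasis_mem (A : Finset (Fin n)) : formBasis 𝕜 n A ∈ ⋀[𝕜]^A.card (Fin n → 𝕜) := by
  have h := prod_stdE_mem (𝕜 := 𝕜) A.sort
  rwa [Finset.length_sort, ← formBasis_eq] at h

/-- The scalar part of a form. -/
abbrev scalarPart (𝕜 : Type*) [RCLike 𝕜] (n : ℕ) : ExteriorAlgebra 𝕜 (Fin n → 𝕜) →ₐ[𝕜] 𝕜 :=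
  ExteriorAlgebra.algebraMapInv

theorem scalarPart_ι_mul (v : Fin n → 𝕜) (α : ExteriorAlgebra 𝕜 (Fin n → 𝕜)) :
    scalarPart 𝕜 n (ExteriorAlgebra.ι 𝕜 v * α) = 0 := by
  rw [map_mul, scalarPart, ExteriorAlgebra.algebraMapInv, ExteriorAlgebra.lift_ι_apply,
    LinearMap.zero_apply, zero_mul]

theorem scalarPart_of_mem {p : ℕ} (hp : p ≠ 0) {α : ExteriorAlgebra 𝕜 (Fin n → 𝕜)}
    (h : α ∈ ⋀[𝕜]^p (Fin n → 𝕜)) : scalarPart 𝕜 n α = 0 := by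
  obtain ⟨p, rfl⟩ := Nat.exists_eq_succ_of_ne_zero hp
  refine exteriorPower_succ_induction (fun x y hx hy => ?_) (fun v a _ => scalarPart_ι_mul v a) h
  rw [map_add, hx, hy, add_zero]

theorem stdI_prod_stdE {a : Fin n} {l : List (Fin n)} (ha : a ∉ l) :
    stdI 𝕜 a (l.map (stdE 𝕜)).prod = 0 := by
  induction l with
  | nil => exact CliffordAlgebra.contractLeft_one _ _
  | cons b l ih =>
    rw [List.mem_cons, not_or] at ha
    rw [List.map_cons, List.prod_cons, stdI_stdE_mul, if_neg ha.1, ih ha.2, mul_zero, zero_smul,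
      sub_zero]

variable (𝕜) in
/-- The iterated interior product with the vectors in a list, the first one being applied first. -/
def contractList (l : List (Fin n)) : Module.End 𝕜 (ExteriorAlgebra 𝕜 (Fin n → 𝕜)) :=
  (l.reverse.map (stdI 𝕜)).prod

theorem contractList_cons (a : Fin n) (l : List (Fin n)) (α : ExteriorAlgebra 𝕜 (Fin n → 𝕜)) :
    contractList 𝕜 (a :: l) α = contractList 𝕜 l (stdI 𝕜 a α) := by
  simp [contractList, List.prod_append]

theorem contractList_eq_zero {a : Fin n} {l : List (Fin n)} (ha : a ∈ l)
    {α : ExteriorAlgebra 𝕜 (Fin n → 𝕜)} (h : stdI 𝕜 a α = 0) : contractList 𝕜 l α = 0 := by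
  induction l generalizing α with
  | nil => simp at ha
  | cons b l ih =>
    rw [contractList_cons]
    rcases List.mem_cons.1 ha with rfl | ha
    · rw [h, map_zero]
    · exact ih ha (by rw [stdI_stdI_comm, h, map_zero, neg_zero])

theorem contractList_self {l : List (Fin n)} (hl : l.Nodup) :
    contractList 𝕜 l (l.map (stdE 𝕜)).prod = 1 := by
  induction l with
  | nil => simp [contractList]
  | cons a l ih =>
    rw [List.nodup_cons] at hl
    rw [contractList_cons, List.map_cons, List.prod_cons, stdI_stdE_mul, if_pos rfl,
      stdI_prod_stdE hl.1, mul_zero, sub_zero, one_smul, ih hl.2]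

theorem scalarPart_contractList {p : ℕ} {l : List (Fin n)} (hl : l.length ≠ p)
    {α : ExteriorAlgebra 𝕜 (Fin n → 𝕜)} (h : α ∈ ⋀[𝕜]^p (Fin n → 𝕜)) :
    scalarPart 𝕜 n (contractList 𝕜 l α) = 0 := by
  induction l generalizing p α with
  | nil => exact scalarPart_of_mem (fun h0 => hl h0.symm) h
  | cons a l ih =>
    rw [contractList_cons]
    cases p with
    | zero => rw [stdI, contractLeft_mem_zero _ h, map_zero, map_zero]
    | succ p => exact ih (fun h0 => hl (by rw [List.length_cons, h0])) (contractLeft_mem _ h)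

theorem formBasis_repr_eq (A : Finset (Fin n)) (α : ExteriorAlgebra 𝕜 (Fin n → 𝕜)) :
    (formBasis 𝕜 n).repr α A = scalarPart 𝕜 n (contractList 𝕜 A.sort α) := by
  have h : (Finsupp.lapply A).comp (formBasis 𝕜 n).repr.toLinearMap
      = (scalarPart 𝕜 n).toLinearMap.comp (contractList 𝕜 A.sort) := by
    refine (formBasis 𝕜 n).ext fun B => ?_
    simp only [LinearMap.comp_apply, LinearEquiv.coe_coe, Module.Basis.repr_self,
      Finsupp.lapply_apply, AlgHom.toLinearMap_apply]
    by_cases hAB : A = B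
    · subst hAB
      rw [Finsupp.single_eq_same, formBasis_eq, contractList_self (Finset.sort_nodup _ _), map_one]
    · rw [Finsupp.single_apply, if_neg (Ne.symm hAB)]
      by_cases hc : A.card = B.card
      · obtain ⟨a, ha, hb⟩ : ∃ a ∈ A, a ∉ B := by
          by_contra! hc'
          exact hAB (Finset.eq_of_subset_of_card_le hc' hc.ge)
        rw [formBasis_eq, contractList_eq_zero ((Finset.mem_sort _).2 ha)
          (stdI_prod_stdE fun h => hb ((Finset.mem_sort _).1 h)), map_zero]
      · exact (scalarPart_contractList (by rwa [Finset.length_sort]) (formBasis_mem B)).symm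
  exact LinearMap.congr_fun h α

theorem formBasis_repr_eq_zero {p : ℕ} {A : Finset (Fin n)} (hA : A.card ≠ p)
    {α : ExteriorAlgebra 𝕜 (Fin n → 𝕜)} (h : α ∈ ⋀[𝕜]^p (Fin n → 𝕜)) :
    (formBasis 𝕜 n).repr α A = 0 := by
  rw [formBasis_repr_eq, scalarPart_contractList (by rwa [Finset.length_sort]) h]

/-- The component of degree `p`. -/
def degreePart (𝕜 : Type*) [RCLike 𝕜] (n p : ℕ) :
    ExteriorAlgebra 𝕜 (Fin n → 𝕜) →ₗ[𝕜] ExteriorAlgebra 𝕜 (Fin n → 𝕜) :=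
  ∑ A ∈ Finset.powersetCard p Finset.univ, ((formBasis 𝕜 n).coord A).smulRight (formBasis 𝕜 n A)

theorem degreePart_apply (p : ℕ) (α : ExteriorAlgebra 𝕜 (Fin n → 𝕜)) :
    degreePart 𝕜 n p α = ∑ A ∈ Finset.powersetCard p Finset.univ,
      (formBasis 𝕜 n).repr α A • formBasis 𝕜 n A := by
  simp [degreePart]

theorem degreePart_mem (p : ℕ) (α : ExteriorAlgebra 𝕜 (Fin n → 𝕜)) :
    degreePart 𝕜 n p α ∈ ⋀[𝕜]^p (Fin n → 𝕜) := by
  rw [degreePart_apply]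
  refine Submodule.sum_mem _ fun A hA => Submodule.smul_mem _ _ ?_
  rw [← (Finset.mem_powersetCard.1 hA).2]
  exact formBasis_mem A

theorem degreePart_of_mem {p : ℕ} {α : ExteriorAlgebra 𝕜 (Fin n → 𝕜)}
    (h : α ∈ ⋀[𝕜]^p (Fin n → 𝕜)) : degreePart 𝕜 n p α = α := by
  conv_rhs => rw [← (formBasis 𝕜 n).sum_repr α]
  rw [degreePart_apply]
  refine Finset.sum_subset (Finset.subset_univ _) fun A _ hA => ?_
  rw [formBasis_repr_eq_zero (fun hc => hA (Finset.mem_powersetCard.2 ⟨Finset.subset_univ _, hc⟩)) h,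
    zero_smul]

theorem degreePart_of_mem_ne {p q : ℕ} (hpq : p ≠ q) {α : ExteriorAlgebra 𝕜 (Fin n → 𝕜)}
    (h : α ∈ ⋀[𝕜]^q (Fin n → 𝕜)) : degreePart 𝕜 n p α = 0 := by
  rw [degreePart_apply]
  refine Finset.sum_eq_zero fun A hA => ?_
  rw [formBasis_repr_eq_zero (fun hc => hpq ?_) h, zero_smul]
  rw [← hc, (Finset.mem_powersetCard.1 hA).2]

/-- An operator of degree `r - q` intertwines the components of degrees `q` and `r`. -/
theorem degreePart_comm (L : ExteriorAlgebra 𝕜 (Fin n → 𝕜) →ₗ[𝕜] ExteriorAlgebra 𝕜 (Fin n → 𝕜))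
    {q r : ℕ} (h₁ : ∀ α ∈ ⋀[𝕜]^q (Fin n → 𝕜), L α ∈ ⋀[𝕜]^r (Fin n → 𝕜))
    (h₂ : ∀ m, m ≠ q → ∀ α ∈ ⋀[𝕜]^m (Fin n → 𝕜), degreePart 𝕜 n r (L α) = 0)
    (α : ExteriorAlgebra 𝕜 (Fin n → 𝕜)) :
    degreePart 𝕜 n r (L α) = L (degreePart 𝕜 n q α) := by
  refine LinearMap.congr_fun (f := degreePart 𝕜 n r ∘ₗ L) (g := L ∘ₗ degreePart 𝕜 n q)
    ((formBasis 𝕜 n).ext fun B => ?_) α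
  simp only [LinearMap.comp_apply]
  by_cases hB : B.card = q
  · have hm := formBasis_mem (𝕜 := 𝕜) B
    rw [hB] at hm
    rw [degreePart_of_mem hm, degreePart_of_mem (h₁ _ hm)]
  · rw [degreePart_of_mem_ne (Ne.symm hB) (formBasis_mem B), map_zero,
      h₂ _ hB _ (formBasis_mem B)]

theorem degreePart_stdI (p : ℕ) (a : Fin n) (α : ExteriorAlgebra 𝕜 (Fin n → 𝕜)) :
    degreePart 𝕜 n p (stdI 𝕜 a α) = stdI 𝕜 a (degreePart 𝕜 n (p + 1) α) := by
  refine degreePart_comm (q := p + 1) (stdI 𝕜 a) (fun β hβ => stdI_mem hβ a) (fun m hm β hβ => ?_) α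
  cases m with
  | zero => rw [stdI, contractLeft_mem_zero _ hβ, map_zero]
  | succ m => exact degreePart_of_mem_ne (fun h => hm (by omega)) (stdI_mem hβ a)

theorem degreePart_stdE_mul (p : ℕ) (a : Fin n) (α : ExteriorAlgebra 𝕜 (Fin n → 𝕜)) :
    degreePart 𝕜 n (p + 1) (stdE 𝕜 a * α) = stdE 𝕜 a * degreePart 𝕜 n p α :=
  degreePart_comm (LinearMap.mulLeft 𝕜 (stdE 𝕜 a)) (fun β hβ => ι_mul_mem _ hβ)
    (fun m hm β hβ => degreePart_of_mem_ne (fun h => hm (by omega)) (ι_mul_mem _ hβ)) α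

theorem degreePart_stdE_mul_stdI (p : ℕ) (a b : Fin n) (α : ExteriorAlgebra 𝕜 (Fin n → 𝕜)) :
    degreePart 𝕜 n p (stdE 𝕜 a * stdI 𝕜 b α) = stdE 𝕜 a * stdI 𝕜 b (degreePart 𝕜 n p α) := by
  cases p with
  | zero =>
    rw [stdI, contractLeft_mem_zero _ (degreePart_mem 0 α), mul_zero]
    refine LinearMap.congr_fun (f := degreePart 𝕜 n 0 ∘ₗ LinearMap.mulLeft 𝕜 (stdE 𝕜 a) ∘ₗ stdI 𝕜 b)
      (g := 0) ((formBasis 𝕜 n).ext fun B => ?_) α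
    exact degreePart_of_mem_ne (Nat.succ_ne_zero _).symm
      (ι_mul_mem _ (stdI_mem (formBasis_mem B) b))
  | succ p => rw [degreePart_stdE_mul, degreePart_stdI]

theorem degreePart_involute (p : ℕ) (α : ExteriorAlgebra 𝕜 (Fin n → 𝕜)) :
    degreePart 𝕜 n p (CliffordAlgebra.involute α)
      = CliffordAlgebra.involute (degreePart 𝕜 n p α) := by
  refine degreePart_comm CliffordAlgebra.involute.toLinearMap (fun β hβ => ?_)
    (fun m hm β hβ => ?_) α
  · rw [AlgHom.toLinearMap_apply, involute_of_mem hβ]; exact Submodule.smul_mem _ _ hβ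
  · rw [AlgHom.toLinearMap_apply, involute_of_mem hβ, map_smul,
      degreePart_of_mem_ne (Ne.symm hm) hβ, smul_zero]

variable (η) in
/-- The vector that is dual to a covector, as a functional on covectors. -/
def sharp : (Fin n → 𝕜) →ₗ[𝕜] Module.Dual 𝕜 (Fin n → 𝕜) :=
  ∑ a, (LinearMap.proj a).smulRight (algebraMap ℝ 𝕜 (η a) • stdD 𝕜 a)

theorem sharp_apply (u v : Fin n → 𝕜) : sharp η u v = ∑ a, u a * (algebraMap ℝ 𝕜 (η a) * v a) := by
  rw [sharp, LinearMap.sum_apply, LinearMap.sum_apply]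
  rfl

variable (η) in
/-- The action of forms on forms by iterated interior products with the dual vectors. -/
def contractForm : ExteriorAlgebra 𝕜 (Fin n → 𝕜) →ₐ[𝕜]
    Module.End 𝕜 (ExteriorAlgebra 𝕜 (Fin n → 𝕜)) :=
  ExteriorAlgebra.lift 𝕜 ⟨CliffordAlgebra.contractLeft ∘ₗ sharp η, fun u =>
    LinearMap.ext fun α => CliffordAlgebra.contractLeft_contractLeft (sharp η u) α⟩

theorem contractForm_ι (u : Fin n → 𝕜) (α : ExteriorAlgebra 𝕜 (Fin n → 𝕜)) :
    contractForm η (ExteriorAlgebra.ι 𝕜 u) α = CliffordAlgebra.contractLeft (sharp η u) α := by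
  rw [contractForm, ExteriorAlgebra.lift_ι_apply]; rfl

theorem contractForm_stdF (hη : ∀ a, η a * η a = 1) (a : Fin n) :
    contractForm η (stdF 𝕜 η a) = stdI 𝕜 a := by
  refine LinearMap.ext fun α => ?_
  have h : sharp η (Pi.single a (1 : 𝕜)) = algebraMap ℝ 𝕜 (η a) • stdD 𝕜 a :=
    LinearMap.ext fun v => by
      rw [sharp_apply, Finset.sum_eq_single a (fun b _ hb => by rw [Pi.single_eq_of_ne hb, zero_mul])
        (by simp), Pi.single_eq_same, one_mul]
      rfl
  rw [stdF_eq, map_smul, LinearMap.smul_apply, stdE, contractForm_ι, h, map_smul,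
    LinearMap.smul_apply, smul_smul, ← map_mul, hη, map_one, one_smul]
  rfl

theorem contractForm_stdF_mul (hη : ∀ a, η a * η a = 1) (a : Fin n)
    (α β : ExteriorAlgebra 𝕜 (Fin n → 𝕜)) :
    contractForm η α (stdF 𝕜 η a * β)
      = stdF 𝕜 η a * contractForm η (CliffordAlgebra.involute α) β
        - contractForm η (stdI 𝕜 a (CliffordAlgebra.involute α)) β := by
  induction α using CliffordAlgebra.left_induction with
  | algebraMap r =>
    have h1 : ∀ γ, contractForm η (algebraMap 𝕜 (CliffordAlgebra
        (0 : QuadraticForm 𝕜 (Fin n → 𝕜))) r) γ = r • γ := fun γ => by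
      rw [Algebra.algebraMap_eq_smul_one, map_smul, LinearMap.smul_apply]
      exact congrArg (r • ·) (LinearMap.congr_fun (map_one (contractForm η)) γ)
    rw [CliffordAlgebra.involute.commutes, stdI, CliffordAlgebra.contractLeft_algebraMap, map_zero,
      LinearMap.zero_apply, sub_zero, h1, h1, mul_smul_comm]
  | add x y hx hy =>
    simp only [map_add, LinearMap.add_apply, hx, hy, mul_add]
    abel
  | ι_mul x v hx =>
    have h1 : sharp η v (Pi.single a (1 : 𝕜)) = v a * algebraMap ℝ 𝕜 (η a) := by
      rw [sharp_apply, Finset.sum_eq_single a (fun b _ hb => by rw [Pi.single_eq_of_ne hb]; ring)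
        (by simp), Pi.single_eq_same, mul_one]
    have h2 : ∀ γ : ExteriorAlgebra 𝕜 (Fin n → 𝕜), contractForm η (CliffordAlgebra.ι 0 v) γ
        = CliffordAlgebra.contractLeft (sharp η v) γ := contractForm_ι v
    have h3 : ∀ γ, CliffordAlgebra.contractLeft (sharp η v) (stdF 𝕜 η a * γ)
        = v a • γ - stdF 𝕜 η a * CliffordAlgebra.contractLeft (sharp η v) γ := by
      intro γ
      have h4 := CliffordAlgebra.contractLeft_ι_mul (Q := (0 : QuadraticForm 𝕜 (Fin n → 𝕜)))
        (d := sharp η v) (Pi.single a (1 : 𝕜)) γ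
      rw [h1] at h4
      rw [stdF_eq, smul_mul_assoc, map_smul, stdE, ExteriorAlgebra.ι, h4, smul_sub, smul_smul,
        mul_left_comm, ← map_mul, hη, map_one, mul_one, smul_mul_assoc]
    have h5 : stdI 𝕜 a (CliffordAlgebra.ι 0 v * CliffordAlgebra.involute x)
        = v a • CliffordAlgebra.involute x
          - CliffordAlgebra.ι 0 v * stdI 𝕜 a (CliffordAlgebra.involute x) :=
      CliffordAlgebra.contractLeft_ι_mul (d := stdD 𝕜 a) v _
    have h6 : ∀ y γ, contractForm η (CliffordAlgebra.ι 0 v * y) γ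
        = CliffordAlgebra.contractLeft (sharp η v) (contractForm η y γ) := fun y γ =>
      (LinearMap.congr_fun (map_mul (contractForm η) (ExteriorAlgebra.ι 𝕜 v) y) γ).trans (h2 _)
    have h7 : CliffordAlgebra.involute (CliffordAlgebra.ι 0 v * x)
        = -(CliffordAlgebra.ι 0 v * CliffordAlgebra.involute x) := by
      rw [map_mul, CliffordAlgebra.involute_ι, neg_mul]
    rw [h6, hx, map_sub, h3, h7, map_neg, map_neg, map_neg, h5, map_sub, map_smul,
      LinearMap.neg_apply, LinearMap.neg_apply, LinearMap.sub_apply, LinearMap.smul_apply, h6, h6,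
      mul_neg]
    abel

variable (𝕜 η) in
/-- The product of the dual covectors with indices in `A`, in descending order. -/
def reverseProd (A : Finset (Fin n)) : ExteriorAlgebra 𝕜 (Fin n → 𝕜) :=
  (A.sort.reverse.map (stdF 𝕜 η)).prod

theorem contractForm_reverseProd (hη : ∀ a, η a * η a = 1) (A : Finset (Fin n)) :
    contractForm η (reverseProd 𝕜 η A) = contractList 𝕜 A.sort := by
  rw [reverseProd, map_list_prod, List.map_map, contractList]
  congr 2
  funext a
  exact contractForm_stdF hη a

theorem formBasis_repr_eq' (hη : ∀ a, η a * η a = 1) (A : Finset (Fin n))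
    (α : ExteriorAlgebra 𝕜 (Fin n → 𝕜)) : (formBasis 𝕜 n).repr α A
      = scalarPart 𝕜 n (contractForm η (reverseProd 𝕜 η A) α) := by
  rw [formBasis_repr_eq, contractForm_reverseProd hη]

theorem eq_of_scalarPart_contractForm (hη : ∀ a, η a * η a = 1)
    {α β : ExteriorAlgebra 𝕜 (Fin n → 𝕜)} (h : ∀ γ, scalarPart 𝕜 n (contractForm η γ α)
      = scalarPart 𝕜 n (contractForm η γ β)) : α = β :=
  (formBasis 𝕜 n).repr.injective (Finsupp.ext fun A => by
    rw [formBasis_repr_eq' hη, h, ← formBasis_repr_eq' hη])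

theorem quantize_prod_stdF {l : List (Fin n)} (hl : l.Nodup) :
    quantize η (l.map (stdF 𝕜 η)).prod = (l.map fun a => quantize η (stdF 𝕜 η a)).prod := by
  induction l with
  | nil => exact quantize_one
  | cons a l ih =>
    rw [List.nodup_cons] at hl
    have h0 : stdI 𝕜 a (l.map (stdF 𝕜 η)).prod = 0 := by
      have e : stdF 𝕜 η = fun b => algebraMap ℝ 𝕜 (η b) • stdE 𝕜 b := funext fun b => stdF_eq b
      rw [e, prod_map_smul, map_smul, stdI_prod_stdE hl.1, smul_zero]
    rw [List.map_cons, List.prod_cons, List.map_cons, List.prod_cons, ← ih hl.2, stdF_eq, map_smul,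
      quantize_stdE, smul_mul_assoc, smul_mul_assoc, cliffE_mul_quantize, h0, smul_zero, add_zero,
      map_smul]

theorem exists_smul_reverseProd (hη : ∀ a, η a * η a = 1) (A : Finset (Fin n)) :
    ∃ c : 𝕜, formBasis 𝕜 n A = c • reverseProd 𝕜 η A := by
  have h0 : ∀ a, algebraMap ℝ 𝕜 (η a) ≠ 0 := fun a h => by
    have h1 := congrArg (algebraMap ℝ 𝕜) (hη a)
    rw [map_mul, h, zero_mul, map_one] at h1
    exact zero_ne_one h1
  have e : stdF 𝕜 η = fun b => algebraMap ℝ 𝕜 (η b) • stdE 𝕜 b := funext fun b => stdF_eq b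
  have h1 := prod_map_reverse (stdE 𝕜 : Fin n → _) (fun a b _ => by
    have := stdE_mul_stdE_mul (𝕜 := 𝕜) a b 1
    rwa [mul_one, mul_one] at this) A.sort (Finset.sort_nodup _ _)
  set c := (A.sort.reverse.map fun b => algebraMap ℝ 𝕜 (η b)).prod with hc
  have hc0 : c ≠ 0 := by
    rw [hc]
    refine List.prod_ne_zero fun hm => ?_
    obtain ⟨b, _, hb⟩ := List.mem_map.1 hm
    exact h0 b hb
  set m := A.sort.length * (A.sort.length - 1) / 2
  refine ⟨(-1) ^ m * c⁻¹, ?_⟩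
  have hs : ((-1 : 𝕜) ^ m) * (-1 : 𝕜) ^ m = 1 := by rw [← mul_pow]; simp
  have e1 : ((-1 : ExteriorAlgebra 𝕜 (Fin n → 𝕜)) ^ m) = ((-1 : 𝕜) ^ m) • 1 := by
    rw [← map_one (algebraMap 𝕜 _), ← map_neg, ← map_pow, Algebra.algebraMap_eq_smul_one, map_one]
  rw [reverseProd, e, prod_map_smul, h1, smul_smul, mul_assoc, inv_mul_cancel₀ hc0, mul_one, e1,
    smul_mul_assoc, one_mul, smul_smul, hs, one_smul, formBasis_eq]

end Pairing

end

section

section ContractForm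

variable {𝕜 : Type*} [RCLike 𝕜] {n : ℕ} {η : Fin n → ℝ}

theorem contractForm_ι_mul (v : Fin n → 𝕜) (α β : ExteriorAlgebra 𝕜 (Fin n → 𝕜)) :
    contractForm η (CliffordAlgebra.ι 0 v * α) β
      = CliffordAlgebra.contractLeft (sharp η v) (contractForm η α β) :=
  (LinearMap.congr_fun (map_mul (contractForm η) (ExteriorAlgebra.ι 𝕜 v) α) β).trans
    (contractForm_ι v _)

theorem contractForm_algebraMap (r : 𝕜) (β : ExteriorAlgebra 𝕜 (Fin n → 𝕜)) :
    contractForm η (algebraMap 𝕜 (CliffordAlgebra (0 : QuadraticForm 𝕜 (Fin n → 𝕜))) r) β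
      = r • β := by
  rw [Algebra.algebraMap_eq_smul_one, map_smul, LinearMap.smul_apply]
  exact congrArg (r • ·) (LinearMap.congr_fun (map_one (contractForm η)) β)

theorem contractForm_involute (α β : ExteriorAlgebra 𝕜 (Fin n → 𝕜)) :
    contractForm η (CliffordAlgebra.involute α) (CliffordAlgebra.involute β)
      = CliffordAlgebra.involute (contractForm η α β) := by
  induction α using CliffordAlgebra.left_induction with
  | algebraMap r =>
    rw [CliffordAlgebra.involute.commutes, contractForm_algebraMap, contractForm_algebraMap,
      map_smul]
  | add x y hx hy => simp only [map_add, LinearMap.add_apply, hx, hy]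
  | ι_mul x v hx =>
    rw [map_mul, CliffordAlgebra.involute_ι, neg_mul, map_neg, LinearMap.neg_apply,
      contractForm_ι_mul, hx, contractForm_ι_mul, involute_contractLeft]

theorem contractForm_map {o : (Fin n → 𝕜) →ₗ[𝕜] Fin n → 𝕜}
    (ho : ∀ u v, sharp η (o u) (o v) = sharp η u v) (α β : ExteriorAlgebra 𝕜 (Fin n → 𝕜)) :
    contractForm η (ExteriorAlgebra.map o α) (ExteriorAlgebra.map o β)
      = ExteriorAlgebra.map o (contractForm η α β) := by
  induction α using CliffordAlgebra.left_induction with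
  | algebraMap r =>
    rw [contractForm_algebraMap, map_smul, (ExteriorAlgebra.map o).commutes]
    exact contractForm_algebraMap _ _
  | add x y hx hy => simp only [map_add, LinearMap.add_apply, hx, hy]
  | ι_mul x v hx =>
    have h : ExteriorAlgebra.map o (CliffordAlgebra.ι 0 v * x)
        = CliffordAlgebra.ι 0 (o v) * ExteriorAlgebra.map o x :=
      (map_mul (ExteriorAlgebra.map o) (ExteriorAlgebra.ι 𝕜 v) x).trans
        (congrArg (· * _) (ExteriorAlgebra.map_apply_ι _ _))
    rw [h, contractForm_ι_mul, contractForm_ι_mul, hx]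
    exact (map_contractLeft o _ _ (ho v) _).symm

theorem scalarPart_map (o : (Fin n → 𝕜) →ₗ[𝕜] Fin n → 𝕜) (α : ExteriorAlgebra 𝕜 (Fin n → 𝕜)) :
    scalarPart 𝕜 n (ExteriorAlgebra.map o α) = scalarPart 𝕜 n α := by
  have h : (scalarPart 𝕜 n).comp (ExteriorAlgebra.map o) = scalarPart 𝕜 n :=
    ExteriorAlgebra.hom_ext (LinearMap.ext fun v => by
      simp [scalarPart, ExteriorAlgebra.algebraMapInv])
  exact AlgHom.congr_fun h α

theorem scalarPart_involute (α : ExteriorAlgebra 𝕜 (Fin n → 𝕜)) :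
    scalarPart 𝕜 n (CliffordAlgebra.involute α) = scalarPart 𝕜 n α := by
  have h : (scalarPart 𝕜 n).comp CliffordAlgebra.involute = scalarPart 𝕜 n :=
    ExteriorAlgebra.hom_ext (LinearMap.ext fun v => by
      have e : CliffordAlgebra.involute (ExteriorAlgebra.ι 𝕜 v) = -ExteriorAlgebra.ι 𝕜 v :=
        CliffordAlgebra.involute_ι v
      simp [scalarPart, ExteriorAlgebra.algebraMapInv, e])
  exact AlgHom.congr_fun h α

theorem scalarPart_contractForm_involute (α β : ExteriorAlgebra 𝕜 (Fin n → 𝕜)) :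
    scalarPart 𝕜 n (contractForm η α (CliffordAlgebra.involute β))
      = scalarPart 𝕜 n (contractForm η (CliffordAlgebra.involute α) β) := by
  rw [← scalarPart_involute, ← contractForm_involute]
  exact congrArg (fun z => scalarPart 𝕜 n (contractForm η (CliffordAlgebra.involute α) z))
    (CliffordAlgebra.involute_involute β)

theorem mul_stdF (a : Fin n) (α : ExteriorAlgebra 𝕜 (Fin n → 𝕜)) :
    α * stdF 𝕜 η a = stdF 𝕜 η a * CliffordAlgebra.involute α := by
  have h := ι_mul_eq (𝕜 := 𝕜) ((algebraMap ℝ 𝕜 (η a)) • Pi.single a (1 : 𝕜))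
    (CliffordAlgebra.involute α)
  rw [stdF, h]
  exact congrArg (· * _) (CliffordAlgebra.involute_involute α).symm

theorem map_algebraMap_real {σ : 𝕜 →+* 𝕜} (hσ : σ = RingHom.id 𝕜 ∨ σ = starRingEnd 𝕜) (r : ℝ) :
    σ (algebraMap ℝ 𝕜 r) = algebraMap ℝ 𝕜 r := by
  rcases hσ with rfl | rfl
  · rfl
  · exact RCLike.conj_ofReal r

end ContractForm

namespace SpinorInnerProduct

variable {𝕜 : Type*} [RCLike 𝕜] {n : ℕ} {η : Fin n → ℝ} {Δ : Type*} [AddCommGroup Δ] [Module 𝕜 Δ]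
  {ρ : CliffordAlgebra (quadForm 𝕜 η) →ₐ[𝕜] Module.End 𝕜 Δ} {σ : 𝕜 →+* 𝕜}
  (B : SpinorInnerProduct ρ σ)

open SpinStructure in
/-- The inhomogeneous form `∑_p (f ū)_p`. -/
def totalCurrent : Δ →ₛₗ[σ] Δ →ₗ[𝕜] ExteriorAlgebra 𝕜 (Fin n → 𝕜) :=
  LinearMap.mk₂'ₛₗ σ (RingHom.id 𝕜)
    (fun u f => ∑ A, B.form u (cliffAct ρ (reverseProd 𝕜 η A) f) • formBasis 𝕜 n A)
    (fun u u' f => by simp only [map_add, LinearMap.add_apply, add_smul, Finset.sum_add_distrib])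
    (fun c u f => by simp only [map_smulₛₗ, LinearMap.smul_apply, smul_assoc, Finset.smul_sum])
    (fun u f f' => by simp only [map_add, add_smul, Finset.sum_add_distrib])
    (fun c u f => by simp only [map_smul, smul_assoc, Finset.smul_sum, RingHom.id_apply])

open SpinStructure

theorem repr_totalCurrent (u f : Δ) (A : Finset (Fin n)) :
    (formBasis 𝕜 n).repr (B.totalCurrent u f) A
      = B.form u (cliffAct ρ (reverseProd 𝕜 η A) f) := by
  have h : B.totalCurrent u f
      = ∑ A, B.form u (cliffAct ρ (reverseProd 𝕜 η A) f) • formBasis 𝕜 n A := rfl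
  rw [h, Module.Basis.repr_sum_self]

theorem s_mul_self : B.s * B.s = 1 := by rcases B.s_eq with h | h <;> simp [h]

theorem adjoint_stdF (a : Fin n) (u f : Δ) : B.form (cliffAct ρ (stdF 𝕜 η a) u) f
    = B.s * B.form u (cliffAct ρ (stdF 𝕜 η a) f) := by
  rw [cliffAct_stdF, LinearMap.smul_apply, LinearMap.smul_apply, map_smulₛₗ,
    map_algebraMap_real B.conj_eq, LinearMap.smul_apply, map_smul, cliffE, B.adjoint,
    smul_eq_mul, smul_eq_mul, mul_left_comm]

variable (hη : ∀ a, η a * η a = 1)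
include hη

/-- The total current is characterised by its pairings with all forms. -/
theorem form_cliffAct (u f : Δ) (α : ExteriorAlgebra 𝕜 (Fin n → 𝕜)) :
    B.form u (cliffAct ρ α f) = scalarPart 𝕜 n (contractForm η α (B.totalCurrent u f)) := by
  have h : B.form u ∘ₗ (LinearMap.applyₗ f) ∘ₗ (cliffAct ρ)
      = (scalarPart 𝕜 n).toLinearMap ∘ₗ (LinearMap.applyₗ (B.totalCurrent u f))
        ∘ₗ (contractForm η).toLinearMap := by
    refine (formBasis 𝕜 n).ext fun A => ?_
    obtain ⟨c, hc⟩ := exists_smul_reverseProd (𝕜 := 𝕜) hη A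
    simp only [hc, map_smul]
    congr 1
    simp only [LinearMap.comp_apply, LinearMap.applyₗ_apply_apply, AlgHom.toLinearMap_apply]
    rw [← formBasis_repr_eq' hη, repr_totalCurrent]
  exact LinearMap.congr_fun h α

theorem scalarPart_contractForm_stdF_mul (a : Fin n) (α β : ExteriorAlgebra 𝕜 (Fin n → 𝕜)) :
    scalarPart 𝕜 n (contractForm η α (stdF 𝕜 η a * β))
      = -scalarPart 𝕜 n (contractForm η (stdI 𝕜 a (CliffordAlgebra.involute α)) β) := by
  rw [contractForm_stdF_mul hη, map_sub, stdF, scalarPart_ι_mul, zero_sub]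

theorem totalCurrent_stdF_right (a : Fin n) (u f : Δ) :
    B.totalCurrent u (cliffAct ρ (stdF 𝕜 η a) f)
      = stdI 𝕜 a (B.totalCurrent u f) + stdF 𝕜 η a * B.totalCurrent u f := by
  refine eq_of_scalarPart_contractForm hη fun α => ?_
  rw [← B.form_cliffAct hη, ← Module.End.mul_apply, cliffAct_mul_stdF' hη, map_sub,
    LinearMap.sub_apply, map_sub, B.form_cliffAct hη, B.form_cliffAct hη, ← mul_stdF, map_mul,
    Module.End.mul_apply, contractForm_stdF hη, map_add, map_add,
    scalarPart_contractForm_stdF_mul hη, sub_eq_add_neg]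

theorem totalCurrent_stdF_left (a : Fin n) (u f : Δ) :
    B.totalCurrent (cliffAct ρ (stdF 𝕜 η a) u) f
      = B.s • (stdF 𝕜 η a * CliffordAlgebra.involute (B.totalCurrent u f)
        - stdI 𝕜 a (CliffordAlgebra.involute (B.totalCurrent u f))) := by
  refine eq_of_scalarPart_contractForm hη fun α => ?_
  have e1 : CliffordAlgebra.involute (stdI 𝕜 a (CliffordAlgebra.involute α)) = -stdI 𝕜 a α := by
    rw [stdI, involute_contractLeft, CliffordAlgebra.involute_involute]
  have e2 : CliffordAlgebra.involute (α * stdF 𝕜 η a) = -(stdF 𝕜 η a * α) := by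
    have e3 : CliffordAlgebra.involute (stdF 𝕜 η a) = -stdF 𝕜 η a := CliffordAlgebra.involute_ι _
    rw [mul_stdF, map_mul, e3, CliffordAlgebra.involute_involute, neg_mul]
  rw [← B.form_cliffAct hη, B.adjoint_stdF, ← Module.End.mul_apply, cliffAct_stdF_mul' hη, map_add,
    LinearMap.add_apply, map_add, B.form_cliffAct hη, B.form_cliffAct hη, map_smul, map_smul,
    map_sub, map_sub, scalarPart_contractForm_stdF_mul hη, scalarPart_contractForm_involute, e1,
    ← contractForm_stdF hη a, ← Module.End.mul_apply (contractForm η α), ← map_mul,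
    scalarPart_contractForm_involute, e2, smul_eq_mul]
  simp only [map_neg, LinearMap.neg_apply]
  ring

theorem totalCurrent_cliffE_right (a : Fin n) (u f : Δ) :
    B.totalCurrent u (ρ (cliffE 𝕜 η a) f)
      = stdE 𝕜 a * B.totalCurrent u f
        + algebraMap ℝ 𝕜 (η a) • stdI 𝕜 a (B.totalCurrent u f) := by
  have e : ρ (cliffE 𝕜 η a) f = algebraMap ℝ 𝕜 (η a) • cliffAct ρ (stdF 𝕜 η a) f := by
    rw [cliffAct_stdF, LinearMap.smul_apply, smul_smul, ← map_mul, hη, map_one, one_smul]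
  rw [e, map_smul, B.totalCurrent_stdF_right hη, stdF_eq, smul_mul_assoc, smul_add, smul_smul,
    ← map_mul, hη, map_one, one_smul, add_comm]

theorem totalCurrent_cliffE_left (a : Fin n) (u f : Δ) :
    B.totalCurrent (ρ (cliffE 𝕜 η a) u) f
      = B.s • (stdE 𝕜 a * CliffordAlgebra.involute (B.totalCurrent u f)
        - algebraMap ℝ 𝕜 (η a) • stdI 𝕜 a (CliffordAlgebra.involute (B.totalCurrent u f))) := by
  have e : ρ (cliffE 𝕜 η a) u = algebraMap ℝ 𝕜 (η a) • cliffAct ρ (stdF 𝕜 η a) u := by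
    rw [cliffAct_stdF, LinearMap.smul_apply, smul_smul, ← map_mul, hη, map_one, one_smul]
  rw [e, map_smulₛₗ, map_algebraMap_real B.conj_eq, LinearMap.smul_apply,
    B.totalCurrent_stdF_left hη, stdF_eq, smul_mul_assoc, smul_comm _ B.s, smul_sub, smul_smul,
    ← map_mul, hη, map_one, one_smul]

/-- The total current is equivariant under the Lie algebra of the spin group. -/
theorem totalCurrent_spinElement {A : Fin n → Fin n → ℝ} (hA : ∀ b c, A b c = -A c b) (u f : Δ) :
    B.totalCurrent (ρ (spinElement 𝕜 η A) u) f + B.totalCurrent u (ρ (spinElement 𝕜 η A) f)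
      = -∑ b, ∑ c, (algebraMap ℝ 𝕜 (η c * A b c)) • (stdE 𝕜 b * stdI 𝕜 c (B.totalCurrent u f)) := by
  set J := B.totalCurrent u f
  set h : Fin n → 𝕜 := fun a => algebraMap ℝ 𝕜 (η a)
  set r : Fin n → Fin n → 𝕜 := fun b c => algebraMap ℝ 𝕜 (A b c)
  have hs := B.s_mul_self
  have inv_I : ∀ a (X : ExteriorAlgebra 𝕜 (Fin n → 𝕜)), CliffordAlgebra.involute (stdI 𝕜 a X)
      = -stdI 𝕜 a (CliffordAlgebra.involute X) := fun a X => involute_contractLeft _ _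
  have inv_E : ∀ a (X : ExteriorAlgebra 𝕜 (Fin n → 𝕜)), CliffordAlgebra.involute (stdE 𝕜 a * X)
      = -(stdE 𝕜 a * CliffordAlgebra.involute X) := fun a X => by
    have e : CliffordAlgebra.involute (stdE 𝕜 a : ExteriorAlgebra 𝕜 (Fin n → 𝕜)) = -stdE 𝕜 a :=
      CliffordAlgebra.involute_ι _
    rw [map_mul, e, neg_mul]
  have key : ∀ b c, B.totalCurrent (ρ (cliffE 𝕜 η c) (ρ (cliffE 𝕜 η b) u)) f
      + B.totalCurrent u (ρ (cliffE 𝕜 η c) (ρ (cliffE 𝕜 η b) f))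
      = (2 : 𝕜) • (h b • (stdE 𝕜 c * stdI 𝕜 b J) - h c • (stdE 𝕜 b * stdI 𝕜 c J)
        + (if c = b then h c else 0) • J) := by
    intro b c
    rw [B.totalCurrent_cliffE_left hη, B.totalCurrent_cliffE_left hη,
      B.totalCurrent_cliffE_right hη, B.totalCurrent_cliffE_right hη]
    simp only [map_smul, map_sub, inv_E, inv_I, CliffordAlgebra.involute_involute]
    have e : (B.s * B.s) • (-(stdE 𝕜 c * (stdE 𝕜 b * J)) + h b • (stdE 𝕜 c * stdI 𝕜 b J)
        + h c • stdI 𝕜 c (stdE 𝕜 b * J) - (h c * h b) • stdI 𝕜 c (stdI 𝕜 b J))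
        = -(stdE 𝕜 c * (stdE 𝕜 b * J)) + h b • (stdE 𝕜 c * stdI 𝕜 b J)
        + h c • stdI 𝕜 c (stdE 𝕜 b * J) - (h c * h b) • stdI 𝕜 c (stdI 𝕜 b J) := by
      rw [hs, one_smul]
    have e' := stdI_stdE_mul (𝕜 := 𝕜) c b J
    have e'' : (if c = b then h c else 0) • J = h c • (if c = b then (1 : 𝕜) else 0) • J := by
      split_ifs <;> simp
    rw [e'']
    simp only [mul_sub, mul_add, mul_smul_comm, map_add, map_smul, map_neg, mul_neg]
    linear_combination (norm := module) e + (2 * h c) • e'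
  have l1 : B.totalCurrent (ρ (spinElement 𝕜 η A) u) f
      = (1 / 4 : 𝕜) • ∑ b, ∑ c, r b c • B.totalCurrent (ρ (cliffE 𝕜 η c) (ρ (cliffE 𝕜 η b) u)) f := by
    have h4 : σ (1 / 4 : 𝕜) = 1 / 4 := by rw [map_div₀, map_one, map_ofNat]
    simp only [spinElement, map_smul, map_sum, map_mul, LinearMap.smul_apply, LinearMap.sum_apply,
      Module.End.mul_apply, map_smulₛₗ, h4, map_algebraMap_real B.conj_eq]
    rfl
  have l2 : B.totalCurrent u (ρ (spinElement 𝕜 η A) f)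
      = (1 / 4 : 𝕜) • ∑ b, ∑ c, r b c • B.totalCurrent u (ρ (cliffE 𝕜 η c) (ρ (cliffE 𝕜 η b) f)) := by
    simp only [spinElement, map_smul, map_sum, map_mul, LinearMap.smul_apply, LinearMap.sum_apply,
      Module.End.mul_apply]
    rfl
  have hr : ∀ b c, r b c = -r c b := fun b c => by simp only [r]; rw [hA, map_neg]
  have s1 : ∑ b, ∑ c, r b c • h b • (stdE 𝕜 c * stdI 𝕜 b J)
      = -∑ b, ∑ c, r b c • h c • (stdE 𝕜 b * stdI 𝕜 c J) := by
    rw [Finset.sum_comm, ← Finset.sum_neg_distrib]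
    refine Finset.sum_congr rfl fun b _ => ?_
    rw [← Finset.sum_neg_distrib]
    refine Finset.sum_congr rfl fun c _ => ?_
    rw [hr c b, neg_smul]
  have s2 : ∑ b, ∑ c, r b c • (if c = b then h c else 0) • J = 0 := by
    refine Finset.sum_eq_zero fun b _ => Finset.sum_eq_zero fun c _ => ?_
    split_ifs with hbc
    · subst hbc
      have : r c c = 0 := by linear_combination hr c c / 2
      rw [this, zero_smul]
    · rw [zero_smul, smul_zero]
  have e3 : ∑ b, ∑ c, (algebraMap ℝ 𝕜 (η c * A b c)) • (stdE 𝕜 b * stdI 𝕜 c J)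
      = ∑ b, ∑ c, r b c • h c • (stdE 𝕜 b * stdI 𝕜 c J) :=
    Finset.sum_congr rfl fun b _ => Finset.sum_congr rfl fun c _ => by
      rw [smul_smul, map_mul, mul_comm]
  rw [l1, l2, ← smul_add, ← Finset.sum_add_distrib]
  simp only [← Finset.sum_add_distrib, ← smul_add, key]
  simp only [smul_comm _ (2 : 𝕜), ← Finset.smul_sum, smul_add, smul_sub, Finset.sum_add_distrib,
    Finset.sum_sub_distrib, s1, s2, e3]
  module

end SpinorInnerProduct

end

section

namespace SpinorInnerProduct

variable {𝕜 : Type*} [RCLike 𝕜] {n : ℕ} {η : Fin n → ℝ} {Δ : Type*} [AddCommGroup Δ] [Module 𝕜 Δ]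
  {ρ : CliffordAlgebra (quadForm 𝕜 η) →ₐ[𝕜] Module.End 𝕜 Δ} {σ : 𝕜 →+* 𝕜}
  (B : SpinorInnerProduct ρ σ)

theorem adjoint_real (v : Fin n → ℝ) (u f : Δ) :
    B.form (ρ (cliffordOfReal 𝕜 η (CliffordAlgebra.ι _ v)) u) f
      = B.s * B.form u (ρ (cliffordOfReal 𝕜 η (CliffordAlgebra.ι _ v)) f) := by
  have h : ∀ a u f, B.form (ρ (cliffE 𝕜 η a) u) f = B.s * B.form u (ρ (cliffE 𝕜 η a) f) :=
    B.adjoint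
  rw [cliffordOfReal_ι, ι_eq_sum_cliffE]
  simp only [map_sum, map_smul, LinearMap.sum_apply, LinearMap.smul_apply, map_smulₛₗ,
    map_algebraMap_real B.conj_eq, smul_eq_mul, h, Finset.mul_sum]
  exact Finset.sum_congr rfl fun a _ => mul_left_comm _ _ _

theorem adjoint_even {z : CliffordAlgebra (quadForm ℝ η)}
    (hz : z ∈ CliffordAlgebra.evenOdd (quadForm ℝ η) 0) (u f : Δ) :
    B.form (ρ (cliffordOfReal 𝕜 η z) u) f
      = B.form u (ρ (cliffordOfReal 𝕜 η (CliffordAlgebra.reverse z)) f) := by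
  induction z, hz using CliffordAlgebra.even_induction generalizing f with
  | algebraMap r =>
    have h : ∀ v : Δ, ρ (cliffordOfReal 𝕜 η (algebraMap ℝ _ r)) v = algebraMap ℝ 𝕜 r • v := by
      intro v
      rw [AlgHom.commutes, IsScalarTower.algebraMap_apply ℝ 𝕜 (CliffordAlgebra (quadForm 𝕜 η)),
        AlgHom.commutes, Module.algebraMap_end_apply]
    rw [CliffordAlgebra.reverse.commutes, h, h, map_smulₛₗ, map_algebraMap_real B.conj_eq,
      LinearMap.smul_apply, map_smul]
  | add x y hx hy ihx ihy => simp only [map_add, LinearMap.add_apply, ihx, ihy]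
  | ι_mul_ι_mul v w x hx ih =>
    simp only [map_mul, Module.End.mul_apply, CliffordAlgebra.reverse.map_mul,
      CliffordAlgebra.reverse_ι, B.adjoint_real, ih]
    rw [← mul_assoc, B.s_mul_self, one_mul]

end SpinorInnerProduct

namespace SpinStructure

variable {n : ℕ} {M : Type*} [TopologicalSpace M] [ChartedSpace (Model n) M]
  [IsManifold 𝓘(ℝ, Model n) ∞ M] {g : PseudoRiemannianMetric n M} {η : Fin n → ℝ} {ι : Type*}
  {S : SpinStructure g η ι} {i j : ι} {x : M} {𝕜 : Type*} [RCLike 𝕜]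
  {Δ : Type*} [AddCommGroup Δ] [Module 𝕜 Δ]
  {ρ : CliffordAlgebra (quadForm 𝕜 η) →ₐ[𝕜] Module.End 𝕜 Δ} {σ : 𝕜 →+* 𝕜}
  {B : SpinorInnerProduct ρ σ} {ψ ψ' φ φ' : S.SpinorField Δ} {p : ℕ}

theorem form_transition (hi : x ∈ S.baseSet i) (hj : x ∈ S.baseSet j) (u f : Δ) :
    B.form (ρ (S.transition 𝕜 i j x) u) f = B.form u (ρ (S.transitionInv 𝕜 i j x) f) := by
  rw [transitionInv, transition, reverse_cliffordOfReal]
  exact B.adjoint_even (spinGroup.mem_even (S.lift_mem i j x ⟨hi, hj⟩)) u f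

/-- The total current does not depend on the spin frame. -/
theorem totalCurrent_transition (hi : x ∈ S.baseSet i) (hj : x ∈ S.baseSet j) (u f : Δ) :
    B.totalCurrent (ρ (S.transition 𝕜 i j x) u) (ρ (S.transition 𝕜 i j x) f)
      = S.toFrame i x (S.ofFrame j x (B.totalCurrent u f)) := by
  set o : (Fin n → 𝕜) →ₗ[𝕜] Fin n → 𝕜 := LinearMap.pi fun a => ∑ b,
    (algebraMap ℝ 𝕜 (η b * g.val x (S.frame j b x) (S.frame i a x))) • LinearMap.proj b with ho
  have oa : ∀ v a, o v a
      = ∑ b, algebraMap ℝ 𝕜 (η b * g.val x (S.frame j b x) (S.frame i a x)) * v b := by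
    intro v a
    simp only [ho, LinearMap.pi_apply, LinearMap.sum_apply, LinearMap.smul_apply,
      LinearMap.proj_apply, smul_eq_mul]
  have hmap : ∀ β, S.toFrame i x (S.ofFrame j x β) = ExteriorAlgebra.map o β := by
    intro β
    have h : (S.toFrame i x).comp (S.ofFrame j x) = ExteriorAlgebra.map o := by
      rw [ofFrame, toFrame, ExteriorAlgebra.map_comp_map]
      congr 1
      refine LinearMap.ext fun f => funext fun b => ?_
      rw [oa]
      simp only [LinearMap.comp_apply, LinearMap.sum_apply, LinearMap.smulRight_apply,
        LinearMap.proj_apply, LinearMap.coe_mk, AddHom.coe_mk, LinearMap.smul_apply,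
        ContinuousLinearMap.coe_coe, Algebra.linearMap_apply, smul_eq_mul, map_mul]
      exact Finset.sum_congr rfl fun a _ => mul_comm _ _
    exact AlgHom.congr_fun h β
  have hsharp : ∀ u v, sharp η (o u) (o v) = sharp η u v := by
    intro u v
    have e : ∀ a, o u a * (algebraMap ℝ 𝕜 (η a) * o v a) = ∑ b, ∑ c,
        algebraMap ℝ 𝕜 (η b * η c) * (u b * v c) * algebraMap ℝ 𝕜 (η a *
          (g.val x (S.frame j b x) (S.frame i a x) * g.val x (S.frame j c x) (S.frame i a x))) := by
      intro a
      rw [oa, oa, Finset.mul_sum, Finset.sum_mul_sum]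
      refine Finset.sum_congr rfl fun b _ => Finset.sum_congr rfl fun c _ => ?_
      simp only [map_mul]
      ring
    rw [sharp_apply, sharp_apply]
    simp only [e]
    rw [Finset.sum_comm]
    refine Finset.sum_congr rfl fun b _ => ?_
    rw [Finset.sum_comm, Finset.sum_eq_single b]
    · rw [← Finset.mul_sum, ← map_sum, S.sum_metric_mul_metric hj hi, if_pos rfl, S.sign_mul_self,
        map_one]
      ring
    · intro c _ hc
      rw [← Finset.mul_sum, ← map_sum, S.sum_metric_mul_metric hj hi, if_neg (Ne.symm hc), map_zero,
        mul_zero]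
    · simp
  refine eq_of_scalarPart_contractForm S.sign_mul_self fun γ => ?_
  have hγ : γ = S.toFrame i x (S.ofFrame i x γ) := (S.toFrame_ofFrame hi γ).symm
  set α := S.ofFrame i x γ
  have hα : S.toFrame i x α = ExteriorAlgebra.map o (S.toFrame j x α) := by
    rw [← hmap, S.ofFrame_toFrame hj]
  rw [hmap, ← B.form_cliffAct S.sign_mul_self, hγ, form_transition hi hj, cliffAct_apply]
  rw [← Module.End.mul_apply (ρ (quantize η _)), ← map_mul,
    S.quantize_toFrame_mul_transition hi hj, map_mul, Module.End.mul_apply,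
    ← Module.End.mul_apply (ρ (S.transitionInv 𝕜 i j x)), ← map_mul, S.transitionInv_mul 𝕜 hi hj,
    map_one, Module.End.one_apply, ← cliffAct_apply, B.form_cliffAct S.sign_mul_self, hα,
    contractForm_map hsharp, scalarPart_map]

theorem list_prod_eq_cliffAct (A : Finset (Fin n)) :
    ((A.sort.reverse.map fun a =>
      ρ (quantize η (S.toFrame (S.indexAt x) x (S.flat 𝕜 (S.frame (S.indexAt x) a x))))).prod)
      = cliffAct ρ (reverseProd 𝕜 η A) := by
  rw [cliffAct_apply, reverseProd,
    quantize_prod_stdF (List.nodup_reverse.2 (Finset.sort_nodup _ _)), map_list_prod, List.map_map]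
  congr 2
  funext a
  rw [toFrame_flat_frame_eq (S.mem_baseSet_at x)]
  rfl

theorem currentCoeff_eq (ψ φ : S.SpinorField Δ) (A : Finset (Fin n)) :
    S.currentCoeff B ψ φ A x = B.form (φ x) (cliffAct ρ (reverseProd 𝕜 η A) (ψ x)) := by
  rw [currentCoeff, list_prod_eq_cliffAct]

theorem current_apply (ψ φ : S.SpinorField Δ) : S.current B p ψ φ x
    = S.ofFrame (S.indexAt x) x (degreePart 𝕜 n p (B.totalCurrent (φ x) (ψ x))) := by
  rw [degreePart_apply, map_sum, current]
  refine Finset.sum_congr rfl fun A _ => ?_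
  rw [currentCoeff_eq, map_smul, B.repr_totalCurrent]

theorem degreePart_toFrame_ofFrame (α : ExteriorAlgebra 𝕜 (Fin n → 𝕜)) :
    degreePart 𝕜 n p (S.toFrame i x (S.ofFrame j x α))
      = S.toFrame i x (S.ofFrame j x (degreePart 𝕜 n p α)) :=
  degreePart_comm (((S.toFrame i x).comp (S.ofFrame j x)).toLinearMap)
    (fun _ h => S.toFrame_mem (S.ofFrame_mem h))
    (fun _ hm _ h => degreePart_of_mem_ne (Ne.symm hm) (S.toFrame_mem (S.ofFrame_mem h))) α

theorem locForm_current (hx : x ∈ S.baseSet i) (ψ φ : S.SpinorField Δ) :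
    S.locForm i (S.current B p ψ φ) x
      = degreePart 𝕜 n p (B.totalCurrent (S.spinorIn ρ i φ x) (S.spinorIn ρ i ψ x)) := by
  rw [locForm, current_apply, ← degreePart_toFrame_ofFrame,
    ← totalCurrent_transition hx (S.mem_baseSet_at x)]
  rfl

theorem current_add_left : S.current B p (ψ + ψ') φ
    = S.current B p ψ φ + S.current B p ψ' φ := funext fun x => by
  simp only [current_apply, Pi.add_apply, map_add]

theorem current_add_right : S.current B p ψ (φ + φ')
    = S.current B p ψ φ + S.current B p ψ φ' := funext fun x => by
  simp only [current_apply, Pi.add_apply, map_add, LinearMap.add_apply]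

theorem current_smul_left (c : 𝕜) : S.current B p (c • ψ) φ = c • S.current B p ψ φ :=
  funext fun x => by simp only [current_apply, Pi.smul_apply, map_smul]

theorem current_smul_right (c : 𝕜) : S.current B p ψ (c • φ) = σ c • S.current B p ψ φ :=
  funext fun x => by
    simp only [current_apply, Pi.smul_apply, map_smulₛₗ, LinearMap.smul_apply,
      RingHom.id_apply]

theorem currentCoeff_swap (ψ φ : S.SpinorField Δ) {A : Finset (Fin n)} (hA : A.card = p) :
    S.currentCoeff B φ ψ A x
      = B.ε * B.s ^ p * (-1) ^ (p * (p - 1) / 2) * σ (S.currentCoeff B ψ φ A x) := by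
  set G : Fin n → Module.End 𝕜 Δ := fun a => cliffAct ρ (stdF 𝕜 η a) with hG
  have anti : ∀ a b, a ≠ b → G a * G b = -(G b * G a) := by
    intro a b hab
    simp only [hG, cliffAct_stdF, smul_mul_smul_comm, ← map_mul ρ]
    rw [cliffE_mul_cliffE, if_neg hab, zero_smul, zero_sub, map_neg, smul_neg,
      mul_comm (algebraMap ℝ 𝕜 (η a))]
  have adj : ∀ (l : List (Fin n)) (u f : Δ), B.form ((l.map G).prod u) f
      = B.s ^ l.length * B.form u ((l.reverse.map G).prod f) := by
    intro l
    induction l with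
    | nil => simp
    | cons a l ih =>
      intro u f
      rw [List.map_cons, List.prod_cons, Module.End.mul_apply, B.adjoint_stdF, ih,
        List.reverse_cons, List.map_append, List.prod_append, List.map_singleton,
        List.prod_singleton, List.length_cons, pow_succ, Module.End.mul_apply]
      ring
  have hrev : cliffAct ρ (reverseProd 𝕜 η A) = (A.sort.reverse.map G).prod := by
    rw [cliffAct_apply, reverseProd,
      quantize_prod_stdF (List.nodup_reverse.2 (Finset.sort_nodup _ _)), map_list_prod,
      List.map_map]
    rfl
  have hsort := prod_map_reverse G anti A.sort (Finset.sort_nodup _ _)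
  rw [Finset.length_sort, hA] at hsort
  have hone : ((-1 : Module.End 𝕜 Δ) ^ (p * (p - 1) / 2))
      = ((-1 : 𝕜) ^ (p * (p - 1) / 2)) • (1 : Module.End 𝕜 Δ) := by
    rw [← Algebra.algebraMap_eq_smul_one, map_pow, map_neg, map_one]
  rw [hone, smul_mul_assoc, one_mul] at hsort
  set m := (-1 : 𝕜) ^ (p * (p - 1) / 2) with hm
  have hmm : m * m = 1 := by rw [hm, ← mul_pow]; simp
  have hσ : σ m = m := by rw [hm, map_pow, map_neg, map_one]
  have hs : B.s ^ p * B.s ^ p = 1 := by rw [← mul_pow, B.s_mul_self, one_pow]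
  have h1 := adj A.sort (ψ x) (φ x)
  rw [Finset.length_sort, hA, B.symm] at h1
  have h2 : (A.sort.map G).prod = m • (A.sort.reverse.map G).prod := by
    rw [hsort, smul_smul, hmm, one_smul]
  rw [h2, LinearMap.smul_apply, map_smul, smul_eq_mul, map_mul, hσ] at h1
  rw [currentCoeff_eq, currentCoeff_eq, hrev]
  linear_combination (-B.form (ψ x) ((A.sort.reverse.map G).prod (φ x))) * hs - B.s ^ p * h1

section System

variable [FiniteDimensional 𝕜 Δ]

theorem smooth_totalCurrent {U : Set M} {f h : M → Δ}
    (hf : CoordSmoothOn (n := n) (Module.finBasis 𝕜 Δ) f U)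
    (hh : CoordSmoothOn (n := n) (Module.finBasis 𝕜 Δ) h U) :
    CoordSmoothOn (n := n) (formBasis 𝕜 n) (fun y => B.totalCurrent (f y) (h y)) U :=
  CoordSmoothOn.sesquilinear B.conj_eq B.totalCurrent hf hh

theorem IsSmoothSpinor.current (hψ : S.IsSmoothSpinor ρ ψ) (hφ : S.IsSmoothSpinor ρ φ) :
    S.IsSmoothForm p (S.current B p ψ φ) := by
  refine .of_loc (fun i => ?_) fun i y hy => ?_
  · exact (CoordSmoothOn.linear (degreePart 𝕜 n p) (smooth_totalCurrent (hφ i) (hψ i))).congr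
      fun y hy => locForm_current hy ψ φ
  · rw [locForm_current hy]; exact degreePart_mem _ _

theorem covIn_totalCurrent {U : Set M} (hU : IsOpen U) (hx : x ∈ U) {f h : M → Δ}
    (hf : CoordSmoothOn (n := n) (Module.finBasis 𝕜 Δ) f U)
    (hh : CoordSmoothOn (n := n) (Module.finBasis 𝕜 Δ) h U) (v : TangentSpace 𝓘(ℝ, Model n) x) :
    S.covIn i (fun y => B.totalCurrent (f y) (h y)) x v
      = B.totalCurrent (S.spinCovIn ρ i f x v) (h x)
        + B.totalCurrent (f x) (S.spinCovIn ρ i h x v) := by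
  rw [covIn, coordDeriv_sesquilinear (b₁ := Module.finBasis 𝕜 Δ) (b₂ := Module.finBasis 𝕜 Δ)
    B.conj_eq B.totalCurrent hU hx hf hh, spinCovIn, spinCovIn, map_add, map_add,
    LinearMap.add_apply, sub_eq_add_neg,
    ← B.totalCurrent_spinElement S.sign_mul_self (S.connAlong_swap v)]
  rw [connElement]
  abel

theorem covIn_degreePart {U : Set M} (hU : IsOpen U) (hx : x ∈ U)
    {W : M → ExteriorAlgebra 𝕜 (Fin n → 𝕜)} (hW : CoordSmoothOn (n := n) (formBasis 𝕜 n) W U)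
    (v : TangentSpace 𝓘(ℝ, Model n) x) :
    S.covIn i (fun y => degreePart 𝕜 n p (W y)) x v = degreePart 𝕜 n p (S.covIn i W x v) := by
  rw [covIn, covIn, coordDeriv_linear (degreePart 𝕜 n p) hU hx hW, map_sub]
  simp only [map_sum, map_smul, degreePart_stdE_mul_stdI]

theorem covIn_current (hx : x ∈ S.baseSet i) (hψ : S.IsSmoothSpinor ρ ψ)
    (hφ : S.IsSmoothSpinor ρ φ) {a : Fin n} {f u : Δ}
    (h₁ : S.spinCovIn ρ i (S.spinorIn ρ i ψ) x (S.frame i a x) = cliffAct ρ (stdF 𝕜 η a) f)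
    (h₂ : S.spinCovIn ρ i (S.spinorIn ρ i φ) x (S.frame i a x) = cliffAct ρ (stdF 𝕜 η a) u) :
    S.covIn i (S.locForm i (S.current B p ψ φ)) x (S.frame i a x)
      = degreePart 𝕜 n p (stdI 𝕜 a (B.totalCurrent (S.spinorIn ρ i φ x) f))
        + degreePart 𝕜 n p (stdF 𝕜 η a * B.totalCurrent (S.spinorIn ρ i φ x) f)
        + (B.s * (-1) ^ p) •
          (degreePart 𝕜 n p (stdI 𝕜 a (B.totalCurrent u (S.spinorIn ρ i ψ x)))
            - degreePart 𝕜 n p (stdF 𝕜 η a * B.totalCurrent u (S.spinorIn ρ i ψ x))) := by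
  have hU := S.isOpen_baseSet i
  have sm := smooth_totalCurrent (B := B) (hφ i) (hψ i)
  have inv_I : ∀ X : ExteriorAlgebra 𝕜 (Fin n → 𝕜), stdI 𝕜 a (CliffordAlgebra.involute X)
      = -CliffordAlgebra.involute (stdI 𝕜 a X) := fun X => by
    rw [stdI, involute_contractLeft, neg_neg]
  have inv_F : ∀ X : ExteriorAlgebra 𝕜 (Fin n → 𝕜), stdF 𝕜 η a * CliffordAlgebra.involute X
      = -CliffordAlgebra.involute (stdF 𝕜 η a * X) := fun X => by
    have e : CliffordAlgebra.involute (stdF 𝕜 η a : ExteriorAlgebra 𝕜 (Fin n → 𝕜)) = -stdF 𝕜 η a :=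
      CliffordAlgebra.involute_ι _
    rw [map_mul, e, neg_mul, neg_neg]
  rw [S.covIn_congr hU hx (fun y hy => locForm_current hy ψ φ), covIn_degreePart hU hx sm,
    covIn_totalCurrent hU hx (hφ i) (hψ i), h₁, h₂, B.totalCurrent_stdF_right S.sign_mul_self,
    B.totalCurrent_stdF_left S.sign_mul_self, inv_I, inv_F]
  simp only [map_add, map_smul, map_sub, map_neg, degreePart_involute,
    involute_of_mem (degreePart_mem p _)]
  module

end System

end SpinStructure

end

section

namespace SpinStructure

variable {n : ℕ} {M : Type*} [TopologicalSpace M] [ChartedSpace (Model n) M]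
  [IsManifold 𝓘(ℝ, Model n) ∞ M] {g : PseudoRiemannianMetric n M} {η : Fin n → ℝ} {ι : Type*}
  {S : SpinStructure g η ι} {i : ι} {x : M} {𝕜 : Type*} [RCLike 𝕜]
  {Δ : Type*} [AddCommGroup Δ] [Module 𝕜 Δ] [FiniteDimensional 𝕜 Δ]
  {ρ : CliffordAlgebra (quadForm 𝕜 η) →ₐ[𝕜] Module.End 𝕜 Δ} {σ : 𝕜 →+* 𝕜}
  {B : SpinorInnerProduct ρ σ} {ψ φ : S.SpinorField Δ} {p : ℕ}

theorem degreePart_stdF_mul (a : Fin n) (α : ExteriorAlgebra 𝕜 (Fin n → 𝕜)) :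
    degreePart 𝕜 n (p + 1) (stdF 𝕜 η a * α) = stdF 𝕜 η a * degreePart 𝕜 n p α := by
  rw [stdF_eq, smul_mul_assoc, map_smul, degreePart_stdE_mul, smul_mul_assoc]

/-- The Dirac currents of twistor spinors solve the prolonged system. -/
theorem prolongedSystem_current {l k : ℝ} (hE : S.IsEinstein l) (hn : 3 ≤ n)
    (hk : k = -(l / (2 * ((n : ℝ) - 1)))) (hp : 1 ≤ p) (hψ : S.IsTwistorSpinor ρ ψ)
    (hφ : S.IsTwistorSpinor ρ φ) :
    ∃ m f t, S.ProlongedSystem (algebraMap ℝ 𝕜 k) p (S.current B p ψ φ) m f t := by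
  obtain ⟨p, rfl⟩ := Nat.exists_eq_add_of_le' hp
  set χ := (1 / (n : 𝕜)) • S.dirac ρ ψ with hχ
  set χ' := (1 / (n : 𝕜)) • S.dirac ρ φ with hχ'
  have sχ : S.IsSmoothSpinor ρ χ := hψ.1.dirac.smul _
  have sχ' : S.IsSmoothSpinor ρ χ' := hφ.1.dirac.smul _
  set κ := algebraMap ℝ 𝕜 k with hκ
  have hσ : σ (κ / 2) = κ / 2 := by
    rw [map_div₀, hκ, map_algebraMap_real B.conj_eq, map_ofNat]
  set e : 𝕜 := B.s * (-1) ^ (p + 1) with he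
  have hee : e * e = 1 := by
    rw [he, mul_mul_mul_comm, B.s_mul_self, ← mul_pow]; simp
  have hs : B.s * (-1) ^ p = -e := by rw [he, pow_succ]; ring
  have d₁ : ∀ i, ∀ x ∈ S.baseSet i, ∀ a, S.spinCovIn ρ i (S.spinorIn ρ i ψ) x (S.frame i a x)
      = cliffAct ρ (stdF 𝕜 η a) (S.spinorIn ρ i χ x) := fun i x hx a => hψ.spinCovIn_eq hx a
  have d₂ : ∀ i, ∀ x ∈ S.baseSet i, ∀ a, S.spinCovIn ρ i (S.spinorIn ρ i φ) x (S.frame i a x)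
      = cliffAct ρ (stdF 𝕜 η a) (S.spinorIn ρ i χ' x) := fun i x hx a => hφ.spinCovIn_eq hx a
  have d₃ : ∀ i, ∀ x ∈ S.baseSet i, ∀ a, S.spinCovIn ρ i (S.spinorIn ρ i χ) x (S.frame i a x)
      = cliffAct ρ (stdF 𝕜 η a) ((κ / 2) • S.spinorIn ρ i ψ x) := fun i x hx a => by
    rw [map_smul]; exact hψ.spinCovIn_dirac hE hn hk hx a
  have d₄ : ∀ i, ∀ x ∈ S.baseSet i, ∀ a, S.spinCovIn ρ i (S.spinorIn ρ i χ') x (S.frame i a x)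
      = cliffAct ρ (stdF 𝕜 η a) ((κ / 2) • S.spinorIn ρ i φ x) := fun i x hx a => by
    rw [map_smul]; exact hφ.spinCovIn_dirac hE hn hk hx a
  have c₁ : ∀ q, S.IsSmoothForm q (S.current B q χ φ) := fun q => sχ.current hφ.1
  have c₂ : ∀ q, S.IsSmoothForm q (S.current B q ψ χ') := fun q => IsSmoothSpinor.current hψ.1 sχ'
  refine ⟨S.current B (p + 1 + 1) χ φ + e • S.current B (p + 1 + 1) ψ χ',
    S.current B p χ φ + (-e) • S.current B p ψ χ', (2 * e) • S.current B (p + 1) χ χ',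
    IsSmoothSpinor.current hψ.1 hφ.1, (c₁ _).add ((c₂ _).smul _), (c₁ _).add ((c₂ _).smul _),
    (sχ.current sχ').smul _, ?_, ?_, ?_, ?_⟩
  all_goals
    intro i x hx a
    have hU := S.isOpen_baseSet i
  · rw [covIn_current hx hψ.1 hφ.1 (d₁ i x hx a) (d₂ i x hx a), ← he]
    simp only [locForm_add_apply, locForm_smul_apply, locForm_current hx, degreePart_stdI,
      degreePart_stdF_mul, map_add, map_smul, mul_add, mul_smul_comm]
    module
  · rw [locForm_add, S.covIn_add hU hx ((c₁ _).smooth i) (((c₂ _).smul e).smooth i), locForm_smul,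
      S.covIn_smul e hU hx ((c₂ _).smooth i),
      covIn_current hx sχ hφ.1 (d₃ i x hx a) (d₂ i x hx a),
      covIn_current hx hψ.1 sχ' (d₁ i x hx a) (d₄ i x hx a), pow_succ (-1 : 𝕜) (p + 1),
      ← mul_assoc, ← he]
    simp only [locForm_smul_apply, locForm_current hx, degreePart_stdI,
      degreePart_stdF_mul, map_smulₛₗ, hσ, LinearMap.smul_apply, mul_add, mul_smul_comm,
      RingHom.id_apply]
    generalize stdI 𝕜 a (degreePart 𝕜 n (p + 1 + 1 + 1)
      (B.totalCurrent (S.spinorIn ρ i φ x) (S.spinorIn ρ i ψ x))) = P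
    generalize stdF 𝕜 η a * degreePart 𝕜 n (p + 1)
      (B.totalCurrent (S.spinorIn ρ i φ x) (S.spinorIn ρ i ψ x)) = Q
    linear_combination (norm := module) (-(κ / 2)) • (hee • (P - Q))
  · rw [locForm_add, S.covIn_add hU hx ((c₁ _).smooth i) (((c₂ _).smul (-e)).smooth i),
      locForm_smul, S.covIn_smul (-e) hU hx ((c₂ _).smooth i),
      covIn_current hx sχ hφ.1 (d₃ i x hx a) (d₂ i x hx a),
      covIn_current hx hψ.1 sχ' (d₁ i x hx a) (d₄ i x hx a), hs]
    simp only [locForm_smul_apply, locForm_current hx, degreePart_stdI, map_smulₛₗ, hσ,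
      LinearMap.smul_apply, map_sub, mul_smul_comm, RingHom.id_apply]
    generalize stdI 𝕜 a (degreePart 𝕜 n (p + 1)
      (B.totalCurrent (S.spinorIn ρ i φ x) (S.spinorIn ρ i ψ x))) = P
    generalize degreePart 𝕜 n p (stdF 𝕜 η a *
      B.totalCurrent (S.spinorIn ρ i φ x) (S.spinorIn ρ i ψ x)) = Q
    linear_combination (norm := module) (κ / 2) • (hee • (P - Q))
  · rw [locForm_smul, S.covIn_smul _ hU hx ((sχ.current sχ').smooth i),
      covIn_current hx sχ sχ' (d₃ i x hx a) (d₄ i x hx a), ← he]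
    simp only [locForm_add_apply, locForm_smul_apply, locForm_current hx, degreePart_stdI,
      degreePart_stdF_mul, map_smulₛₗ, hσ, LinearMap.smul_apply, map_add, mul_add,
      mul_smul_comm, RingHom.id_apply]
    generalize stdI 𝕜 a (degreePart 𝕜 n (p + 1 + 1)
      (B.totalCurrent (S.spinorIn ρ i φ x) (S.spinorIn ρ i χ x))) = P
    generalize stdF 𝕜 η a * degreePart 𝕜 n p
      (B.totalCurrent (S.spinorIn ρ i φ x) (S.spinorIn ρ i χ x)) = Q
    linear_combination (norm := module) κ • (hee • (P - Q))

end SpinStructure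

end

end

end SpinGeometry

namespace SpinGeometry

namespace SpinStructure

section

open scoped Manifold ContDiff

variable {n : ℕ} {M : Type*} [TopologicalSpace M] [ChartedSpace (Model n) M]
  [IsManifold 𝓘(ℝ, Model n) ∞ M] {g : PseudoRiemannianMetric n M} {η : Fin n → ℝ} {ι : Type*}
  {S : SpinStructure g η ι} {𝕜 : Type*} [RCLike 𝕜]
  {Δ : Type*} [AddCommGroup Δ] [Module 𝕜 Δ] [FiniteDimensional 𝕜 Δ]
  {ρ : CliffordAlgebra (quadForm 𝕜 η) →ₐ[𝕜] Module.End 𝕜 Δ} {σ : 𝕜 →+* 𝕜}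

/-- The action of the normal CKY forms on the twistor spinors of an Einstein manifold. -/
noncomputable def twistorAction (ρ : CliffordAlgebra (quadForm 𝕜 η) →ₐ[𝕜] Module.End 𝕜 Δ) {l k : ℝ}
    (hE : S.IsEinstein l) (hn : 3 ≤ n) (hk : k = -(l / (2 * ((n : ℝ) - 1)))) {p : ℕ} (hp : 1 ≤ p) :
    S.prolongedForms (algebraMap ℝ 𝕜 k) p →ₗ[𝕜] S.twistorSpinors ρ (by omega)
      →ₗ[𝕜] S.twistorSpinors ρ (by omega) :=
  LinearMap.mk₂ 𝕜 (fun w ψ => ⟨S.ckyOperator ρ p w ψ, by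
      obtain ⟨_, _, _, h⟩ := w.2
      exact IsTwistorSpinor.ckyOperator hE hn hk hp h ψ.2⟩)
    (fun w w' _ => Subtype.ext (ckyOperator_add_left (smooth_of_mem_prolongedForms w.2)
      (smooth_of_mem_prolongedForms w'.2)))
    (fun c w _ => Subtype.ext (ckyOperator_smul_left c (smooth_of_mem_prolongedForms w.2)))
    (fun _ ψ ψ' => Subtype.ext (ckyOperator_add_right ψ.2.1 ψ'.2.1))
    (fun c _ ψ => Subtype.ext (ckyOperator_smul_right c ψ.2.1))

/-- The Dirac currents of the twistor spinors of an Einstein manifold. -/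
noncomputable def twistorCurrent (B : SpinorInnerProduct ρ σ) {l k : ℝ}
    (hE : S.IsEinstein l) (hn : 3 ≤ n) (hk : k = -(l / (2 * ((n : ℝ) - 1)))) {p : ℕ} (hp : 1 ≤ p) :
    S.twistorSpinors ρ (by omega) →ₗ[𝕜] S.twistorSpinors ρ (by omega)
      →ₛₗ[σ] S.prolongedForms (algebraMap ℝ 𝕜 k) p :=
  LinearMap.mk₂'ₛₗ (RingHom.id 𝕜) σ
    (fun ψ φ => ⟨S.current B p ψ φ, prolongedSystem_current hE hn hk hp ψ.2 φ.2⟩)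
    (fun ψ ψ' φ => Subtype.ext
      (current_add_left (B := B) (p := p) (ψ := ψ.1) (ψ' := ψ'.1) (φ := φ.1)))
    (fun c ψ φ => Subtype.ext
      (current_smul_left (B := B) (p := p) (ψ := ψ.1) (φ := φ.1) c))
    (fun ψ φ φ' => Subtype.ext
      (current_add_right (B := B) (p := p) (ψ := ψ.1) (φ := φ.1) (φ' := φ'.1)))
    (fun c ψ φ => Subtype.ext
      (current_smul_right (B := B) (p := p) (ψ := ψ.1) (φ := φ.1) c))

/-- On an Einstein manifold the normal CKY forms and the twistor spinors form a superalgebra. -/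
theorem IsEinstein.isExtendedSuperalgebra (B : SpinorInnerProduct ρ σ) {l k : ℝ}
    (hE : S.IsEinstein l) (hn : 3 ≤ n) (hk : k = -(l / (2 * ((n : ℝ) - 1)))) :
    S.IsExtendedSuperalgebra B (S.prolongedForms (algebraMap ℝ 𝕜 k))
      (S.twistorSpinors ρ (by omega)) where
  even_even p q hp hq := ⟨S.prolongedBracket _ p q hp hq, fun _ _ => rfl⟩
  even_even_symm := by
    rintro p q hp hq w₁ ⟨_, _, _, h₁⟩ w₂ ⟨_, _, _, h₂⟩
    exact h₁.ckyBracket_symm h₂ hp hq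
  even_jacobi := by
    rintro p q r hp hq hr w₁ ⟨_, _, _, h₁⟩ w₂ ⟨_, _, _, h₂⟩ w₃ ⟨_, _, _, h₃⟩
    exact h₁.ckyBracket_jacobi h₂ h₃ hp hq hr
  even_odd p hp := ⟨twistorAction ρ hE hn hk hp, fun _ _ => rfl⟩
  odd_odd p hp := ⟨twistorCurrent B hE hn hk hp, fun _ _ => rfl⟩
  odd_odd_reverse _ ψ _ φ _ _ hA _ := currentCoeff_swap ψ φ hA
  polar_mem p hp _ hψ _ hφ := (S.prolongedForms _ p).smul_mem _ ((S.prolongedForms _ p).add_mem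
    (prolongedSystem_current hE hn hk hp hψ hφ) (prolongedSystem_current hE hn hk hp hφ hψ))
  polar_symm p ψ _ φ _ := by rw [polarCurrent, polarCurrent, add_comm]
  polar_self p ψ _ := by rw [polarCurrent]; module

end

end SpinStructure

end SpinGeometry

open SpinGeometry in
theorem mainTheorem2 {𝕜 : Type*} [RCLike 𝕜] {n : ℕ} (hn : 3 ≤ n)
    {M : Type*} [TopologicalSpace M] [ChartedSpace (Model n) M]
    [IsManifold 𝓘(ℝ, Model n) ∞ M] (g : PseudoRiemannianMetric n M)
    (η : Fin n → ℝ) {ι : Type*} (S : SpinStructure g η ι)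
    {Δ : Type*} [AddCommGroup Δ] [Module 𝕜 Δ] [FiniteDimensional 𝕜 Δ]
    (ρ : CliffordAlgebra (quadForm 𝕜 η) →ₐ[𝕜] Module.End 𝕜 Δ)
    {σ : 𝕜 →+* 𝕜} (B : SpinorInnerProduct ρ σ) :
    (∀ c : ℝ, S.HasConstantCurvature c →
      ∃ (E : ℕ → Submodule 𝕜 (FormField 𝕜 n M)) (O : Submodule 𝕜 (S.SpinorField Δ)),
        (∀ p, 1 ≤ p → p < n → ∀ w, w ∈ E p ↔ S.IsCKY p w) ∧
        (∀ p, n ≤ p → ∀ w, w ∈ E p ↔ S.IsNormalCKY p w) ∧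
        (∀ ψ, ψ ∈ O ↔ S.IsTwistorSpinor ρ ψ) ∧
        S.IsExtendedSuperalgebra B E O) ∧
    (∀ l : ℝ, S.IsEinstein l →
      ∃ (E : ℕ → Submodule 𝕜 (FormField 𝕜 n M)) (O : Submodule 𝕜 (S.SpinorField Δ)),
        (∀ p, 1 ≤ p → ∀ w, w ∈ E p ↔ S.IsNormalCKY p w) ∧
        (∀ ψ, ψ ∈ O ↔ S.IsTwistorSpinor ρ ψ) ∧
        S.IsExtendedSuperalgebra B E O) := by
  have hn' : (n : ℝ) - 1 ≠ 0 := by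
    have h : (3 : ℝ) ≤ n := by exact_mod_cast hn
    linarith
  refine ⟨fun c hc => ?_, fun l hE => ?_⟩
  · have hE := hc.isEinstein
    have hk : -c / 2 = -(((n : ℝ) - 1) * c / (2 * ((n : ℝ) - 1))) := by
      field_simp
    have hv : ∀ (x : M) (v : TangentSpace 𝓘(ℝ, Model n) x), S.kVec v = (-c / 2) • v :=
      fun x v => by rw [hk]; exact hE.kVec S hn v
    refine ⟨_, _, fun p hp hpn w => ⟨fun h => ?_, fun h => ?_⟩, fun p hp w => ?_, fun ψ => ?_,
      hE.isExtendedSuperalgebra B hn hk⟩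
    · exact ((SpinStructure.mem_prolongedForms_iff hv hp).1 h).1
    · obtain ⟨τ, h⟩ := hc.prolongedSystem (𝕜 := 𝕜) (k := -c / 2) (by ring) hn hp hpn h
      exact ⟨_, _, _, h⟩
    · exact SpinStructure.mem_prolongedForms_iff hv (by omega)
    · exact SpinStructure.mem_twistorSpinors
  · exact ⟨_, _, fun p hp w => SpinStructure.mem_prolongedForms_iff (fun x v => hE.kVec S hn v) hp,
      fun ψ => SpinStructure.mem_twistorSpinors, hE.isExtendedSuperalgebra B hn rfl⟩
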